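/- Fix $n\ge 0$ and work over $\mathbb R$ with $m=n+1$ labeled oriented segments. **Diagrams.** A homotopy link diagram of order $n$ consists of the $m$ segments, $2n$ vertices, some on the segments (segment vertices) and the others free, and edges between vertices, such that every vertex is trivalent (segments contribute $2$ to the valence of a segment vertex), every vertex is joined to some segment by a path of edges, no two vertices on the same segment are joined by a path of edges, and there are no closed loops of edges. A (Lie) orientation is an ordering of the three half-edges at every free vertex. $\mathcal{HT}_n$ is the vector space generated by oriented homotopy link diagrams of order $n$, where isomorphic diagrams (the isomorphisms preserve the labels and orientations of the segments) are identified up to the product of the signs of the permutations of half-edges at the free vertices; $\mathcal{HT}=\bigoplus_n\mathcal{HT}_n$. Homotopy link diagrams have no nontrivial automorphisms, so every element of $\mathcal{HT}$ has a well-defined coefficient at each oriented diagram; graphs that are not homotopy link diagrams have coefficient $0$. **Cocycles.** Let $\mathcal{HW}_n^*\subset\mathcal{HT}_n$ be the space of elements that satisfy the STU condition: for all triples $S,T,U$ of graphs that agree except near one place of one segment, where $S$ has a segment vertex joined by an edge to a free vertex $w$ whose half-edges are, in cyclic order, (the stem, $b$, $a$), while in $T$ (respectively $U$) the edges $a,b$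 end directly on the segment at consecutive positions, $a$ before $b$ (respectively $b$ before $a$), the coefficients satisfy $c_S-c_T+c_U=0$. Let $\mathcal{HW}^k_n\subset\mathcal{HW}^*_n$ be the subspace of those cocycles that are linear combinations of diagrams with at most $k$ free vertices, with $\mathcal{HW}^{-1}_n=0$; let $\mathcal{HT}_n^{k}\subset \mathcal{HT}_n$ be the span of the diagrams with at most $k$ free vertices. **Shuffle product.** For diagrams $\Gamma_1,\Gamma_2$, let $\Gamma_1\bullet\Gamma_2=\sum_\sigma\Gamma_1\bullet_\sigma\Gamma_2$, where $\sigma$ runs over the $m$-tuples of shuffles of the vertices of $\Gamma_1$ and $\Gamma_2$ on each segment and $\Gamma_1\bullet_\sigma\Gamma_2$ is the diagram obtained by attaching the legs of both to the segments in the order $\sigma$; extend bilinearly to $\mathcal{HT}$. **Trees.** For $I\subset\{1,\dots,n+1\}$ with $|I|\ge2$ let $\mathcal T_I\subset\mathcal{HT}_{|I|-1}$ be the span of the connected homotopy link diagrams with vertices exactly on the segments in $I$ (trivalent trees with leaves labeled bijectively by $I$). Let $U_I^\perp\subset\mathcal T_I$ be the subspace of those elements that satisfy all IHX conditions $c_{\mathrm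 I}-c_{\mathrm H}+c_{\mathrm X}=0$, for diagrams that agree except near an edge joining free vertices $u,v$, where the neighboring half-edges in cyclic order are $u:(v,b,a),\ v:(u,c,d)$ in $\mathrm I$; $u:(v,a,c),\ v:(u,d,b)$ in $\mathrm H$; $u:(v,b,c),\ v:(u,d,a)$ in $\mathrm X$. (This is the orthogonal complement in $\mathcal T_I$ of the span $U_I$ of the IHX relations.) **Proposition.** Let $k\ge 0$. The map $\mathcal{HW}^k_n/\mathcal{HW}^{k-1}_n\to\mathcal{HT}/\mathcal{HT}^{k-1}_n$ induced by inclusion is injective, and its image is the span of the classes of the shuffle products $\alpha_1\bullet\cdots\bullet\alpha_r$ with $\alpha_j\in U_{I_j}^\perp$, $\sum_j(|I_j|-1)=n$ and $\sum_j(|I_j|-2)=k$ (so $r=n-k$). More precisely, there is a linear isomorphism $$\Phi:\ \bigoplus_{\nu}\ \bigotimes_{I} S^{\nu(I)}\big(U_I^\perp\big)\ \xrightarrow{\ \cong\ }\ \mathcal{HW}^k_n/\mathcal{HW}^{k-1}_n ,$$ where $I$ runs over the subsets of $\{1,\dots,n+1\}$ with $|I|\ge 2$, $\nu$ runs over the functions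 from these subsets to $\mathbb Z_{\ge0}$ with $\sum_I\nu(I)(|I|-1)=n$ and $\sum_I\nu(I)(|I|-2)=k$, and $S^0=\mathbb R$; and $\Phi$ sends $\bigotimes_I\prod_{j=1}^{\nu(I)}x_{I,j}$ to the class whose image in $\mathcal{HT}/\mathcal{HT}^{k-1}_n$ is the class of the shuffle product of all the $x_{I,j}$. -/

import Mathlib

open scoped TensorProduct DirectSum

noncomputable section

namespace HLink

/-! ### Trivalent diagrams on `m` segments -/

/-- The vertices of a diagram: the `q i` vertices on segment `i`, listed in the order in which they
occur on the oriented segment, and the `f` free vertices. -/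
abbrev Vertex {m : ℕ} (q : Fin m → ℕ) (f : ℕ) : Type := (Σ i, Fin (q i)) ⊕ Fin f

/-- The half-edges of a diagram: one at every segment vertex (the two half-arcs of the segment give
the rest of its valence), and three, ordered, at every free vertex. -/
abbrev HalfEdge {m : ℕ} (q : Fin m → ℕ) (f : ℕ) : Type := (Σ i, Fin (q i)) ⊕ (Fin f × Fin 3)

/-- The vertex from which a half-edge emanates. -/
def vert {m : ℕ} {q : Fin m → ℕ} {f : ℕ} : HalfEdge q f → Vertex q f := Sum.map id Prod.fst

/-- A trivalent graph attached to `m` labeled oriented segments, with a Lie orientation (an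
ordering of the three half-edges at every free vertex). The edges are the orbits of the
fixed-point-free involution `e` on half-edges. -/
structure Diagram (m : ℕ) where
  q : Fin m → ℕ
  f : ℕ
  e : HalfEdge q f → HalfEdge q f
  e_e : ∀ h, e (e h) = h
  e_ne : ∀ h, e h ≠ h

namespace Diagram

variable {m : ℕ}

/-- The half-edge at the `p`-th vertex of segment `i`. -/
abbrev leg (Γ : Diagram m) (i : Fin m) (p : Fin (Γ.q i)) : HalfEdge Γ.q Γ.f := Sum.inl ⟨i, p⟩

/-- The `c`-th half-edge at the free vertex `v`. -/
abbrev half (Γ : Diagram m) (v : Fin Γ.f) (c : Fin 3) : HalfEdge Γ.q Γ.f := Sum.inr (v, c)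

/-- The graph formed by the vertices and the edges; the segments are not part of it. -/
def graph (Γ : Diagram m) : SimpleGraph (Vertex Γ.q Γ.f) where
  Adj u v := u ≠ v ∧ ∃ h, vert h = u ∧ vert (Γ.e h) = v
  symm := ⟨fun _ _ ⟨hne, h, h1, h2⟩ => ⟨hne.symm, Γ.e h, h2, by rw [Γ.e_e]; exact h1⟩⟩
  loopless := ⟨fun _ h => h.1 rfl⟩

/-- Homotopy link diagrams: there are no closed loops of edges (no edge from a vertex to itself, no
multiple edges, no cycles), every vertex is joined to some segment by a path of edges, and no two
vertices on the same segment are joined by a path of edges. -/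
structure IsHomotopyLink (Γ : Diagram m) : Prop where
  no_loop : ∀ h, vert (Γ.e h) ≠ vert h
  no_multi : ∀ h h', vert h = vert h' → vert (Γ.e h) = vert (Γ.e h') → h = h'
  acyclic : Γ.graph.IsAcyclic
  attached : ∀ v, ∃ s, Γ.graph.Reachable v (Sum.inl s)
  distinct : ∀ i p p', Γ.graph.Reachable (Sum.inl ⟨i, p⟩) (Sum.inl ⟨i, p'⟩) → p = p'

/-- A diagram has order `n` if it has `2 n` vertices. -/
def HasOrder (Γ : Diagram m) (n : ℕ) : Prop := Fintype.card (Vertex Γ.q Γ.f) = 2 * n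

/-! ### Isomorphisms and signs -/

/-- The map on half-edges given by the order preserving identification of the segment vertices, a
map `free` of free vertices, and reorderings `rot` of the half-edges at each free vertex. -/
def halfMap {q q' : Fin m → ℕ} {f f' : ℕ} (hq : q = q') (free : Fin f → Fin f')
    (rot : Fin f → Equiv.Perm (Fin 3)) : HalfEdge q f → HalfEdge q' f' :=
  Sum.map (Sigma.map id fun i => Fin.cast (congrFun hq i)) fun x => (free x.1, rot x.1 x.2)

/-- Isomorphisms of diagrams. They preserve the segments with their labels and orientations, but
need not preserve the orderings of the half-edges at the free vertices: `rot v` is the reordering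
at `v`. -/
@[ext]
structure Iso (Γ Γ' : Diagram m) where
  q_eq : Γ.q = Γ'.q
  free : Fin Γ.f ≃ Fin Γ'.f
  rot : Fin Γ.f → Equiv.Perm (Fin 3)
  comm : ∀ h, halfMap q_eq free rot (Γ.e h) = Γ'.e (halfMap q_eq free rot h)

namespace Iso

/-- The sign by which an isomorphism changes the Lie orientation. -/
def sign {Γ Γ' : Diagram m} (φ : Iso Γ Γ') : ℝ := ∏ v, ((Equiv.Perm.sign (φ.rot v) : ℤ) : ℝ)

instance (Γ Γ' : Diagram m) : Finite (Iso Γ Γ') :=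
  Finite.of_injective (fun φ : Iso Γ Γ' => (φ.free, φ.rot)) fun _ _ h =>
    Iso.ext (congrArg Prod.fst h) (congrArg Prod.snd h)

instance (Γ Γ' : Diagram m) : Fintype (Iso Γ Γ') := Fintype.ofFinite _

/-- The identity. -/
def refl (Γ : Diagram m) : Iso Γ Γ where
  q_eq := rfl
  free := Equiv.refl _
  rot _ := 1
  comm h := by
    have : ∀ h : HalfEdge Γ.q Γ.f, halfMap rfl (Equiv.refl _) (fun _ => 1) h = h := by
      rintro (⟨i, p⟩ | ⟨v, c⟩) <;> rfl
    rw [this, this]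

theorem sign_refl (Γ : Diagram m) : (refl Γ).sign = 1 := by simp [sign, refl]

/-- Composition. -/
def trans {Γ₁ Γ₂ Γ₃ : Diagram m} (φ : Iso Γ₁ Γ₂) (ψ : Iso Γ₂ Γ₃) : Iso Γ₁ Γ₃ where
  q_eq := φ.q_eq.trans ψ.q_eq
  free := φ.free.trans ψ.free
  rot v := ψ.rot (φ.free v) * φ.rot v
  comm h := by
    have key : ∀ h, halfMap (φ.q_eq.trans ψ.q_eq) (φ.free.trans ψ.free)
        (fun v => ψ.rot (φ.free v) * φ.rot v) h
        = halfMap ψ.q_eq ψ.free ψ.rot (halfMap φ.q_eq φ.free φ.rot h) := by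
      rintro (⟨i, p⟩ | ⟨v, c⟩) <;> rfl
    rw [key, key, φ.comm, ψ.comm]

theorem sign_trans {Γ₁ Γ₂ Γ₃ : Diagram m} (φ : Iso Γ₁ Γ₂) (ψ : Iso Γ₂ Γ₃) :
    (φ.trans ψ).sign = φ.sign * ψ.sign := by
  have : ψ.sign = ∏ v, ((Equiv.Perm.sign (ψ.rot (φ.free v)) : ℤ) : ℝ) :=
    (Equiv.prod_comp φ.free fun v => ((Equiv.Perm.sign (ψ.rot v) : ℤ) : ℝ)).symm
  rw [this, sign, sign, ← Finset.prod_mul_distrib]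
  refine Finset.prod_congr rfl fun v _ => ?_
  simp [trans, mul_comm]

/-- The inverse. -/
def symm {Γ Γ' : Diagram m} (φ : Iso Γ Γ') : Iso Γ' Γ where
  q_eq := φ.q_eq.symm
  free := φ.free.symm
  rot v := (φ.rot (φ.free.symm v))⁻¹
  comm h := by
    have h1 : ∀ h, halfMap φ.q_eq.symm φ.free.symm (fun v => (φ.rot (φ.free.symm v))⁻¹)
        (halfMap φ.q_eq φ.free φ.rot h) = h := by
      rintro (⟨i, p⟩ | ⟨v, c⟩) <;> simp [halfMap, Sigma.map]
    have h2 : ∀ h, halfMap φ.q_eq φ.free φ.rot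
        (halfMap φ.q_eq.symm φ.free.symm (fun v => (φ.rot (φ.free.symm v))⁻¹) h) = h := by
      rintro (⟨i, p⟩ | ⟨v, c⟩) <;> simp [halfMap, Sigma.map]
    conv_lhs => rw [← h2 h, ← φ.comm, h1]

theorem symm_trans_trans {Γ₀ Γ Γ' : Diagram m} (φ : Iso Γ Γ') (ψ : Iso Γ₀ Γ') :
    (ψ.trans φ.symm).trans φ = ψ := by
  ext v <;> simp [trans, symm]

theorem trans_trans_symm {Γ₀ Γ Γ' : Diagram m} (φ : Iso Γ Γ') (ψ : Iso Γ₀ Γ) :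
    (ψ.trans φ).trans φ.symm = ψ := by
  ext v <;> simp [trans, symm]

end Iso

/-! ### Inheriting the homotopy link condition -/

theorem IsHomotopyLink.of_map {Γ Γ' : Diagram m} (hm : HalfEdge Γ.q Γ.f → HalfEdge Γ'.q Γ'.f)
    (vm : Vertex Γ.q Γ.f → Vertex Γ'.q Γ'.f) (hinj : Function.Injective hm)
    (vinj : Function.Injective vm) (hv : ∀ h, vert (hm h) = vm (vert h))
    (he : ∀ h, hm (Γ.e h) = Γ'.e (hm h)) (hs : ∀ v h', vert h' = vm v → ∃ h, hm h = h')
    (hseg : ∀ i p, ∃ p', vm (Sum.inl ⟨i, p⟩) = Sum.inl ⟨i, p'⟩)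
    (hfree : ∀ a, ∃ b, vm (Sum.inr a) = Sum.inr b) (H : Γ'.IsHomotopyLink) :
    Γ.IsHomotopyLink := by
  let F : Γ.graph →g Γ'.graph :=
    { toFun := vm
      map_rel' := by
        rintro u v ⟨hne, h, rfl, rfl⟩
        exact ⟨fun h' => hne (vinj h'), hm h, hv h, by rw [← he, hv]⟩ }
  have lift : ∀ u w, Γ'.graph.Reachable u w → ∀ v, vm v = u →
      ∃ v', vm v' = w ∧ Γ.graph.Reachable v v' := by
    rintro u w ⟨W⟩
    induction W with
    | nil => exact fun v hv' => ⟨v, hv', SimpleGraph.Reachable.refl _⟩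
    | cons hadj _ ih =>
      intro v hvu
      obtain ⟨hne, h', h1, h2⟩ := hadj
      obtain ⟨h, rfl⟩ := hs v h' (h1.trans hvu.symm)
      have e1 : vert h = v := vinj (by rw [← hv, h1, hvu])
      rw [← he, hv] at h2
      obtain ⟨v', hv', hr⟩ := ih _ h2
      refine ⟨v', hv', SimpleGraph.Reachable.trans (SimpleGraph.Adj.reachable ⟨?_, h, e1, rfl⟩) hr⟩
      intro hh
      exact hne (by rw [← hvu, ← h2, ← hh])
  refine ⟨?_, ?_, H.acyclic.comap F vinj, ?_, ?_⟩
  · intro h hh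
    exact H.no_loop (hm h) (by rw [← he, hv, hv, hh])
  · intro h h' h1 h2
    exact hinj (H.no_multi _ _ (by rw [hv, hv, h1]) (by rw [← he, ← he, hv, hv, h2]))
  · intro v
    obtain ⟨s, hr⟩ := H.attached (vm v)
    obtain ⟨v', hv', hr'⟩ := lift _ _ hr v rfl
    rcases v' with s' | a
    · exact ⟨s', hr'⟩
    · obtain ⟨b, hb⟩ := hfree a
      rw [hb] at hv'
      cases hv'
  · intro i p p' hr
    obtain ⟨r, hr1⟩ := hseg i p
    obtain ⟨r', hr2⟩ := hseg i p'
    have h3 : Γ'.graph.Reachable (vm (Sum.inl ⟨i, p⟩)) (vm (Sum.inl ⟨i, p'⟩)) := hr.map F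
    rw [hr1, hr2] at h3
    have h4 := H.distinct _ _ _ h3
    subst h4
    have h5 := vinj (hr1.trans hr2.symm)
    simpa using h5

theorem IsHomotopyLink.of_iso {Γ Γ' : Diagram m} (φ : Iso Γ Γ') (H : Γ'.IsHomotopyLink) :
    Γ.IsHomotopyLink := by
  obtain ⟨q, f, e, _, _⟩ := Γ
  obtain ⟨q', f', e', _, _⟩ := Γ'
  obtain ⟨hq, free, rot, comm⟩ := φ
  dsimp only at hq free rot comm
  subst hq
  refine H.of_map (Γ := ⟨q, f, e, _, _⟩) (Γ' := ⟨q, f', e', _, _⟩) (halfMap rfl free rot)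
    (Sum.map id free) ?_ ?_ ?_ comm ?_ ?_ ?_
  · rintro (⟨i, p⟩ | ⟨v, c⟩) (⟨j, r⟩ | ⟨w, d⟩) h <;> simp_all [halfMap, Sigma.map]
    obtain ⟨rfl, h⟩ := h
    exact (rot v).injective h
  · exact Sum.map_injective.2 ⟨Function.injective_id, free.injective⟩
  · rintro (⟨i, p⟩ | ⟨v, c⟩) <;> rfl
  · rintro (⟨i, p⟩ | v) (⟨j, r⟩ | ⟨w, d⟩) h <;> simp [vert] at h
    · exact ⟨Sum.inl ⟨j, r⟩, rfl⟩
    · exact ⟨Sum.inr (v, (rot v).symm d), by simp [halfMap, h]⟩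
  · exact fun i p => ⟨p, rfl⟩
  · exact fun a => ⟨free a, rfl⟩

/-! ### Attaching two diagrams along shuffles -/

/-- An `m`-tuple of shuffles: for every segment, an ordering of the vertices of both diagrams which
respects the two given orderings. -/
abbrev Shuffle (q₁ q₂ : Fin m → ℕ) : Type :=
  {σ : (i : Fin m) → Fin (q₁ i) ⊕ Fin (q₂ i) ≃ Fin (q₁ i + q₂ i) //
    ∀ i, StrictMono (fun p => σ i (Sum.inl p)) ∧ StrictMono (fun p => σ i (Sum.inr p))}

/-- The identification of the half-edges of two diagrams with those of the combined diagram. -/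
def glueHalf {q₁ q₂ : Fin m → ℕ} {f₁ f₂ : ℕ} (σ : Shuffle q₁ q₂) :
    HalfEdge q₁ f₁ ⊕ HalfEdge q₂ f₂ ≃ HalfEdge (q₁ + q₂) (f₁ + f₂) :=
  (Equiv.sumSumSumComm _ _ _ _).trans <| Equiv.sumCongr
    ((Equiv.sigmaSumDistrib _ _).symm.trans (Equiv.sigmaCongrRight σ.1))
    ((Equiv.sumProdDistrib _ _ _).symm.trans (Equiv.prodCongr finSumFinEquiv (Equiv.refl _)))

/-- The diagram obtained by attaching the legs of both diagrams to the segments in the order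
prescribed by the shuffles `σ`. -/
def glue (Γ₁ Γ₂ : Diagram m) (σ : Shuffle Γ₁.q Γ₂.q) : Diagram m where
  q := Γ₁.q + Γ₂.q
  f := Γ₁.f + Γ₂.f
  e h := glueHalf σ (Sum.map Γ₁.e Γ₂.e ((glueHalf σ).symm h))
  e_e h := by
    rw [Equiv.symm_apply_apply]
    conv_rhs => rw [← (glueHalf σ).apply_symm_apply h]
    generalize (glueHalf σ).symm h = x
    rcases x with x | x <;> simp [e_e]
  e_ne h := by
    rw [Ne, ← Equiv.eq_symm_apply]
    generalize (glueHalf σ).symm h = x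
    rcases x with x | x <;> simp [e_ne]

/-- The shuffles are the same for isomorphic diagrams. -/
def Shuffle.cast {q₁ q₂ q₁' q₂' : Fin m → ℕ} (h₁ : q₁ = q₁') (h₂ : q₂ = q₂') :
    Shuffle q₁ q₂ ≃ Shuffle q₁' q₂' := by
  subst h₁ h₂
  exact Equiv.refl _

theorem exists_glue_iso {Γ₁ Γ₁' Γ₂ Γ₂' : Diagram m} (φ : Iso Γ₁ Γ₁') (ψ : Iso Γ₂ Γ₂')
    (σ : Shuffle Γ₁.q Γ₂.q) :
    ∃ χ : Iso (glue Γ₁ Γ₂ σ) (glue Γ₁' Γ₂' (Shuffle.cast φ.q_eq ψ.q_eq σ)),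
      χ.sign = φ.sign * ψ.sign := by
  obtain ⟨q₁, f₁, e₁, _, _⟩ := Γ₁
  obtain ⟨q₂, f₂, e₂, _, _⟩ := Γ₂
  obtain ⟨q₁', f₁', e₁', _, _⟩ := Γ₁'
  obtain ⟨q₂', f₂', e₂', _, _⟩ := Γ₂'
  obtain ⟨hq₁, free₁, rot₁, comm₁⟩ := φ
  obtain ⟨hq₂, free₂, rot₂, comm₂⟩ := ψ
  dsimp only at hq₁ free₁ rot₁ comm₁ hq₂ free₂ rot₂ comm₂ σ
  subst hq₁ hq₂
  let fr : Fin (f₁ + f₂) ≃ Fin (f₁' + f₂') :=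
    finSumFinEquiv.symm.trans ((Equiv.sumCongr free₁ free₂).trans finSumFinEquiv)
  let rt : Fin (f₁ + f₂) → Equiv.Perm (Fin 3) :=
    fun v => Sum.elim rot₁ rot₂ (finSumFinEquiv.symm v)
  have key : ∀ x : HalfEdge q₁ f₁ ⊕ HalfEdge q₂ f₂,
      halfMap (q := q₁ + q₂) rfl fr rt (glueHalf σ x) =
        glueHalf σ (Sum.map (halfMap rfl free₁ rot₁) (halfMap rfl free₂ rot₂) x) := by
    rintro ((⟨i, p⟩ | ⟨v, c⟩) | (⟨i, p⟩ | ⟨v, c⟩)) <;>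
      simp [glueHalf, halfMap, fr, rt, Sigma.map]
  refine ⟨⟨rfl, fr, rt, fun h => ?_⟩, ?_⟩
  · change halfMap rfl fr rt (glueHalf σ (Sum.map e₁ e₂ ((glueHalf σ).symm h))) =
      glueHalf σ (Sum.map e₁' e₂' ((glueHalf σ).symm (halfMap rfl fr rt h)))
    obtain ⟨x, rfl⟩ := (glueHalf σ).surjective h
    rw [key, key, Equiv.symm_apply_apply, Equiv.symm_apply_apply]
    rcases x with x | x <;> simp [comm₁, comm₂]
  · simp only [Iso.sign]
    change ∏ v : Fin (f₁ + f₂), ((Equiv.Perm.sign (rt v) : ℤ) : ℝ) = _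
    rw [← Equiv.prod_comp finSumFinEquiv, Fintype.prod_sum_type]
    simp [rt]

theorem isHomotopyLink_of_glue {Γ₁ Γ₂ : Diagram m} {σ : Shuffle Γ₁.q Γ₂.q}
    (H : (glue Γ₁ Γ₂ σ).IsHomotopyLink) : Γ₁.IsHomotopyLink ∧ Γ₂.IsHomotopyLink := by
  let vg : Vertex Γ₁.q Γ₁.f ⊕ Vertex Γ₂.q Γ₂.f ≃ Vertex (Γ₁.q + Γ₂.q) (Γ₁.f + Γ₂.f) :=
    (Equiv.sumSumSumComm _ _ _ _).trans <| Equiv.sumCongr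
      ((Equiv.sigmaSumDistrib _ _).symm.trans (Equiv.sigmaCongrRight σ.1)) finSumFinEquiv
  have hv : ∀ x, vert (glueHalf σ x) = vg (Sum.map vert vert x) := by
    rintro ((⟨i, p⟩ | ⟨v, c⟩) | (⟨i, p⟩ | ⟨v, c⟩)) <;> rfl
  constructor
  · refine H.of_map (fun h => glueHalf σ (Sum.inl h)) (fun v => vg (Sum.inl v)) ?_ ?_ ?_ ?_ ?_ ?_ ?_
    · exact (glueHalf σ).injective.comp Sum.inl_injective
    · exact vg.injective.comp Sum.inl_injective
    · exact fun h => hv _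
    · intro h
      simp [glue]
    · intro v h' hh
      obtain ⟨x, rfl⟩ := (glueHalf σ).surjective h'
      have := vg.injective ((hv x).symm.trans hh)
      rcases x with x | x
      · exact ⟨x, rfl⟩
      · simp at this
    · exact fun i p => ⟨_, rfl⟩
    · exact fun a => ⟨_, rfl⟩
  · refine H.of_map (fun h => glueHalf σ (Sum.inr h)) (fun v => vg (Sum.inr v)) ?_ ?_ ?_ ?_ ?_ ?_ ?_
    · exact (glueHalf σ).injective.comp Sum.inr_injective
    · exact vg.injective.comp Sum.inr_injective
    · exact fun h => hv _
    · intro h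
      simp [glue]
    · intro v h' hh
      obtain ⟨x, rfl⟩ := (glueHalf σ).surjective h'
      have := vg.injective ((hv x).symm.trans hh)
      rcases x with x | x
      · simp at this
      · exact ⟨x, rfl⟩
    · exact fun i p => ⟨_, rfl⟩
    · exact fun a => ⟨_, rfl⟩

/-- The diagram without vertices. -/
def empty (m : ℕ) : Diagram m where
  q _ := 0
  f := 0
  e := id
  e_e _ := rfl
  e_ne h := by
    rcases h with ⟨_, p⟩ | ⟨v, _⟩
    · exact p.elim0
    · exact v.elim0

end Diagram

/-! ### The space of homotopy link diagrams -/

open Diagram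

variable {m : ℕ}

/-- The relations in the space of diagrams: isomorphic diagrams agree up to the sign by which the
isomorphism changes the orientation, and graphs which are not homotopy link diagrams are zero. -/
def relations (m : ℕ) : Submodule ℝ (Diagram m →₀ ℝ) :=
  Submodule.span ℝ
    ({x | ∃ (Γ Γ' : Diagram m) (φ : Iso Γ Γ'),
        x = Finsupp.single Γ 1 - φ.sign • Finsupp.single Γ' 1} ∪
      {x | ∃ Γ : Diagram m, ¬ Γ.IsHomotopyLink ∧ x = Finsupp.single Γ 1})

/-- The vector space generated by oriented homotopy link diagrams of all orders on `m` segments. -/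
abbrev HT (m : ℕ) : Type := (Diagram m →₀ ℝ) ⧸ relations m

/-- The element of `HT m` given by a diagram. -/
def diag (Γ : Diagram m) : HT m := (relations m).mkQ (Finsupp.single Γ 1)

theorem diag_iso {Γ Γ' : Diagram m} (φ : Iso Γ Γ') : diag Γ = φ.sign • diag Γ' := by
  rw [diag, diag, ← map_smul, ← sub_eq_zero, ← map_sub, Submodule.mkQ_apply,
    Submodule.Quotient.mk_eq_zero]
  exact Submodule.subset_span (Or.inl ⟨Γ, Γ', φ, rfl⟩)

theorem diag_eq_zero {Γ : Diagram m} (h : ¬ Γ.IsHomotopyLink) : diag Γ = 0 := by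
  rw [diag, Submodule.mkQ_apply, Submodule.Quotient.mk_eq_zero]
  exact Submodule.subset_span (Or.inr ⟨Γ, h, rfl⟩)

/-- To define a linear map on `HT m` it suffices to give it on diagrams, compatibly with the
relations. -/
def liftHT {M : Type*} [AddCommGroup M] [Module ℝ M] (g : Diagram m → M)
    (h₁ : ∀ (Γ Γ' : Diagram m) (φ : Iso Γ Γ'), g Γ = φ.sign • g Γ')
    (h₂ : ∀ Γ : Diagram m, ¬ Γ.IsHomotopyLink → g Γ = 0) : HT m →ₗ[ℝ] M :=
  (relations m).liftQ (Finsupp.linearCombination ℝ g) <| by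
    rw [relations, Submodule.span_le]
    rintro x (⟨Γ, Γ', φ, rfl⟩ | ⟨Γ, h, rfl⟩)
    · simp [h₁ Γ Γ' φ]
    · simp [h₂ Γ h]

theorem liftHT_diag {M : Type*} [AddCommGroup M] [Module ℝ M] (g : Diagram m → M) (h₁ h₂)
    (Γ : Diagram m) : liftHT g h₁ h₂ (diag Γ) = g Γ := by
  simp [liftHT, diag]

open Classical in
/-- The pairing of diagrams: the signed number of isomorphisms. As homotopy link diagrams have no
nontrivial automorphisms, it is `±1` on isomorphic homotopy link diagrams. It is `0` on
non-isomorphic diagrams, and on graphs which are not homotopy link diagrams. -/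
def pairing (Γ₀ Γ : Diagram m) : ℝ := if Γ.IsHomotopyLink then ∑ φ : Iso Γ₀ Γ, φ.sign else 0

/-- The coefficient of the diagram `Γ₀` in an element of `HT m`, i.e. the linear extension of the
pairing with `Γ₀`. -/
def coeff (Γ₀ : Diagram m) : HT m →ₗ[ℝ] ℝ :=
  liftHT (pairing Γ₀)
    (by
      intro Γ Γ' φ
      have hiff : Γ.IsHomotopyLink ↔ Γ'.IsHomotopyLink :=
        ⟨fun h => h.of_iso φ.symm, fun h => h.of_iso φ⟩
      have hss : φ.sign * φ.sign = 1 := by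
        rw [Iso.sign, ← Finset.prod_mul_distrib]
        refine Finset.prod_eq_one fun v _ => ?_
        rcases Int.units_eq_one_or (Equiv.Perm.sign (φ.rot v)) with h | h <;> simp [h]
      by_cases h : Γ'.IsHomotopyLink
      · rw [pairing, pairing, if_pos h, if_pos (hiff.2 h), smul_eq_mul, Finset.mul_sum]
        refine Fintype.sum_equiv ⟨fun ψ => ψ.trans φ, fun ψ => ψ.trans φ.symm,
          fun ψ => Iso.trans_trans_symm φ ψ, fun ψ => Iso.symm_trans_trans φ ψ⟩ _ _ fun ψ => ?_
        change ψ.sign = φ.sign * (ψ.trans φ).sign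
        rw [Iso.sign_trans, mul_comm, mul_assoc, hss, mul_one]
      · rw [pairing, pairing, if_neg h, if_neg (fun h' => h (hiff.1 h')), smul_zero])
    (by
      intro Γ h
      rw [pairing, if_neg h])

/-- The shuffle product of two diagrams: the sum over all `m`-tuples of shuffles of the diagrams
obtained by attaching the legs of both to the segments accordingly. -/
def shuffleDiag (Γ₁ Γ₂ : Diagram m) : HT m := ∑ᶠ σ : Shuffle Γ₁.q Γ₂.q, diag (glue Γ₁ Γ₂ σ)

theorem shuffleDiag_iso {Γ₁ Γ₁' Γ₂ Γ₂' : Diagram m} (φ : Iso Γ₁ Γ₁') (ψ : Iso Γ₂ Γ₂') :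
    shuffleDiag Γ₁ Γ₂ = (φ.sign * ψ.sign) • shuffleDiag Γ₁' Γ₂' := by
  rw [shuffleDiag, shuffleDiag, smul_finsum]
  refine finsum_eq_of_bijective _ (Shuffle.cast φ.q_eq ψ.q_eq).bijective fun σ => ?_
  obtain ⟨χ, hχ⟩ := exists_glue_iso φ ψ σ
  rw [diag_iso χ, hχ]

theorem shuffleDiag_eq_zero {Γ₁ Γ₂ : Diagram m} (h : ¬ (Γ₁.IsHomotopyLink ∧ Γ₂.IsHomotopyLink)) :
    shuffleDiag Γ₁ Γ₂ = 0 := by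
  rw [shuffleDiag]
  exact finsum_eq_zero_of_forall_eq_zero fun σ =>
    diag_eq_zero fun H => h (isHomotopyLink_of_glue H)

/-- The shuffle product, extended bilinearly. -/
def shuffle (m : ℕ) : HT m →ₗ[ℝ] HT m →ₗ[ℝ] HT m :=
  liftHT
    (fun Γ₁ => liftHT (fun Γ₂ => shuffleDiag Γ₁ Γ₂)
      (fun Γ₂ Γ₂' ψ => by
        simpa [Iso.sign_refl] using shuffleDiag_iso (Iso.refl Γ₁) ψ)
      (fun _ h => shuffleDiag_eq_zero fun h' => h h'.2))
    (fun Γ₁ Γ₁' φ => by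
      refine Submodule.linearMap_qext _ (Finsupp.lhom_ext' fun Γ₂ => LinearMap.ext_ring ?_)
      have := shuffleDiag_iso φ (Iso.refl Γ₂)
      rw [Iso.sign_refl, mul_one] at this
      simpa [liftHT] using this)
    (fun Γ₁ h => by
      refine Submodule.linearMap_qext _ (Finsupp.lhom_ext' fun Γ₂ => LinearMap.ext_ring ?_)
      simpa [liftHT] using shuffleDiag_eq_zero (Γ₂ := Γ₂) fun h' => h h'.1)

theorem shuffle_diag (Γ₁ Γ₂ : Diagram m) : shuffle m (diag Γ₁) (diag Γ₂) = shuffleDiag Γ₁ Γ₂ := by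
  rw [shuffle, liftHT_diag, liftHT_diag]

/-- The shuffle product of the members of a list. -/
def shuffleProd (l : List (HT m)) : HT m := l.foldr (fun a b => shuffle m a b) (diag (empty m))

/-! ### Cocycles and their filtration -/

/-- The diagram `D` arises from `S` as one of the two resolutions in the STU relation. In `S` the
`p`-th vertex of segment `i` is joined by an edge to the free vertex `w`, by the half-edge `0` of
`w`. In `D` this edge and its ends are removed, and the two loose edges, which ended at the
half-edges `x` and `y` of `w`, are attached to segment `i` at the positions `p` and `p + 1`,
respectively, instead. All the rest is the same. The map `ψ` compares the half-edges. -/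
def IsResolution (S D : Diagram m) (i : Fin m) (p : Fin (S.q i)) (w : Fin S.f) (x y : Fin 3) :
    Prop :=
  S.e (S.leg i p) = S.half w 0 ∧
  D.q i = S.q i + 1 ∧ (∀ j, j ≠ i → D.q j = S.q j) ∧ D.f + 1 = S.f ∧
  ∃ ψ : HalfEdge D.q D.f → HalfEdge S.q S.f, Function.Injective ψ ∧
    (∀ h, ψ (D.e h) = S.e (ψ h)) ∧
    (∀ v, ∃ v', v' ≠ w ∧ ∀ c, ψ (D.half v c) = S.half v' c) ∧
    (∀ j, j ≠ i → ∀ r : Fin (D.q j), ∃ r' : Fin (S.q j), (r' : ℕ) = r ∧ ψ (D.leg j r) = S.leg j r') ∧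
    (∀ r : Fin (D.q i), (r : ℕ) < p → ∃ r' : Fin (S.q i), (r' : ℕ) = r ∧ ψ (D.leg i r) = S.leg i r') ∧
    (∀ r : Fin (D.q i), (r : ℕ) = p → ψ (D.leg i r) = S.half w x) ∧
    (∀ r : Fin (D.q i), (r : ℕ) = p + 1 → ψ (D.leg i r) = S.half w y) ∧
    (∀ r : Fin (D.q i), (p : ℕ) + 1 < r → ∃ r' : Fin (S.q i), (r' : ℕ) + 1 = r ∧ ψ (D.leg i r) = S.leg i r')

/-- The diagrams `S`, `T`, `U` of an STU relation `S - T + U = 0`. With the segment drawn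
horizontally from left to right, and the half-edges at the free vertex of `S` in the counterclockwise
order stem, right branch, left branch, the left branch is attached first in `T` and last in `U`. -/
def IsSTU (S T U : Diagram m) : Prop :=
  ∃ i p w, IsResolution S T i p w 2 1 ∧ IsResolution S U i p w 1 2

/-- The cocycles: the elements of `HT m` that satisfy all STU conditions. (A diagram occurring in
an STU relation which is not a homotopy link diagram has coefficient zero.) -/
def cocycles (m : ℕ) : Submodule ℝ (HT m) :=
  ⨅ (S) (T) (U) (_ : IsSTU S T U), LinearMap.ker (coeff S - coeff T + coeff U)

/-- The span of the homotopy link diagrams of order `n` with at most `k` free vertices. -/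
def chains (m n : ℕ) (k : ℤ) : Submodule ℝ (HT m) :=
  Submodule.span ℝ {x | ∃ Γ : Diagram m,
    Γ.IsHomotopyLink ∧ Γ.HasOrder n ∧ (Γ.f : ℤ) ≤ k ∧ x = diag Γ}

/-- The space of cocycles of order `n` composed of diagrams with at most `k` free vertices. It is
zero for `k = -1`. -/
def HW (m n : ℕ) (k : ℤ) : Submodule ℝ (HT m) := cocycles m ⊓ chains m n k

/-- The filtration quotients of the space of cocycles. -/
abbrev HWQuot (m n : ℕ) (k : ℤ) : Type :=
  HW m n k ⧸ (HW m n (k - 1)).submoduleOf (HW m n k)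

/-- The canonical map from the filtration quotients of the space of cocycles to the space of
diagrams modulo diagrams of order `n` with at most `k - 1` free vertices, induced by the
inclusion. -/
def symbol (m n : ℕ) (k : ℤ) : HWQuot m n k →ₗ[ℝ] HT m ⧸ chains m n (k - 1) :=
  Submodule.mapQ _ _ (HW m n k).subtype fun _ hx => hx.2

/-! ### Trees and the IHX conditions -/

/-- The sets of labels that leaves of a trivalent tree can have. -/
abbrev LabelSet (m : ℕ) : Type := {I : Finset (Fin m) // 2 ≤ I.card}

/-- The span of the trivalent trees with leaves labeled by the elements of `I`, i.e. of the
connected homotopy link diagrams with vertices exactly on the segments in `I`. (There is then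
exactly one vertex on each of these segments.) -/
def treeSpace (I : Finset (Fin m)) : Submodule ℝ (HT m) :=
  Submodule.span ℝ {x | ∃ Γ : Diagram m,
    Γ.IsHomotopyLink ∧ Γ.graph.Connected ∧ (∀ i, i ∈ I ↔ 0 < Γ.q i) ∧ x = diag Γ}

/-- The diagram in which the ends of the edges are permuted: an edge with ends `h` and `h'` becomes
an edge with ends `π h` and `π h'`. -/
def Diagram.reglue (Γ : Diagram m) (π : Equiv.Perm (HalfEdge Γ.q Γ.f)) : Diagram m where
  q := Γ.q
  f := Γ.f
  e h := π (Γ.e (π.symm h))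
  e_e h := by simp [Γ.e_e]
  e_ne h := by
    rw [Ne, ← Equiv.eq_symm_apply]
    exact Γ.e_ne _

/-- The second diagram of the IHX relation `I - H + X = 0`. In `I` the free vertices `u` and `v`
are joined by an edge, and in cyclic order, `u` is adjacent to `v, b, a` and `v` to `u, c, d`. In
`H` they are adjacent to `v, a, c` and to `u, d, b`. -/
def Diagram.ihxH (Γ : Diagram m) (u v : Fin Γ.f) : Diagram m :=
  Γ.reglue (List.formPerm [Γ.half u 1, Γ.half v 2, Γ.half v 1, Γ.half u 2])

/-- The third diagram of the IHX relation `I - H + X = 0`. In `I` the free vertices `u` and `v`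
are joined by an edge, and in cyclic order, `u` is adjacent to `v, b, a` and `v` to `u, c, d`. In
`X` they are adjacent to `v, b, c` and to `u, d, a`. -/
def Diagram.ihxX (Γ : Diagram m) (u v : Fin Γ.f) : Diagram m :=
  Γ.reglue (List.formPerm [Γ.half u 2, Γ.half v 2, Γ.half v 1])

/-- The linear combinations of trees with leaves labeled by the elements of `I` that satisfy all
IHX conditions, i.e. the orthogonal complement of the IHX relations in the space of trees. -/
def ihxPerp (I : Finset (Fin m)) : Submodule ℝ (HT m) :=
  treeSpace I ⊓ ⨅ (Γ : Diagram m) (u : Fin Γ.f) (v : Fin Γ.f)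
    (_ : u ≠ v ∧ Γ.e (Γ.half u 0) = Γ.half v 0),
    LinearMap.ker (coeff Γ - coeff (Γ.ihxH u v) + coeff (Γ.ihxX u v))

/-- The multiplicities `ν` with which the sets of leaf labels may occur for the trees in a forest of
order `n` with `k` free vertices: a tree with `i` leaves has order `i - 1` and `i - 2` free
vertices. -/
abbrev Multiplicity (m n k : ℕ) : Type :=
  {ν : LabelSet m → ℕ //
    ∑ I, ν I * (I.1.card - 1) = n ∧ ∑ I, ν I * (I.1.card - 2) = k}

/-- The tensor product, over the sets `I` of leaf labels, of the `ν I`-th symmetric powers of the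
spaces of solutions of the IHX conditions. The sets `I` with `ν I = 0` contribute the ground field. -/
abbrev SymTensor (ν : LabelSet m → ℕ) : Type :=
  ⨂[ℝ] I : LabelSet m, SymmetricPower ℝ (Fin (ν I)) (ihxPerp I.1)

end HLink

end

/-! Consider a cocycle with at most `k` free vertices and its coefficients at diagrams with exactly
`k` of them. If `T` and `U` in an STU relation have `k` free vertices, then `S` has `k + 1` and its
coefficient is zero. Hence the leading coefficients do not change when neighbouring legs on a
segment are exchanged (`IsSTUFun.symm_of_top`), so they depend only on the family of tree
components. Moreover STU implies IHX (`IsSTUFun.ihxSum_eq_zero`), just as the Jacobi identity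
follows when brackets are written as commutators. The leading part is therefore a symmetric function
of families of trees that satisfies IHX in every tree, that is, an element of a sum of products of
symmetric powers of the spaces of IHX solutions. If it vanishes, the cocycle lies in the previous
filtration step.

Conversely, every such leading part occurs (`exists_isSTUFun`). The other coefficients are
constructed by descending induction on the number of free vertices. Once those with more than `j`
free vertices are known, STU prescribes how a coefficient with `j` free vertices changes when two
neighbouring legs are exchanged. Such prescribed differences come from a function on all orders of
the legs if they respect the Coxeter relations (`exists_potential`). Here involutivity is the
antisymmetry of the orientation, commutation of distant exchanges is STU one level higher, and the
braid relation is STU together with IHX (`isExchangeCost_mergeCost`). The function is normalized to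
have mean zero over all orders of the legs. This makes it unique, so it inherits invariance under
relabeling, the orientation signs, IHX and the vanishing conditions (`IsPartialExtension.step`).

Shuffle products enter through a comultiplication formula: the coefficient of a product at a diagram
is the sum over all ways to split the diagram into two unions of components (`evL_shuffle`). No
multiplicities occur because homotopy link diagrams have no automorphisms. For products of trees
this gives a sum over bijections between factors and components (`evL_shuffleProd`), which is
visibly symmetric in the legs and satisfies IHX. In the other direction, `symPart` assembles the
values at families of trees to a symmetric tensor. It recovers the factors of a shuffle product
(`symPart_shuffleProd_self`) and loses nothing of a leading part (`forestForm_symPart`). This makes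
`leadingEquiv` an isomorphism, and its inverse is the desired map.

Throughout, diagrams are handled by codes: the two ends of an edge carry labels `x` and `-x`, the
legs form a word of pairs (segment, label), and the free vertices form a multiset of triples.
Functionals on oriented diagrams become functions of codes that are invariant under relabeling and
alternating in every triple. Resolving, gluing and splitting are then operations on words and
multisets. -/

noncomputable section

namespace HLink

open Diagram

variable {m : ℕ}

/-! ### Codes of diagrams -/

/-- The labels on segment `i` of a word, in their order. -/
def onSeg (w : List (Fin m × ℤ)) (i : Fin m) : List ℤ := (w.filter fun x => x.1 = i).map Prod.snd

/-- All the labels of a code. -/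
def lab (W : Multiset (Fin m × ℤ)) (T : Multiset (Fin 3 → ℤ)) : Multiset ℤ :=
  W.map Prod.snd + T.bind fun τ => ∑ c, {τ c}

/-- A code is valid if its labels are nonzero, distinct, and come in pairs `x`, `-x`. -/
structure Valid (W : Multiset (Fin m × ℤ)) (T : Multiset (Fin 3 → ℤ)) : Prop where
  nodup : (lab W T).Nodup
  zero : 0 ∉ lab W T
  neg : ∀ x ∈ lab W T, -x ∈ lab W T

/-- The half-edges of `Γ` are labeled by `ℓ` such that the ends of edges have opposite labels, the
segments spell the word `w`, and the free vertices give the triples `T`. -/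
structure Labels (Γ : Diagram m) (w : List (Fin m × ℤ)) (T : Multiset (Fin 3 → ℤ))
    (ℓ : HalfEdge Γ.q Γ.f → ℤ) : Prop where
  inj : Function.Injective ℓ
  neg : ∀ h, ℓ (Γ.e h) = -ℓ h
  word : ∀ i, onSeg w i = List.ofFn fun p => ℓ (Γ.leg i p)
  tri : T = Finset.univ.val.map fun v c => ℓ (Γ.half v c)

theorem onSeg_cons (x : Fin m × ℤ) (w : List (Fin m × ℤ)) (i : Fin m) :
    onSeg (x :: w) i = if x.1 = i then x.2 :: onSeg w i else onSeg w i := by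
  by_cases h : x.1 = i <;> simp [onSeg, h]

@[simp] theorem onSeg_nil (i : Fin m) : onSeg [] i = [] := rfl

@[simp] theorem onSeg_append (w w' : List (Fin m × ℤ)) (i : Fin m) :
    onSeg (w ++ w') i = onSeg w i ++ onSeg w' i := by simp [onSeg]

theorem onSeg_map (w : List (Fin m × ℤ)) (g : ℤ → ℤ) (i : Fin m) :
    onSeg (w.map (Prod.map id g)) i = (onSeg w i).map g := by
  induction w with
  | nil => rfl
  | cons x w ih => by_cases h : x.1 = i <;> simp [onSeg_cons, ih, h]

theorem onSeg_filter (w : List (Fin m × ℤ)) (P : ℤ → Prop) [DecidablePred P] (i : Fin m) :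
    onSeg (w.filter fun x => P x.2) i = (onSeg w i).filter P := by
  induction w with
  | nil => rfl
  | cons x w ih =>
    by_cases h : x.1 = i <;> by_cases h' : P x.2 <;> simp_all [onSeg_cons]

theorem mem_onSeg {w : List (Fin m × ℤ)} {i : Fin m} {x : ℤ} : x ∈ onSeg w i ↔ (i, x) ∈ w := by
  induction w with
  | nil => simp
  | cons y w ih =>
    obtain ⟨j, y⟩ := y
    by_cases h : j = i
    · subst h
      simp [onSeg_cons, ih]
    · simp [onSeg_cons, ih, h, Ne.symm h]

theorem onSeg_perm {w w' : List (Fin m × ℤ)} (h : w.Perm w') (i : Fin m) :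
    (onSeg w i).Perm (onSeg w' i) := (h.filter _).map _

theorem sum_onSeg {β : Type*} (w : List (Fin m × ℤ)) (g : Fin m → ℤ → β) :
    ∑ i, (((onSeg w i).map (g i) : List β) : Multiset β) = (w.map fun x => g x.1 x.2 : List β) := by
  induction w with
  | nil => simp
  | cons x w ih =>
    have : ∀ i, (((onSeg (x :: w) i).map (g i) : List β) : Multiset β) =
        (if x.1 = i then {g x.1 x.2} else 0) + ((onSeg w i).map (g i) : List β) := by
      intro i
      by_cases h : x.1 = i
      · subst h
        simp only [onSeg_cons, if_true]
        rfl
      · simp [onSeg_cons, h]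
    simp only [this, Finset.sum_add_distrib, ih, Finset.sum_ite_eq, Finset.mem_univ, if_true]
    rfl

theorem sum_singleton {α β : Type*} [Fintype α] (g : α → β) :
    ∑ p, ({g p} : Multiset β) = Finset.univ.val.map g := by
  rw [Finset.sum_eq_multiset_sum, ← Multiset.sum_map_singleton (Finset.univ.val.map g),
    Multiset.map_map]
  rfl

theorem coe_ofFn {β : Type*} {n : ℕ} (g : Fin n → β) :
    ((List.ofFn g : List β) : Multiset β) = ∑ p, {g p} := by
  rw [sum_singleton]
  simp [List.ofFn_eq_map]

theorem lab_add (W W' : Multiset (Fin m × ℤ)) (T T' : Multiset (Fin 3 → ℤ)) :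
    lab (W + W') (T + T') = lab W T + lab W' T' := by
  simp only [lab, Multiset.map_add, Multiset.add_bind]
  abel

theorem mem_lab {W : Multiset (Fin m × ℤ)} {T : Multiset (Fin 3 → ℤ)} {x : ℤ} :
    x ∈ lab W T ↔ (∃ i, (i, x) ∈ W) ∨ ∃ τ ∈ T, ∃ c, τ c = x := by
  simp [lab, Multiset.mem_sum, eq_comm]

/-- Every half-edge is counted once: the legs through the words, the others through the triples.
Thus distinctness of the labels of a code is injectivity of the labeling. -/
theorem lab_eq_sum {q : Fin m → ℕ} {f : ℕ} (ℓ : HalfEdge q f → ℤ) (w : List (Fin m × ℤ))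
    (hw : ∀ i, onSeg w i = List.ofFn fun p => ℓ (Sum.inl ⟨i, p⟩)) :
    lab (w : Multiset (Fin m × ℤ)) (Finset.univ.val.map fun v c => ℓ (Sum.inr (v, c))) =
      Finset.univ.val.map ℓ := by
  rw [← sum_singleton ℓ, Fintype.sum_sum_type, Fintype.sum_sigma,
    Fintype.sum_prod_type, lab]
  congr 1
  · rw [Multiset.map_coe, ← sum_onSeg w fun _ x => x]
    refine Finset.sum_congr rfl fun i _ => ?_
    rw [hw, List.map_id', coe_ofFn]
  · rw [Multiset.bind_map]
    rfl

namespace Labels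
variable {Γ Γ' : Diagram m} {w w' : List (Fin m × ℤ)} {T T' : Multiset (Fin 3 → ℤ)}
  {ℓ : HalfEdge Γ.q Γ.f → ℤ} {ℓ' : HalfEdge Γ'.q Γ'.f → ℤ}

theorem lab_eq (H : Labels Γ w T ℓ) : lab (w : Multiset (Fin m × ℤ)) T = Finset.univ.val.map ℓ := by
  rw [H.tri]
  exact lab_eq_sum ℓ w H.word

theorem mem_lab_iff (H : Labels Γ w T ℓ) {x : ℤ} : x ∈ lab (w : Multiset (Fin m × ℤ)) T ↔ ∃ h, ℓ h = x := by
  rw [H.lab_eq]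
  simp

theorem ne_zero (H : Labels Γ w T ℓ) (h) : ℓ h ≠ 0 := by
  intro h0
  have h1 := H.neg h
  rw [h0, neg_zero, ← h0] at h1
  exact Γ.e_ne h (H.inj h1)

theorem valid (H : Labels Γ w T ℓ) : Valid (w : Multiset (Fin m × ℤ)) T where
  nodup := by
    rw [H.lab_eq]
    exact Finset.univ.nodup.map H.inj
  zero := by
    rw [H.mem_lab_iff]
    rintro ⟨h, h0⟩
    exact H.ne_zero h h0
  neg x hx := by
    rw [H.mem_lab_iff] at hx ⊢
    obtain ⟨h, rfl⟩ := hx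
    exact ⟨Γ.e h, H.neg h⟩

theorem card_word (H : Labels Γ w T ℓ) (i : Fin m) : (onSeg w i).length = Γ.q i := by
  rw [H.word, List.length_ofFn]

theorem card_tri (H : Labels Γ w T ℓ) : Multiset.card T = Γ.f := by
  rw [H.tri]
  simp

theorem length_word (H : Labels Γ w T ℓ) : w.length = ∑ i, Γ.q i := by
  have := congrArg Multiset.card (sum_onSeg w fun _ x => x)
  simp at this
  rw [← this]
  exact Finset.sum_congr rfl fun i _ => H.card_word i

theorem congr_word (H : Labels Γ w T ℓ) (h : ∀ i, onSeg w i = onSeg w' i) : Labels Γ w' T ℓ :=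
  ⟨H.inj, H.neg, fun i => by rw [← h, H.word], H.tri⟩

theorem relabel (H : Labels Γ w T ℓ) (g : ℤ → ℤ) (hinj : Set.InjOn g {x | x ∈ lab (w : Multiset (Fin m × ℤ)) T})
    (hneg : ∀ x ∈ lab (w : Multiset (Fin m × ℤ)) T, g (-x) = -g x) :
    Labels Γ (w.map (Prod.map id g)) (T.map fun τ => g ∘ τ) (g ∘ ℓ) where
  inj h h' e := H.inj (hinj (H.mem_lab_iff.2 ⟨h, rfl⟩) (H.mem_lab_iff.2 ⟨h', rfl⟩) e)
  neg h := by simp [H.neg, hneg _ (H.mem_lab_iff.2 ⟨h, rfl⟩)]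
  word i := by
    rw [onSeg_map, H.word, List.map_ofFn]
    rfl
  tri := by
    rw [H.tri, Multiset.map_map]
    rfl

/-- The code of a diagram determines it up to isomorphism. -/
theorem exists_iso (H : Labels Γ w T ℓ) (H' : Labels Γ' w' T ℓ')
    (hw : ∀ i, onSeg w i = onSeg w' i) :
    ∃ φ : Iso Γ Γ', φ.sign = 1 ∧ ∀ h, ℓ' (halfMap φ.q_eq φ.free φ.rot h) = ℓ h := by
  obtain ⟨q, f, e, ee, en⟩ := Γ
  obtain ⟨q', f', e', ee', en'⟩ := Γ'
  have hq : q = q' := funext fun i => by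
    have h1 := H.card_word i
    have h2 := H'.card_word i
    rw [← hw] at h2
    exact h1.symm.trans h2
  have hf : f = f' := by
    have h1 := H.card_tri
    have h2 := H'.card_tri
    exact h1.symm.trans h2
  subst hq hf
  have hleg : ∀ i p, ℓ (Sum.inl ⟨i, p⟩) = ℓ' (Sum.inl ⟨i, p⟩) := fun i p =>
    congrFun (List.ofFn_injective ((H.word i).symm.trans ((hw i).trans (H'.word i)))) p
  -- Free vertices are matched by their triples as ordered triples, so no half-edges are reordered
  -- and the isomorphism has sign `1`.
  have hfree : ∀ v, ∃ v', ∀ c, ℓ' (Sum.inr (v', c)) = ℓ (Sum.inr (v, c)) := by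
    intro v
    have h1 : (fun c => ℓ (Sum.inr (v, c))) ∈ T := by
      rw [H.tri]
      exact Multiset.mem_map_of_mem _ (Finset.mem_univ v)
    rw [H'.tri, Multiset.mem_map] at h1
    obtain ⟨v', -, h2⟩ := h1
    exact ⟨v', fun c => congrFun h2 c⟩
  choose ρ hρ using hfree
  have ρinj : Function.Injective ρ := by
    intro v v' hvv
    have h1 := hρ v 0
    rw [hvv, hρ v' 0] at h1
    simpa using (H.inj h1).symm
  have key : ∀ h, ℓ' (halfMap (q := q) (q' := q) rfl (Equiv.ofBijective ρ
      (Finite.injective_iff_bijective.1 ρinj)) (fun _ => 1) h) = ℓ h := by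
    rintro (⟨i, p⟩ | ⟨v, c⟩)
    · exact (hleg i p).symm
    · exact hρ v c
  refine ⟨⟨rfl, Equiv.ofBijective ρ (Finite.injective_iff_bijective.1 ρinj), fun _ => 1, ?_⟩, ?_, key⟩
  · intro h
    apply H'.inj
    rw [key]
    have := H'.neg (halfMap (q := q) (q' := q) rfl (Equiv.ofBijective ρ
      (Finite.injective_iff_bijective.1 ρinj)) (fun _ => 1) h)
    rw [key] at this
    rw [this]
    exact H.neg h
  · simp [Iso.sign]

end Labels

/-- The positions in the words and the entries of the triples serve as half-edges, and an edge joins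
`x` to `-x`. This involution has no fixed point because `0` is not a label. -/
theorem Valid.exists_labels {w : List (Fin m × ℤ)} {T : Multiset (Fin 3 → ℤ)}
    (H : Valid (w : Multiset (Fin m × ℤ)) T) : ∃ Γ ℓ, Labels (m := m) Γ w T ℓ := by
  induction T using Quotient.inductionOn with | h t => ?_
  let ℓ : HalfEdge (fun i => (onSeg w i).length) t.length → ℤ :=
    Sum.elim (fun s => (onSeg w s.1).get s.2) fun x => t.get x.1 x.2
  have hT : ((t : Multiset (Fin 3 → ℤ))) = Finset.univ.val.map fun v c => ℓ (Sum.inr (v, c)) := by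
    rw [← sum_singleton, ← coe_ofFn]
    exact congrArg _ (List.ofFn_get t).symm
  have hw : ∀ i, onSeg w i = List.ofFn fun p => ℓ (Sum.inl ⟨i, p⟩) := fun i =>
    (List.ofFn_get _).symm
  have hlab := lab_eq_sum ℓ w hw
  rw [← hT] at hlab
  change Valid (w : Multiset (Fin m × ℤ)) (t : Multiset _) at H
  have hinj : Function.Injective ℓ := by
    have := H.nodup
    rw [hlab, Multiset.nodup_map_iff_inj_on Finset.univ.nodup] at this
    exact fun x y h => this x (Finset.mem_univ _) y (Finset.mem_univ _) h
  have hex : ∀ h, ∃ h', ℓ h' = -ℓ h := by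
    intro h
    have := H.neg (ℓ h) (by rw [hlab]; exact Multiset.mem_map_of_mem _ (Finset.mem_univ h))
    rw [hlab, Multiset.mem_map] at this
    obtain ⟨h', -, h2⟩ := this
    exact ⟨h', h2⟩
  choose e he using hex
  refine ⟨⟨_, _, e, fun h => hinj (by rw [he, he, neg_neg]), fun h hh => ?_⟩, ℓ, hinj, he, hw, hT⟩
  have h1 := he h
  rw [hh] at h1
  have h0 : ℓ h = 0 := by omega
  exact H.zero (by rw [hlab, ← h0]; exact Multiset.mem_map_of_mem _ (Finset.mem_univ h))

theorem exists_labels (Γ : Diagram m) : ∃ w T ℓ, Labels Γ w T ℓ := by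
  classical
  let E := Fintype.equivFin (HalfEdge Γ.q Γ.f)
  -- In an enumeration of the half-edges, the earlier end of an edge gets its number and the later
  -- end the negative of that number; adding `1` avoids the label `0`.
  let ℓ : HalfEdge Γ.q Γ.f → ℤ := fun h =>
    if E h < E (Γ.e h) then ((E h : ℕ) : ℤ) + 1 else -(((E (Γ.e h) : ℕ) : ℤ) + 1)
  have hne : ∀ h, E h ≠ E (Γ.e h) := fun h hh => Γ.e_ne h (E.injective hh).symm
  refine ⟨(List.finRange m).flatMap fun i => List.ofFn fun p => (i, ℓ (Γ.leg i p)), _, ℓ, ?_, ?_,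
    ?_, rfl⟩
  · intro h h' hh
    simp only [ℓ] at hh
    split_ifs at hh with h1 h2 h2
    · exact E.injective (Fin.ext (by omega))
    · omega
    · omega
    · have : Γ.e h = Γ.e h' := E.injective (Fin.ext (by omega))
      rw [← Γ.e_e h, this, Γ.e_e]
  · intro h
    simp only [ℓ, Γ.e_e]
    have := hne h
    rcases lt_or_gt_of_ne this with h1 | h1
    · rw [if_neg (not_lt.2 h1.le), if_pos h1]
    · rw [if_pos h1, if_neg (not_lt.2 h1.le), neg_neg]
  · intro i
    have key : ∀ l : List (Fin m), onSeg (l.flatMap fun i => List.ofFn fun p => (i, ℓ (Γ.leg i p))) i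
        = (l.filter (· = i)).flatMap fun i => List.ofFn fun p => ℓ (Γ.leg i p) := by
      intro l
      induction l with
      | nil => rfl
      | cons j l ih =>
        rw [List.flatMap_cons, onSeg_append, ih, List.filter_cons]
        by_cases hj : j = i
        · subst hj
          simp [onSeg, List.filter_eq_self.2, Function.comp_def]
        · simp [hj, onSeg, List.filter_eq_nil_iff]
    have h3 : (List.finRange m).filter (· = i) = [i] := by
      rw [List.filter_eq, List.count_eq_one_of_mem (List.nodup_finRange m) (List.mem_finRange i)]
      rfl
    rw [key, h3]
    simp

/-! ### Functions of diagrams and of codes -/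

/-- Functions of diagrams that are linear functionals of oriented homotopy link diagrams. -/
structure IsDiagramFun (c : Diagram m → ℝ) : Prop where
  iso : ∀ {Γ Γ' : Diagram m} (φ : Iso Γ Γ'), c Γ = φ.sign * c Γ'
  zero : ∀ {Γ : Diagram m}, ¬ Γ.IsHomotopyLink → c Γ = 0

/-- A code of a homotopy link diagram. -/
def CodeHL (w : List (Fin m × ℤ)) (T : Multiset (Fin 3 → ℤ)) : Prop :=
  ∃ (Γ : Diagram m) (ℓ : _), Labels Γ w T ℓ ∧ Γ.IsHomotopyLink

theorem Labels.isHomotopyLink_iff {Γ : Diagram m} {w : List (Fin m × ℤ)}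
    {T : Multiset (Fin 3 → ℤ)} {ℓ : HalfEdge Γ.q Γ.f → ℤ} (H : Labels Γ w T ℓ) :
    Γ.IsHomotopyLink ↔ CodeHL w T := by
  refine ⟨fun h => ⟨Γ, ℓ, H, h⟩, fun ⟨Γ', ℓ', H', h⟩ => ?_⟩
  obtain ⟨φ, -⟩ := H.exists_iso H' fun _ => rfl
  exact h.of_iso φ

theorem CodeHL.valid {w : List (Fin m × ℤ)} {T : Multiset (Fin 3 → ℤ)} (h : CodeHL w T) :
    Valid (w : Multiset (Fin m × ℤ)) T := by
  obtain ⟨Γ, ℓ, H, -⟩ := h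
  exact H.valid

open Classical in
/-- The value of a function of diagrams at a code. -/
def ev (c : Diagram m → ℝ) (w : List (Fin m × ℤ)) (T : Multiset (Fin 3 → ℤ)) : ℝ :=
  -- Invalid codes get the value `0`, so that relations between codes hold trivially when the codes
  -- are invalid.
  if h : ∃ (Γ : Diagram m) (ℓ : _), Labels Γ w T ℓ then c h.choose else 0

/-- Functions of codes that come from functions of diagrams. -/
structure IsCodeFun (F : List (Fin m × ℤ) → Multiset (Fin 3 → ℤ) → ℝ) : Prop where
  zero : ∀ {w : List (Fin m × ℤ)} {T}, ¬ CodeHL w T → F w T = 0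
  word : ∀ {w w' : List (Fin m × ℤ)} {T}, (∀ i, onSeg w i = onSeg w' i) → F w T = F w' T
  relabel : ∀ {w : List (Fin m × ℤ)} {T} (g : ℤ → ℤ), Valid (w : Multiset (Fin m × ℤ)) T →
    Set.InjOn g {x | x ∈ lab (w : Multiset (Fin m × ℤ)) T} → (∀ x ∈ lab (w : Multiset (Fin m × ℤ)) T, g (-x) = -g x) →
    F (w.map (Prod.map id g)) (T.map fun τ => g ∘ τ) = F w T
  turn : ∀ {w : List (Fin m × ℤ)} {T} (τ : Fin 3 → ℤ) (π : Equiv.Perm (Fin 3)),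
    F w ((τ ∘ π) ::ₘ T) = ((Equiv.Perm.sign π : ℤ) : ℝ) * F w (τ ::ₘ T)

/-! ### Passing between functions of diagrams and functions of codes -/

theorem halfMap_bijective {q q' : Fin m → ℕ} {f f' : ℕ} (hq : q = q') (free : Fin f ≃ Fin f')
    (rot : Fin f → Equiv.Perm (Fin 3)) : Function.Bijective (halfMap hq free rot) := by
  subst hq
  constructor
  · rintro (⟨i, p⟩ | ⟨v, c⟩) (⟨j, r⟩ | ⟨w, d⟩) h <;> simp_all [halfMap, Sigma.map]
    obtain ⟨rfl, h⟩ := h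
    exact (rot v).injective h
  · rintro (⟨j, r⟩ | ⟨w, d⟩)
    · exact ⟨Sum.inl ⟨j, r⟩, rfl⟩
    · exact ⟨Sum.inr (free.symm w, (rot (free.symm w)).symm d), by simp [halfMap]⟩

/-- The half-edge map of an isomorphism. -/
def Diagram.Iso.halfEquiv {Γ Γ' : Diagram m} (φ : Iso Γ Γ') :
    HalfEdge Γ.q Γ.f ≃ HalfEdge Γ'.q Γ'.f :=
  Equiv.ofBijective _ (halfMap_bijective φ.q_eq φ.free φ.rot)

theorem Diagram.Iso.halfEquiv_e {Γ Γ' : Diagram m} (φ : Iso Γ Γ') (h) :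
    φ.halfEquiv (Γ.e h) = Γ'.e (φ.halfEquiv h) := φ.comm h

theorem Diagram.Iso.halfEquiv_leg {Γ Γ' : Diagram m} (φ : Iso Γ Γ') (i p) :
    φ.halfEquiv (Γ.leg i p) = Γ'.leg i (Fin.cast (congrFun φ.q_eq i) p) := rfl

theorem Diagram.Iso.halfEquiv_half {Γ Γ' : Diagram m} (φ : Iso Γ Γ') (v c) :
    φ.halfEquiv (Γ.half v c) = Γ'.half (φ.free v) (φ.rot v c) := rfl

/-- Isomorphic diagrams have the same codes, up to the orderings of the triples. -/
theorem Labels.of_iso {Γ Γ' : Diagram m} (φ : Iso Γ Γ') {w : List (Fin m × ℤ)}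
    {T : Multiset (Fin 3 → ℤ)} {ℓ : HalfEdge Γ.q Γ.f → ℤ} (H : Labels Γ w T ℓ) :
    Labels Γ' w (Finset.univ.val.map fun v c => ℓ (Γ.half v ((φ.rot v).symm c)))
      (ℓ ∘ φ.halfEquiv.symm) where
  inj := H.inj.comp φ.halfEquiv.symm.injective
  neg h := by
    obtain ⟨h, rfl⟩ := φ.halfEquiv.surjective h
    simp [← φ.halfEquiv_e, H.neg]
  word i := by
    rw [H.word]
    have h1 := congrFun φ.q_eq i
    apply List.ext_get
    · simp [h1]
    · intro n h1 h2
      simp only [List.get_ofFn, Function.comp_apply]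
      congr 1
      rw [Equiv.eq_symm_apply, φ.halfEquiv_leg]
      rfl
  tri := by
    have : (Finset.univ : Finset (Fin Γ'.f)).val = Finset.univ.val.map φ.free := by
      have := congrArg Finset.val (Finset.map_univ_equiv φ.free)
      rw [← this]
      rfl
    rw [this, Multiset.map_map]
    refine Multiset.map_congr rfl fun v _ => ?_
    funext c
    simp only [Function.comp_apply]
    congr 1
    rw [Equiv.eq_symm_apply, φ.halfEquiv_half, Equiv.apply_symm_apply]

theorem ev_of_labels {c : Diagram m → ℝ} (hc : IsDiagramFun c) {Γ : Diagram m}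
    {w : List (Fin m × ℤ)} {T : Multiset (Fin 3 → ℤ)} {ℓ : HalfEdge Γ.q Γ.f → ℤ}
    (H : Labels Γ w T ℓ) : ev c w T = c Γ := by
  have hex : ∃ (Γ : Diagram m) (ℓ : _), Labels Γ w T ℓ := ⟨Γ, ℓ, H⟩
  rw [ev, dif_pos hex]
  obtain ⟨φ, h1, -⟩ := hex.choose_spec.choose_spec.exists_iso H fun _ => rfl
  rw [hc.iso φ, h1, one_mul]

theorem ev_of_not_valid {c : Diagram m → ℝ} {w : List (Fin m × ℤ)} {T : Multiset (Fin 3 → ℤ)}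
    (H : ¬ Valid (w : Multiset (Fin m × ℤ)) T) : ev c w T = 0 := by
  rw [ev, dif_neg]
  rintro ⟨Γ, ℓ, h⟩
  exact H h.valid

/-- The diagram with the half-edges at the free vertices reordered. -/
def Diagram.turn (Γ : Diagram m) (rot : Fin Γ.f → Equiv.Perm (Fin 3)) : Diagram m where
  q := Γ.q
  f := Γ.f
  e h := halfMap rfl id rot (Γ.e (halfMap rfl id (fun v => (rot v)⁻¹) h))
  e_e h := by
    have h1 : ∀ h : HalfEdge Γ.q Γ.f,
        halfMap rfl id (fun v => (rot v)⁻¹) (halfMap rfl id rot h) = h := by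
      rintro (⟨i, p⟩ | ⟨v, c⟩) <;> simp [halfMap, Sigma.map]
    have h2 : ∀ h : HalfEdge Γ.q Γ.f,
        halfMap rfl id rot (halfMap rfl id (fun v => (rot v)⁻¹) h) = h := by
      rintro (⟨i, p⟩ | ⟨v, c⟩) <;> simp [halfMap, Sigma.map]
    rw [h1, Γ.e_e, h2]
  e_ne h := by
    have h1 : ∀ h : HalfEdge Γ.q Γ.f,
        halfMap rfl id (fun v => (rot v)⁻¹) (halfMap rfl id rot h) = h := by
      rintro (⟨i, p⟩ | ⟨v, c⟩) <;> simp [halfMap, Sigma.map]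
    intro hh
    have := congrArg (halfMap rfl id fun v => (rot v)⁻¹) hh
    rw [h1] at this
    exact Γ.e_ne _ this

/-- Reordering the half-edges is an isomorphism. -/
def Diagram.turnIso (Γ : Diagram m) (rot : Fin Γ.f → Equiv.Perm (Fin 3)) : Iso Γ (Γ.turn rot) where
  q_eq := rfl
  free := Equiv.refl _
  rot := rot
  comm h := by
    have h1 : ∀ h : HalfEdge Γ.q Γ.f,
        halfMap rfl id (fun v => (rot v)⁻¹) (halfMap rfl id rot h) = h := by
      rintro (⟨i, p⟩ | ⟨v, c⟩) <;> simp [halfMap, Sigma.map]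
    change _ = halfMap rfl id rot (Γ.e (halfMap rfl id (fun v => (rot v)⁻¹) (halfMap rfl id rot h)))
    rw [h1]
    rfl

theorem IsDiagramFun.isCodeFun {c : Diagram m → ℝ} (hc : IsDiagramFun c) : IsCodeFun (ev c) where
  zero {w T} h := by
    by_cases hv : Valid (w : Multiset (Fin m × ℤ)) T
    · obtain ⟨Γ, ℓ, H⟩ := hv.exists_labels
      rw [ev_of_labels hc H, hc.zero]
      rwa [H.isHomotopyLink_iff]
    · exact ev_of_not_valid hv
  word {w w' T} h := by
    by_cases hex : ∃ (Γ : Diagram m) (ℓ : _), Labels Γ w T ℓ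
    · obtain ⟨Γ, ℓ, H⟩ := hex
      rw [ev_of_labels hc H, ev_of_labels hc (H.congr_word h)]
    · rw [ev, ev, dif_neg hex, dif_neg]
      rintro ⟨Γ, ℓ, H⟩
      exact hex ⟨Γ, ℓ, H.congr_word fun i => (h i).symm⟩
  relabel {w T} g hv hinj hneg := by
    obtain ⟨Γ, ℓ, H⟩ := hv.exists_labels
    rw [ev_of_labels hc H, ev_of_labels hc (H.relabel g hinj hneg)]
  turn {w T} τ π := by
    have key : ∀ (τ : Fin 3 → ℤ) (π : Equiv.Perm (Fin 3)) (Γ : Diagram m) (ℓ : _),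
        Labels Γ w (τ ::ₘ T) ℓ → ∃ Γ' ℓ', Labels Γ' w ((τ ∘ π) ::ₘ T) ℓ' ∧
          c Γ = ((Equiv.Perm.sign π : ℤ) : ℝ) * c Γ' := by
      intro τ π Γ ℓ H
      have h1 : τ ∈ τ ::ₘ T := Multiset.mem_cons_self _ _
      rw [H.tri, Multiset.mem_map] at h1
      obtain ⟨v, -, hv⟩ := h1
      -- Only the vertex `v` is reordered, by the inverse of `π` because `Labels.of_iso` reads the
      -- triples through the inverse reordering.
      let rot : Fin Γ.f → Equiv.Perm (Fin 3) := Function.update (fun _ => 1) v π⁻¹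
      refine ⟨Γ.turn rot, ℓ ∘ (Γ.turnIso rot).halfEquiv.symm, ?_, ?_⟩
      · have := H.of_iso (Γ.turnIso rot)
        convert this using 1
        have h2 : (Finset.univ : Finset (Fin Γ.f)).val =
            v ::ₘ (Finset.univ.erase v).val := by
          rw [← Finset.insert_val_of_notMem (Finset.notMem_erase _ _),
            Finset.insert_erase (Finset.mem_univ _)]
        have h3 := H.tri
        rw [h2, Multiset.map_cons, hv, Multiset.cons_inj_right] at h3
        rw [h2, Multiset.map_cons, h3]
        congr 1
        · funext c
          rw [← hv]
          simp [turnIso, rot]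
          rfl
        · refine Multiset.map_congr rfl fun u hu => ?_
          have : u ≠ v := (Finset.mem_erase.1 (Finset.mem_def.2 hu)).1
          funext c
          simp [turnIso, rot, this]
          rfl
      · rw [hc.iso (Γ.turnIso rot)]
        congr 1
        simp only [Iso.sign]
        change ∏ u, ((Equiv.Perm.sign (rot u) : ℤ) : ℝ) = _
        rw [Finset.prod_eq_single v]
        · simp [rot]
        · intro u _ hu
          simp [rot, hu]
        · simp
    by_cases hex : ∃ (Γ : Diagram m) (ℓ : _), Labels Γ w (τ ::ₘ T) ℓ
    · obtain ⟨Γ, ℓ, H⟩ := hex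
      obtain ⟨Γ', ℓ', H', h⟩ := key τ π Γ ℓ H
      rw [ev_of_labels hc H, ev_of_labels hc H', h, ← mul_assoc, ← Int.cast_mul, ← Units.val_mul]
      simp
    · have hex' : ¬ ∃ (Γ : Diagram m) (ℓ : _), Labels Γ w ((τ ∘ π) ::ₘ T) ℓ := by
        rintro ⟨Γ, ℓ, H⟩
        obtain ⟨Γ', ℓ', H', -⟩ := key _ π⁻¹ Γ ℓ H
        refine hex ⟨Γ', ℓ', ?_⟩
        convert H' using 2
        funext c
        simp
      rw [ev, ev, dif_neg hex, dif_neg hex', mul_zero]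

theorem IsCodeFun.turn_all {F : List (Fin m × ℤ) → Multiset (Fin 3 → ℤ) → ℝ} (hF : IsCodeFun F)
    (w : List (Fin m × ℤ)) {α : Type*} (s : Finset α) (τ : α → Fin 3 → ℤ)
    (π : α → Equiv.Perm (Fin 3)) (T : Multiset (Fin 3 → ℤ)) :
    F w ((s.val.map fun v => τ v ∘ π v) + T) =
      (∏ v ∈ s, ((Equiv.Perm.sign (π v) : ℤ) : ℝ)) * F w (s.val.map τ + T) := by
  classical
  induction s using Finset.induction_on generalizing T with
  | empty => simp
  | insert a s ha ih =>
    rw [Finset.insert_val_of_notMem ha, Multiset.map_cons, Multiset.map_cons, Multiset.cons_add,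
      Multiset.cons_add, hF.turn, ← Multiset.add_cons, ← Multiset.add_cons, ih,
      Finset.prod_insert ha, mul_assoc]

/-- The value of a function of codes at a diagram. -/
def IsCodeFun.onDiagram (F : List (Fin m × ℤ) → Multiset (Fin 3 → ℤ) → ℝ) (Γ : Diagram m) : ℝ :=
  F (exists_labels Γ).choose (exists_labels Γ).choose_spec.choose

/-- Two labelings of one diagram differ by the relabeling that sends `ℓ h` to `ℓ' h`; it is
injective and odd on the labels that occur. -/
theorem IsCodeFun.eq_of_labels {F : List (Fin m × ℤ) → Multiset (Fin 3 → ℤ) → ℝ} (hF : IsCodeFun F)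
    {Γ : Diagram m} {w w' : List (Fin m × ℤ)} {T T' : Multiset (Fin 3 → ℤ)}
    {ℓ ℓ' : HalfEdge Γ.q Γ.f → ℤ} (H : Labels Γ w T ℓ) (H' : Labels Γ w' T' ℓ') :
    F w T = F w' T' := by
  classical
  let g : ℤ → ℤ := fun x => if hx : ∃ h, ℓ h = x then ℓ' hx.choose else 0
  have hg : ∀ h, g (ℓ h) = ℓ' h := fun h => by
    have hx : ∃ h', ℓ h' = ℓ h := ⟨h, rfl⟩
    simp only [g, dif_pos hx]
    rw [H.inj hx.choose_spec]
  rw [← hF.relabel (w := w) (T := T) g H.valid ?_ ?_]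
  · have h2 : T.map (fun τ => g ∘ τ) = T' := by
      rw [H.tri, H'.tri, Multiset.map_map]
      refine Multiset.map_congr rfl fun v _ => ?_
      funext c
      exact hg _
    rw [h2]
    refine hF.word fun i => ?_
    rw [onSeg_map, H.word, H'.word, List.map_ofFn]
    congr 1
    funext p
    exact hg _
  · intro x hx y hy hxy
    obtain ⟨h, rfl⟩ := H.mem_lab_iff.1 hx
    obtain ⟨h', rfl⟩ := H.mem_lab_iff.1 hy
    rw [hg, hg] at hxy
    rw [H'.inj hxy]
  · intro x hx
    obtain ⟨h, rfl⟩ := H.mem_lab_iff.1 hx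
    rw [← H.neg, hg, hg, H'.neg]

theorem IsCodeFun.onDiagram_eq {F : List (Fin m × ℤ) → Multiset (Fin 3 → ℤ) → ℝ}
    (hF : IsCodeFun F) {Γ : Diagram m} {w : List (Fin m × ℤ)} {T : Multiset (Fin 3 → ℤ)}
    {ℓ : HalfEdge Γ.q Γ.f → ℤ} (H : Labels Γ w T ℓ) : onDiagram F Γ = F w T :=
  hF.eq_of_labels (exists_labels Γ).choose_spec.choose_spec.choose_spec H

theorem IsCodeFun.isDiagramFun {F : List (Fin m × ℤ) → Multiset (Fin 3 → ℤ) → ℝ}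
    (hF : IsCodeFun F) : IsDiagramFun (onDiagram F) where
  zero {Γ} h := by
    obtain ⟨w, T, ℓ, H⟩ := exists_labels Γ
    rw [hF.onDiagram_eq H, hF.zero]
    rwa [← H.isHomotopyLink_iff]
  iso {Γ Γ'} φ := by
    obtain ⟨w, T, ℓ, H⟩ := exists_labels Γ
    rw [hF.onDiagram_eq H, hF.onDiagram_eq (H.of_iso φ), H.tri]
    have := hF.turn_all w Finset.univ (fun v c => ℓ (Γ.half v c)) (fun v => (φ.rot v).symm) 0
    simp only [add_zero] at this
    have h2 : (fun v => (fun c => ℓ (Γ.half v c)) ∘ ⇑(φ.rot v).symm) =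
      fun v c => ℓ (Γ.half v ((φ.rot v).symm c)) := rfl
    rw [h2] at this
    rw [this, ← mul_assoc]
    have h3 : φ.sign * ∏ v, ((Equiv.Perm.sign (φ.rot v).symm : ℤ) : ℝ) = 1 := by
      rw [Iso.sign, ← Finset.prod_mul_distrib]
      refine Finset.prod_eq_one fun v _ => ?_
      rw [← Int.cast_mul, ← Units.val_mul]
      simp
    rw [h3, one_mul]

/-- This completes the dictionary between functionals on diagrams and functions of codes, so that
cocycles can be constructed on codes. -/
theorem IsCodeFun.ev_onDiagram {F : List (Fin m × ℤ) → Multiset (Fin 3 → ℤ) → ℝ}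
    (hF : IsCodeFun F) : ev (onDiagram F) = F := by
  funext w T
  by_cases hv : Valid (w : Multiset (Fin m × ℤ)) T
  · obtain ⟨Γ, ℓ, H⟩ := hv.exists_labels
    rw [ev_of_labels hF.isDiagramFun H, hF.onDiagram_eq H]
  · rw [ev_of_not_valid hv, hF.zero fun h => hv h.valid]

theorem isDiagramFun_coeff (x : HT m) : IsDiagramFun fun Γ => coeff Γ x where
  iso {Γ Γ'} φ := by
    have key : coeff Γ = φ.sign • coeff Γ' := by
      refine Submodule.linearMap_qext _ (Finsupp.lhom_ext' fun Γ₁ => LinearMap.ext_ring ?_)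
      have h1 : ∀ Γ, coeff Γ ((relations m).mkQ (Finsupp.single Γ₁ 1)) = pairing Γ Γ₁ :=
        fun Γ => liftHT_diag _ _ _ Γ₁
      simp only [LinearMap.comp_apply, Finsupp.lsingle_apply, LinearMap.smul_apply]
      rw [h1, h1, pairing, pairing]
      by_cases h : Γ₁.IsHomotopyLink
      · rw [if_pos h, if_pos h, smul_eq_mul, Finset.mul_sum]
        -- Composition with `φ` is a bijection between the isomorphisms from the two diagrams to
        -- `Γ₁`, and it multiplies signs by that of `φ`.
        refine Fintype.sum_equiv ⟨fun ψ => φ.symm.trans ψ, fun ψ => φ.trans ψ, ?_, ?_⟩ _ _ ?_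
        · intro ψ
          ext v <;> simp [Iso.trans, Iso.symm]
        · intro ψ
          ext v <;> simp [Iso.trans, Iso.symm]
        · intro ψ
          change ψ.sign = φ.sign * (φ.symm.trans ψ).sign
          rw [← Iso.sign_trans]
          congr 1
          ext v <;> simp [Iso.trans, Iso.symm]
      · rw [if_neg h, if_neg h, smul_zero]
    rw [key]
    rfl
  zero {Γ} h := by
    have key : coeff Γ = 0 := by
      refine Submodule.linearMap_qext _ (Finsupp.lhom_ext' fun Γ₁ => LinearMap.ext_ring ?_)
      have h1 : ∀ Γ, coeff Γ ((relations m).mkQ (Finsupp.single Γ₁ 1)) = pairing Γ Γ₁ :=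
        fun Γ => liftHT_diag _ _ _ Γ₁
      simp only [LinearMap.comp_apply, Finsupp.lsingle_apply, LinearMap.zero_apply]
      rw [h1, pairing]
      split_ifs with h2
      · exact Finset.sum_eq_zero fun φ _ => absurd (h2.of_iso φ) h
      · rfl
    rw [key]
    rfl

theorem coeff_diag (Γ Γ' : Diagram m) : coeff Γ (diag Γ') = pairing Γ Γ' := liftHT_diag _ _ _ _

/-! ### Homotopy link diagrams have no nontrivial automorphisms -/

theorem Diagram.IsHomotopyLink.adj {Γ : Diagram m} (H : Γ.IsHomotopyLink) (h) :
    Γ.graph.Adj (vert h) (vert (Γ.e h)) :=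
  ⟨(H.no_loop h).symm, h, rfl, rfl⟩

/-- Legs are fixed by every automorphism. If a half-edge is moved, so is the other end of its edge,
which therefore lies at a free vertex, and a second half-edge at that vertex must move too.
Continuing in this way produces paths of any length in a finite forest. -/
theorem Diagram.IsHomotopyLink.aut_apply {Γ : Diagram m} (H : Γ.IsHomotopyLink) (φ : Iso Γ Γ) (h) :
    φ.halfEquiv h = h := by
  by_contra hne
  have hleg : ∀ h, φ.halfEquiv h ≠ h → ∃ v c, h = Γ.half v c := by
    rintro (⟨i, p⟩ | ⟨v, c⟩) hh
    · exact absurd (φ.halfEquiv_leg i p) hh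
    · exact ⟨v, c, rfl⟩
  have he : ∀ h, φ.halfEquiv h ≠ h → φ.halfEquiv (Γ.e h) ≠ Γ.e h := by
    intro h hh h'
    rw [φ.halfEquiv_e] at h'
    exact hh (by rw [← Γ.e_e (φ.halfEquiv h), h', Γ.e_e])
  have key : ∀ n : ℕ, ∃ (h : HalfEdge Γ.q Γ.f) (u : Vertex Γ.q Γ.f) (p : Γ.graph.Walk u (vert h)),
      φ.halfEquiv h ≠ h ∧ p.length = n ∧ p.IsPath ∧ vert (Γ.e h) ∉ p.support := by
    intro n
    induction n with
    | zero =>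
      exact ⟨h, vert h, SimpleGraph.Walk.nil, hne, rfl, SimpleGraph.Walk.IsPath.nil, by
        simpa using H.no_loop h⟩
    | succ n ih =>
      obtain ⟨h, u, p, h1, h2, h3, h4⟩ := ih
      obtain ⟨v, c, hv⟩ := hleg _ (he h h1)
      -- If the two other half-edges were fixed, the vertex would be fixed, and a permutation of
      -- three elements that fixes two of them fixes the third.
      have hc : ∃ c', c' ≠ c ∧ φ.halfEquiv (Γ.half v c') ≠ Γ.half v c' := by
        by_contra! hcon
        have hfix : ∀ c', c' ≠ c → φ.free v = v ∧ φ.rot v c' = c' := by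
          intro c' hc'
          have := hcon c' hc'
          rw [φ.halfEquiv_half] at this
          simpa using this
        have hfree : φ.free v = v := (hfix (c + 1) ((by decide : ∀ c : Fin 3, c + 1 ≠ c) c)).1
        have hrot : φ.rot v c = c := by
          by_contra hr
          exact hr ((φ.rot v).injective (hfix _ hr).2)
        apply he h h1
        rw [hv, φ.halfEquiv_half, hfree, hrot]
      obtain ⟨c', hc', hc''⟩ := hc
      have hq := h3.concat h4 (H.adj h)
      have hvv : vert (Γ.e h) = vert (Γ.half v c') := by rw [hv]; rfl
      refine ⟨Γ.half v c', u, (p.concat (H.adj h)).copy rfl hvv, hc'', by simp [h2], by simpa, ?_⟩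
      intro hmem
      rw [SimpleGraph.Walk.support_copy] at hmem
      have hadj := H.adj (Γ.half v c')
      rw [← hvv] at hadj
      -- In a forest, a neighbour of the end of a path that lies on the path is its penultimate
      -- vertex. The new edge would then be parallel to the last one.
      have h5 := H.acyclic.eq_penultimate_of_adj_end hq hadj hmem
      rw [SimpleGraph.Walk.penultimate_concat] at h5
      have h6 := H.no_multi (Γ.half v c') (Γ.e h) hvv.symm (by rw [h5, Γ.e_e])
      rw [hv] at h6
      simp at h6
      exact hc' h6
  obtain ⟨h, u, p, -, h2, h3, -⟩ := key (Fintype.card (Vertex Γ.q Γ.f))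
  have := h3.length_lt
  omega

theorem Diagram.Iso.ext_half {Γ Γ' : Diagram m} {φ ψ : Iso Γ Γ'}
    (h : ∀ h, φ.halfEquiv h = ψ.halfEquiv h) : φ = ψ := by
  have h1 : ∀ v c, φ.free v = ψ.free v ∧ φ.rot v c = ψ.rot v c := by
    intro v c
    have := h (Γ.half v c)
    rw [halfEquiv_half, halfEquiv_half] at this
    simpa using this
  ext v c
  · rw [(h1 v 0).1]
  · rw [(h1 v c).2]

theorem Diagram.Iso.halfEquiv_trans {Γ₁ Γ₂ Γ₃ : Diagram m} (φ : Iso Γ₁ Γ₂) (ψ : Iso Γ₂ Γ₃) (h) :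
    (φ.trans ψ).halfEquiv h = ψ.halfEquiv (φ.halfEquiv h) := by
  rcases h with ⟨i, p⟩ | ⟨v, c⟩ <;> rfl

theorem Diagram.Iso.halfEquiv_symm_apply {Γ₁ Γ₂ : Diagram m} (φ : Iso Γ₁ Γ₂) (h) :
    φ.symm.halfEquiv (φ.halfEquiv h) = h := by
  rcases h with ⟨i, p⟩ | ⟨v, c⟩
  · rfl
  · rw [φ.halfEquiv_half, halfEquiv_half]
    simp [symm]

theorem Diagram.IsHomotopyLink.iso_unique {Γ Γ' : Diagram m} (H : Γ.IsHomotopyLink)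
    (φ ψ : Iso Γ Γ') : φ = ψ := by
  apply Iso.ext_half
  intro h
  have := H.aut_apply (φ.trans ψ.symm) h
  rw [Iso.halfEquiv_trans] at this
  apply ψ.symm.halfEquiv.injective
  rw [this, ψ.halfEquiv_symm_apply]

theorem Diagram.Iso.sign_mul_self {Γ Γ' : Diagram m} (φ : Iso Γ Γ') : φ.sign * φ.sign = 1 := by
  rw [Iso.sign, ← Finset.prod_mul_distrib]
  refine Finset.prod_eq_one fun v _ => ?_
  rcases Int.units_eq_one_or (Equiv.Perm.sign (φ.rot v)) with h | h <;> simp [h]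

theorem pairing_of_iso {Γ Γ' : Diagram m} (H : Γ'.IsHomotopyLink) (φ : Iso Γ Γ') :
    pairing Γ Γ' = φ.sign := by
  rw [pairing, if_pos H, Fintype.sum_eq_single φ]
  exact fun ψ hψ => absurd ((H.of_iso φ).iso_unique ψ φ) hψ

theorem pairing_of_isEmpty {Γ Γ' : Diagram m} (h : IsEmpty (Iso Γ Γ')) : pairing Γ Γ' = 0 := by
  rw [pairing]
  split_ifs
  · exact Finset.sum_eq_zero fun φ _ => h.elim φ
  · rfl

theorem pairing_of_not {Γ Γ' : Diagram m} (H : ¬ Γ'.IsHomotopyLink) : pairing Γ Γ' = 0 := by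
  rw [pairing, if_neg H]

theorem pairing_ne_zero {Γ Γ' : Diagram m} (h : pairing Γ Γ' ≠ 0) :
    Γ'.IsHomotopyLink ∧ Nonempty (Iso Γ Γ') := by
  constructor
  · by_contra H
    exact h (pairing_of_not H)
  · by_contra H
    exact h (pairing_of_isEmpty (not_nonempty_iff.1 H))

/-! ### Reconstructing an element from its coefficients -/

open Classical in
/-- The number of diagrams in a finite set which are isomorphic to a given one. -/
def isoCount (s : Finset (Diagram m)) (Γ : Diagram m) : ℝ :=
  ((s.filter fun Γ' => Nonempty (Iso Γ Γ')).card : ℝ)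

theorem isoCount_iso (s : Finset (Diagram m)) {Γ Γ' : Diagram m} (φ : Iso Γ Γ') :
    isoCount s Γ = isoCount s Γ' := by
  classical
  rw [isoCount, isoCount]
  congr 2
  ext Γ₁
  simp only [Finset.mem_filter]
  exact and_congr_right fun _ => ⟨fun ⟨ψ⟩ => ⟨φ.symm.trans ψ⟩, fun ⟨ψ⟩ => ⟨φ.trans ψ⟩⟩

theorem isoCount_ne_zero {s : Finset (Diagram m)} {Γ : Diagram m} (h : Γ ∈ s) :
    isoCount s Γ ≠ 0 := by
  classical
  rw [isoCount, Nat.cast_ne_zero, ← Nat.pos_iff_ne_zero, Finset.card_pos]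
  exact ⟨Γ, Finset.mem_filter.2 ⟨h, ⟨Iso.refl Γ⟩⟩⟩

/-- The combination of the diagrams in a finite set with prescribed coefficients. -/
def recon (s : Finset (Diagram m)) (c : Diagram m → ℝ) : HT m :=
  ∑ Γ ∈ s, (c Γ / isoCount s Γ) • diag Γ

/-- All members of `s` isomorphic to `Γ₀` contribute the same amount, since the signs of `c`, of the
pairing and of the isomorphism match; division by `isoCount` compensates for their number. -/
theorem coeff_recon {s : Finset (Diagram m)} {c : Diagram m → ℝ} (hc : IsDiagramFun c)
    {Γ₀ : Diagram m} (h : ∃ Γ ∈ s, Nonempty (Iso Γ₀ Γ)) : coeff Γ₀ (recon s c) = c Γ₀ := by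
  classical
  obtain ⟨Γ₁, hΓ₁, ⟨φ₁⟩⟩ := h
  rw [recon, map_sum]
  simp only [map_smul, coeff_diag, smul_eq_mul]
  by_cases H : Γ₀.IsHomotopyLink
  · have key : ∀ Γ ∈ s, c Γ / isoCount s Γ * pairing Γ₀ Γ =
        if Nonempty (Iso Γ₀ Γ) then c Γ₀ / isoCount s Γ₀ else 0 := by
      intro Γ _
      split_ifs with h
      · obtain ⟨φ⟩ := h
        rw [pairing_of_iso (H.of_iso φ.symm) φ, hc.iso φ, isoCount_iso s φ]
        ring
      · rw [pairing_of_isEmpty (not_nonempty_iff.1 h), mul_zero]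
    rw [Finset.sum_congr rfl key, ← Finset.sum_filter, Finset.sum_const, nsmul_eq_mul]
    change isoCount s Γ₀ * _ = _
    have := isoCount_ne_zero hΓ₁
    rw [← isoCount_iso s φ₁] at this
    field_simp
  · rw [hc.zero H]
    refine Finset.sum_eq_zero fun Γ _ => ?_
    by_cases hn : Nonempty (Iso Γ₀ Γ)
    · obtain ⟨φ⟩ := hn
      rw [pairing_of_not fun h => H (h.of_iso φ), mul_zero]
    · rw [pairing_of_isEmpty (not_nonempty_iff.1 hn), mul_zero]

theorem coeff_recon_of_not {s : Finset (Diagram m)} {c : Diagram m → ℝ}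
    {Γ₀ : Diagram m} (h : ∀ Γ ∈ s, IsEmpty (Iso Γ₀ Γ)) : coeff Γ₀ (recon s c) = 0 := by
  rw [recon, map_sum]
  refine Finset.sum_eq_zero fun Γ hΓ => ?_
  rw [map_smul, coeff_diag, pairing_of_isEmpty (h Γ hΓ), smul_zero]

/-- It follows that an element of such a span is determined by its coefficients. Here too `isoCount`
corrects for several representatives of one isomorphism class. -/
theorem recon_coeff {s : Finset (Diagram m)} {x : HT m}
    (hx : x ∈ Submodule.span ℝ (diag '' (s : Set (Diagram m)))) :
    recon s (fun Γ => coeff Γ x) = x := by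
  classical
  induction hx using Submodule.span_induction with
  | zero => simp [recon]
  | add x y _ _ hx hy =>
    conv_rhs => rw [← hx, ← hy]
    simp only [recon, map_add, add_div, add_smul, Finset.sum_add_distrib]
  | smul a x _ hx =>
    conv_rhs => rw [← hx]
    simp only [recon, map_smul, smul_eq_mul, mul_div_assoc, mul_smul, Finset.smul_sum]
  | mem x hx =>
    obtain ⟨Γ₁, hΓ₁, rfl⟩ := hx
    rw [recon]
    by_cases H : Γ₁.IsHomotopyLink
    · have key : ∀ Γ ∈ s, (coeff Γ (diag Γ₁) / isoCount s Γ) • diag Γ =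
          if Nonempty (Iso Γ₁ Γ) then (isoCount s Γ₁)⁻¹ • diag Γ₁ else 0 := by
        intro Γ _
        split_ifs with h
        · obtain ⟨φ⟩ := h
          rw [coeff_diag, pairing_of_iso H φ.symm, diag_iso φ.symm, smul_smul, isoCount_iso s φ]
          congr 1
          have := φ.symm.sign_mul_self
          rw [div_mul_eq_mul_div, this, one_div]
        · rw [coeff_diag, pairing_of_isEmpty ⟨fun φ => h ⟨φ.symm⟩⟩, zero_div, zero_smul]
      rw [Finset.sum_congr rfl key, ← Finset.sum_filter, Finset.sum_const, ← Nat.cast_smul_eq_nsmul ℝ,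
        smul_smul]
      change (isoCount s Γ₁ * _) • _ = _
      rw [mul_inv_cancel₀ (isoCount_ne_zero hΓ₁), one_smul]
    · rw [diag_eq_zero H]
      simp

/-! ### Diagrams of fixed order, and the filtration read off from coefficients -/

theorem finite_bounded (N : ℕ) : {Γ : Diagram m | (∀ i, Γ.q i < N) ∧ Γ.f < N}.Finite := by
  have : {Γ : Diagram m | (∀ i, Γ.q i < N) ∧ Γ.f < N} ⊆ ⋃ (q : Fin m → Fin N) (f : Fin N),
      Set.range fun e : {e : HalfEdge (fun i => (q i : ℕ)) f → HalfEdge (fun i => (q i : ℕ)) f //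
        (∀ h, e (e h) = h) ∧ ∀ h, e h ≠ h} => (⟨_, _, e.1, e.2.1, e.2.2⟩ : Diagram m) := by
    rintro ⟨q, f, e, h1, h2⟩ ⟨hq, hf⟩
    simp only [Set.mem_iUnion]
    exact ⟨fun i => ⟨q i, hq i⟩, ⟨f, hf⟩, ⟨e, h1, h2⟩, rfl⟩
  exact (Set.finite_iUnion fun q => Set.finite_iUnion fun f => Set.finite_range _).subset this

theorem finite_hasOrder (m n : ℕ) : {Γ : Diagram m | Γ.HasOrder n}.Finite := by
  refine (finite_bounded (2 * n + 1)).subset fun Γ h => ?_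
  have h1 : (∑ i, Γ.q i) + Γ.f = 2 * n := by
    have : Fintype.card (Vertex Γ.q Γ.f) = 2 * n := h
    simpa using this
  refine ⟨fun i => ?_, by omega⟩
  have := Finset.single_le_sum (f := Γ.q) (fun _ _ => Nat.zero_le _) (Finset.mem_univ i)
  omega

/-- The diagrams of order `n`. -/
def ofOrder (m n : ℕ) : Finset (Diagram m) := (finite_hasOrder m n).toFinset

theorem mem_ofOrder {n : ℕ} {Γ : Diagram m} : Γ ∈ ofOrder m n ↔ Γ.HasOrder n := by
  simp [ofOrder]

theorem hasOrder_iff {n : ℕ} {Γ : Diagram m} : Γ.HasOrder n ↔ (∑ i, Γ.q i) + Γ.f = 2 * n := by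
  have : Γ.HasOrder n ↔ Fintype.card (Vertex Γ.q Γ.f) = 2 * n := Iff.rfl
  rw [this]
  simp

theorem HasOrder.of_iso {n : ℕ} {Γ Γ' : Diagram m} (φ : Iso Γ Γ') (h : Γ.HasOrder n) :
    Γ'.HasOrder n := by
  rw [hasOrder_iff] at h ⊢
  have : Γ.f = Γ'.f := by simpa using Fintype.card_congr φ.free
  rw [← φ.q_eq, ← this, h]

theorem free_card {Γ Γ' : Diagram m} (φ : Iso Γ Γ') : Γ.f = Γ'.f := by
  simpa using Fintype.card_congr φ.free

theorem chains_le_span (m n : ℕ) (k : ℤ) :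
    chains m n k ≤ Submodule.span ℝ (diag '' (ofOrder m n : Set (Diagram m))) := by
  refine Submodule.span_mono ?_
  rintro x ⟨Γ, -, h, -, rfl⟩
  exact ⟨Γ, mem_ofOrder.2 h, rfl⟩

theorem coeff_eq_zero_of_mem_chains {n : ℕ} {k : ℤ} {x : HT m} (hx : x ∈ chains m n k)
    {Γ : Diagram m} (h : ¬ (Γ.HasOrder n ∧ (Γ.f : ℤ) ≤ k)) : coeff Γ x = 0 := by
  have : chains m n k ≤ LinearMap.ker (coeff Γ) := by
    rw [chains, Submodule.span_le]
    rintro y ⟨Γ', -, h1, h2, rfl⟩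
    rw [SetLike.mem_coe, LinearMap.mem_ker, coeff_diag]
    refine pairing_of_isEmpty ⟨fun φ => h ?_⟩
    rw [free_card φ]
    exact ⟨HasOrder.of_iso φ.symm h1, h2⟩
  exact this hx

theorem recon_mem_chains {n : ℕ} {k : ℤ} {c : Diagram m → ℝ} (hc : IsDiagramFun c)
    (h : ∀ Γ, Γ.HasOrder n → k < Γ.f → c Γ = 0) : recon (ofOrder m n) c ∈ chains m n k := by
  refine Submodule.sum_mem _ fun Γ hΓ => ?_
  rw [mem_ofOrder] at hΓ
  by_cases H : Γ.IsHomotopyLink ∧ (Γ.f : ℤ) ≤ k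
  · exact Submodule.smul_mem _ _ (Submodule.subset_span ⟨Γ, H.1, hΓ, H.2, rfl⟩)
  · have : c Γ = 0 := by
      by_cases H1 : Γ.IsHomotopyLink
      · exact h Γ hΓ (lt_of_not_ge fun h2 => H ⟨H1, h2⟩)
      · exact hc.zero H1
    rw [this, zero_div, zero_smul]
    exact Submodule.zero_mem _

theorem coeff_recon_ofOrder {n : ℕ} {c : Diagram m → ℝ} (hc : IsDiagramFun c)
    (h : ∀ Γ, ¬ Γ.HasOrder n → c Γ = 0) (Γ : Diagram m) :
    coeff Γ (recon (ofOrder m n) c) = c Γ := by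
  by_cases hΓ : Γ.HasOrder n
  · exact coeff_recon hc ⟨Γ, mem_ofOrder.2 hΓ, ⟨Iso.refl Γ⟩⟩
  · rw [h Γ hΓ]
    refine coeff_recon_of_not fun Γ' h' => ⟨fun φ => hΓ (HasOrder.of_iso φ.symm ?_)⟩
    exact mem_ofOrder.1 h'

/-- An element of `chains m n k` lies in `chains m n k'` if its coefficients do. -/
theorem mem_chains_iff {n : ℕ} {k k' : ℤ} {x : HT m} (hx : x ∈ chains m n k) :
    x ∈ chains m n k' ↔ ∀ Γ : Diagram m, Γ.HasOrder n → k' < Γ.f → coeff Γ x = 0 := by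
  constructor
  · intro h Γ _ hf
    exact coeff_eq_zero_of_mem_chains h fun h' => absurd h'.2 (not_le.2 hf)
  · intro h
    rw [← recon_coeff (chains_le_span m n k hx)]
    exact recon_mem_chains (isDiagramFun_coeff x) h

/-! ### The homotopy link condition for resolutions and disjoint unions -/

/-- The edges of `D` are edges of `S`, but both new legs lie over the vertex `w`. Bridges of `S`
stay bridges in `D`, which excludes cycles. The only legs of `D` on one segment that could become
connected are the two new ones, and a path between them would close up to a cycle through `w` in
`S`. -/
theorem IsResolution.isHomotopyLink {S D : Diagram m} {i : Fin m} {p : Fin (S.q i)} {w : Fin S.f}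
    {x y : Fin 3} (R : IsResolution S D i p w x y) (H : S.IsHomotopyLink) : D.IsHomotopyLink := by
  obtain ⟨hstem, hqi, hqj, -, ψ, ψinj, ψe, ψfree, ψj, ψlt, ψp, ψp1, ψgt⟩ := R
  choose v' hv'w hv' using ψfree
  let V : Vertex D.q D.f → Vertex S.q S.f := Sum.elim (fun s => vert (ψ (Sum.inl s))) fun v =>
    Sum.inr (v' v)
  have hV : ∀ h, vert (ψ h) = V (vert h) := by
    rintro (s | ⟨v, c⟩)
    · rfl
    · change vert (ψ (D.half v c)) = _
      rw [hv']
      rfl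
  -- As `ψ` is injective and `S` has no multiple edges, no other edge of `D` lies over the image of
  -- the edge at `h`. So deleting an edge is compatible with the vertex map `V`.
  have hdel : ∀ h u v, (D.graph.deleteEdges {s(vert h, vert (D.e h))}).Reachable u v →
      (S.graph.deleteEdges {s(V (vert h), V (vert (D.e h)))}).Reachable (V u) (V v) := by
    intro h u v hr
    let F : D.graph.deleteEdges {s(vert h, vert (D.e h))} →g
        S.graph.deleteEdges {s(V (vert h), V (vert (D.e h)))} :=
      { toFun := V
        map_rel' := by
          intro a b hab
          rw [SimpleGraph.deleteEdges_adj] at hab ⊢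
          obtain ⟨⟨hne, h', rfl, rfl⟩, hs⟩ := hab
          refine ⟨?_, fun hs' => hs ?_⟩
          · rw [← hV, ← hV, ψe]
            exact H.adj _
          · rw [Set.mem_singleton_iff, ← hV, ← hV, ← hV, ← hV, ψe, ψe, Sym2.eq_iff] at hs'
            rcases hs' with ⟨h1, h2⟩ | ⟨h1, h2⟩
            · rw [ψinj (H.no_multi _ _ h1 h2)]
              rfl
            · have := ψinj ((H.no_multi (ψ h') (ψ (D.e h)) (by rw [h1, ψe])
                (by rw [h2, ψe, S.e_e])))
              rw [this, D.e_e, Sym2.eq_swap]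
              rfl }
    exact hr.map F
  have hacyc : D.graph.IsAcyclic := by
    rw [SimpleGraph.isAcyclic_iff_forall_adj_isBridge]
    rintro u v ⟨hne, h, rfl, rfl⟩
    rw [SimpleGraph.isBridge_iff]
    intro hr
    have h1 := hdel h _ _ hr
    rw [← hV, ← hV, ψe] at h1
    exact SimpleGraph.isBridge_iff.1
      (SimpleGraph.isAcyclic_iff_forall_adj_isBridge.1 H.acyclic (H.adj (ψ h))) h1
  have hloop : ∀ h, vert (D.e h) ≠ vert h := by
    intro h hh
    apply H.no_loop (ψ h)
    rw [← ψe, hV, hV, hh]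
  have hadj : ∀ h, D.graph.Adj (vert h) (vert (D.e h)) := fun h => ⟨(hloop h).symm, h, rfl, rfl⟩
  let F : D.graph →g S.graph :=
    { toFun := V
      map_rel' := by
        rintro a b ⟨hne, h', rfl, rfl⟩
        rw [← hV, ← hV, ψe]
        exact H.adj _ }
  refine ⟨hloop, ?_, hacyc, ?_, ?_⟩
  · intro h h' h1 h2
    refine ψinj (H.no_multi _ _ ?_ ?_)
    · rw [hV, hV, h1]
    · rw [← ψe, ← ψe, hV, hV, h2]
  -- A walk in `S` to a segment is followed in `D` until it reaches a leg of `D`; this may happen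
  -- already at `w`.
  · have lift : ∀ u t, S.graph.Walk u t → ∀ s, t = Sum.inl s → ∀ v, V v = u →
        ∃ s', D.graph.Reachable v (Sum.inl s') := by
      intro u t W
      induction W with
      | nil =>
        rintro s rfl (s' | a) hv
        · exact ⟨s', SimpleGraph.Reachable.refl _⟩
        · cases hv
      | cons hadj' _ ih =>
        rintro s rfl (s' | a) hv
        · exact ⟨s', SimpleGraph.Reachable.refl _⟩
        · subst hv
          obtain ⟨-, h', h1, h2⟩ := hadj'
          rcases h' with h' | ⟨b, c⟩
          · cases h1
          · have h3 : b = v' a := Sum.inr_injective h1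
            subst h3
            obtain ⟨s', hs'⟩ := ih s rfl (vert (D.e (D.half a c))) (by rw [← hV, ψe, hv']; exact h2)
            exact ⟨s', (hadj (D.half a c)).reachable.trans hs'⟩
    intro v
    obtain ⟨s, ⟨W⟩⟩ := H.attached (V v)
    exact lift _ _ W s rfl v rfl
  · intro j r r' hr
    have hr2 : S.graph.Reachable (V (Sum.inl ⟨j, r⟩)) (V (Sum.inl ⟨j, r'⟩)) := hr.map F
    by_cases hj : j = i
    · subst hj
      have hw : S.graph.Reachable (Sum.inl ⟨j, p⟩) (Sum.inr w) := by
        have := (H.adj (S.leg j p)).reachable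
        rw [hstem] at this
        exact this
      -- The positions `p` and `p + 1` of `D` both correspond to position `p` of `S`, through the
      -- removed edge; later positions are shifted by one.
      have near : ∀ r : Fin (D.q j), ∃ t : Fin (S.q j),
          ((r : ℕ) ≤ p ∧ (t : ℕ) = r ∨ (p : ℕ) < r ∧ (t : ℕ) + 1 = r) ∧
          S.graph.Reachable (Sum.inl ⟨j, t⟩) (V (Sum.inl ⟨j, r⟩)) := by
        intro r
        change ∃ t : Fin (S.q j), _ ∧ S.graph.Reachable _ (vert (ψ (D.leg j r)))
        rcases lt_trichotomy (r : ℕ) p with h | h | h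
        · obtain ⟨t, h1, h2⟩ := ψlt r h
          exact ⟨t, Or.inl ⟨h.le, h1⟩, by rw [h2]; exact SimpleGraph.Reachable.refl _⟩
        · exact ⟨p, Or.inl ⟨h.le, h.symm⟩, by rw [ψp r h]; exact hw⟩
        · by_cases h1 : (r : ℕ) = p + 1
          · exact ⟨p, Or.inr ⟨h, h1.symm⟩, by rw [ψp1 r h1]; exact hw⟩
          · obtain ⟨t, h2, h3⟩ := ψgt r (by omega)
            exact ⟨t, Or.inr ⟨h, h2⟩, by rw [h3]; exact SimpleGraph.Reachable.refl _⟩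
      -- After its first edge, a path from `a` to `b` does not use that edge again. Its image joins
      -- the far end of the edge to `w`, which is also its near end, so the edge would not be a
      -- bridge of `S`.
      have far : ∀ a b : Fin (D.q j), (a : ℕ) = p → (b : ℕ) = p + 1 →
          ¬ D.graph.Reachable (Sum.inl ⟨j, a⟩) (Sum.inl ⟨j, b⟩) := by
        intro a b ha hb hab
        have hVa : V (Sum.inl ⟨j, a⟩) = Sum.inr w := by
          change vert (ψ (D.leg j a)) = _
          rw [ψp a ha]; rfl
        have hVb : V (Sum.inl ⟨j, b⟩) = Sum.inr w := by
          change vert (ψ (D.leg j b)) = _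
          rw [ψp1 b hb]; rfl
        obtain ⟨P, hP⟩ := hab.exists_isPath
        cases P with
        | nil => omega
        | cons hadj' Q =>
          rw [SimpleGraph.Walk.cons_isPath_iff] at hP
          obtain ⟨-, h, h1, rfl⟩ := hadj'
          have h1' : h = D.leg j a := by
            rcases h with s | ⟨v, c⟩
            · have : s = ⟨j, a⟩ := Sum.inl_injective h1
              rw [this]
            · cases h1
          have hr3 : (D.graph.deleteEdges {s(vert h, vert (D.e h))}).Reachable
              (vert (D.e h)) (Sum.inl ⟨j, b⟩) := by
            rw [SimpleGraph.reachable_deleteEdges_iff_exists_walk]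
            refine ⟨Q, fun hmem => hP.2 ?_⟩
            rw [← h1]
            exact SimpleGraph.Walk.fst_mem_support_of_mem_edges _ hmem
          have hr4 := hdel h _ _ hr3
          rw [hVb, ← hVa, ← h1] at hr4
          rw [← hV, ← hV, ψe] at hr4
          exact SimpleGraph.isBridge_iff.1
            (SimpleGraph.isAcyclic_iff_forall_adj_isBridge.1 H.acyclic (H.adj (ψ h))) hr4.symm
      obtain ⟨t, ht, ht'⟩ := near r
      obtain ⟨t', hs, hs'⟩ := near r'
      have := H.distinct _ _ _ (ht'.trans (hr2.trans hs'.symm))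
      subst this
      by_contra hne
      have hne' : (r : ℕ) ≠ r' := fun h => hne (Fin.ext h)
      rcases ht with ht | ht <;> rcases hs with hs | hs
      · omega
      · exact far r r' (by omega) (by omega) hr
      · exact far r' r (by omega) (by omega) hr.symm
      · omega
    · obtain ⟨t, h1, h2⟩ := ψj j hj r
      obtain ⟨t', h1', h2'⟩ := ψj j hj r'
      change S.graph.Reachable (vert (ψ (D.leg j r))) (vert (ψ (D.leg j r'))) at hr2
      rw [h2, h2'] at hr2
      have := H.distinct _ _ _ hr2
      apply Fin.ext
      rw [← h1, ← h1', this]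

/-- Walks lift along maps of diagrams that are local isomorphisms. -/
theorem exists_walk_lift {Γ Γ' : Diagram m} (H : Γ.IsHomotopyLink)
    (hm : HalfEdge Γ.q Γ.f → HalfEdge Γ'.q Γ'.f)
    (vm : Vertex Γ.q Γ.f → Vertex Γ'.q Γ'.f) (vinj : Function.Injective vm)
    (hv : ∀ h, vert (hm h) = vm (vert h)) (he : ∀ h, hm (Γ.e h) = Γ'.e (hm h))
    (hs : ∀ v h', vert h' = vm v → ∃ h, hm h = h') {u t} (W : Γ'.graph.Walk u t) :
    ∀ v, vm v = u → ∃ v', vm v' = t ∧ ∃ P : Γ.graph.Walk v v', P.edges.map (Sym2.map vm) = W.edges := by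
  induction W with
  | nil => exact fun v hv => ⟨v, hv, SimpleGraph.Walk.nil, rfl⟩
  | cons hadj W ih =>
    rintro v rfl
    obtain ⟨-, h', h1, h2⟩ := id hadj
    subst h2
    obtain ⟨h, rfl⟩ := hs v h' h1
    have e1 : vert h = v := vinj (by rw [← hv, h1])
    subst e1
    obtain ⟨v', hv', P, hP⟩ := ih (vert (Γ.e h)) (by rw [← hv, he])
    refine ⟨v', hv', SimpleGraph.Walk.cons (H.adj h) P, ?_⟩
    have e2 : vert (Γ'.e (hm h)) = vm (vert (Γ.e h)) := by rw [← he, hv]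
    rw [SimpleGraph.Walk.edges_cons, SimpleGraph.Walk.edges_cons, List.map_cons, hP]
    congr 1
    change s(vm _, vm _) = s(_, _)
    rw [e2]

/-- The identification of the vertices of two diagrams with those of the combined diagram. -/
def glueVert {q₁ q₂ : Fin m → ℕ} {f₁ f₂ : ℕ} (σ : Shuffle q₁ q₂) :
    Vertex q₁ f₁ ⊕ Vertex q₂ f₂ ≃ Vertex (q₁ + q₂) (f₁ + f₂) :=
  (Equiv.sumSumSumComm _ _ _ _).trans <| Equiv.sumCongr
    ((Equiv.sigmaSumDistrib _ _).symm.trans (Equiv.sigmaCongrRight σ.1)) finSumFinEquiv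

theorem vert_glueHalf {q₁ q₂ : Fin m → ℕ} {f₁ f₂ : ℕ} (σ : Shuffle q₁ q₂)
    (x : HalfEdge q₁ f₁ ⊕ HalfEdge q₂ f₂) :
    vert (glueHalf σ x) = glueVert σ (Sum.map vert vert x) := by
  rcases x with (⟨i, p⟩ | ⟨v, c⟩) | (⟨i, p⟩ | ⟨v, c⟩) <;> rfl

theorem glue_e {Γ₁ Γ₂ : Diagram m} (σ : Shuffle Γ₁.q Γ₂.q) (x) :
    (glue Γ₁ Γ₂ σ).e (glueHalf σ x) = glueHalf σ (Sum.map Γ₁.e Γ₂.e x) := by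
  change glueHalf σ (Sum.map Γ₁.e Γ₂.e ((glueHalf σ).symm _)) = _
  rw [Equiv.symm_apply_apply]

/-- There are no edges between the two parts, so every walk stays in one part and lifts to it; each
condition is then inherited from that part. -/
theorem isHomotopyLink_glue {Γ₁ Γ₂ : Diagram m} (σ : Shuffle Γ₁.q Γ₂.q) (H₁ : Γ₁.IsHomotopyLink)
    (H₂ : Γ₂.IsHomotopyLink) : (glue Γ₁ Γ₂ σ).IsHomotopyLink := by
  have L₁ : ∀ {u t} (W : (glue Γ₁ Γ₂ σ).graph.Walk u t) (v), glueVert σ (Sum.inl v) = u →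
      ∃ v', glueVert σ (Sum.inl v') = t ∧ ∃ P : Γ₁.graph.Walk v v',
        P.edges.map (Sym2.map fun v => glueVert σ (Sum.inl v)) = W.edges := by
    intro u t W
    refine exists_walk_lift H₁ (fun h => glueHalf σ (Sum.inl h)) _
      ((glueVert σ).injective.comp Sum.inl_injective) (fun h => vert_glueHalf σ _)
      (fun h => (glue_e σ (Sum.inl h)).symm) ?_ W
    intro v h' hh
    obtain ⟨x, rfl⟩ := (glueHalf σ).surjective h'
    have := (glueVert σ).injective ((vert_glueHalf σ x).symm.trans hh)
    rcases x with x | x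
    · exact ⟨x, rfl⟩
    · simp at this
  have L₂ : ∀ {u t} (W : (glue Γ₁ Γ₂ σ).graph.Walk u t) (v), glueVert σ (Sum.inr v) = u →
      ∃ v', glueVert σ (Sum.inr v') = t ∧ ∃ P : Γ₂.graph.Walk v v',
        P.edges.map (Sym2.map fun v => glueVert σ (Sum.inr v)) = W.edges := by
    intro u t W
    refine exists_walk_lift H₂ (fun h => glueHalf σ (Sum.inr h)) _
      ((glueVert σ).injective.comp Sum.inr_injective) (fun h => vert_glueHalf σ _)
      (fun h => (glue_e σ (Sum.inr h)).symm) ?_ W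
    intro v h' hh
    obtain ⟨x, rfl⟩ := (glueHalf σ).surjective h'
    have := (glueVert σ).injective ((vert_glueHalf σ x).symm.trans hh)
    rcases x with x | x
    · simp at this
    · exact ⟨x, rfl⟩
  have hloop : ∀ h, vert ((glue Γ₁ Γ₂ σ).e h) ≠ vert h := by
    intro h hh
    obtain ⟨x, rfl⟩ := (glueHalf σ).surjective h
    rw [glue_e] at hh
    have hh := (vert_glueHalf _ _).symm.trans (hh.trans (vert_glueHalf _ _))
    rcases x with x | x
    · exact H₁.no_loop x (by simpa using hh)
    · exact H₂.no_loop x (by simpa using hh)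
  refine ⟨hloop, ?_, ?_, ?_, ?_⟩
  · intro h h' h1 h2
    obtain ⟨x, rfl⟩ := (glueHalf σ).surjective h
    obtain ⟨x', rfl⟩ := (glueHalf σ).surjective h'
    rw [glue_e, glue_e] at h2
    have h1 := (vert_glueHalf _ _).symm.trans (h1.trans (vert_glueHalf _ _))
    have h2 := (vert_glueHalf _ _).symm.trans (h2.trans (vert_glueHalf _ _))
    rcases x with x | x <;> rcases x' with x' | x' <;> simp at h1 h2
    · rw [H₁.no_multi _ _ h1 h2]
    · rw [H₂.no_multi _ _ h1 h2]
  · rw [SimpleGraph.isAcyclic_iff_forall_adj_isBridge]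
    rintro u v ⟨hne, h, rfl, rfl⟩
    obtain ⟨x, rfl⟩ := (glueHalf σ).surjective h
    rw [SimpleGraph.isBridge_iff_forall_walk_mem_edges]
    intro W
    rcases x with x | x
    · obtain ⟨v', hv', P, hP⟩ := L₁ W (vert x) (vert_glueHalf σ (Sum.inl x)).symm
      rw [← hP]
      have hv'' : v' = vert (Γ₁.e x) := by
        rw [glue_e] at hv'
        have := hv'.trans (vert_glueHalf _ _)
        simpa using this
      rw [hv''] at hv'
      subst hv''
      exact List.mem_map.2 ⟨s(vert x, vert (Γ₁.e x)),
        SimpleGraph.isBridge_iff_forall_walk_mem_edges.1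
          (SimpleGraph.isAcyclic_iff_forall_adj_isBridge.1 H₁.acyclic (H₁.adj x)) P,
        congrArg₂ (fun a b => s(a, b)) (vert_glueHalf σ (Sum.inl x)).symm hv'⟩
    · obtain ⟨v', hv', P, hP⟩ := L₂ W (vert x) (vert_glueHalf σ (Sum.inr x)).symm
      rw [← hP]
      have hv'' : v' = vert (Γ₂.e x) := by
        rw [glue_e] at hv'
        have := hv'.trans (vert_glueHalf _ _)
        simpa using this
      rw [hv''] at hv'
      subst hv''
      exact List.mem_map.2 ⟨s(vert x, vert (Γ₂.e x)),
        SimpleGraph.isBridge_iff_forall_walk_mem_edges.1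
          (SimpleGraph.isAcyclic_iff_forall_adj_isBridge.1 H₂.acyclic (H₂.adj x)) P,
        congrArg₂ (fun a b => s(a, b)) (vert_glueHalf σ (Sum.inr x)).symm hv'⟩
  · intro v
    obtain ⟨x, rfl⟩ := (glueVert σ).surjective v
    rcases x with x | x
    · obtain ⟨⟨i, p⟩, hs⟩ := H₁.attached x
      let F : Γ₁.graph →g (glue Γ₁ Γ₂ σ).graph :=
        { toFun := fun v => glueVert σ (Sum.inl v)
          map_rel' := by
            rintro a b ⟨hne, h, rfl, rfl⟩
            exact ⟨fun hh => hne (Sum.inl_injective ((glueVert σ).injective hh)),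
              glueHalf σ (Sum.inl h), vert_glueHalf σ _, by rw [glue_e]; exact vert_glueHalf σ _⟩ }
      exact ⟨_, hs.map F⟩
    · obtain ⟨⟨i, p⟩, hs⟩ := H₂.attached x
      let F : Γ₂.graph →g (glue Γ₁ Γ₂ σ).graph :=
        { toFun := fun v => glueVert σ (Sum.inr v)
          map_rel' := by
            rintro a b ⟨hne, h, rfl, rfl⟩
            exact ⟨fun hh => hne (Sum.inr_injective ((glueVert σ).injective hh)),
              glueHalf σ (Sum.inr h), vert_glueHalf σ _, by rw [glue_e]; exact vert_glueHalf σ _⟩ }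
      exact ⟨_, hs.map F⟩
  · rintro i p p' ⟨W⟩
    obtain ⟨x, rfl⟩ := (σ.1 i).surjective p
    obtain ⟨x', rfl⟩ := (σ.1 i).surjective p'
    rcases x with x | x
    · obtain ⟨v', hv', P, -⟩ := L₁ W (Sum.inl ⟨i, x⟩) rfl
      rcases x' with x' | x'
      · have h2 : glueVert σ (Sum.inl v') = glueVert σ (Sum.inl (Sum.inl ⟨i, x'⟩)) := hv'
        have := Sum.inl_injective ((glueVert σ).injective h2)
        subst this
        rw [H₁.distinct _ _ _ ⟨P⟩]
      · have h2 : glueVert σ (Sum.inl v') = glueVert σ (Sum.inr (Sum.inl ⟨i, x'⟩)) := hv'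
        have := (glueVert σ).injective h2
        simp at this
    · obtain ⟨v', hv', P, -⟩ := L₂ W (Sum.inl ⟨i, x⟩) rfl
      rcases x' with x' | x'
      · have h2 : glueVert σ (Sum.inr v') = glueVert σ (Sum.inl (Sum.inl ⟨i, x'⟩)) := hv'
        have := (glueVert σ).injective h2
        simp at this
      · have h2 : glueVert σ (Sum.inr v') = glueVert σ (Sum.inr (Sum.inl ⟨i, x'⟩)) := hv'
        have := Sum.inr_injective ((glueVert σ).injective h2)
        subst this
        rw [H₂.distinct _ _ _ ⟨P⟩]

/-- A walk from `v` to a segment has to leave the free vertices at some edge, and this edge ends at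
a leg. -/
theorem Diagram.IsHomotopyLink.exists_leg {Γ : Diagram m} (H : Γ.IsHomotopyLink) (v : Fin Γ.f) :
    ∃ v' c i p, Γ.e (Γ.half v' c) = Γ.leg i p := by
  have key : ∀ u t, Γ.graph.Walk u t → ∀ s v, t = Sum.inl s → u = Sum.inr v →
      ∃ v' c i p, Γ.e (Γ.half v' c) = Γ.leg i p := by
    intro u t W
    induction W with
    | nil =>
      rintro s v h1 h2
      rw [h1] at h2
      cases h2
    | cons hadj _ ih =>
      rintro s v h1 rfl
      obtain ⟨-, h, h2, h3⟩ := hadj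
      rcases h with _ | ⟨b, c⟩
      · cases h2
      · rcases h4 : Γ.e (Sum.inr (b, c)) with ⟨i, p⟩ | ⟨a, d⟩
        · exact ⟨b, c, i, p, h4⟩
        · rw [h4] at h3
          exact ih s a h1 h3.symm
  obtain ⟨s, ⟨W⟩⟩ := H.attached (Sum.inr v)
  exact key _ _ W s v rfl rfl

theorem CodeHL.exists_leg {w : List (Fin m × ℤ)} {T : Multiset (Fin 3 → ℤ)} (H : CodeHL w T)
    (hT : T ≠ 0) : ∃ τ ∈ T, ∃ c i, (i, -τ c) ∈ w := by
  obtain ⟨Γ, ℓ, HL, H⟩ := H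
  have hf : 0 < Γ.f := by
    rw [← HL.card_tri]
    exact Multiset.card_pos.2 hT
  obtain ⟨v, c, i, p, h⟩ := H.exists_leg ⟨0, hf⟩
  refine ⟨fun c => ℓ (Γ.half v c), ?_, c, i, ?_⟩
  · rw [HL.tri]
    exact Multiset.mem_map_of_mem _ (Finset.mem_univ v)
  · rw [← mem_onSeg, HL.word, List.mem_ofFn]
    exact ⟨p, by rw [← h, HL.neg]⟩

/-! ### Potentials on words -/

section Potential

variable {α : Type*}

/-- The cost of moving the letter `a`, which follows the word `pre`, into the word `l` as in
insertion sort, if `ω pre a b post` is the cost of exchanging `a` and `b` in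
`pre ++ a :: b :: post`. -/
def insCost [LinearOrder α] (ω : List α → α → α → List α → ℝ) : List α → α → List α → ℝ
  | _, _, [] => 0
  | pre, a, b :: l => if a ≤ b then 0 else ω pre a b l + insCost ω (pre ++ [b]) a l

/-- The cost of sorting the word `l`, which follows the word `pre`, by insertion. -/
def sortCost [LinearOrder α] (ω : List α → α → α → List α → ℝ) : List α → List α → ℝ
  | _, [] => 0
  | pre, a :: l => sortCost ω (pre ++ [a]) l + insCost ω pre a (l.insertionSort (· ≤ ·))

/-- The conditions for the costs of exchanging adjacent letters to come from a potential. They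
correspond to the Coxeter relations in the symmetric group. -/
structure IsExchangeCost (ω : List α → α → α → List α → ℝ) : Prop where
  anti : ∀ pre a b post, ω pre a b post = -ω pre b a post
  square : ∀ pre a b mid x y post,
    ω pre a b (mid ++ x :: y :: post) - ω pre a b (mid ++ y :: x :: post) =
      ω (pre ++ a :: b :: mid) x y post - ω (pre ++ b :: a :: mid) x y post
  hexagon : ∀ pre a b c post,
    ω pre a b (c :: post) + ω (pre ++ [b]) a c post + ω pre b c (a :: post) =
      ω (pre ++ [a]) b c post + ω pre a c (b :: post) + ω (pre ++ [c]) a b post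

variable [LinearOrder α] {ω : List α → α → α → List α → ℝ}

/-- Moving `x` through `l` is independent of exchanging `a` and `b` far to the left: each step
changes the difference by an instance of `square`, and the sum telescopes. -/
theorem insCost_exchange (H : IsExchangeCost ω) (pre : List α) (a b x : α) (l mid : List α) :
    insCost ω (pre ++ a :: b :: mid) x l - insCost ω (pre ++ b :: a :: mid) x l =
      ω pre a b (mid ++ x :: l) - ω pre a b (mid ++ l.orderedInsert (· ≤ ·) x) := by
  induction l generalizing mid with
  | nil => simp [insCost]
  | cons y l ih =>
    rw [insCost, insCost, List.orderedInsert]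
    split_ifs with h
    · simp
    · have h1 := ih (mid ++ [y])
      have h2 := H.square pre a b mid x y l
      simp only [List.append_assoc, List.cons_append, List.nil_append] at h1 ⊢
      linarith

/-- The same telescoping, over the insertions that sort `l`. -/
theorem sortCost_exchange (H : IsExchangeCost ω) (pre : List α) (a b : α) (l mid : List α) :
    sortCost ω (pre ++ a :: b :: mid) l - sortCost ω (pre ++ b :: a :: mid) l =
      ω pre a b (mid ++ l) - ω pre a b (mid ++ l.insertionSort (· ≤ ·)) := by
  induction l generalizing mid with
  | nil => simp [sortCost]
  | cons x l ih =>
    rw [sortCost, sortCost]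
    have h1 := ih (mid ++ [x])
    have h2 := insCost_exchange H pre a b x (l.insertionSort (· ≤ ·)) mid
    simp only [List.append_assoc, List.cons_append, List.nil_append] at h1 ⊢
    rw [List.insertionSort_cons]
    linarith

/-- Inserting `b` and then `a`, or `a` and then `b`, leads to the same list, so the costs may differ
only by that of the initial exchange. The essential case is that both letters pass `c`: this is the
hexagon, with `insCost_exchange` accounting for the remaining motion. -/
theorem insCost_two (H : IsExchangeCost ω) (a b : α) (l pre : List α) :
    insCost ω (pre ++ [a]) b l + insCost ω pre a (l.orderedInsert (· ≤ ·) b) -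
      (insCost ω (pre ++ [b]) a l + insCost ω pre b (l.orderedInsert (· ≤ ·) a)) =
      ω pre a b l := by
  have self : ∀ pre a l, ω pre a a l = 0 := fun pre a l => by
    have := H.anti pre a a l
    linarith
  induction l generalizing pre with
  | nil =>
    have := H.anti pre a b []
    rcases lt_trichotomy a b with h | h | h
    · simp only [insCost, List.orderedInsert, if_pos h.le, if_neg (not_le.2 h)]
      linarith
    · subst h
      simp [insCost, self]
    · simp only [insCost, List.orderedInsert, if_pos h.le, if_neg (not_le.2 h)]
      linarith
  | cons c l ih =>
    have hanti := H.anti pre a b (c :: l)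
    by_cases ha : a ≤ c <;> by_cases hb : b ≤ c
    · rcases lt_trichotomy a b with h | h | h
      · simp only [insCost, List.orderedInsert, if_pos h.le, if_neg (not_le.2 h), if_pos ha,
          if_pos hb]
        linarith
      · subst h
        simp [self]
      · simp only [insCost, List.orderedInsert, if_pos h.le, if_neg (not_le.2 h), if_pos ha,
          if_pos hb]
        linarith
    · have h : ¬ b ≤ a := fun h => hb (h.trans ha)
      simp only [insCost, List.orderedInsert, if_pos ha, if_neg hb, if_neg h]
      linarith
    · have h : ¬ a ≤ b := fun h => ha (h.trans hb)
      simp only [insCost, List.orderedInsert, if_pos hb, if_neg ha, if_neg h]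
      linarith
    · simp only [insCost, List.orderedInsert, if_neg ha, if_neg hb]
      have h1 := ih (pre ++ [c])
      have h2 := insCost_exchange H pre a c b l []
      have h3 := insCost_exchange H pre b c a l []
      have h4 := H.hexagon pre a b c l
      simp only [List.append_assoc, List.cons_append, List.nil_append] at h1 h2 h3 ⊢
      linarith

/-- The potential of a word is the cost of sorting it. The two words have the same sorted form, and
the two ways to reach it differ by the exchange in question. -/
theorem sortCost_swap (H : IsExchangeCost ω) (a b : α) (post pre p : List α) :
    sortCost ω p (pre ++ a :: b :: post) - sortCost ω p (pre ++ b :: a :: post) =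
      ω (p ++ pre) a b post := by
  induction pre generalizing p with
  | nil =>
    have h1 := sortCost_exchange H p a b post []
    have h2 := insCost_two H a b (post.insertionSort (· ≤ ·)) p
    simp only [List.nil_append, List.append_nil, sortCost, List.insertionSort_cons,
      List.append_assoc, List.cons_append] at h1 h2 ⊢
    linarith
  | cons x pre ih =>
    -- Both tails are sorted when `x` is inserted, so that insertion costs the same in both words.
    have hs : (pre ++ a :: b :: post).insertionSort (· ≤ ·) =
        (pre ++ b :: a :: post).insertionSort (· ≤ ·) := by
      refine List.Perm.eq_of_pairwise (le := (· ≤ ·)) (fun _ _ _ _ => le_antisymm)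
        (List.pairwise_insertionSort _ _) (List.pairwise_insertionSort _ _) ?_
      refine (List.perm_insertionSort _ _).trans (List.Perm.trans ?_
        (List.perm_insertionSort _ _).symm)
      exact (List.Perm.swap _ _ _).append_left _
    simp only [List.cons_append, sortCost, hs]
    have := ih (p ++ [x])
    simp only [List.append_assoc, List.cons_append, List.nil_append] at this
    linarith

end Potential

/-- Costs of exchanging adjacent letters that satisfy the Coxeter relations come from a potential
on words. -/
theorem exists_potential {α : Type*} {ω : List α → α → α → List α → ℝ} (H : IsExchangeCost ω) :
    ∃ h : List α → ℝ, ∀ pre a b post,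
      h (pre ++ a :: b :: post) - h (pre ++ b :: a :: post) = ω pre a b post := by
  classical
  -- Any linear order will do; it only selects a base point, the sorted word, among the
  -- rearrangements of each word.
  let _ : LinearOrder α := IsWellOrder.linearOrder WellOrderingRel
  exact ⟨sortCost ω [], fun pre a b post => sortCost_swap H a b post pre []⟩

/-- A function on words which is invariant under exchanges of adjacent letters is invariant under
permutations. -/
theorem perm_invariant {α β : Type*} {h : List α → β} {w w' : List α} (p : w.Perm w')
    (H : ∀ pre a b post, (pre ++ a :: b :: post).Perm w →
      h (pre ++ a :: b :: post) = h (pre ++ b :: a :: post)) : h w = h w' := by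
  have key : ∀ {u v : List α}, u.Perm v → ∀ pre, (pre ++ u).Perm w → h (pre ++ u) = h (pre ++ v) := by
    intro u v q
    induction q with
    | nil => exact fun _ _ => rfl
    | cons x _ ih =>
      intro pre hp
      have := ih (pre ++ [x])
      simp only [List.append_assoc, List.cons_append, List.nil_append] at this
      exact this hp
    | swap x y l => exact fun pre hp => H pre y x l hp
    | trans q1 _ ih1 ih2 =>
      intro pre hp
      exact (ih1 pre hp).trans (ih2 pre ((q1.symm.append_left pre).trans hp))
  exact key p [] (List.Perm.refl _)

/-! ### The STU relation in terms of codes -/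

/-- The STU condition for functions of codes. -/
def IsSTUFun (F : List (Fin m × ℤ) → Multiset (Fin 3 → ℤ) → ℝ) : Prop :=
  ∀ (pre post : List (Fin m × ℤ)) (i : Fin m) (a b : ℤ) (T : Multiset (Fin 3 → ℤ)) (k : ℤ),
    k ≠ 0 → k ∉ lab (m := m) (pre ++ (i, a) :: (i, b) :: post : List (Fin m × ℤ)) T →
    -k ∉ lab (m := m) (pre ++ (i, a) :: (i, b) :: post : List (Fin m × ℤ)) T →
    F (pre ++ (i, a) :: (i, b) :: post) T - F (pre ++ (i, b) :: (i, a) :: post) T =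
      F (pre ++ (i, k) :: post) (![-k, b, a] ::ₘ T)

theorem lab_swap (pre post : List (Fin m × ℤ)) (x y : Fin m × ℤ) (T : Multiset (Fin 3 → ℤ)) :
    lab (m := m) (pre ++ x :: y :: post : List (Fin m × ℤ)) T =
      lab (m := m) (pre ++ y :: x :: post : List (Fin m × ℤ)) T := by
  congr 1
  exact Multiset.coe_eq_coe.2 ((List.Perm.swap _ _ _).append_left _)

theorem lab_middle (pre post : List (Fin m × ℤ)) (x : Fin m × ℤ) (T : Multiset (Fin 3 → ℤ)) :
    lab (m := m) (pre ++ x :: post : List (Fin m × ℤ)) T =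
      x.2 ::ₘ lab (m := m) (pre ++ post : List (Fin m × ℤ)) T := by
  rw [lab, lab, Multiset.coe_eq_coe.2 List.perm_middle, ← Multiset.cons_coe, Multiset.map_cons,
    Multiset.cons_add]

theorem lab_cons (W : Multiset (Fin m × ℤ)) (τ : Fin 3 → ℤ) (T : Multiset (Fin 3 → ℤ)) :
    lab W (τ ::ₘ T) = lab W T + ∑ c, {τ c} := by
  rw [lab, lab, Multiset.cons_bind]
  abel

theorem lab_merge (pre post : List (Fin m × ℤ)) (i : Fin m) (a b k : ℤ)
    (T : Multiset (Fin 3 → ℤ)) :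
    lab (m := m) (pre ++ (i, k) :: post : List (Fin m × ℤ)) (![-k, b, a] ::ₘ T) =
      k ::ₘ (-k) ::ₘ lab (m := m) (pre ++ (i, a) :: (i, b) :: post : List (Fin m × ℤ)) T := by
  rw [lab_cons, lab_middle, lab_middle, lab_middle, Fin.sum_univ_three]
  simp only [← Multiset.singleton_add, Matrix.cons_val_zero, Matrix.cons_val_one, Matrix.cons_val]
  abel

theorem Valid.congr {W W' : Multiset (Fin m × ℤ)} {T T' : Multiset (Fin 3 → ℤ)}
    (h : lab W T = lab W' T') (H : Valid W T) : Valid W' T' :=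
  ⟨h ▸ H.nodup, h ▸ H.zero, h ▸ H.neg⟩

/-- A fresh pair `k`, `-k` does not affect validity. So the codes in an STU relation are all valid
or all invalid, and in the latter case the relation is trivial. -/
theorem valid_merge {W W' : Multiset (Fin m × ℤ)} {T T' : Multiset (Fin 3 → ℤ)} {k : ℤ}
    (h : lab W' T' = k ::ₘ (-k) ::ₘ lab W T) (h0 : k ≠ 0) (h1 : k ∉ lab W T) (h2 : -k ∉ lab W T) :
    Valid W' T' ↔ Valid W T := by
  constructor
  · intro H
    have hn := H.nodup
    have hz := H.zero
    have hneg := H.neg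
    rw [h] at hn hz hneg
    refine ⟨(Multiset.nodup_cons.1 (Multiset.nodup_cons.1 hn).2).2, fun h' => hz (by simp [h']), ?_⟩
    intro x hx
    have := hneg x (by simp [hx])
    rw [Multiset.mem_cons, Multiset.mem_cons] at this
    rcases this with h3 | h3 | h3
    · rw [← h3, neg_neg] at h2
      exact absurd hx h2
    · rw [neg_inj.1 h3] at hx
      exact absurd hx h1
    · exact h3
  · intro H
    refine ⟨?_, ?_, ?_⟩
    · rw [h, Multiset.nodup_cons, Multiset.nodup_cons, Multiset.mem_cons]
      refine ⟨?_, h2, H.nodup⟩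
      rintro (h3 | h3)
      · omega
      · exact h1 h3
    · rw [h, Multiset.mem_cons, Multiset.mem_cons]
      rintro (h3 | h3 | h3)
      · exact h0 h3.symm
      · omega
      · exact H.zero h3
    · intro x hx
      rw [h] at hx ⊢
      rw [Multiset.mem_cons, Multiset.mem_cons] at hx ⊢
      rcases hx with rfl | rfl | h3
      · exact Or.inr (Or.inl rfl)
      · exact Or.inl (neg_neg _)
      · exact Or.inr (Or.inr (H.neg x h3))

theorem Labels.leg_of_getElem? {Γ : Diagram m} {w : List (Fin m × ℤ)} {T : Multiset (Fin 3 → ℤ)}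
    {ℓ : HalfEdge Γ.q Γ.f → ℤ} (H : Labels Γ w T ℓ) {i : Fin m} {n : ℕ} {x : ℤ}
    (h : (onSeg w i)[n]? = some x) : ∃ hn : n < Γ.q i, ℓ (Γ.leg i ⟨n, hn⟩) = x := by
  rw [H.word, List.getElem?_ofFn] at h
  split_ifs at h with hn
  exact ⟨hn, by simpa using h⟩

theorem Labels.getElem?_leg {Γ : Diagram m} {w : List (Fin m × ℤ)} {T : Multiset (Fin 3 → ℤ)}
    {ℓ : HalfEdge Γ.q Γ.f → ℤ} (H : Labels Γ w T ℓ) (i : Fin m) (p : Fin (Γ.q i)) :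
    (onSeg w i)[(p : ℕ)]? = some (ℓ (Γ.leg i p)) := by
  rw [H.word, List.getElem?_ofFn, dif_pos p.2]

theorem Labels.exists_half {Γ : Diagram m} {w : List (Fin m × ℤ)} {T : Multiset (Fin 3 → ℤ)}
    {ℓ : HalfEdge Γ.q Γ.f → ℤ} (H : Labels Γ w T ℓ) {τ : Fin 3 → ℤ} (h : τ ∈ T) :
    ∃ v, ∀ c, ℓ (Γ.half v c) = τ c := by
  rw [H.tri, Multiset.mem_map] at h
  obtain ⟨v, -, hv⟩ := h
  exact ⟨v, fun c => congrFun hv c⟩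

theorem Labels.half_mem {Γ : Diagram m} {w : List (Fin m × ℤ)} {T : Multiset (Fin 3 → ℤ)}
    {ℓ : HalfEdge Γ.q Γ.f → ℤ} (H : Labels Γ w T ℓ) (v : Fin Γ.f) :
    (fun c => ℓ (Γ.half v c)) ∈ T := by
  rw [H.tri]
  exact Multiset.mem_map_of_mem _ (Finset.mem_univ v)

/-- Diagrams with codes as in the STU relation are related by a resolution. -/
theorem Labels.isResolution {S D : Diagram m} {pre post : List (Fin m × ℤ)} {i : Fin m}
    {x y k : ℤ} {c d : Fin 3} {τ : Fin 3 → ℤ} {T : Multiset (Fin 3 → ℤ)}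
    {ℓS : HalfEdge S.q S.f → ℤ} {ℓD : HalfEdge D.q D.f → ℤ}
    (HS : Labels S (pre ++ (i, k) :: post) (τ ::ₘ T) ℓS)
    (HD : Labels D (pre ++ (i, x) :: (i, y) :: post) T ℓD)
    (h0 : τ 0 = -k) (hc : τ c = x) (hd : τ d = y)
    {p : Fin (S.q i)} (hp : (p : ℕ) = (onSeg pre i).length) {w : Fin S.f}
    (hw : ∀ c, ℓS (S.half w c) = τ c) :
    IsResolution S D i p w c d := by
  have hSi : onSeg (pre ++ (i, k) :: post) i = onSeg pre i ++ k :: onSeg post i := by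
    simp [onSeg_cons]
  have hDi : onSeg (pre ++ (i, x) :: (i, y) :: post) i = onSeg pre i ++ x :: y :: onSeg post i := by
    simp [onSeg_cons]
  have hj : ∀ j, j ≠ i → onSeg (pre ++ (i, k) :: post) j =
      onSeg (pre ++ (i, x) :: (i, y) :: post) j := by
    intro j hj
    simp [onSeg_cons, hj.symm]
  have hpk : ℓS (S.leg i p) = k := by
    have := HS.getElem?_leg i p
    rw [hSi, hp] at this
    simpa using this.symm
  have hleg : ∀ (r : Fin (D.q i)) (z : ℤ), (onSeg pre i ++ x :: y :: onSeg post i)[(r : ℕ)]? = some z →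
      ℓD (D.leg i r) = z := by
    intro r z hz
    have := HD.getElem?_leg i r
    rw [hDi, hz] at this
    exact (Option.some_injective _ this).symm
  have hfree : ∀ v, ∃ v', v' ≠ w ∧ ∀ c, ℓS (S.half v' c) = ℓD (D.half v c) := by
    intro v
    have h1 := HD.half_mem v
    obtain ⟨v', hv'⟩ := HS.exists_half (Multiset.mem_cons_of_mem h1)
    refine ⟨v', ?_, hv'⟩
    rintro rfl
    -- If `w` also corresponded to a free vertex of `D`, its triple would occur twice in the code of
    -- `S`, contrary to distinctness of labels.
    have h2 : τ = fun c => ℓD (D.half v c) := funext fun c => by rw [← hw, hv']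
    have hn := HS.valid.nodup
    rw [lab_cons, Multiset.nodup_add] at hn
    have h3 : τ 0 ∈ lab (m := m) (pre ++ (i, k) :: post : List (Fin m × ℤ)) T :=
      mem_lab.2 (Or.inr ⟨τ, by rw [h2]; exact h1, 0, rfl⟩)
    have h4 : τ 0 ∈ ∑ c, ({τ c} : Multiset ℤ) :=
      Multiset.mem_sum.2 ⟨0, Finset.mem_univ _, Multiset.mem_singleton_self _⟩
    exact Multiset.disjoint_left.1 hn.2.2 h3 h4
  choose v' hv'w hv' using hfree
  -- Half-edges are compared by their labels. On segment `i`, the positions after the two new legs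
  -- of `D` are larger by one than those of `S`.
  have hψ : ∀ h, ∃ h', ℓS h' = ℓD h := by
    rintro (⟨j, r⟩ | ⟨v, b⟩)
    · by_cases hji : j = i
      · subst hji
        have h1 := HD.getElem?_leg j r
        rw [hDi] at h1
        rcases lt_trichotomy (r : ℕ) (onSeg pre j).length with h | h | h
        · rw [List.getElem?_append_left h] at h1
          obtain ⟨hn, h2⟩ := HS.leg_of_getElem? (i := j) (n := r) (x := ℓD (D.leg j r))
            (by rw [hSi, List.getElem?_append_left h, h1])
          exact ⟨_, h2⟩
        · refine ⟨S.half w c, ?_⟩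
          rw [hw, hc]
          exact (hleg r x (by rw [h]; simp)).symm
        · by_cases h' : (r : ℕ) = (onSeg pre j).length + 1
          · refine ⟨S.half w d, ?_⟩
            rw [hw, hd]
            exact (hleg r y (by rw [h']; simp)).symm
          · obtain ⟨t, ht⟩ : ∃ t, (r : ℕ) = (onSeg pre j).length + (t + 2) :=
              ⟨r - (onSeg pre j).length - 2, by omega⟩
            rw [ht, List.getElem?_append_right (by omega)] at h1
            obtain ⟨hn, h2⟩ := HS.leg_of_getElem? (i := j) (n := (onSeg pre j).length + (t + 1))
              (x := ℓD (D.leg j r)) (by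
                rw [hSi, List.getElem?_append_right (by omega)]
                simpa using h1)
            exact ⟨_, h2⟩
      · have h1 := HD.getElem?_leg j r
        rw [← hj j hji] at h1
        obtain ⟨hn, h2⟩ := HS.leg_of_getElem? h1
        exact ⟨_, h2⟩
    · exact ⟨S.half (v' v) b, hv' v b⟩
  choose ψ hψ using hψ
  have hq : ∀ j, j ≠ i → D.q j = S.q j := by
    intro j hji
    rw [← HD.card_word, ← HS.card_word, hj j hji]
  refine ⟨?_, ?_, hq, ?_, ψ, ?_, ?_, ?_, ?_, ?_, ?_, ?_, ?_⟩
  · apply HS.inj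
    rw [HS.neg, hpk, hw, h0]
  · rw [← HD.card_word, ← HS.card_word, hSi, hDi]
    simp only [List.length_append, List.length_cons]
    omega
  · rw [← HD.card_tri, ← HS.card_tri, Multiset.card_cons]
  · intro h h' hh
    apply HD.inj
    rw [← hψ, ← hψ, hh]
  · intro h
    apply HS.inj
    rw [hψ, HS.neg, hψ, HD.neg]
  · intro v
    refine ⟨v' v, hv'w v, fun c => ?_⟩
    apply HS.inj
    rw [hψ, hv']
  · intro j hji r
    refine ⟨Fin.cast (hq j hji) r, rfl, ?_⟩
    apply HS.inj
    rw [hψ]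
    have h1 := HD.getElem?_leg j r
    have h2 := HS.getElem?_leg j (Fin.cast (hq j hji) r)
    rw [hj j hji] at h2
    exact Option.some_injective _ (h1.symm.trans h2)
  · intro r hr
    refine ⟨⟨r, hr.trans p.2⟩, rfl, ?_⟩
    apply HS.inj
    rw [hψ]
    apply hleg
    rw [← HS.getElem?_leg, hSi]
    rw [hp] at hr
    rw [List.getElem?_append_left hr, List.getElem?_append_left hr]
  · intro r hr
    apply HS.inj
    rw [hψ, hw, hc]
    exact hleg r x (by rw [hr, hp]; simp)
  · intro r hr
    apply HS.inj
    rw [hψ, hw, hd]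
    exact hleg r y (by rw [hr, hp]; simp)
  · intro r hr
    have hlt : (r : ℕ) - 1 < S.q i := by
      have h1 := r.2
      have h2 : D.q i = S.q i + 1 := by
        rw [← HD.card_word, ← HS.card_word, hSi, hDi]
        simp only [List.length_append, List.length_cons]
        omega
      omega
    refine ⟨⟨r - 1, hlt⟩, by simp only []; omega, ?_⟩
    apply HS.inj
    rw [hψ]
    apply hleg
    rw [← HS.getElem?_leg, hSi]
    obtain ⟨t, ht⟩ : ∃ t, (r : ℕ) = (onSeg pre i).length + (t + 2) :=
      ⟨r - (onSeg pre i).length - 2, by omega⟩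
    have ht' : (r : ℕ) - 1 = (onSeg pre i).length + (t + 1) := by omega
    simp only [ht']
    rw [ht, List.getElem?_append_right (by omega), List.getElem?_append_right (by omega)]
    simp



theorem Valid.fresh {pre post : List (Fin m × ℤ)} {i : Fin m} {a b k : ℤ} {T : Multiset (Fin 3 → ℤ)}
    (H : Valid (m := m) (pre ++ (i, k) :: post : List (Fin m × ℤ)) (![-k, b, a] ::ₘ T)) :
    k ≠ 0 ∧ k ∉ lab (m := m) (pre ++ (i, a) :: (i, b) :: post : List (Fin m × ℤ)) T ∧
      -k ∉ lab (m := m) (pre ++ (i, a) :: (i, b) :: post : List (Fin m × ℤ)) T := by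
  have h1 := H.nodup
  have h2 := H.zero
  rw [lab_merge] at h1 h2
  rw [Multiset.nodup_cons, Multiset.nodup_cons, Multiset.mem_cons] at h1
  rw [Multiset.mem_cons, Multiset.mem_cons] at h2
  exact ⟨fun h => h2 (Or.inl h.symm), fun h => h1.1 (Or.inr h), h1.2.1⟩

theorem IsDiagramFun.isSTUFun {c : Diagram m → ℝ} (hc : IsDiagramFun c)
    (h : ∀ S T U, IsSTU S T U → c S - c T + c U = 0) : IsSTUFun (ev c) := by
  intro pre post i a b T k h0 h1 h2
  have hm := valid_merge (lab_merge pre post i a b k T) h0 h1 h2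
  have hs := lab_swap pre post (i, a) (i, b) T
  by_cases hv : Valid (m := m) (pre ++ (i, a) :: (i, b) :: post : List (Fin m × ℤ)) T
  · obtain ⟨D, ℓD, HD⟩ := hv.exists_labels
    obtain ⟨U, ℓU, HU⟩ := (hv.congr hs).exists_labels
    obtain ⟨S, ℓS, HS⟩ := (hm.2 hv).exists_labels
    obtain ⟨w, hw⟩ := HS.exists_half (Multiset.mem_cons_self _ _)
    have hp : (onSeg pre i).length < S.q i := by
      rw [← HS.card_word]
      simp [onSeg_cons]
    rw [ev_of_labels hc HD, ev_of_labels hc HU, ev_of_labels hc HS]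
    -- In the triple `![-k, b, a]` the entry `2` is `a`, which comes first in `D`, and the entry `1`
    -- is `b`, which comes first in `U`.
    have := h S D U ⟨i, ⟨_, hp⟩, w, HS.isResolution HD rfl rfl rfl rfl hw,
      HS.isResolution HU rfl rfl rfl rfl hw⟩
    linarith
  · rw [ev_of_not_valid hv, ev_of_not_valid fun h' => hv (h'.congr hs.symm),
      ev_of_not_valid fun h' => hv (hm.1 h'), sub_zero]

/-- Because of this, the differences prescribed by STU vanish at codes that are not of homotopy link
diagrams, and the coefficients constructed from them can be chosen to vanish there. -/
theorem CodeHL.of_merge {pre post : List (Fin m × ℤ)} {i : Fin m} {a b k : ℤ}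
    {T : Multiset (Fin 3 → ℤ)} (H : CodeHL (pre ++ (i, k) :: post) (![-k, b, a] ::ₘ T)) :
    CodeHL (pre ++ (i, a) :: (i, b) :: post) T := by
  obtain ⟨h0, h1, h2⟩ := H.valid.fresh
  obtain ⟨D, ℓD, HD⟩ := ((valid_merge (lab_merge pre post i a b k T) h0 h1 h2).1
    H.valid).exists_labels
  obtain ⟨S, ℓS, HS, hS⟩ := H
  obtain ⟨w, hw⟩ := HS.exists_half (Multiset.mem_cons_self _ _)
  have hp : (onSeg pre i).length < S.q i := by
    rw [← HS.card_word]
    simp [onSeg_cons]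
  exact ⟨D, ℓD, HD, (HS.isResolution (p := ⟨_, hp⟩) (c := 2) (d := 1) HD rfl rfl rfl rfl
    hw).isHomotopyLink hS⟩

/-- A code of a resolution. -/
theorem Labels.of_isResolution {S D : Diagram m} {w : List (Fin m × ℤ)} {T : Multiset (Fin 3 → ℤ)}
    {ℓ : HalfEdge S.q S.f → ℤ} {i : Fin m} {p : Fin (S.q i)} {v : Fin S.f} {x y : Fin 3}
    (H : Labels S w ((fun c => ℓ (S.half v c)) ::ₘ T) ℓ) (R : IsResolution S D i p v x y) :
    ∃ ℓ', Labels D (((onSeg w i).take p).map (fun z => (i, z)) ++ (i, ℓ (S.half v x)) ::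
      (i, ℓ (S.half v y)) :: (((onSeg w i).drop (p + 1)).map (fun z => (i, z)) ++
        w.filter fun z => z.1 ≠ i)) T ℓ' := by
  obtain ⟨-, hqi, hqj, hf, ψ, ψinj, ψe, ψfree, ψj, ψlt, ψp, ψp1, ψgt⟩ := R
  have onmap : ∀ (L : List ℤ) j, onSeg (L.map fun z => (i, z)) j = if i = j then L else [] := by
    intro L j
    induction L with
    | nil => simp
    | cons z L ih =>
      rw [List.map_cons, onSeg_cons, ih]
      split_ifs <;> rfl
  have onfil : ∀ j, onSeg (w.filter fun z => z.1 ≠ i) j = if i = j then [] else onSeg w j := by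
    intro j
    simp only [onSeg, List.filter_filter]
    split_ifs with hj
    · subst hj
      simp
    · congr 1
      refine List.filter_congr fun z _ => ?_
      by_cases hz : z.1 = j
      · simp [hz, Ne.symm hj]
      · simp [hz]
  -- The labels are pulled back from `S`. Writing the letters of the other segments last does not
  -- change the word on any segment.
  refine ⟨ℓ ∘ ψ, H.inj.comp ψinj, fun h => ?_, fun j => ?_, ?_⟩
  · simp [ψe, H.neg]
  · simp only [onSeg_append, onSeg_cons, onmap, onfil]
    by_cases hj : i = j
    · subst hj
      have hlen := H.card_word i
      simp only [if_true, List.append_nil]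
      apply List.ext_getElem
      · simp only [List.length_append, List.length_cons, List.length_take, List.length_drop,
          List.length_ofFn, hlen]
        have := p.2
        omega
      · intro r h1 h2
        rw [List.getElem_ofFn]
        rw [List.length_ofFn] at h2
        have htk : ((onSeg w i).take p).length = p := by
          rw [List.length_take, hlen, min_eq_left p.2.le]
        have hget : ∀ r' : Fin (S.q i), ∀ h, (onSeg w i)[(r' : ℕ)]'h = ℓ (S.leg i r') := by
          intro r' h
          have := H.getElem?_leg i r'
          rw [List.getElem?_eq_getElem h] at this
          exact Option.some_injective _ this
        rcases lt_trichotomy r (p : ℕ) with hr | hr | hr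
        · obtain ⟨r', e1, e2⟩ := ψlt ⟨r, h2⟩ hr
          rw [List.getElem_append_left (by omega), List.getElem_take, Function.comp_apply, e2, ← hget r' (by rw [hlen]; exact r'.2)]
          simp only [e1]
        · rw [List.getElem_append_right (by omega), Function.comp_apply, ψp ⟨r, h2⟩ hr]
          simp only [htk, hr, Nat.sub_self, List.getElem_cons_zero]
        · rw [List.getElem_append_right (by omega)]
          by_cases hr' : r = p + 1
          · rw [Function.comp_apply, ψp1 ⟨r, h2⟩ hr']
            simp only [htk, hr', Nat.add_sub_cancel_left, List.getElem_cons_succ,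
              List.getElem_cons_zero]
          · obtain ⟨r', e1, e2⟩ := ψgt ⟨r, h2⟩ (show (p : ℕ) + 1 < r by omega)
            simp only at e1
            rw [Function.comp_apply, e2, ← hget r' (by rw [hlen]; exact r'.2)]
            have e3 : r - ((onSeg w i).take p).length = (r' - (p + 1)) + 1 + 1 := by omega
            simp only [e3, List.getElem_cons_succ, List.getElem_drop]
            congr 1
            omega
    · simp only [if_neg hj, List.nil_append]
      rw [H.word]
      have hq := hqj j (Ne.symm hj)
      apply List.ext_getElem
      · simp [hq]
      · intro r h1 h2
        rw [List.getElem_ofFn, List.getElem_ofFn]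
        rw [List.length_ofFn] at h2
        obtain ⟨r', e1, e2⟩ := ψj j (Ne.symm hj) ⟨r, h2⟩
        simp only [Function.comp_apply, e2]
        congr
        exact e1.symm
  · choose v' hv'w hv' using ψfree
    have hinj : Function.Injective v' := by
      intro a b hab
      have h1 : D.half a 0 = D.half b 0 := ψinj (by rw [hv', hv', hab])
      simpa using h1
    have huniv : insert v (Finset.univ.map ⟨v', hinj⟩) = Finset.univ := by
      apply Finset.eq_univ_of_card
      rw [Finset.card_insert_of_notMem]
      · simp [hf]
      · simp only [Finset.mem_map, Finset.mem_univ, true_and, Function.Embedding.coeFn_mk, not_exists]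
        exact hv'w
    have htri := H.tri
    rw [← huniv, Finset.insert_val_of_notMem, Multiset.map_cons, Multiset.cons_inj_right,
      Finset.map_val, Multiset.map_map] at htri
    · rw [htri]
      refine Multiset.map_congr rfl fun a _ => funext fun c => ?_
      simp [hv']
    · simp only [Finset.mem_map, Finset.mem_univ, true_and, Function.Embedding.coeFn_mk, not_exists]
      exact hv'w

theorem IsDiagramFun.stu_of_isSTUFun {c : Diagram m → ℝ} (hc : IsDiagramFun c)
    (h : IsSTUFun (ev c)) {S T U : Diagram m} (R : IsSTU S T U) : c S - c T + c U = 0 := by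
  obtain ⟨i, p, v, R1, R2⟩ := R
  obtain ⟨w, T', ℓ, H⟩ := exists_labels S
  obtain ⟨TD, rfl⟩ := Multiset.exists_cons_of_mem (H.half_mem v)
  obtain ⟨ℓ1, H1⟩ := H.of_isResolution R1
  obtain ⟨ℓ2, H2⟩ := H.of_isResolution R2
  set pre := ((onSeg w i).take p).map fun z => (i, z) with hpre
  set post := ((onSeg w i).drop (p + 1)).map (fun z => (i, z)) ++ w.filter fun z => z.1 ≠ i
    with hpost
  have onmap : ∀ (L : List ℤ) j, onSeg (L.map fun z => (i, z)) j = if i = j then L else [] := by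
    intro L j
    induction L with
    | nil => simp
    | cons z L ih =>
      rw [List.map_cons, onSeg_cons, ih]
      split_ifs <;> rfl
  have onfil : ∀ j, onSeg (w.filter fun z => z.1 ≠ i) j = if i = j then [] else onSeg w j := by
    intro j
    simp only [onSeg, List.filter_filter]
    split_ifs with hj
    · subst hj
      simp
    · congr 1
      refine List.filter_congr fun z _ => ?_
      by_cases hz : z.1 = j
      · simp [hz, Ne.symm hj]
      · simp [hz]
  have hτ : (fun c => ℓ (S.half v c)) =
      ![-ℓ (S.leg i p), ℓ (S.half v 1), ℓ (S.half v 2)] := by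
    funext c
    fin_cases c
    · simp [← H.neg, R1.1]
    · rfl
    · rfl
  have HS : Labels S (pre ++ (i, ℓ (S.leg i p)) :: post)
      (![-ℓ (S.leg i p), ℓ (S.half v 1), ℓ (S.half v 2)] ::ₘ TD) ℓ := by
    rw [← hτ]
    refine H.congr_word fun j => ?_
    simp only [onSeg_append, onSeg_cons, onmap, onfil, hpre, hpost]
    by_cases hj : i = j
    · subst hj
      simp only [if_true, List.append_nil]
      have h1 : (p : ℕ) < (onSeg w i).length := by
        rw [H.card_word]
        exact p.2
      have h2 := H.getElem?_leg i p
      rw [List.getElem?_eq_getElem h1] at h2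
      rw [← Option.some_injective _ h2, ← List.drop_eq_getElem_cons, List.take_append_drop]
    · simp [hj]
  obtain ⟨h0, h1, h2⟩ := HS.valid.fresh
  have key := h pre post i _ _ TD _ h0 h1 h2
  rw [ev_of_labels hc H1, ev_of_labels hc H2, ev_of_labels hc HS] at key
  linarith

theorem mem_cocycles_iff {x : HT m} :
    x ∈ cocycles m ↔ IsSTUFun (ev fun Γ => coeff Γ x) := by
  have h1 : x ∈ cocycles m ↔ ∀ S T U, IsSTU S T U → coeff S x - coeff T x + coeff U x = 0 := by
    simp [cocycles]
  rw [h1]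
  exact ⟨fun h => (isDiagramFun_coeff x).isSTUFun h,
    fun h S T U R => (isDiagramFun_coeff x).stu_of_isSTUFun h R⟩

/-! ### Fresh labels -/

/-- A label which, together with its negative, does not occur in `s`. -/
def fresh (s : Multiset ℤ) : ℤ := ((s.map Int.natAbs).sum : ℤ) + 1

theorem natAbs_le_of_mem {s : Multiset ℤ} {x : ℤ} (h : x ∈ s) :
    x.natAbs ≤ (s.map Int.natAbs).sum :=
  Multiset.single_le_sum (fun _ _ => Nat.zero_le _) _ (Multiset.mem_map_of_mem _ h)

theorem fresh_ne_zero (s : Multiset ℤ) : fresh s ≠ 0 := by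
  rw [fresh]
  omega

theorem fresh_notMem (s : Multiset ℤ) : fresh s ∉ s := by
  intro h
  have := natAbs_le_of_mem h
  rw [fresh] at this
  omega

theorem neg_fresh_notMem (s : Multiset ℤ) : -fresh s ∉ s := by
  intro h
  have := natAbs_le_of_mem h
  rw [fresh] at this
  omega

theorem lab_map (W : Multiset (Fin m × ℤ)) (T : Multiset (Fin 3 → ℤ)) (g : ℤ → ℤ) :
    lab (W.map (Prod.map id g)) (T.map fun τ => g ∘ τ) = (lab W T).map g := by
  rw [lab, lab, Multiset.map_add, Multiset.map_map, Multiset.map_map, Multiset.map_bind,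
    Multiset.bind_map]
  simp [Fin.sum_univ_three]

/-- The relabeling `g` is extended to the new edge by `k ↦ k'` and `-k ↦ -k'`; freshness of both
labels keeps the extension injective. -/
theorem IsCodeFun.relabel_merge {F : List (Fin m × ℤ) → Multiset (Fin 3 → ℤ) → ℝ} (hF : IsCodeFun F)
    {pre post : List (Fin m × ℤ)} {i : Fin m} {a b k k' : ℤ} {T : Multiset (Fin 3 → ℤ)} {g : ℤ → ℤ}
    (H : Valid (m := m) (pre ++ (i, a) :: (i, b) :: post : List (Fin m × ℤ)) T)
    (hinj : Set.InjOn g {x | x ∈ lab (m := m) (pre ++ (i, a) :: (i, b) :: post : List (Fin m × ℤ)) T})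
    (hneg : ∀ x ∈ lab (m := m) (pre ++ (i, a) :: (i, b) :: post : List (Fin m × ℤ)) T,
      g (-x) = -g x)
    (h0 : k ≠ 0) (h1 : k ∉ lab (m := m) (pre ++ (i, a) :: (i, b) :: post : List (Fin m × ℤ)) T)
    (h2 : -k ∉ lab (m := m) (pre ++ (i, a) :: (i, b) :: post : List (Fin m × ℤ)) T)
    (h0' : k' ≠ 0)
    (h1' : k' ∉ (lab (m := m) (pre ++ (i, a) :: (i, b) :: post : List (Fin m × ℤ)) T).map g)
    (h2' : -k' ∉ (lab (m := m) (pre ++ (i, a) :: (i, b) :: post : List (Fin m × ℤ)) T).map g) :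
    F (pre.map (Prod.map id g) ++ (i, k') :: post.map (Prod.map id g))
        (![-k', g b, g a] ::ₘ T.map fun τ => g ∘ τ) =
      F (pre ++ (i, k) :: post) (![-k, b, a] ::ₘ T) := by
  have hm := (valid_merge (lab_merge pre post i a b k T) h0 h1 h2).2 H
  let g' : ℤ → ℤ := fun x => if x = k then k' else if x = -k then -k' else g x
  have hk : g' k = k' := if_pos rfl
  have hk' : g' (-k) = -k' := by
    simp only [g', if_true]
    rw [if_neg (by omega)]
  have hg : ∀ x ∈ lab (m := m) (pre ++ (i, a) :: (i, b) :: post : List (Fin m × ℤ)) T,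
      g' x = g x := by
    intro x hx
    simp only [g']
    rw [if_neg, if_neg]
    · rintro rfl
      exact h2 hx
    · rintro rfl
      exact h1 hx
  have hlab := lab_merge pre post i a b k T
  have key := hF.relabel g' hm ?_ ?_
  · rw [← key, List.map_append, List.map_cons, Multiset.map_cons]
    have e1 : ∀ x ∈ pre, Prod.map id g' x = (Prod.map id g x : Fin m × ℤ) := fun x hx => by
      rw [Prod.map, Prod.map, hg]
      exact mem_lab.2 (Or.inl ⟨x.1, by simp [hx]⟩)
    have e2 : ∀ x ∈ post, Prod.map id g' x = (Prod.map id g x : Fin m × ℤ) := fun x hx => by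
      rw [Prod.map, Prod.map, hg]
      exact mem_lab.2 (Or.inl ⟨x.1, by simp [hx]⟩)
    have e3 : (T.map fun τ => g' ∘ τ) = T.map fun τ => g ∘ τ :=
      Multiset.map_congr rfl fun τ hτ => funext fun c => hg _ (mem_lab.2 (Or.inr ⟨τ, hτ, c, rfl⟩))
    have e4 : g' ∘ ![-k, b, a] = ![-k', g b, g a] := by
      funext c
      fin_cases c
      · exact hk'
      · exact hg _ (mem_lab.2 (Or.inl ⟨i, by simp⟩))
      · exact hg _ (mem_lab.2 (Or.inl ⟨i, by simp⟩))
    rw [List.map_congr_left e1, List.map_congr_left e2, e3, e4, Prod.map, hk, id]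
  · rw [hlab]
    have hmem : ∀ x ∈ lab (m := m) (pre ++ (i, a) :: (i, b) :: post : List (Fin m × ℤ)) T,
        g' x ≠ k' ∧ g' x ≠ -k' := by
      intro x hx
      rw [hg x hx]
      exact ⟨fun h => h1' (h ▸ Multiset.mem_map_of_mem g hx),
        fun h => h2' (h ▸ Multiset.mem_map_of_mem g hx)⟩
    have hne : k' ≠ -k' := by omega
    intro x hx y hy hxy
    simp only [Set.mem_ofPred_eq, Multiset.mem_cons] at hx hy
    rcases hx with rfl | rfl | hx <;> rcases hy with rfl | rfl | hy
    · rfl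
    · rw [hk, hk'] at hxy
      exact absurd hxy hne
    · rw [hk] at hxy
      exact absurd hxy.symm (hmem y hy).1
    · rw [hk, hk'] at hxy
      exact absurd hxy.symm hne
    · rfl
    · rw [hk'] at hxy
      exact absurd hxy.symm (hmem y hy).2
    · rw [hk] at hxy
      exact absurd hxy (hmem x hx).1
    · rw [hk'] at hxy
      exact absurd hxy (hmem x hx).2
    · rw [hg x hx, hg y hy] at hxy
      exact hinj hx hy hxy
  · intro x hx
    rw [hlab, Multiset.mem_cons, Multiset.mem_cons] at hx
    rcases hx with rfl | rfl | hx
    · rw [hk, hk']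
    · rw [neg_neg, hk, hk', neg_neg]
    · rw [hg x hx, hg _ (H.neg x hx), hneg x hx]

/-- The choice of the label of the new edge does not matter. -/
theorem IsCodeFun.merge_congr {F : List (Fin m × ℤ) → Multiset (Fin 3 → ℤ) → ℝ} (hF : IsCodeFun F)
    {pre post : List (Fin m × ℤ)} {i : Fin m} {a b k k' : ℤ} {T : Multiset (Fin 3 → ℤ)}
    (h0 : k ≠ 0) (h1 : k ∉ lab (m := m) (pre ++ (i, a) :: (i, b) :: post : List (Fin m × ℤ)) T)
    (h2 : -k ∉ lab (m := m) (pre ++ (i, a) :: (i, b) :: post : List (Fin m × ℤ)) T)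
    (h0' : k' ≠ 0)
    (h1' : k' ∉ lab (m := m) (pre ++ (i, a) :: (i, b) :: post : List (Fin m × ℤ)) T)
    (h2' : -k' ∉ lab (m := m) (pre ++ (i, a) :: (i, b) :: post : List (Fin m × ℤ)) T) :
    F (pre ++ (i, k') :: post) (![-k', b, a] ::ₘ T) =
      F (pre ++ (i, k) :: post) (![-k, b, a] ::ₘ T) := by
  by_cases H : Valid (m := m) (pre ++ (i, a) :: (i, b) :: post : List (Fin m × ℤ)) T
  · have := hF.relabel_merge (g := id) (k := k) (k' := k') H Function.injective_id.injOn
      (fun _ _ => rfl) h0 h1 h2 h0' (by rwa [Multiset.map_id]) (by rwa [Multiset.map_id])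
    simpa using this
  · rw [hF.zero fun h => H ((valid_merge (lab_merge pre post i a b k' T) h0' h1' h2').1 h.valid),
      hF.zero fun h => H ((valid_merge (lab_merge pre post i a b k T) h0 h1 h2).1 h.valid)]

theorem IsCodeFun.cycle {F : List (Fin m × ℤ) → Multiset (Fin 3 → ℤ) → ℝ} (hF : IsCodeFun F)
    (w : List (Fin m × ℤ)) (x y z : ℤ) (T : Multiset (Fin 3 → ℤ)) :
    F w (![x, y, z] ::ₘ T) = F w (![y, z, x] ::ₘ T) := by
  have h : ![y, z, x] = ![x, y, z] ∘ finRotate 3 := by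
    funext c
    fin_cases c <;> rfl
  rw [h, hF.turn, sign_finRotate]
  simp

theorem IsCodeFun.flip {F : List (Fin m × ℤ) → Multiset (Fin 3 → ℤ) → ℝ} (hF : IsCodeFun F)
    (w : List (Fin m × ℤ)) (x y z : ℤ) (T : Multiset (Fin 3 → ℤ)) :
    F w (![x, y, z] ::ₘ T) = -F w (![x, z, y] ::ₘ T) := by
  have h : ![x, z, y] = ![x, y, z] ∘ Equiv.swap 1 2 := by
    funext c
    fin_cases c
    · exact congrArg ![x, y, z] (Equiv.swap_apply_of_ne_of_ne (show (0 : Fin 3) ≠ 1 by decide) (show (0 : Fin 3) ≠ 2 by decide)).symm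
    · exact congrArg ![x, y, z] (Equiv.swap_apply_left 1 2).symm
    · exact congrArg ![x, y, z] (Equiv.swap_apply_right 1 2).symm
  rw [h, hF.turn, Equiv.Perm.sign_swap (by decide)]
  simp

/-! ### The STU relations imply the IHX relations -/

/-- The alternating sum in the IHX condition. -/
def ihxSum (F : List (Fin m × ℤ) → Multiset (Fin 3 → ℤ) → ℝ) (w : List (Fin m × ℤ))
    (e a b c d : ℤ) (T : Multiset (Fin 3 → ℤ)) : ℝ :=
  F w (![e, b, a] ::ₘ ![-e, c, d] ::ₘ T) - F w (![e, a, c] ::ₘ ![-e, d, b] ::ₘ T) +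
    F w (![e, b, c] ::ₘ ![-e, d, a] ::ₘ T)

theorem lab_ihx (W : Multiset (Fin m × ℤ)) (e a b c d : ℤ) (T : Multiset (Fin 3 → ℤ)) :
    lab W (![e, a, c] ::ₘ ![-e, d, b] ::ₘ T) = lab W (![e, b, a] ::ₘ ![-e, c, d] ::ₘ T) ∧
      lab W (![e, b, c] ::ₘ ![-e, d, a] ::ₘ T) = lab W (![e, b, a] ::ₘ ![-e, c, d] ::ₘ T) := by
  simp only [lab_cons, Fin.sum_univ_three, Matrix.cons_val_zero, Matrix.cons_val_one,
    Matrix.cons_val]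
  constructor <;> abel

theorem IsSTUFun.merge {F : List (Fin m × ℤ) → Multiset (Fin 3 → ℤ) → ℝ} (h : IsSTUFun F)
    {pre post : List (Fin m × ℤ)} {i : Fin m} {a b k l : ℤ} {T : Multiset (Fin 3 → ℤ)}
    (H : Valid (m := m) (pre ++ (i, k) :: post : List (Fin m × ℤ)) (![l, b, a] ::ₘ T))
    (hl : l = -k) :
    F (pre ++ (i, k) :: post) (![l, b, a] ::ₘ T) =
      F (pre ++ (i, a) :: (i, b) :: post) T - F (pre ++ (i, b) :: (i, a) :: post) T := by
  subst hl
  obtain ⟨h0, h1, h2⟩ := H.fresh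
  exact (h pre post i a b T k h0 h1 h2).symm

/-- Both free vertices adjacent to an edge are resolved, beginning at a leg `d`. -/
theorem IsSTUFun.resolve_two {F : List (Fin m × ℤ) → Multiset (Fin 3 → ℤ) → ℝ} (hF : IsCodeFun F)
    (h : IsSTUFun F) {pre post : List (Fin m × ℤ)} {i : Fin m} {a b c d e f k : ℤ}
    {T : Multiset (Fin 3 → ℤ)} (hf : f = -e) (hk : d = -k)
    (H : Valid (m := m) (pre ++ (i, k) :: post : List (Fin m × ℤ))
      (![e, b, a] ::ₘ ![f, c, d] ::ₘ T)) :
    F (pre ++ (i, k) :: post) (![e, b, a] ::ₘ ![f, c, d] ::ₘ T) =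
      F (pre ++ (i, c) :: (i, a) :: (i, b) :: post) T -
        F (pre ++ (i, c) :: (i, b) :: (i, a) :: post) T -
        F (pre ++ (i, a) :: (i, b) :: (i, c) :: post) T +
        F (pre ++ (i, b) :: (i, a) :: (i, c) :: post) T := by
  -- The triple at the leg is rotated so that `d`, the end joined to the leg, becomes the stem. Its
  -- resolution puts `f` on the segment, where it is the stem of the other triple.
  have hlab : lab (m := m) (pre ++ (i, k) :: post : List (Fin m × ℤ))
      (![e, b, a] ::ₘ ![f, c, d] ::ₘ T) = lab (m := m) (pre ++ (i, k) :: post : List (Fin m × ℤ))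
      (![d, f, c] ::ₘ ![e, b, a] ::ₘ T) := by
    simp only [lab_cons, Fin.sum_univ_three, Matrix.cons_val_zero, Matrix.cons_val_one,
      Matrix.cons_val]
    abel
  have H1 := H.congr hlab
  subst hk
  obtain ⟨h0, h1, h2⟩ := H1.fresh
  have H2 := (valid_merge (lab_merge pre post i c f k _) h0 h1 h2).1 H1
  have H3 := H2.congr (lab_swap _ _ _ _ _)
  have he : e = -f := by omega
  have e1 := h.merge H1 rfl
  have e2 := h.merge (pre := pre ++ [(i, c)]) (by simpa using H2) he
  have e3 := h.merge H3 he
  simp only [List.append_assoc, List.cons_append, List.nil_append] at e2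
  rw [Multiset.cons_swap, ← hF.cycle, e1, e2, e3]
  ring

/-- Induction on the number of free vertices away from the edge `e`. If one of them is joined to a
leg, resolving it in all three terms reduces to the sum with one free vertex less. Otherwise one of
the four branches `a`, `b`, `c`, `d` ends at a leg, and resolving both vertices of the edge from
there writes every term as a double commutator; the sum vanishes as in the Jacobi identity. -/
theorem IsSTUFun.ihxSum_eq_zero {F : List (Fin m × ℤ) → Multiset (Fin 3 → ℤ) → ℝ} (hF : IsCodeFun F)
    (h : IsSTUFun F) (w : List (Fin m × ℤ)) (e a b c d : ℤ) (T : Multiset (Fin 3 → ℤ)) :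
    ihxSum F w e a b c d T = 0 := by
  induction hn : Multiset.card T using Nat.strong_induction_on generalizing T w with
  | _ n ih =>
  subst hn
  have hlab := lab_ihx (w : Multiset (Fin m × ℤ)) e a b c d T
  -- If one of the three codes is of a homotopy link diagram, it has a free vertex joined to a leg;
  -- if none is, all three terms are zero.
  by_cases hHL : CodeHL w (![e, b, a] ::ₘ ![-e, c, d] ::ₘ T) ∨
    CodeHL w (![e, a, c] ::ₘ ![-e, d, b] ::ₘ T) ∨ CodeHL w (![e, b, c] ::ₘ ![-e, d, a] ::ₘ T)
  swap
  · rw [not_or, not_or] at hHL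
    rw [ihxSum, hF.zero hHL.1, hF.zero hHL.2.1, hF.zero hHL.2.2]
    ring
  have hv : Valid (w : Multiset (Fin m × ℤ)) (![e, b, a] ::ₘ ![-e, c, d] ::ₘ T) := by
    rcases hHL with H | H | H
    · exact H.valid
    · exact H.valid.congr hlab.1
    · exact H.valid.congr hlab.2
  have hleg : (∃ τ ∈ T, ∃ c i, (i, -τ c) ∈ w) ∨
      ∃ i, (i, -a) ∈ w ∨ (i, -b) ∈ w ∨ (i, -c) ∈ w ∨ (i, -d) ∈ w := by
    -- The labels `e` and `-e` already occur at the free vertices, so neither of them is on a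
    -- segment and the leg found is not an end of the inner edge.
    have hdis : ∀ i x, (i, x) ∈ w → x ≠ e ∧ x ≠ -e := by
      intro i x hx
      have hn := hv.nodup
      rw [lab_cons, lab_cons, Multiset.nodup_add, Multiset.nodup_add] at hn
      have h1 : x ∈ lab (w : Multiset (Fin m × ℤ)) T := mem_lab.2 (Or.inl ⟨i, by simpa using hx⟩)
      constructor
      · rintro rfl
        exact Multiset.disjoint_left.1 hn.2.2 (Multiset.mem_add.2 (Or.inl h1))
          (by simp [Multiset.mem_sum, Fin.exists_fin_succ])
      · rintro rfl
        exact Multiset.disjoint_left.1 hn.1.2.2 h1 (by simp [Multiset.mem_sum, Fin.exists_fin_succ])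
    have hne : ∀ i x, (i, x) ∈ w → (x = -e ∨ x = -(-e)) → False := by
      rintro i x hx (h | h)
      · exact (hdis i x hx).2 h
      · exact (hdis i x hx).1 (by rw [h, neg_neg])
    have main : ∀ x₁ x₂ x₃ x₄ : ℤ, CodeHL w (![e, x₁, x₂] ::ₘ ![-e, x₃, x₄] ::ₘ T) →
        (∃ τ ∈ T, ∃ c i, (i, -τ c) ∈ w) ∨
          ∃ i, (i, -x₁) ∈ w ∨ (i, -x₂) ∈ w ∨ (i, -x₃) ∈ w ∨ (i, -x₄) ∈ w := by
      intro x₁ x₂ x₃ x₄ H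
      obtain ⟨τ, hτ, z, i, hz⟩ := H.exists_leg (by simp)
      rw [Multiset.mem_cons, Multiset.mem_cons] at hτ
      rcases hτ with rfl | rfl | hτ
      · fin_cases z
        · exact (hne i _ hz (Or.inl rfl)).elim
        · exact Or.inr ⟨i, Or.inl hz⟩
        · exact Or.inr ⟨i, Or.inr (Or.inl hz)⟩
      · fin_cases z
        · exact (hne i _ hz (Or.inr rfl)).elim
        · exact Or.inr ⟨i, Or.inr (Or.inr (Or.inl hz))⟩
        · exact Or.inr ⟨i, Or.inr (Or.inr (Or.inr hz))⟩
      · exact Or.inl ⟨τ, hτ, z, i, hz⟩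
    rcases hHL with H | H | H
    · rcases main _ _ _ _ H with h1 | ⟨i, h1⟩
      · exact Or.inl h1
      · exact Or.inr ⟨i, by tauto⟩
    · rcases main _ _ _ _ H with h1 | ⟨i, h1⟩
      · exact Or.inl h1
      · exact Or.inr ⟨i, by tauto⟩
    · rcases main _ _ _ _ H with h1 | ⟨i, h1⟩
      · exact Or.inl h1
      · exact Or.inr ⟨i, by tauto⟩
  rcases hleg with ⟨τ, hτ, z, i, hz⟩ | ⟨i, hi⟩
  -- The permutation `π` moves the half-edge joined to the leg to the stem position; its sign is a
  -- common factor of the three terms.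
  · obtain ⟨π, hπ⟩ : ∃ π : Equiv.Perm (Fin 3), π z = 0 := ⟨Equiv.swap z 0, Equiv.swap_apply_left _ _⟩
    obtain ⟨T', rfl⟩ := Multiset.exists_cons_of_mem hτ
    obtain ⟨pre, post, rfl⟩ := List.append_of_mem hz
    obtain ⟨k, y, x, h1⟩ : ∃ k y x, τ = ![-k, y, x] ∘ π := by
      refine ⟨-τ (π.symm 0), τ (π.symm 1), τ (π.symm 2), funext fun c => ?_⟩
      obtain ⟨c, rfl⟩ := π.symm.surjective c
      fin_cases c <;> simp
    have hk : -τ z = k := by simp [h1, hπ]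
    rw [hk] at hv ⊢
    have key : ∀ A B : Fin 3 → ℤ, lab (m := m) (pre ++ (i, k) :: post : List (Fin m × ℤ))
          (A ::ₘ B ::ₘ τ ::ₘ T') = lab (m := m) (pre ++ (i, k) :: post : List (Fin m × ℤ))
          (![e, b, a] ::ₘ ![-e, c, d] ::ₘ τ ::ₘ T') →
        F (pre ++ (i, k) :: post) (A ::ₘ B ::ₘ τ ::ₘ T') = ((Equiv.Perm.sign π : ℤ) : ℝ) *
          (F (pre ++ (i, x) :: (i, y) :: post) (A ::ₘ B ::ₘ T') -
            F (pre ++ (i, y) :: (i, x) :: post) (A ::ₘ B ::ₘ T')) := by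
      intro A B hAB
      rw [Multiset.cons_swap B, Multiset.cons_swap A, h1, hF.turn]
      congr 1
      refine h.merge (hv.congr ?_) rfl
      rw [← hAB]
      simp only [lab_cons, h1, Fin.sum_univ_three]
      have := Equiv.sum_comp π fun c => ({![-k, y, x] c} : Multiset ℤ)
      rw [Fin.sum_univ_three, Fin.sum_univ_three] at this
      simp only [Function.comp_apply]
      rw [add_assoc, this]
      abel
    have hlab := lab_ihx (m := m) (pre ++ (i, k) :: post : List (Fin m × ℤ)) e a b c d (τ ::ₘ T')
    have i1 := ih (Multiset.card T') (by simp) (pre ++ (i, x) :: (i, y) :: post) T' rfl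
    have i2 := ih (Multiset.card T') (by simp) (pre ++ (i, y) :: (i, x) :: post) T' rfl
    rw [ihxSum] at i1 i2 ⊢
    rw [key _ _ rfl, key _ _ hlab.1, key _ _ hlab.2]
    linear_combination ((Equiv.Perm.sign π : ℤ) : ℝ) * (i1 - i2)
  -- Each term becomes a signed sum of four words without the two vertices. The twelve words cancel
  -- in pairs, whichever branch ends at the leg.
  · clear ih
    rw [ihxSum]
    have flip2 : ∀ (A : Fin 3 → ℤ) (x y z : ℤ), F w (A ::ₘ ![x, y, z] ::ₘ T) =
        -F w (A ::ₘ ![x, z, y] ::ₘ T) := by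
      intro A x y z
      rw [Multiset.cons_swap, hF.flip, Multiset.cons_swap]
    have R : ∀ (pre post : List (Fin m × ℤ)) (k x₁ x₂ x₃ y e' f' : ℤ), w = pre ++ (i, k) :: post →
        f' = -e' → y = -k → lab (w : Multiset (Fin m × ℤ)) (![e', x₂, x₁] ::ₘ ![f', x₃, y] ::ₘ T) =
          lab (w : Multiset (Fin m × ℤ)) (![e, b, a] ::ₘ ![-e, c, d] ::ₘ T) →
        F w (![e', x₂, x₁] ::ₘ ![f', x₃, y] ::ₘ T) =
          F (pre ++ (i, x₃) :: (i, x₁) :: (i, x₂) :: post) T -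
            F (pre ++ (i, x₃) :: (i, x₂) :: (i, x₁) :: post) T -
            F (pre ++ (i, x₁) :: (i, x₂) :: (i, x₃) :: post) T +
            F (pre ++ (i, x₂) :: (i, x₁) :: (i, x₃) :: post) T := by
      rintro pre post k x₁ x₂ x₃ y e' f' rfl hf hy hl
      exact h.resolve_two hF hf hy (hv.congr hl.symm)
    have hl : ∀ {A B : Fin 3 → ℤ}, ∑ z, ({A z} : Multiset ℤ) + ∑ z, {B z} =
        ∑ z, {![e, b, a] z} + ∑ z, {![-e, c, d] z} → lab (w : Multiset (Fin m × ℤ)) (A ::ₘ B ::ₘ T) =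
          lab (w : Multiset (Fin m × ℤ)) (![e, b, a] ::ₘ ![-e, c, d] ::ₘ T) := by
      intro A B hAB
      rw [add_comm, add_comm (∑ z, {![e, b, a] z})] at hAB
      rw [lab_cons, lab_cons, lab_cons, lab_cons, add_assoc, hAB, add_assoc]
    rcases hi with hi | hi | hi | hi <;> obtain ⟨pre, post, hw⟩ := List.append_of_mem hi
    · rw [Multiset.cons_swap ![e, b, a], Multiset.cons_swap ![e, a, c], flip2 ![-e, d, b],
        R pre post (-a) d c b a (-e) e hw (by ring) (by ring) (hl (by simp only [Fin.sum_univ_three, Matrix.cons_val_zero, Matrix.cons_val_one, Matrix.cons_val]; abel)),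
        R pre post (-a) b d c a (-e) e hw (by ring) (by ring) (hl (by simp only [Fin.sum_univ_three, Matrix.cons_val_zero, Matrix.cons_val_one, Matrix.cons_val]; abel)),
        R pre post (-a) c b d a e (-e) hw (by ring) (by ring) (hl (by simp only [Fin.sum_univ_three, Matrix.cons_val_zero, Matrix.cons_val_one, Matrix.cons_val]; abel))]
      ring
    · rw [Multiset.cons_swap ![e, b, a], Multiset.cons_swap ![e, b, c], flip2 ![-e, c, d],
        flip2 ![-e, d, a],
        R pre post (-b) d c a b (-e) e hw (by ring) (by ring) (hl (by simp only [Fin.sum_univ_three, Matrix.cons_val_zero, Matrix.cons_val_one, Matrix.cons_val]; abel)),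
        R pre post (-b) c a d b e (-e) hw (by ring) (by ring) (hl (by simp only [Fin.sum_univ_three, Matrix.cons_val_zero, Matrix.cons_val_one, Matrix.cons_val]; abel)),
        R pre post (-b) a d c b (-e) e hw (by ring) (by ring) (hl (by simp only [Fin.sum_univ_three, Matrix.cons_val_zero, Matrix.cons_val_one, Matrix.cons_val]; abel))]
      ring
    · rw [Multiset.cons_swap ![e, a, c], Multiset.cons_swap ![e, b, c], flip2 ![e, b, a],
        R pre post (-c) a b d c e (-e) hw (by ring) (by ring) (hl (by simp only [Fin.sum_univ_three, Matrix.cons_val_zero, Matrix.cons_val_one, Matrix.cons_val]; abel)),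
        R pre post (-c) b d a c (-e) e hw (by ring) (by ring) (hl (by simp only [Fin.sum_univ_three, Matrix.cons_val_zero, Matrix.cons_val_one, Matrix.cons_val]; abel)),
        R pre post (-c) a d b c (-e) e hw (by ring) (by ring) (hl (by simp only [Fin.sum_univ_three, Matrix.cons_val_zero, Matrix.cons_val_one, Matrix.cons_val]; abel))]
      ring
    · rw [flip2 ![e, a, c], flip2 ![e, b, c],
        R pre post (-d) a b c d e (-e) hw (by ring) (by ring) rfl,
        R pre post (-d) c a b d e (-e) hw (by ring) (by ring) (hl (by simp only [Fin.sum_univ_three, Matrix.cons_val_zero, Matrix.cons_val_one, Matrix.cons_val]; abel)),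
        R pre post (-d) c b a d e (-e) hw (by ring) (by ring) (hl (by simp only [Fin.sum_univ_three, Matrix.cons_val_zero, Matrix.cons_val_one, Matrix.cons_val]; abel))]
      ring

/-! ### Invariance properties of functions on words -/

theorem lab_perm {w w' : List (Fin m × ℤ)} (h : w.Perm w') (T : Multiset (Fin 3 → ℤ)) :
    lab (w : Multiset (Fin m × ℤ)) T = lab (w' : Multiset (Fin m × ℤ)) T := by
  rw [Multiset.coe_eq_coe.2 h]

/-- The homotopy link condition passes to sub-diagrams. -/
theorem CodeHL.mono {w w' : List (Fin m × ℤ)} {T T' : Multiset (Fin 3 → ℤ)} (H : CodeHL w T)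
    (hv : Valid (w' : Multiset (Fin m × ℤ)) T') (hw : ∀ x ∈ w', x ∈ w) (hT : ∀ τ ∈ T', τ ∈ T) :
    CodeHL w' T' := by
  obtain ⟨Γ', ℓ', H'⟩ := hv.exists_labels
  obtain ⟨Γ, ℓ, HL, HΓ⟩ := H
  refine ⟨Γ', ℓ', H', ?_⟩
  have hleg : ∀ i (p : Fin (Γ'.q i)), ∃ p', ℓ (Γ.leg i p') = ℓ' (Γ'.leg i p) := by
    intro i p
    have h1 : ℓ' (Γ'.leg i p) ∈ onSeg w i := by
      refine mem_onSeg.2 (hw _ (mem_onSeg.1 ?_))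
      rw [H'.word]
      simp
    rw [HL.word] at h1
    simpa using h1
  have hfree : ∀ v, ∃ v', ∀ c, ℓ (Γ.half v' c) = ℓ' (Γ'.half v c) := fun v =>
    HL.exists_half (hT _ (H'.half_mem v))
  choose L hL using hleg
  choose f hf using hfree
  have hm : ∀ h, ℓ (Sum.elim (fun s => Γ.leg s.1 (L s.1 s.2)) (fun x => Γ.half (f x.1) x.2) h) =
      ℓ' h := by
    rintro (⟨i, p⟩ | ⟨v, c⟩)
    · exact hL i p
    · exact hf v c
  set M : HalfEdge Γ'.q Γ'.f → HalfEdge Γ.q Γ.f :=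
    Sum.elim (fun s => Γ.leg s.1 (L s.1 s.2)) (fun x => Γ.half (f x.1) x.2) with hM
  refine HΓ.of_map M (Sum.elim (fun s => Sum.inl ⟨s.1, L s.1 s.2⟩) fun v => Sum.inr (f v))
    (fun x y hxy => H'.inj ((hm x).symm.trans ((congrArg ℓ hxy).trans (hm y)))) ?_ ?_
    (fun h => HL.inj (by rw [hm, H'.neg, HL.neg, hm])) ?_ (fun i p => ⟨_, rfl⟩) fun a => ⟨_, rfl⟩
  · rintro (⟨i, p⟩ | v) (⟨j, r⟩ | u) hxy
    · have h1 : ℓ (Γ.leg i (L i p)) = ℓ (Γ.leg j (L j r)) :=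
        congrArg ℓ (congrArg Sum.inl (Sum.inl_injective hxy))
      rw [hL, hL] at h1
      exact congrArg Sum.inl (Sum.inl_injective (H'.inj h1))
    · simp at hxy
    · simp at hxy
    · have h1 : f v = f u := Sum.inr_injective hxy
      have h2 := hf v 0
      rw [h1, hf u 0] at h2
      have h3 := H'.inj h2
      simp only [Sum.inr.injEq, Prod.mk.injEq, and_true] at h3
      rw [h3]
  · rintro (⟨i, p⟩ | ⟨v, c⟩) <;> rfl
  · rintro (⟨i, p⟩ | v) (⟨j, r⟩ | ⟨u, c⟩) hxy
    · exact ⟨Sum.inl ⟨i, p⟩, congrArg Sum.inl (Sum.inl_injective hxy).symm⟩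
    · simp [vert] at hxy
    · simp [vert] at hxy
    · refine ⟨Sum.inr (v, c), ?_⟩
      have h1 : u = f v := Sum.inr_injective hxy
      rw [h1]
      rfl

/-- The homotopy link condition does not depend on the order of the vertices on the segments. -/
theorem CodeHL.perm {w w' : List (Fin m × ℤ)} {T : Multiset (Fin 3 → ℤ)} (H : CodeHL w T)
    (h : w.Perm w') : CodeHL w' T :=
  H.mono (H.valid.congr (lab_perm h T)) (fun _ hx => h.mem_iff.2 hx) fun _ hτ => hτ

/-- A function on words which is invariant under exchanges of adjacent letters on different
segments depends only on the words on the segments. -/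
theorem word_invariant {β : Type*} {h : List (Fin m × ℤ) → β}
    (H : ∀ pre x y post, x.1 ≠ y.1 → h (pre ++ x :: y :: post) = h (pre ++ y :: x :: post))
    {w w' : List (Fin m × ℤ)} (hw : ∀ i, onSeg w i = onSeg w' i) : h w = h w' := by
  have front : ∀ (p pre s : List (Fin m × ℤ)) (x : Fin m × ℤ), (∀ y ∈ p, y.1 ≠ x.1) →
      h (pre ++ p ++ x :: s) = h (pre ++ x :: (p ++ s)) := by
    intro p
    induction p with
    | nil => intros; simp
    | cons y p ih =>
      intro pre s x hp
      have h1 := ih (pre ++ [y]) s x fun z hz => hp z (by simp [hz])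
      simp only [List.append_assoc, List.cons_append, List.nil_append] at h1 ⊢
      rw [h1]
      exact H _ _ _ _ (hp y (by simp))
  have key : ∀ (u v pre : List (Fin m × ℤ)), (∀ i, onSeg u i = onSeg v i) →
      h (pre ++ u) = h (pre ++ v) := by
    intro u
    induction u with
    | nil =>
      intro v pre hv
      cases v with
      | nil => rfl
      | cons y v =>
        have := hv y.1
        simp [onSeg_cons] at this
    | cons x u ih =>
      intro v pre hv
      -- The first letter of the word occurs in `v` preceded only by letters on other segments, so
      -- it can be moved to the front.
      obtain ⟨p, s, rfl, hp⟩ : ∃ p s, v = p ++ x :: s ∧ ∀ y ∈ p, y.1 ≠ x.1 := by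
        clear ih
        have h1 : onSeg v x.1 = x.2 :: onSeg u x.1 := by
          rw [← hv, onSeg_cons, if_pos rfl]
        clear hv
        induction v with
        | nil => simp at h1
        | cons y v ih =>
          by_cases hy : y.1 = x.1
          · rw [onSeg_cons, if_pos hy, List.cons.injEq] at h1
            exact ⟨[], v, by rw [List.nil_append, Prod.ext hy h1.1], by simp⟩
          · rw [onSeg_cons, if_neg hy] at h1
            obtain ⟨p, s, rfl, hp⟩ := ih h1
            refine ⟨y :: p, s, rfl, ?_⟩
            simp only [List.mem_cons, forall_eq_or_imp]
            exact ⟨hy, hp⟩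
      have hps : ∀ i, onSeg u i = onSeg (p ++ s) i := by
        intro i
        have h1 := hv i
        rw [onSeg_append, onSeg_cons, onSeg_cons] at h1
        rw [onSeg_append]
        split_ifs at h1 with hi
        · have h2 : onSeg p i = [] := by
            rw [List.eq_nil_iff_forall_not_mem]
            intro z hz
            exact hp _ (mem_onSeg.1 hz) hi.symm
          rw [h2] at h1 ⊢
          simpa using h1
        · exact h1
      have h1 := ih (p ++ s) (pre ++ [x]) hps
      have h2 := front p pre s x hp
      simp only [List.append_assoc, List.cons_append, List.nil_append] at h1 h2
      rw [h1, ← h2]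
  exact key w w' [] hw

/-! ### Centered functions on words -/

section Centered

variable {α : Type*}

/-- The difference between a function on words and its average over all reorderings. -/
def centered (h : List α → ℝ) (w : List α) : ℝ :=
  h w - (w.permutations.map h).sum / (w.length.factorial : ℝ)

/-- The subtracted average is the same for all rearrangements of a word, so centering does not
change differences. -/
theorem centered_sub {h : List α → ℝ} {w w' : List α} (p : w.Perm w') :
    centered h w - centered h w' = h w - h w' := by
  rw [centered, centered, (p.permutations.map h).sum_eq, p.length_eq]
  ring

theorem sum_permutations_of_perm {D : List α → ℝ} {w : List α}
    (h : ∀ u, u.Perm w → D u = D w) :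
    (w.permutations.map D).sum = (w.length.factorial : ℝ) * D w := by
  have h1 : w.permutations.map D = w.permutations.map fun _ => D w :=
    List.map_congr_left fun u hu => h u (List.mem_permutations.1 hu)
  rw [h1, List.map_const', List.sum_replicate, List.length_permutations, nsmul_eq_mul]

theorem sum_centered (h : List α → ℝ) (w : List α) : (w.permutations.map (centered h)).sum = 0 := by
  have h1 := sum_permutations_of_perm (D := fun w => centered h w - h w) (w := w) fun u hu => by
    have := centered_sub (h := h) hu
    linarith
  have h2 : (w.permutations.map (centered h)).sum = (w.permutations.map h).sum +
      (w.permutations.map fun w => centered h w - h w).sum := by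
    rw [← List.sum_map_add]
    simp
  have h3 : (w.length.factorial : ℝ) ≠ 0 := Nat.cast_ne_zero.2 (Nat.factorial_ne_zero _)
  rw [h2, h1, centered]
  field_simp
  ring

/-- A function that is constant on the rearrangements of a word and sums to zero over them is zero.
By this principle, linear identities between centered functions need to be checked on exchanges of
adjacent letters only. -/
theorem eq_zero_of_swap {D : List α → ℝ} {w : List α}
    (hs : ∀ pre a b post, (pre ++ a :: b :: post).Perm w →
      D (pre ++ a :: b :: post) = D (pre ++ b :: a :: post))
    (h0 : (w.permutations.map D).sum = 0) : D w = 0 := by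
  have h1 := sum_permutations_of_perm (D := D) (w := w) fun u hu =>
    perm_invariant hu fun pre a b post hp => hs pre a b post (hp.trans hu)
  rw [h0] at h1
  have h3 : (w.length.factorial : ℝ) ≠ 0 := Nat.cast_ne_zero.2 (Nat.factorial_ne_zero _)
  exact ((mul_eq_zero.1 h1.symm).resolve_left h3)

end Centered

/-! ### The cost of exchanging legs -/

/-- The value that the difference between two words must have by the STU relation. -/
def mergeCost (F : List (Fin m × ℤ) → Multiset (Fin 3 → ℤ) → ℝ) (T : Multiset (Fin 3 → ℤ))
    (pre : List (Fin m × ℤ)) (x y : Fin m × ℤ) (post : List (Fin m × ℤ)) : ℝ :=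
  if x.1 = y.1 then
    F (pre ++ (x.1, fresh (lab (m := m) (pre ++ x :: y :: post : List (Fin m × ℤ)) T)) :: post)
      (![-fresh (lab (m := m) (pre ++ x :: y :: post : List (Fin m × ℤ)) T), y.2, x.2] ::ₘ T)
  else 0

theorem mergeCost_of_ne (F : List (Fin m × ℤ) → Multiset (Fin 3 → ℤ) → ℝ)
    (T : Multiset (Fin 3 → ℤ)) (pre : List (Fin m × ℤ)) {x y : Fin m × ℤ}
    (post : List (Fin m × ℤ)) (h : x.1 ≠ y.1) : mergeCost F T pre x y post = 0 := if_neg h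

theorem mergeCost_eq {F : List (Fin m × ℤ) → Multiset (Fin 3 → ℤ) → ℝ} (hF : IsCodeFun F)
    {T : Multiset (Fin 3 → ℤ)} {pre post : List (Fin m × ℤ)} {i : Fin m} {a b k : ℤ} (h0 : k ≠ 0)
    (h1 : k ∉ lab (m := m) (pre ++ (i, a) :: (i, b) :: post : List (Fin m × ℤ)) T)
    (h2 : -k ∉ lab (m := m) (pre ++ (i, a) :: (i, b) :: post : List (Fin m × ℤ)) T) :
    mergeCost F T pre (i, a) (i, b) post = F (pre ++ (i, k) :: post) (![-k, b, a] ::ₘ T) := by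
  rw [mergeCost, if_pos rfl]
  exact hF.merge_congr h0 h1 h2 (fresh_ne_zero _) (fresh_notMem _) (neg_fresh_notMem _)

/-- With one multiset `s` that contains all the labels involved, several costs can be compared using
the same new label. -/
theorem mergeCost_eq' {F : List (Fin m × ℤ) → Multiset (Fin 3 → ℤ) → ℝ} (hF : IsCodeFun F)
    {T : Multiset (Fin 3 → ℤ)} {pre post : List (Fin m × ℤ)} {i : Fin m} {a b : ℤ}
    {s : Multiset ℤ}
    (h : lab (m := m) (pre ++ (i, a) :: (i, b) :: post : List (Fin m × ℤ)) T ≤ s) :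
    mergeCost F T pre (i, a) (i, b) post =
      F (pre ++ (i, fresh s) :: post) (![-fresh s, b, a] ::ₘ T) :=
  mergeCost_eq hF (fresh_ne_zero _) (fun h' => fresh_notMem s (Multiset.mem_of_le h h'))
    fun h' => neg_fresh_notMem s (Multiset.mem_of_le h h')

/-- The prescribed differences satisfy the Coxeter relations. Antisymmetry comes from the
orientation of the new vertex. For `square`, both sides equal the value with both pairs of legs
merged. For `hexagon`, STU turns the three differences of opposite terms into the three terms of an
IHX relation. If letters lie on different segments, some costs vanish and the others agree, as the
words on the segments are the same. -/
theorem isExchangeCost_mergeCost {F : List (Fin m × ℤ) → Multiset (Fin 3 → ℤ) → ℝ}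
    (hF : IsCodeFun F) {T : Multiset (Fin 3 → ℤ)}
    (hS : ∀ (pre post : List (Fin m × ℤ)) (i : Fin m) (a b : ℤ) (τ : Fin 3 → ℤ) (k : ℤ),
      k ≠ 0 → k ∉ lab (m := m) (pre ++ (i, a) :: (i, b) :: post : List (Fin m × ℤ)) (τ ::ₘ T) →
      -k ∉ lab (m := m) (pre ++ (i, a) :: (i, b) :: post : List (Fin m × ℤ)) (τ ::ₘ T) →
      F (pre ++ (i, a) :: (i, b) :: post) (τ ::ₘ T) -
        F (pre ++ (i, b) :: (i, a) :: post) (τ ::ₘ T) =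
        F (pre ++ (i, k) :: post) (![-k, b, a] ::ₘ τ ::ₘ T))
    (hX : ∀ w e a b c d, ihxSum F w e a b c d T = 0) : IsExchangeCost (mergeCost F T) where
  anti pre x y post := by
    obtain ⟨i, a⟩ := x
    obtain ⟨j, b⟩ := y
    by_cases hij : i = j
    · subst hij
      rw [mergeCost_eq' hF le_rfl, mergeCost_eq' hF (lab_swap pre post (i, b) (i, a) T).le, hF.flip]
    · rw [mergeCost_of_ne _ _ _ _ hij, mergeCost_of_ne _ _ _ _ (Ne.symm hij), neg_zero]
  square pre x y mid z t post := by
    obtain ⟨i, a⟩ := x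
    obtain ⟨j, b⟩ := y
    obtain ⟨p, c⟩ := z
    obtain ⟨r, d⟩ := t
    set s := lab (m := m) (pre ++ (i, a) :: (j, b) :: (mid ++ (p, c) :: (r, d) :: post) :
      List (Fin m × ℤ)) T with hs
    have hs2 : lab (m := m) (pre ++ (i, a) :: (j, b) :: (mid ++ (r, d) :: (p, c) :: post) :
        List (Fin m × ℤ)) T = s := by
      have := lab_swap (pre ++ (i, a) :: (j, b) :: mid) post (r, d) (p, c) T
      simpa using this
    have hs3 : lab (m := m) ((pre ++ (i, a) :: (j, b) :: mid) ++ (p, c) :: (r, d) :: post :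
        List (Fin m × ℤ)) T = s := by
      simp [hs]
    have hs4 : lab (m := m) ((pre ++ (j, b) :: (i, a) :: mid) ++ (p, c) :: (r, d) :: post :
        List (Fin m × ℤ)) T = s := by
      have := lab_swap pre (mid ++ (p, c) :: (r, d) :: post) (j, b) (i, a) T
      simpa using this
    by_cases hij : i = j
    · subst hij
      by_cases hpr : p = r
      · subst hpr
        set k := fresh s with hk
        -- The label of the second new edge must also avoid that of the first.
        set l := fresh (k ::ₘ (-k) ::ₘ s) with hl
        have k0 := fresh_ne_zero s
        have k1 := fresh_notMem s
        have k2 := neg_fresh_notMem s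
        have l0 := fresh_ne_zero (k ::ₘ (-k) ::ₘ s)
        have l1 := fresh_notMem (k ::ₘ (-k) ::ₘ s)
        have l2 := neg_fresh_notMem (k ::ₘ (-k) ::ₘ s)
        rw [← hk] at k0 k1 k2
        rw [← hl] at l0 l1 l2
        simp only [Multiset.mem_cons, not_or] at l1 l2
        rw [mergeCost_eq hF k0 k1 k2, mergeCost_eq hF (k := k) k0 (by rwa [hs2]) (by rwa [hs2]),
          mergeCost_eq hF (k := l) l0 (by rw [hs3]; exact l1.2.2) (by rw [hs3]; exact l2.2.2),
          mergeCost_eq hF (k := l) l0 (by rw [hs4]; exact l1.2.2) (by rw [hs4]; exact l2.2.2)]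
        have m1 : lab (m := m) ((pre ++ (i, k) :: mid) ++ (p, c) :: (p, d) :: post :
            List (Fin m × ℤ)) (![-k, b, a] ::ₘ T) = k ::ₘ (-k) ::ₘ s := by
          have := lab_merge pre (mid ++ (p, c) :: (p, d) :: post) i a b k T
          simpa using this
        have m2 : lab (m := m) (pre ++ (i, a) :: (i, b) :: (mid ++ (p, l) :: post) :
            List (Fin m × ℤ)) (![-l, d, c] ::ₘ T) = l ::ₘ (-l) ::ₘ s := by
          have := lab_merge (pre ++ (i, a) :: (i, b) :: mid) post p c d l T
          simpa using this
        have e1 := hS (pre ++ (i, k) :: mid) post p c d ![-k, b, a] l l0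
          (by rw [m1]; simpa using l1) (by rw [m1]; simpa using l2)
        have e2 := hS pre (mid ++ (p, l) :: post) i a b ![-l, d, c] k k0
          (by
            rw [m2]
            simp only [Multiset.mem_cons, not_or]
            exact ⟨Ne.symm l1.1, fun h => l2.1 h.symm, k1⟩)
          (by
            rw [m2]
            simp only [Multiset.mem_cons, not_or]
            exact ⟨Ne.symm l1.2.1, fun h => l1.1 (neg_inj.1 h).symm, k2⟩)
        simp only [List.append_assoc, List.cons_append] at e1 e2 ⊢
        rw [e1, e2, Multiset.cons_swap]
      · rw [mergeCost_of_ne _ _ (pre ++ _) _ hpr, mergeCost_of_ne _ _ (pre ++ _) _ hpr, sub_zero,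
          mergeCost_eq' hF hs.symm.le, mergeCost_eq' hF hs2.le, sub_eq_zero]
        refine hF.word fun n => ?_
        by_cases h1 : p = n <;> by_cases h2 : r = n <;> simp_all [onSeg_cons]
    · rw [mergeCost_of_ne _ _ pre _ hij, mergeCost_of_ne _ _ pre _ hij, sub_zero, eq_comm,
        sub_eq_zero]
      by_cases hpr : p = r
      · subst hpr
        rw [mergeCost_eq' hF hs3.le, mergeCost_eq' hF hs4.le]
        refine hF.word fun n => ?_
        by_cases h1 : i = n <;> by_cases h2 : j = n <;> simp_all [onSeg_cons]
      · rw [mergeCost_of_ne _ _ _ _ hpr, mergeCost_of_ne _ _ _ _ hpr]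
  hexagon pre x y z post := by
    obtain ⟨i, a⟩ := x
    obtain ⟨j, b⟩ := y
    obtain ⟨n, c⟩ := z
    set s := lab (m := m) (pre ++ (i, a) :: (j, b) :: (n, c) :: post : List (Fin m × ℤ)) T with hs
    have hs2 : lab (m := m) ((pre ++ [(j, b)]) ++ (i, a) :: (n, c) :: post :
        List (Fin m × ℤ)) T = s := by
      rw [hs, lab_swap pre ((n, c) :: post), List.append_assoc, List.cons_append, List.nil_append]
    have hs3 : lab (m := m) (pre ++ (j, b) :: (n, c) :: (i, a) :: post :
        List (Fin m × ℤ)) T = s := by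
      rw [← hs2, lab_swap (pre ++ [(j, b)]) post (i, a)]
      simp
    have hs4 : lab (m := m) ((pre ++ [(i, a)]) ++ (j, b) :: (n, c) :: post :
        List (Fin m × ℤ)) T = s := by
      simp [hs]
    have hs5 : lab (m := m) (pre ++ (i, a) :: (n, c) :: (j, b) :: post :
        List (Fin m × ℤ)) T = s := by
      rw [← hs4, lab_swap _ _ (j, b)]
      simp
    have hs6 : lab (m := m) ((pre ++ [(n, c)]) ++ (i, a) :: (j, b) :: post :
        List (Fin m × ℤ)) T = s := by
      rw [← hs5, lab_swap pre ((j, b) :: post) (i, a), List.append_assoc, List.cons_append,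
        List.nil_append]
    by_cases hij : i = j
    · subst hij
      by_cases hin : i = n
      · subst hin
        rw [mergeCost_eq' hF hs.symm.le, mergeCost_eq' hF hs2.le, mergeCost_eq' hF hs3.le,
          mergeCost_eq' hF hs4.le, mergeCost_eq' hF hs5.le, mergeCost_eq' hF hs6.le]
        set k := fresh s with hk
        set l := fresh (k ::ₘ (-k) ::ₘ s) with hl
        have l0 := fresh_ne_zero (k ::ₘ (-k) ::ₘ s)
        have l1 := fresh_notMem (k ::ₘ (-k) ::ₘ s)
        have l2 := neg_fresh_notMem (k ::ₘ (-k) ::ₘ s)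
        have m1 := lab_merge pre ((i, c) :: post) i a b k T
        have m2 := lab_merge pre ((i, b) :: post) i a c k T
        have m3 := lab_merge pre ((i, a) :: post) i b c k T
        rw [← hs] at m1
        rw [hs5] at m2
        rw [hs3] at m3
        rw [← hl] at l0 l1 l2
        -- Opposite terms of the hexagon differ in the order of the third letter and the new leg
        -- `k`, so STU merges these two to a leg `l`.
        have e1 := hS pre post i k c ![-k, b, a] l l0 (by rwa [m1]) (by rwa [m1])
        have e2 := hS pre post i k b ![-k, c, a] l l0 (by rwa [m2]) (by rwa [m2])
        have e3 := hS pre post i k a ![-k, c, b] l l0 (by rwa [m3]) (by rwa [m3])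
        -- The inner edge is the first new edge, with ends `-k` and `k`; the four branches are the
        -- legs' ends `a`, `b`, `c` and the end `-l` of the edge to the segment.
        have key := hX (pre ++ (i, l) :: post) (-k) a b c (-l)
        rw [ihxSum, neg_neg, Multiset.cons_swap ![-k, b, a], Multiset.cons_swap ![-k, a, c],
          Multiset.cons_swap ![-k, b, c], ← hF.cycle _ (-l) k c, hF.cycle _ k (-l) b,
          hF.flip _ (-l) k c, hF.cycle _ k (-l) a] at key
        have f1 := hF.flip (pre ++ (i, l) :: post) (-k) c a (![-l, b, k] ::ₘ T)
        have f2 := hF.flip (pre ++ (i, l) :: post) (-k) c b (![-l, a, k] ::ₘ T)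
        rw [Multiset.cons_swap, Multiset.cons_swap ![-k, a, c]] at f1
        rw [Multiset.cons_swap, Multiset.cons_swap ![-k, b, c]] at f2
        simp only [List.append_assoc, List.cons_append, List.nil_append] at e1 e2 e3 key f1 f2 ⊢
        linarith
      · rw [mergeCost_of_ne _ _ (pre ++ [(i, b)]) _ hin,
          mergeCost_of_ne _ _ pre (x := (i, b)) (y := (n, c)) _ hin,
          mergeCost_of_ne _ _ (pre ++ [(i, a)]) _ hin,
          mergeCost_of_ne _ _ pre (x := (i, a)) (y := (n, c)) _ hin,
          mergeCost_eq' hF hs.symm.le, mergeCost_eq' hF hs6.le]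
        simp only [add_zero, zero_add]
        refine hF.word fun t => ?_
        by_cases h1 : i = t <;> by_cases h2 : n = t <;> simp_all [onSeg_cons]
    · by_cases hin : i = n
      · subst hin
        rw [mergeCost_of_ne _ _ pre _ hij, mergeCost_of_ne _ _ pre _ (Ne.symm hij),
          mergeCost_of_ne _ _ (pre ++ [(i, a)]) _ (Ne.symm hij),
          mergeCost_of_ne _ _ (pre ++ [(i, c)]) _ hij, mergeCost_eq' hF hs2.le,
          mergeCost_eq' hF hs5.le]
        simp only [add_zero, zero_add]
        refine hF.word fun t => ?_
        by_cases h1 : i = t <;> by_cases h2 : j = t <;> simp_all [onSeg_cons]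
      · rw [mergeCost_of_ne _ _ pre _ hij, mergeCost_of_ne _ _ (pre ++ [(j, b)]) _ hin,
          mergeCost_of_ne _ _ pre (x := (i, a)) (y := (n, c)) _ hin,
          mergeCost_of_ne _ _ (pre ++ [(n, c)]) _ hij]
        simp only [add_zero, zero_add]
        by_cases hjn : j = n
        · subst hjn
          rw [mergeCost_eq' hF hs3.le, mergeCost_eq' hF hs4.le]
          refine hF.word fun t => ?_
          by_cases h1 : i = t <;> by_cases h2 : j = t <;> simp_all [onSeg_cons]
        · rw [mergeCost_of_ne _ _ _ _ hjn, mergeCost_of_ne _ _ _ _ hjn]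

/-! ### Extending leading coefficients to cocycles -/

/-- A function of codes whose value at codes with `k` free vertices is prescribed by `G`, which
vanishes at codes with more free vertices, and which satisfies the STU relations as far as they
involve the codes with at least `j` free vertices only. -/
structure IsPartialExtension (G F : List (Fin m × ℤ) → Multiset (Fin 3 → ℤ) → ℝ) (n k j : ℕ) :
    Prop where
  code : IsCodeFun F
  top : ∀ w T, Multiset.card T = k → F w T = G w T
  above : ∀ w T, k < Multiset.card T → F w T = 0
  order : ∀ w T, w.length + Multiset.card T ≠ 2 * n → F w T = 0
  stu : ∀ (pre post : List (Fin m × ℤ)) (i : Fin m) (a b : ℤ) (T : Multiset (Fin 3 → ℤ)) (l : ℤ),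
    j ≤ Multiset.card T → l ≠ 0 →
    l ∉ lab (m := m) (pre ++ (i, a) :: (i, b) :: post : List (Fin m × ℤ)) T →
    -l ∉ lab (m := m) (pre ++ (i, a) :: (i, b) :: post : List (Fin m × ℤ)) T →
    F (pre ++ (i, a) :: (i, b) :: post) T - F (pre ++ (i, b) :: (i, a) :: post) T =
      F (pre ++ (i, l) :: post) (![-l, b, a] ::ₘ T)
  ihx : ∀ w e a b c d T, j ≤ Multiset.card T + 2 → ihxSum F w e a b c d T = 0

/-- The potential is centered. If the costs do not satisfy the Coxeter relations, the zero function
takes its place, so that the sums over rearrangements vanish for every `T`. -/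
theorem exists_fun_of_mergeCost (F : List (Fin m × ℤ) → Multiset (Fin 3 → ℤ) → ℝ) :
    ∃ C : Multiset (Fin 3 → ℤ) → List (Fin m × ℤ) → ℝ,
      (∀ T, IsExchangeCost (mergeCost F T) → ∀ pre x y post,
        C T (pre ++ x :: y :: post) - C T (pre ++ y :: x :: post) = mergeCost F T pre x y post) ∧
      ∀ T (w : List (Fin m × ℤ)), (w.permutations.map (C T)).sum = 0 := by
  classical
  refine ⟨fun T => if hT : IsExchangeCost (mergeCost F T) then
    centered (exists_potential hT).choose else centered fun _ => 0, fun T hT pre x y post => ?_,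
    fun T w => ?_⟩
  · simp only [dif_pos hT]
    rw [centered_sub ((List.Perm.swap _ _ _).append_left _)]
    exact (exists_potential hT).choose_spec pre x y post
  · dsimp only
    split_ifs
    · exact sum_centered _ _
    · exact sum_centered _ _

theorem sum_map_sub {α : Type*} (l : List α) (f g : α → ℝ) :
    (l.map fun x => f x - g x).sum = (l.map f).sum - (l.map g).sum := by
  induction l with
  | nil => simp
  | cons x l ih =>
    simp only [List.map_cons, List.sum_cons, ih]
    ring

/-- This and the following lemmas on `mergeCost` transfer the properties of `F` at codes with one
more triple to the costs; through `eq_zero_of_swap` they then pass to the new values. -/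
theorem mergeCost_of_not_codeHL {F : List (Fin m × ℤ) → Multiset (Fin 3 → ℤ) → ℝ}
    (hF : IsCodeFun F) {pre post : List (Fin m × ℤ)} {x y : Fin m × ℤ} {T : Multiset (Fin 3 → ℤ)}
    (h : ¬ CodeHL (pre ++ x :: y :: post) T) : mergeCost F T pre x y post = 0 := by
  obtain ⟨i, a⟩ := x
  obtain ⟨j, b⟩ := y
  by_cases hij : i = j
  · subst hij
    rw [mergeCost_eq' hF le_rfl]
    exact hF.zero fun h' => h h'.of_merge
  · exact mergeCost_of_ne _ _ _ _ hij

theorem mergeCost_map {F : List (Fin m × ℤ) → Multiset (Fin 3 → ℤ) → ℝ}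
    (hF : IsCodeFun F) {pre post : List (Fin m × ℤ)} {x y : Fin m × ℤ} {T : Multiset (Fin 3 → ℤ)}
    {g : ℤ → ℤ} (H : Valid (m := m) (pre ++ x :: y :: post : List (Fin m × ℤ)) T)
    (hinj : Set.InjOn g {z | z ∈ lab (m := m) (pre ++ x :: y :: post : List (Fin m × ℤ)) T})
    (hneg : ∀ z ∈ lab (m := m) (pre ++ x :: y :: post : List (Fin m × ℤ)) T, g (-z) = -g z) :
    mergeCost F (T.map fun τ => g ∘ τ) (pre.map (Prod.map id g)) (Prod.map id g x)
      (Prod.map id g y) (post.map (Prod.map id g)) = mergeCost F T pre x y post := by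
  obtain ⟨i, a⟩ := x
  obtain ⟨j, b⟩ := y
  by_cases hij : i = j
  · subst hij
    have hl : lab (m := m) (pre.map (Prod.map id g) ++ (i, g a) :: (i, g b) ::
        post.map (Prod.map id g) : List (Fin m × ℤ)) (T.map fun τ => g ∘ τ) =
        (lab (m := m) (pre ++ (i, a) :: (i, b) :: post : List (Fin m × ℤ)) T).map g := by
      rw [← lab_map]
      simp
    simp only [Prod.map, id]
    rw [mergeCost_eq' (pre := pre.map _) (post := post.map _) hF hl.le, mergeCost_eq' hF le_rfl]
    exact hF.relabel_merge H hinj hneg (fresh_ne_zero _) (fresh_notMem _) (neg_fresh_notMem _)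
      (fresh_ne_zero _) (fresh_notMem _) (neg_fresh_notMem _)
  · rw [mergeCost_of_ne _ _ _ _ hij, mergeCost_of_ne _ _ _ _ hij]

theorem lab_cons_comp (W : Multiset (Fin m × ℤ)) (τ : Fin 3 → ℤ) (π : Equiv.Perm (Fin 3))
    (T : Multiset (Fin 3 → ℤ)) : lab W ((τ ∘ π) ::ₘ T) = lab W (τ ::ₘ T) := by
  rw [lab_cons, lab_cons]
  congr 1
  exact Equiv.sum_comp π fun c => ({τ c} : Multiset ℤ)

theorem mergeCost_turn {F : List (Fin m × ℤ) → Multiset (Fin 3 → ℤ) → ℝ}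
    (hF : IsCodeFun F) (pre post : List (Fin m × ℤ)) (x y : Fin m × ℤ) (T : Multiset (Fin 3 → ℤ))
    (τ : Fin 3 → ℤ) (π : Equiv.Perm (Fin 3)) :
    mergeCost F ((τ ∘ π) ::ₘ T) pre x y post =
      ((Equiv.Perm.sign π : ℤ) : ℝ) * mergeCost F (τ ::ₘ T) pre x y post := by
  obtain ⟨i, a⟩ := x
  obtain ⟨j, b⟩ := y
  by_cases hij : i = j
  · subst hij
    rw [mergeCost_eq' hF (lab_cons_comp _ τ π T).le, mergeCost_eq' hF le_rfl, Multiset.cons_swap,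
      hF.turn, Multiset.cons_swap]
  · rw [mergeCost_of_ne _ _ _ _ hij, mergeCost_of_ne _ _ _ _ hij, mul_zero]

/-- The new triple is a bystander in the IHX relation, and the three codes have the same labels, so
one fresh label serves for all terms. -/
theorem mergeCost_ihx {F : List (Fin m × ℤ) → Multiset (Fin 3 → ℤ) → ℝ}
    (hF : IsCodeFun F) (pre post : List (Fin m × ℤ)) (x y : Fin m × ℤ) (T : Multiset (Fin 3 → ℤ))
    (e a b c d : ℤ) (h : ∀ w τ, ihxSum F w e a b c d (τ ::ₘ T) = 0) :
    mergeCost F (![e, b, a] ::ₘ ![-e, c, d] ::ₘ T) pre x y post -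
      mergeCost F (![e, a, c] ::ₘ ![-e, d, b] ::ₘ T) pre x y post +
      mergeCost F (![e, b, c] ::ₘ ![-e, d, a] ::ₘ T) pre x y post = 0 := by
  obtain ⟨i, p⟩ := x
  obtain ⟨j, q⟩ := y
  by_cases hij : i = j
  · subst hij
    have hl := lab_ihx (m := m) (pre ++ (i, p) :: (i, q) :: post : List (Fin m × ℤ)) e a b c d T
    rw [mergeCost_eq' hF le_rfl, mergeCost_eq' hF hl.1.le, mergeCost_eq' hF hl.2.le]
    have e1 : ∀ A B C : Fin 3 → ℤ, C ::ₘ A ::ₘ B ::ₘ T = A ::ₘ B ::ₘ C ::ₘ T := by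
      intro A B C
      rw [Multiset.cons_swap C A, Multiset.cons_swap C B]
    simp only [e1 _ _ ![_, q, p]]
    exact h _ _
  · rw [mergeCost_of_ne _ _ _ _ hij, mergeCost_of_ne _ _ _ _ hij, mergeCost_of_ne _ _ _ _ hij]
    ring

/-- At codes with `j` triples the values are replaced by the centered potential of the costs. All
properties are linear, hold for the costs, and hence hold for differences under exchanges; since all
sums over rearrangements are zero, `eq_zero_of_swap` gives them for the values. -/
theorem IsPartialExtension.step {G F : List (Fin m × ℤ) → Multiset (Fin 3 → ℤ) → ℝ} {n k j : ℕ}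
    (hj : j < k) (H : IsPartialExtension G F n k (j + 1)) :
    ∃ F', IsPartialExtension G F' n k j := by
  obtain ⟨C, C1, C2⟩ := exists_fun_of_mergeCost F
  have hF := H.code
  have hC : ∀ T, Multiset.card T = j → ∀ pre x y post,
      C T (pre ++ x :: y :: post) - C T (pre ++ y :: x :: post) = mergeCost F T pre x y post := by
    intro T hT
    refine C1 T (isExchangeCost_mergeCost hF ?_ ?_)
    · intro pre post i a b τ l h0 h1 h2
      exact H.stu pre post i a b _ l (by simp [hT]) h0 h1 h2
    · exact fun w e a b c d => H.ihx w e a b c d T (by omega)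
  clear C1
  -- Where no exchange costs anything, the centered function is constant and so zero. This gives the
  -- vanishing at codes of wrong order and at codes that are not of homotopy link diagrams.
  have zero : ∀ w T, Multiset.card T = j → (∀ pre x y post, (pre ++ x :: y :: post).Perm w →
      mergeCost F T pre x y post = 0) → C T w = 0 := by
    intro w T hT h
    refine eq_zero_of_swap (fun pre x y post hp => ?_) (C2 T w)
    have := hC T hT pre x y post
    rw [h pre x y post hp] at this
    linarith
  classical
  refine ⟨fun w T => if Multiset.card T = j then C T w else F w T, ⟨?_, ?_, ?_, ?_⟩, ?_, ?_, ?_,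
    ?_, ?_⟩
  · intro w T h
    split_ifs with hT
    · refine zero w T hT fun pre x y post hp => mergeCost_of_not_codeHL hF fun h' => h ?_
      exact h'.perm hp
    · exact hF.zero h
  · intro w w' T h
    split_ifs with hT
    · refine word_invariant (fun pre x y post hxy => ?_) h
      have := hC T hT pre x y post
      rw [mergeCost_of_ne _ _ _ _ hxy] at this
      linarith
    · exact hF.word h
  · intro w T g hv hinj hneg
    simp only [Multiset.card_map]
    split_ifs with hT
    · rw [← sub_eq_zero]
      refine eq_zero_of_swap
        (D := fun w => C (T.map fun τ => g ∘ τ) (w.map (Prod.map id g)) - C T w) ?_ ?_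
      · intro pre x y post hp
        have h1 := hC T hT pre x y post
        have h2 := hC (T.map fun τ => g ∘ τ) (by simpa using hT) (pre.map (Prod.map id g))
          (Prod.map id g x) (Prod.map id g y) (post.map (Prod.map id g))
        have hl := lab_perm hp T
        rw [mergeCost_map hF (hv.congr hl.symm) (by rwa [hl]) (by rwa [hl])] at h2
        simp only [List.map_append, List.map_cons]
        linarith
      -- Relabeling commutes with listing the rearrangements of a word, so the relabeled values sum
      -- to zero as well.
      · rw [sum_map_sub, C2, sub_zero]
        have h1 := C2 (T.map fun τ => g ∘ τ) (w.map (Prod.map id g))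
        rw [← List.map_permutations, List.map_map] at h1
        exact h1
    · exact hF.relabel g hv hinj hneg
  · intro w T τ π
    simp only [Multiset.card_cons]
    split_ifs with hT
    · rw [← sub_eq_zero]
      refine eq_zero_of_swap
        (D := fun w => C ((τ ∘ π) ::ₘ T) w - ((Equiv.Perm.sign π : ℤ) : ℝ) * C (τ ::ₘ T) w) ?_ ?_
      · intro pre x y post hp
        have h1 := hC (τ ::ₘ T) (by simpa using hT) pre x y post
        have h2 := hC ((τ ∘ π) ::ₘ T) (by simpa using hT) pre x y post
        rw [mergeCost_turn hF, ← h1] at h2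
        linear_combination h2
      · rw [sum_map_sub, C2, List.sum_map_mul_left, C2]
        ring
    · exact hF.turn τ π
  · intro w T hT
    rw [if_neg (by omega), H.top w T hT]
  · intro w T hT
    rw [if_neg (by omega), H.above w T hT]
  · intro w T h
    split_ifs with hT
    · refine zero w T hT fun pre x y post hp => ?_
      obtain ⟨i, a⟩ := x
      obtain ⟨i', b⟩ := y
      by_cases hii : i = i'
      · subst hii
        rw [mergeCost_eq' hF le_rfl]
        refine H.order _ _ ?_
        have := hp.length_eq
        simp only [List.length_append, List.length_cons, Multiset.card_cons] at this ⊢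
        omega
      · exact mergeCost_of_ne _ _ _ _ hii
    · exact H.order w T h
  · intro pre post i a b T l hjT h0 h1 h2
    simp only [Multiset.card_cons]
    -- As `j ≤ card T`, the merged code has more than `j` triples and keeps its old value.
    rw [if_neg (c := Multiset.card T + 1 = j) (by omega)]
    split_ifs with hT
    · rw [hC T hT, mergeCost_eq hF h0 h1 h2]
    · exact H.stu pre post i a b T l (by omega) h0 h1 h2
  · intro w e a b c d T hjT
    simp only [ihxSum, Multiset.card_cons]
    split_ifs with hT
    · refine eq_zero_of_swap (D := fun w => C (![e, b, a] ::ₘ ![-e, c, d] ::ₘ T) w -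
        C (![e, a, c] ::ₘ ![-e, d, b] ::ₘ T) w + C (![e, b, c] ::ₘ ![-e, d, a] ::ₘ T) w) ?_ ?_
      · intro pre x y post hp
        have h1 := hC (![e, b, a] ::ₘ ![-e, c, d] ::ₘ T) (by simpa using hT) pre x y post
        have h2 := hC (![e, a, c] ::ₘ ![-e, d, b] ::ₘ T) (by simpa using hT) pre x y post
        have h3 := hC (![e, b, c] ::ₘ ![-e, d, a] ::ₘ T) (by simpa using hT) pre x y post
        have h4 := mergeCost_ihx hF pre post x y T e a b c d fun w τ =>
          H.ihx w e a b c d _ (by rw [Multiset.card_cons]; omega)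
        linarith
      · rw [List.sum_map_add, sum_map_sub, C2, C2, C2]
        ring
    · exact H.ihx w e a b c d T (by omega)

/-- Leading coefficients which are symmetric in the legs and satisfy the IHX relations extend to
functions of codes which satisfy the STU relations. -/
theorem exists_isSTUFun {G : List (Fin m × ℤ) → Multiset (Fin 3 → ℤ) → ℝ} {n k : ℕ}
    (hG : IsCodeFun G)
    (hsymm : ∀ pre x y post T, Multiset.card T = k →
      G (pre ++ x :: y :: post) T = G (pre ++ y :: x :: post) T)
    (hihx : ∀ w e a b c d T, Multiset.card T + 2 = k → ihxSum G w e a b c d T = 0)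
    (horder : ∀ w T, w.length + Multiset.card T ≠ 2 * n → G w T = 0) :
    ∃ F : List (Fin m × ℤ) → Multiset (Fin 3 → ℤ) → ℝ, IsCodeFun F ∧ IsSTUFun F ∧
      (∀ w T, Multiset.card T = k → F w T = G w T) ∧ (∀ w T, k < Multiset.card T → F w T = 0) ∧
      ∀ w T, w.length + Multiset.card T ≠ 2 * n → F w T = 0 := by
  classical
  -- The start is `G` at codes with `k` triples and zero elsewhere. The STU relations from level `k`
  -- on reduce to the symmetry of `G` or to `0 = 0`.
  have base : IsPartialExtension G (fun w T => if Multiset.card T = k then G w T else 0) n k k := by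
    refine ⟨⟨?_, ?_, ?_, ?_⟩, ?_, ?_, ?_, ?_, ?_⟩
    · intro w T h
      simp [hG.zero h]
    · intro w w' T h
      simp [hG.word h]
    · intro w T g h1 h2 h3
      simp [hG.relabel g h1 h2 h3]
    · intro w T τ π
      simp [hG.turn τ π]
    · intro w T h
      exact if_pos h
    · intro w T h
      exact if_neg (by omega)
    · intro w T h
      simp [horder w T h]
    · intro pre post i a b T l hT h0 h1 h2
      rw [if_neg (c := Multiset.card (![-l, b, a] ::ₘ T) = k)
        (by rw [Multiset.card_cons]; omega)]
      split_ifs with h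
      · rw [hsymm _ _ _ _ _ h, sub_self]
      · rw [sub_self]
    · intro w e a b c d T hT
      simp only [ihxSum, Multiset.card_cons]
      split_ifs with h
      · exact hihx w e a b c d T (by omega)
      · ring
  -- Here `i` counts the levels that have been filled in below `k`.
  have key : ∀ i, i ≤ k → ∃ F, IsPartialExtension G F n k (k - i) := by
    intro i
    induction i with
    | zero => exact fun _ => ⟨_, base⟩
    | succ i ih =>
      intro hi
      obtain ⟨F, hF⟩ := ih (by omega)
      have e1 : k - i = k - (i + 1) + 1 := by omega
      rw [e1] at hF
      exact hF.step (by omega)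
  obtain ⟨F, hF⟩ := key k le_rfl
  rw [Nat.sub_self] at hF
  exact ⟨F, hF.code, fun pre post i a b T l h0 h1 h2 =>
    hF.stu pre post i a b T l (Nat.zero_le _) h0 h1 h2, hF.top, hF.above, hF.order⟩

/-! ### The leading coefficients of cocycles -/

/-- On one segment, the difference of the two values is a value at a code with one more triple,
which vanishes. On different segments the order in the word is immaterial. -/
theorem IsSTUFun.symm_of_top {F : List (Fin m × ℤ) → Multiset (Fin 3 → ℤ) → ℝ} (hF : IsCodeFun F)
    (h : IsSTUFun F) {T : Multiset (Fin 3 → ℤ)} (hT : ∀ w τ, F w (τ ::ₘ T) = 0)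
    (pre post : List (Fin m × ℤ)) (x y : Fin m × ℤ) :
    F (pre ++ x :: y :: post) T = F (pre ++ y :: x :: post) T := by
  obtain ⟨i, a⟩ := x
  obtain ⟨j, b⟩ := y
  by_cases hij : i = j
  · subst hij
    have := h pre post i a b T _ (fresh_ne_zero _) (fresh_notMem _) (neg_fresh_notMem _)
    rw [hT] at this
    linarith
  · refine hF.word fun t => ?_
    by_cases h1 : i = t <;> by_cases h2 : j = t <;> simp_all [onSeg_cons]

/-! ### Isomorphisms from labels -/

theorem Labels.exists_iso_of_turn {Γ Γ' : Diagram m} {w : List (Fin m × ℤ)}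
    {T T' : Multiset (Fin 3 → ℤ)} {ℓ : HalfEdge Γ.q Γ.f → ℤ} {ℓ' : HalfEdge Γ'.q Γ'.f → ℤ}
    (H : Labels Γ w T ℓ) (H' : Labels Γ' w T' ℓ') (ht : ∀ τ ∈ T, ∃ π : Equiv.Perm (Fin 3), τ ∘ π ∈ T')
    (hc : Multiset.card T = Multiset.card T') :
    ∃ φ : Iso Γ Γ', ∀ h, ℓ' (φ.halfEquiv h) = ℓ h := by
  have hq : Γ.q = Γ'.q := funext fun i => by rw [← H.card_word, ← H'.card_word]
  have hv : ∀ v, ∃ v' : Fin Γ'.f, ∃ π : Equiv.Perm (Fin 3),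
      ∀ c, ℓ' (Γ'.half v' (π c)) = ℓ (Γ.half v c) := by
    intro v
    obtain ⟨π, hπ⟩ := ht _ (H.half_mem v)
    obtain ⟨v', hv'⟩ := H'.exists_half hπ
    exact ⟨v', π⁻¹, fun c => by simp [hv']⟩
  choose fr rot hfr using hv
  have hinj : Function.Injective fr := by
    intro u v huv
    have h1 := hfr u ((rot u).symm 0)
    have h2 := hfr v ((rot v).symm 0)
    rw [Equiv.apply_symm_apply] at h1 h2
    rw [huv, h2] at h1
    have h3 := H.inj h1
    simp only [Sum.inr.injEq, Prod.mk.injEq] at h3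
    exact h3.1.symm
  have hf : Γ.f = Γ'.f := by rw [← H.card_tri, ← H'.card_tri, hc]
  have hbij : Function.Bijective fr :=
    (Fintype.bijective_iff_injective_and_card fr).2 ⟨hinj, by simp [hf]⟩
  have key : ∀ h, ℓ' (halfMap hq (Equiv.ofBijective fr hbij) rot h) = ℓ h := by
    rintro (⟨i, p⟩ | ⟨v, c⟩)
    · have h1 := H.getElem?_leg i p
      have h2 := H'.getElem?_leg i (Fin.cast (congrFun hq i) p)
      exact (Option.some_injective _ (h1.symm.trans h2)).symm
    · exact hfr v c
  refine ⟨⟨hq, Equiv.ofBijective fr hbij, rot, fun h => H'.inj ?_⟩, key⟩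
  rw [key, H'.neg, key, H.neg]

/-! ### Words on the parts of a glued diagram -/

/-- The positions that survive the filter and the values of `e` form increasing lists with the same
members, so they coincide. -/
theorem filter_ofFn {n a : ℕ} (g : Fin n → ℤ) {e : Fin a → Fin n} (he : StrictMono e)
    {p : ℤ → Prop} [DecidablePred p] (hp : ∀ k, p (g k) ↔ k ∈ Set.range e) :
    (List.ofFn g).filter p = List.ofFn (g ∘ e) := by
  have h1 : (List.finRange n).filter (fun k => p (g k)) = List.ofFn e := by
    refine List.Perm.eq_of_pairwise (le := (· < ·)) (fun a b _ _ h1 h2 => (lt_asymm h1 h2).elim)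
      ((List.pairwise_lt_finRange n).filter _) (List.pairwise_ofFn.2 fun _ _ h => he h) ?_
    refine (List.perm_ext_iff_of_nodup ((List.nodup_finRange n).filter _)
      (List.nodup_ofFn.2 he.injective)).2 fun k => ?_
    simp [hp]
  rw [List.ofFn_eq_map, List.filter_map, ← List.map_ofFn, ← h1]
  rfl

/-- The positions of `L` where `p` holds and those where it fails are enumerated increasingly;
together the enumerations form the shuffle that merges the two sublists to `L`. -/
theorem exists_shuffle_of_filter (L : List ℤ) (p : ℤ → Prop) [DecidablePred p] :
    ∃ e : Fin (L.filter p).length ⊕ Fin (L.filter fun x => ¬ p x).length ≃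
        Fin ((L.filter p).length + (L.filter fun x => ¬ p x).length),
      StrictMono (fun k => e (Sum.inl k)) ∧ StrictMono (fun k => e (Sum.inr k)) ∧
      (∀ k, L[(e (Sum.inl k) : ℕ)]? = (L.filter p)[(k : ℕ)]?) ∧
      ∀ k, L[(e (Sum.inr k) : ℕ)]? = (L.filter fun x => ¬ p x)[(k : ℕ)]? := by
  have hlen : L.length = (L.filter p).length + (L.filter fun x => ¬ p x).length := by
    have := List.length_eq_length_filter_add (l := L) (fun x => decide (p x))
    simpa using this
  let s : Finset (Fin L.length) := Finset.univ.filter fun k => p (L.get k)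
  have key : ∀ (q : ℤ → Prop) [DecidablePred q] (s : Finset (Fin L.length))
      (_ : ∀ k, k ∈ s ↔ q (L.get k)), ∃ hs : s.card = (L.filter q).length,
        ∀ k, L[(s.orderEmbOfFin hs k : ℕ)]? = (L.filter q)[(k : ℕ)]? := by
    intro q _ s hs
    have h1 : L.filter q = List.ofFn (L.get ∘ s.orderEmbOfFin rfl) := by
      conv_lhs => rw [← List.ofFn_get L]
      refine filter_ofFn _ (s.orderEmbOfFin rfl).strictMono fun k => ?_
      rw [Finset.range_orderEmbOfFin, ← hs]
      rfl
    have h2 : s.card = (L.filter q).length := by rw [h1, List.length_ofFn]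
    refine ⟨h2, fun k => ?_⟩
    have hk : (k : ℕ) < s.card := k.2.trans_le h2.ge
    have h3 : ∀ n (hn : n < s.card), (L.filter q)[n]? =
        some (L.get (s.orderEmbOfFin rfl ⟨n, hn⟩)) := by
      intro n hn
      rw [h1, List.getElem?_ofFn, dif_pos hn]
      rfl
    have h4 : s.orderEmbOfFin h2 k = s.orderEmbOfFin rfl ⟨k, hk⟩ := by
      rw [← Finset.orderEmbOfFin_unique h2 (f := fun k => s.orderEmbOfFin rfl (Fin.cast h2.symm k))]
      · rfl
      · intro x
        exact Finset.orderEmbOfFin_mem _ _ _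
      · intro x y hxy
        exact (s.orderEmbOfFin rfl).strictMono hxy
    rw [h3 k hk, h4, List.getElem?_eq_getElem (Fin.is_lt _)]
    rfl
  obtain ⟨hs, h1⟩ := key p s (by simp [s])
  obtain ⟨hs', h2⟩ := key (fun x => ¬ p x) sᶜ (by simp [s])
  refine ⟨(finSumEquivOfFinset hs hs').trans (finCongr hlen), ?_, ?_, ?_, ?_⟩
  · exact fun a b hab => (s.orderEmbOfFin hs).strictMono hab
  · exact fun a b hab => (sᶜ.orderEmbOfFin hs').strictMono hab
  · exact h1
  · exact h2

/-! ### Closed sets of labels -/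

/-- A set of labels is closed if it consists of the labels of a union of components. -/
structure IsClosedSet (W : Multiset (Fin m × ℤ)) (T : Multiset (Fin 3 → ℤ)) (P : Finset ℤ) :
    Prop where
  sub : ∀ x ∈ P, x ∈ lab W T
  neg : ∀ x ∈ P, -x ∈ P
  tri : ∀ τ ∈ T, ∀ c, τ c ∈ P ↔ τ 0 ∈ P

/-- The part of a word with labels in `P`. -/
def inWord (P : Finset ℤ) (w : List (Fin m × ℤ)) : List (Fin m × ℤ) := w.filter fun x => x.2 ∈ P

/-- The part of a word with labels not in `P`. -/
def outWord (P : Finset ℤ) (w : List (Fin m × ℤ)) : List (Fin m × ℤ) := w.filter fun x => ¬ x.2 ∈ P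

/-- The triples with labels in `P`. -/
def inTri (P : Finset ℤ) (T : Multiset (Fin 3 → ℤ)) : Multiset (Fin 3 → ℤ) :=
  T.filter fun τ => τ 0 ∈ P

/-- The triples with labels not in `P`. -/
def outTri (P : Finset ℤ) (T : Multiset (Fin 3 → ℤ)) : Multiset (Fin 3 → ℤ) :=
  T.filter fun τ => ¬ τ 0 ∈ P

theorem inTri_add_outTri (P : Finset ℤ) (T : Multiset (Fin 3 → ℤ)) : inTri P T + outTri P T = T :=
  Multiset.filter_add_not _ _

theorem inWord_add_outWord (P : Finset ℤ) (w : List (Fin m × ℤ)) :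
    (inWord P w : Multiset (Fin m × ℤ)) + (outWord P w : Multiset (Fin m × ℤ)) = w := by
  have := Multiset.filter_add_not (fun x : Fin m × ℤ => x.2 ∈ P) (w : Multiset (Fin m × ℤ))
  rwa [Multiset.filter_coe, Multiset.filter_coe] at this

section Restrict

variable {w : List (Fin m × ℤ)} {T : Multiset (Fin 3 → ℤ)} {P : Finset ℤ}

theorem mem_lab_in (hP : IsClosedSet (w : Multiset (Fin m × ℤ)) T P) {x : ℤ} :
    x ∈ lab (inWord P w : Multiset (Fin m × ℤ)) (inTri P T) ↔ x ∈ P := by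
  rw [mem_lab]
  constructor
  · rintro (⟨i, hi⟩ | ⟨τ, hτ, c, rfl⟩)
    · simp only [inWord, Multiset.mem_coe, List.mem_filter, decide_eq_true_eq] at hi
      exact hi.2
    · rw [inTri, Multiset.mem_filter] at hτ
      exact (hP.tri τ hτ.1 c).2 hτ.2
  · intro hx
    rcases mem_lab.1 (hP.sub x hx) with ⟨i, hi⟩ | ⟨τ, hτ, c, rfl⟩
    · exact Or.inl ⟨i, by simpa [inWord, hx] using hi⟩
    · exact Or.inr ⟨τ, Multiset.mem_filter.2 ⟨hτ, (hP.tri τ hτ c).1 hx⟩, c, rfl⟩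

theorem mem_lab_out (hP : IsClosedSet (w : Multiset (Fin m × ℤ)) T P) {x : ℤ} :
    x ∈ lab (outWord P w : Multiset (Fin m × ℤ)) (outTri P T) ↔
      x ∈ lab (w : Multiset (Fin m × ℤ)) T ∧ x ∉ P := by
  rw [mem_lab, mem_lab]
  constructor
  · rintro (⟨i, hi⟩ | ⟨τ, hτ, c, rfl⟩)
    · simp only [outWord, Multiset.mem_coe, List.mem_filter, decide_eq_true_eq] at hi
      exact ⟨Or.inl ⟨i, hi.1⟩, hi.2⟩
    · rw [outTri, Multiset.mem_filter] at hτ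
      exact ⟨Or.inr ⟨τ, hτ.1, c, rfl⟩, fun h => hτ.2 ((hP.tri τ hτ.1 c).1 h)⟩
  · rintro ⟨⟨i, hi⟩ | ⟨τ, hτ, c, rfl⟩, hx⟩
    · exact Or.inl ⟨i, by simpa [outWord, hx] using hi⟩
    · exact Or.inr ⟨τ, Multiset.mem_filter.2 ⟨hτ, fun h => hx ((hP.tri τ hτ c).2 h)⟩, c, rfl⟩

theorem lab_in_add_out (P : Finset ℤ) (w : List (Fin m × ℤ)) (T : Multiset (Fin 3 → ℤ)) :
    lab (inWord P w : Multiset (Fin m × ℤ)) (inTri P T) +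
      lab (outWord P w : Multiset (Fin m × ℤ)) (outTri P T) = lab (w : Multiset (Fin m × ℤ)) T := by
  rw [← lab_add, inWord_add_outWord, inTri_add_outTri]

theorem Valid.inCode (H : Valid (w : Multiset (Fin m × ℤ)) T)
    (hP : IsClosedSet (w : Multiset (Fin m × ℤ)) T P) :
    Valid (inWord P w : Multiset (Fin m × ℤ)) (inTri P T) := by
  have h1 := H.nodup
  rw [← lab_in_add_out P, Multiset.nodup_add] at h1
  refine ⟨h1.1, fun h => H.zero (hP.sub 0 ((mem_lab_in hP).1 h)), fun x hx => ?_⟩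
  exact (mem_lab_in hP).2 (hP.neg x ((mem_lab_in hP).1 hx))

theorem Valid.outCode (H : Valid (w : Multiset (Fin m × ℤ)) T)
    (hP : IsClosedSet (w : Multiset (Fin m × ℤ)) T P) :
    Valid (outWord P w : Multiset (Fin m × ℤ)) (outTri P T) := by
  have h1 := H.nodup
  rw [← lab_in_add_out P, Multiset.nodup_add] at h1
  refine ⟨h1.2.1, fun h => H.zero ((mem_lab_out hP).1 h).1, fun x hx => ?_⟩
  rw [mem_lab_out hP] at hx ⊢
  exact ⟨H.neg x hx.1, fun h => hx.2 (by simpa using hP.neg _ h)⟩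

theorem onSeg_inWord (i : Fin m) : onSeg (inWord P w) i = (onSeg w i).filter (· ∈ P) :=
  onSeg_filter w (· ∈ P) i

theorem onSeg_outWord (i : Fin m) : onSeg (outWord P w) i = (onSeg w i).filter (¬ · ∈ P) :=
  onSeg_filter w (¬ · ∈ P) i

end Restrict

/-- The combination of labels of two diagrams. -/
def glueLabel {Γ₁ Γ₂ : Diagram m} (σ : Shuffle Γ₁.q Γ₂.q) (ℓ₁ : HalfEdge Γ₁.q Γ₁.f → ℤ)
    (ℓ₂ : HalfEdge Γ₂.q Γ₂.f → ℤ) : HalfEdge (glue Γ₁ Γ₂ σ).q (glue Γ₁ Γ₂ σ).f → ℤ :=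
  fun h => Sum.elim ℓ₁ ℓ₂ ((glueHalf σ).symm h)

theorem glueLabel_glueHalf {Γ₁ Γ₂ : Diagram m} (σ : Shuffle Γ₁.q Γ₂.q)
    (ℓ₁ : HalfEdge Γ₁.q Γ₁.f → ℤ) (ℓ₂ : HalfEdge Γ₂.q Γ₂.f → ℤ) (x) :
    glueLabel σ ℓ₁ ℓ₂ (glueHalf σ x) = Sum.elim ℓ₁ ℓ₂ x := by
  change Sum.elim ℓ₁ ℓ₂ ((glueHalf σ).symm (glueHalf σ x)) = _
  rw [Equiv.symm_apply_apply]

/-- The shuffle `σ` merges the words of the two parts of a code to the word `w`. -/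
def Merges {q₁ q₂ : Fin m → ℕ} (σ : Shuffle q₁ q₂) (w w₁ w₂ : List (Fin m × ℤ)) : Prop :=
  ∀ i, (∀ p : Fin (q₁ i), (onSeg w i)[(σ.1 i (Sum.inl p) : ℕ)]? = (onSeg w₁ i)[(p : ℕ)]?) ∧
    ∀ p : Fin (q₂ i), (onSeg w i)[(σ.1 i (Sum.inr p) : ℕ)]? = (onSeg w₂ i)[(p : ℕ)]?

theorem exists_merges {q₁ q₂ : Fin m → ℕ} {w : List (Fin m × ℤ)} {P : Finset ℤ}
    (h₁ : ∀ i, (onSeg (inWord P w) i).length = q₁ i)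
    (h₂ : ∀ i, (onSeg (outWord P w) i).length = q₂ i) :
    ∃ σ : Shuffle q₁ q₂, Merges σ w (inWord P w) (outWord P w) := by
  obtain rfl : _ = q₁ := funext h₁
  obtain rfl : _ = q₂ := funext h₂
  have : ∀ i, ∃ e : Fin (onSeg (inWord P w) i).length ⊕ Fin (onSeg (outWord P w) i).length ≃
        Fin ((onSeg (inWord P w) i).length + (onSeg (outWord P w) i).length),
      StrictMono (fun k => e (Sum.inl k)) ∧ StrictMono (fun k => e (Sum.inr k)) ∧
      (∀ k, (onSeg w i)[(e (Sum.inl k) : ℕ)]? = (onSeg (inWord P w) i)[(k : ℕ)]?) ∧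
      ∀ k, (onSeg w i)[(e (Sum.inr k) : ℕ)]? = (onSeg (outWord P w) i)[(k : ℕ)]? := by
    intro i
    rw [onSeg_inWord, onSeg_outWord]
    exact exists_shuffle_of_filter (onSeg w i) (· ∈ P)
  choose e h1 h2 h3 h4 using this
  exact ⟨⟨e, fun i => ⟨h1 i, h2 i⟩⟩, fun i => ⟨h3 i, h4 i⟩⟩

/-- The labels on a segment are distinct, so each leg has only one possible position in the merged
word. -/
theorem Merges.unique {q₁ q₂ : Fin m → ℕ} {σ σ' : Shuffle q₁ q₂} {w w₁ w₂ : List (Fin m × ℤ)}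
    (H : Merges σ w w₁ w₂) (H' : Merges σ' w w₁ w₂) (hw : ∀ i, (onSeg w i).Nodup)
    (hlen : ∀ i, (onSeg w i).length = q₁ i + q₂ i) : σ = σ' := by
  apply Subtype.ext
  funext i
  have inj : ∀ a b : Fin (q₁ i + q₂ i), (onSeg w i)[(a : ℕ)]? = (onSeg w i)[(b : ℕ)]? → a = b := by
    intro a b h
    have ha : (a : ℕ) < (onSeg w i).length := (hlen i).symm ▸ a.2
    exact Fin.ext ((List.getElem?_inj ha (hw i)).1 h)
  ext x : 1
  rcases x with p | p
  · exact inj _ _ (((H i).1 p).trans ((H' i).1 p).symm)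
  · exact inj _ _ (((H i).2 p).trans ((H' i).2 p).symm)

/-! ### Values of elements at codes -/

theorem HT_induction {p : HT m → Prop} (hd : ∀ Γ, p (diag Γ)) (ha : ∀ x y, p x → p y → p (x + y))
    (hs : ∀ (r : ℝ) x, p x → p (r • x)) (x : HT m) : p x := by
  obtain ⟨f, rfl⟩ := (relations m).mkQ_surjective x
  induction f using Finsupp.induction_linear with
  | zero =>
    rw [map_zero, ← zero_smul ℝ (diag (empty m))]
    exact hs 0 _ (hd _)
  | add f g hf hg =>
    rw [map_add]
    exact ha _ _ hf hg
  | single Γ r =>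
    have : Finsupp.single Γ r = r • Finsupp.single Γ (1 : ℝ) := by simp
    rw [this, map_smul]
    exact hs r _ (hd Γ)

open Classical in
/-- The value of elements of `HT m` at a code. -/
def evL (w : List (Fin m × ℤ)) (T : Multiset (Fin 3 → ℤ)) : HT m →ₗ[ℝ] ℝ :=
  if h : ∃ (Γ : Diagram m) (ℓ : _), Labels Γ w T ℓ then coeff h.choose else 0

theorem evL_apply (w : List (Fin m × ℤ)) (T : Multiset (Fin 3 → ℤ)) (x : HT m) :
    evL w T x = ev (fun Γ => coeff Γ x) w T := by
  rw [evL, ev]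
  split_ifs <;> rfl

theorem isCodeFun_evL (x : HT m) : IsCodeFun fun w T => evL w T x := by
  have : (fun w T => evL w T x) = ev (fun Γ => coeff Γ x) := by
    funext w T
    exact evL_apply w T x
  rw [this]
  exact (isDiagramFun_coeff x).isCodeFun

theorem evL_of_labels {Γ : Diagram m} {w : List (Fin m × ℤ)} {T : Multiset (Fin 3 → ℤ)}
    {ℓ : HalfEdge Γ.q Γ.f → ℤ} (H : Labels Γ w T ℓ) (x : HT m) : evL w T x = coeff Γ x := by
  rw [evL_apply]
  exact ev_of_labels (isDiagramFun_coeff x) H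

/-! ### Turned triples -/

/-- Two triples agree up to the ordering. -/
def IsTurn (τ τ' : Fin 3 → ℤ) : Prop := ∃ π : Equiv.Perm (Fin 3), τ' = τ ∘ π

theorem IsTurn.symm {τ τ' : Fin 3 → ℤ} (h : IsTurn τ τ') : IsTurn τ' τ := by
  obtain ⟨π, rfl⟩ := h
  refine ⟨π⁻¹, ?_⟩
  funext c
  simp

theorem rel_turn_symm {T T' : Multiset (Fin 3 → ℤ)} (h : Multiset.Rel IsTurn T T') :
    Multiset.Rel IsTurn T' T := by
  rw [← Multiset.rel_flip]
  exact h.mono fun _ _ _ _ h => h.symm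

theorem lab_rel {W : Multiset (Fin m × ℤ)} {T T' : Multiset (Fin 3 → ℤ)}
    (h : Multiset.Rel IsTurn T T') : lab W T = lab W T' := by
  induction h with
  | zero => rfl
  | cons hab _ ih =>
    obtain ⟨π, rfl⟩ := hab
    rw [lab_cons_comp, lab_cons, lab_cons, ih]

theorem IsClosedSet.of_rel {W : Multiset (Fin m × ℤ)} {T T' : Multiset (Fin 3 → ℤ)} {P : Finset ℤ}
    (hP : IsClosedSet W T P) (h : Multiset.Rel IsTurn T T') : IsClosedSet W T' P := by
  refine ⟨fun x hx => lab_rel h ▸ hP.sub x hx, hP.neg, fun τ' hτ' c => ?_⟩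
  obtain ⟨τ, hτ, π, hπ⟩ := Multiset.exists_mem_of_rel_of_mem (rel_turn_symm h) hτ'
  have : τ' = τ ∘ ⇑(π⁻¹ : Equiv.Perm (Fin 3)) := by
    rw [hπ]
    funext c
    simp
  rw [this, Function.comp_apply, Function.comp_apply, hP.tri τ hτ, hP.tri τ hτ (π⁻¹ 0)]

theorem rel_filter {α : Type*} {r : α → α → Prop} {s t : Multiset α} {p : α → Prop}
    [DecidablePred p] (h : Multiset.Rel r s t) (hp : ∀ a ∈ s, ∀ b ∈ t, r a b → (p a ↔ p b)) :
    Multiset.Rel r (s.filter p) (t.filter p) := by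
  have h' : Multiset.Rel (fun a b => r a b ∧ (p a ↔ p b)) s t :=
    h.mono fun a ha b hb hab => ⟨hab, hp a ha b hb hab⟩
  clear h hp
  induction h' with
  | zero => exact Multiset.Rel.zero
  | @cons a b _ _ hab _ ih =>
    by_cases h1 : p a
    · rw [Multiset.filter_cons_of_pos _ h1, Multiset.filter_cons_of_pos _ (hab.2.1 h1)]
      exact Multiset.Rel.cons hab.1 ih
    · rw [Multiset.filter_cons_of_neg _ h1, Multiset.filter_cons_of_neg _ fun h => h1 (hab.2.2 h)]
      exact ih

theorem IsClosedSet.mem_iff_of_turn {W : Multiset (Fin m × ℤ)} {T : Multiset (Fin 3 → ℤ)}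
    {P : Finset ℤ} (hP : IsClosedSet W T P) {τ τ' : Fin 3 → ℤ} (hτ : τ ∈ T) (h : IsTurn τ τ') :
    τ 0 ∈ P ↔ τ' 0 ∈ P := by
  obtain ⟨π, rfl⟩ := h
  exact (hP.tri τ hτ _).symm

theorem IsClosedSet.rel_inTri {W : Multiset (Fin m × ℤ)} {T T' : Multiset (Fin 3 → ℤ)}
    {P : Finset ℤ} (hP : IsClosedSet W T P) (h : Multiset.Rel IsTurn T T') :
    Multiset.Rel IsTurn (inTri P T) (inTri P T') :=
  rel_filter h fun _ ha _ _ hab => hP.mem_iff_of_turn ha hab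

theorem IsClosedSet.rel_outTri {W : Multiset (Fin m × ℤ)} {T T' : Multiset (Fin 3 → ℤ)}
    {P : Finset ℤ} (hP : IsClosedSet W T P) (h : Multiset.Rel IsTurn T T') :
    Multiset.Rel IsTurn (outTri P T) (outTri P T') :=
  rel_filter h fun _ ha _ _ hab => not_congr (hP.mem_iff_of_turn ha hab)

theorem Labels.exists_iso_of_rel {Γ Γ' : Diagram m} {w : List (Fin m × ℤ)}
    {T T' : Multiset (Fin 3 → ℤ)} {ℓ : HalfEdge Γ.q Γ.f → ℤ} {ℓ' : HalfEdge Γ'.q Γ'.f → ℤ}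
    (H : Labels Γ w T ℓ) (H' : Labels Γ' w T' ℓ') (h : Multiset.Rel IsTurn T T') :
    ∃ φ : Iso Γ Γ', ∀ h, ℓ' (φ.halfEquiv h) = ℓ h := by
  refine H.exists_iso_of_turn H' (fun τ hτ => ?_) (Multiset.card_eq_card_of_rel h)
  obtain ⟨τ', hτ', π, rfl⟩ := Multiset.exists_mem_of_rel_of_mem h hτ
  exact ⟨π, hτ'⟩

/-- The code of an isomorphic diagram. -/
theorem Labels.transport {Γ Γ' : Diagram m} (φ : Iso Γ Γ') {w : List (Fin m × ℤ)}
    {T : Multiset (Fin 3 → ℤ)} {ℓ : HalfEdge Γ.q Γ.f → ℤ} (H : Labels Γ w T ℓ) :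
    ∃ T', Labels Γ' w T' (ℓ ∘ φ.halfEquiv.symm) ∧ Multiset.Rel IsTurn T T' ∧
      ∀ {F : List (Fin m × ℤ) → Multiset (Fin 3 → ℤ) → ℝ}, IsCodeFun F → ∀ w' S,
        F w' (T' + S) = φ.sign * F w' (T + S) := by
  refine ⟨_, H.of_iso φ, ?_, fun {F} hF w' S => ?_⟩
  · rw [H.tri, Multiset.rel_map]
    exact Multiset.rel_refl_of_refl_on fun v _ => ⟨(φ.rot v).symm, rfl⟩
  · rw [H.tri]
    have := hF.turn_all w' Finset.univ (fun v c => ℓ (Γ.half v c)) (fun v => (φ.rot v).symm) S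
    rw [Iso.sign]
    simp only [Equiv.Perm.sign_symm] at this
    exact this

/-! ### Codes of glued diagrams -/

theorem Labels.glued {Γ₁ Γ₂ : Diagram m} {w w₁ w₂ : List (Fin m × ℤ)}
    {T₁ T₂ : Multiset (Fin 3 → ℤ)} {ℓ₁ : HalfEdge Γ₁.q Γ₁.f → ℤ} {ℓ₂ : HalfEdge Γ₂.q Γ₂.f → ℤ}
    {σ : Shuffle Γ₁.q Γ₂.q} (H₁ : Labels Γ₁ w₁ T₁ ℓ₁) (H₂ : Labels Γ₂ w₂ T₂ ℓ₂)
    (hσ : Merges σ w w₁ w₂) (hlen : ∀ i, (onSeg w i).length = Γ₁.q i + Γ₂.q i)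
    (hd : ∀ h h', ℓ₁ h ≠ ℓ₂ h') : Labels (glue Γ₁ Γ₂ σ) w (T₁ + T₂) (glueLabel σ ℓ₁ ℓ₂) where
  inj := by
    intro h h' e
    obtain ⟨x, rfl⟩ := (glueHalf σ).surjective h
    obtain ⟨y, rfl⟩ := (glueHalf σ).surjective h'
    rw [glueLabel_glueHalf, glueLabel_glueHalf] at e
    rcases x with x | x <;> rcases y with y | y
    · rw [H₁.inj e]
    · exact absurd e (hd _ _)
    · exact absurd e.symm (hd _ _)
    · rw [H₂.inj e]
  neg h := by
    obtain ⟨x, rfl⟩ := (glueHalf σ).surjective h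
    rw [glue_e, glueLabel_glueHalf, glueLabel_glueHalf]
    rcases x with x | x
    · exact H₁.neg x
    · exact H₂.neg x
  word i := by
    have key : ∀ k : Fin (Γ₁.q i + Γ₂.q i), (onSeg w i)[(k : ℕ)]? =
        some (glueLabel σ ℓ₁ ℓ₂ ((Diagram.glue Γ₁ Γ₂ σ).leg i k)) := by
      intro k
      obtain ⟨x, rfl⟩ := (σ.1 i).surjective k
      rcases x with p | p
      · rw [(hσ i).1 p, H₁.getElem?_leg]
        exact congrArg some (glueLabel_glueHalf σ ℓ₁ ℓ₂ (Sum.inl (Sum.inl ⟨i, p⟩))).symm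
      · rw [(hσ i).2 p, H₂.getElem?_leg]
        exact congrArg some (glueLabel_glueHalf σ ℓ₁ ℓ₂ (Sum.inr (Sum.inl ⟨i, p⟩))).symm
    apply List.ext_getElem?
    intro r
    rw [List.getElem?_ofFn]
    split_ifs with hr
    · exact key ⟨r, hr⟩
    · refine List.getElem?_eq_none ?_
      rw [hlen]
      exact not_lt.1 hr
  tri := by
    rw [← sum_singleton]
    change _ = ∑ v : Fin (Γ₁.f + Γ₂.f), _
    rw [← Equiv.sum_comp finSumFinEquiv, Fintype.sum_sum_type, H₁.tri, H₂.tri, ← sum_singleton,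
      ← sum_singleton]
    congr 1
    · refine Finset.sum_congr rfl fun v _ => congrArg _ (funext fun c => ?_)
      exact (glueLabel_glueHalf σ ℓ₁ ℓ₂ (Sum.inl (Sum.inr (v, c)))).symm
    · refine Finset.sum_congr rfl fun v _ => congrArg _ (funext fun c => ?_)
      exact (glueLabel_glueHalf σ ℓ₁ ℓ₂ (Sum.inr (Sum.inr (v, c)))).symm

/-- The labels of the first part of a glued diagram. -/
def partLabels {Γ₁ Γ₂ : Diagram m} (σ : Shuffle Γ₁.q Γ₂.q)
    (L : HalfEdge (glue Γ₁ Γ₂ σ).q (glue Γ₁ Γ₂ σ).f → ℤ) : Finset ℤ :=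
  Finset.univ.image fun h => L (glueHalf σ (Sum.inl h))

section Unglue

variable {Γ₁ Γ₂ : Diagram m} {w : List (Fin m × ℤ)} {T : Multiset (Fin 3 → ℤ)}
  {σ : Shuffle Γ₁.q Γ₂.q} {L : HalfEdge (glue Γ₁ Γ₂ σ).q (glue Γ₁ Γ₂ σ).f → ℤ}

theorem mem_partLabels_inl (h) : L (glueHalf σ (Sum.inl h)) ∈ partLabels σ L :=
  Finset.mem_image.2 ⟨h, Finset.mem_univ _, rfl⟩

theorem notMem_partLabels_inr (H : Labels (glue Γ₁ Γ₂ σ) w T L) (h) :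
    L (glueHalf σ (Sum.inr h)) ∉ partLabels σ L := by
  intro hm
  obtain ⟨h', -, e⟩ := Finset.mem_image.1 hm
  have := (glueHalf σ).injective (H.inj e)
  simp at this

theorem Labels.isClosedSet_partLabels (H : Labels (glue Γ₁ Γ₂ σ) w T L) :
    IsClosedSet (w : Multiset (Fin m × ℤ)) T (partLabels σ L) := by
  refine ⟨fun x hx => ?_, fun x hx => ?_, fun τ hτ c => ?_⟩
  · obtain ⟨h, -, rfl⟩ := Finset.mem_image.1 hx
    exact H.mem_lab_iff.2 ⟨_, rfl⟩
  · obtain ⟨h, -, rfl⟩ := Finset.mem_image.1 hx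
    have : L (glueHalf σ (Sum.inl (Γ₁.e h))) = -L (glueHalf σ (Sum.inl h)) :=
      (congrArg L (glue_e σ (Sum.inl h))).symm.trans (H.neg _)
    exact this ▸ mem_partLabels_inl _
  · obtain ⟨v, hv⟩ := H.exists_half hτ
    obtain ⟨x, rfl⟩ := finSumFinEquiv.surjective v
    rw [← hv, ← hv]
    rcases x with v | v
    · exact iff_of_true (mem_partLabels_inl (Sum.inr (v, c))) (mem_partLabels_inl (Sum.inr (v, 0)))
    · exact iff_of_false (notMem_partLabels_inr H (Sum.inr (v, c)))
        (notMem_partLabels_inr H (Sum.inr (v, 0)))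

theorem Labels.onSeg_in (H : Labels (glue Γ₁ Γ₂ σ) w T L) (i : Fin m) :
    onSeg (inWord (partLabels σ L) w) i =
      List.ofFn fun p => L (glueHalf σ (Sum.inl (Sum.inl ⟨i, p⟩))) := by
  rw [onSeg_inWord, H.word]
  refine filter_ofFn (fun k => L ((Diagram.glue Γ₁ Γ₂ σ).leg i k)) (σ.2 i).1 fun k => ?_
  obtain ⟨x, rfl⟩ := (σ.1 i).surjective k
  rcases x with p | p
  · exact iff_of_true (mem_partLabels_inl (Sum.inl ⟨i, p⟩)) ⟨p, rfl⟩
  · refine iff_of_false (notMem_partLabels_inr H (Sum.inl ⟨i, p⟩)) ?_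
    rintro ⟨p', hp'⟩
    simpa using (σ.1 i).injective hp'

theorem Labels.onSeg_out (H : Labels (glue Γ₁ Γ₂ σ) w T L) (i : Fin m) :
    onSeg (outWord (partLabels σ L) w) i =
      List.ofFn fun p => L (glueHalf σ (Sum.inr (Sum.inl ⟨i, p⟩))) := by
  rw [onSeg_outWord, H.word]
  refine filter_ofFn (fun k => L ((Diagram.glue Γ₁ Γ₂ σ).leg i k)) (σ.2 i).2 fun k => ?_
  obtain ⟨x, rfl⟩ := (σ.1 i).surjective k
  rcases x with p | p
  · refine iff_of_false (fun h => h (mem_partLabels_inl (Sum.inl ⟨i, p⟩))) ?_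
    rintro ⟨p', hp'⟩
    simpa using (σ.1 i).injective hp'
  · exact iff_of_true (notMem_partLabels_inr H (Sum.inl ⟨i, p⟩)) ⟨p, rfl⟩

theorem Labels.merges (H : Labels (glue Γ₁ Γ₂ σ) w T L) :
    Merges σ w (inWord (partLabels σ L) w) (outWord (partLabels σ L) w) := by
  intro i
  constructor
  · intro p
    rw [H.onSeg_in, List.getElem?_ofFn, dif_pos p.2]
    exact H.getElem?_leg i (σ.1 i (Sum.inl p))
  · intro p
    rw [H.onSeg_out, List.getElem?_ofFn, dif_pos p.2]
    exact H.getElem?_leg i (σ.1 i (Sum.inr p))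

theorem Labels.tri_glue (H : Labels (glue Γ₁ Γ₂ σ) w T L) :
    T = (Finset.univ.val.map fun v c => L (glueHalf σ (Sum.inl (Sum.inr (v, c))))) +
      Finset.univ.val.map fun v c => L (glueHalf σ (Sum.inr (Sum.inr (v, c)))) := by
  rw [H.tri, ← sum_singleton]
  change ∑ v : Fin (Γ₁.f + Γ₂.f), _ = _
  rw [← Equiv.sum_comp finSumFinEquiv, Fintype.sum_sum_type, ← sum_singleton, ← sum_singleton]
  rfl

theorem Labels.tri_in (H : Labels (glue Γ₁ Γ₂ σ) w T L) : inTri (partLabels σ L) T =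
    Finset.univ.val.map fun v c => L (glueHalf σ (Sum.inl (Sum.inr (v, c)))) := by
  rw [inTri, H.tri_glue, Multiset.filter_add, Multiset.filter_eq_self.2, Multiset.filter_eq_nil.2,
    add_zero]
  · intro τ hτ
    obtain ⟨v, -, rfl⟩ := Multiset.mem_map.1 hτ
    exact notMem_partLabels_inr H _
  · intro τ hτ
    obtain ⟨v, -, rfl⟩ := Multiset.mem_map.1 hτ
    exact mem_partLabels_inl _

theorem Labels.tri_out (H : Labels (glue Γ₁ Γ₂ σ) w T L) : outTri (partLabels σ L) T =
    Finset.univ.val.map fun v c => L (glueHalf σ (Sum.inr (Sum.inr (v, c)))) := by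
  rw [outTri, H.tri_glue, Multiset.filter_add, Multiset.filter_eq_nil.2, Multiset.filter_eq_self.2,
    zero_add]
  · intro τ hτ
    obtain ⟨v, -, rfl⟩ := Multiset.mem_map.1 hτ
    exact notMem_partLabels_inr H _
  · intro τ hτ
    obtain ⟨v, -, rfl⟩ := Multiset.mem_map.1 hτ
    exact fun h => h (mem_partLabels_inl _)

theorem Labels.unglue_left (H : Labels (glue Γ₁ Γ₂ σ) w T L) :
    Labels Γ₁ (inWord (partLabels σ L) w) (inTri (partLabels σ L) T)
      fun h => L (glueHalf σ (Sum.inl h)) where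
  inj _ _ e := Sum.inl_injective ((glueHalf σ).injective (H.inj e))
  neg h := (congrArg L (glue_e σ (Sum.inl h))).symm.trans (H.neg _)
  word i := H.onSeg_in i
  tri := H.tri_in

theorem Labels.unglue_right (H : Labels (glue Γ₁ Γ₂ σ) w T L) :
    Labels Γ₂ (outWord (partLabels σ L) w) (outTri (partLabels σ L) T)
      fun h => L (glueHalf σ (Sum.inr h)) where
  inj _ _ e := Sum.inr_injective ((glueHalf σ).injective (H.inj e))
  neg h := (congrArg L (glue_e σ (Sum.inr h))).symm.trans (H.neg _)
  word i := H.onSeg_out i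
  tri := H.tri_out

end Unglue

/-! ### Coefficients of shuffle products -/

/-- The sign depends on the turns only and not on the function. So the same sign can be used for a
diagram and for a part of it, whatever the remaining triples `S`. -/
theorem exists_sign_of_rel {T T' : Multiset (Fin 3 → ℤ)} (h : Multiset.Rel IsTurn T T') :
    ∃ s : ℝ, ∀ {F : List (Fin m × ℤ) → Multiset (Fin 3 → ℤ) → ℝ}, IsCodeFun F → ∀ w S,
      F w (T' + S) = s * F w (T + S) := by
  induction h with
  | zero => exact ⟨1, fun _ _ _ => (one_mul _).symm⟩
  | @cons a b as bs hab _ ih =>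
    obtain ⟨s, hs⟩ := ih
    obtain ⟨π, rfl⟩ := hab
    refine ⟨((Equiv.Perm.sign π : ℤ) : ℝ) * s, fun {F} hF w S => ?_⟩
    rw [Multiset.cons_add, hF.turn, ← Multiset.add_cons, hs hF, Multiset.add_cons,
      Multiset.cons_add, mul_assoc]

open Classical in
/-- The closed sets of labels of a code. -/
def closedSets (w : List (Fin m × ℤ)) (T : Multiset (Fin 3 → ℤ)) : Finset (Finset ℤ) :=
  (lab (w : Multiset (Fin m × ℤ)) T).toFinset.powerset.filter
    (IsClosedSet (w : Multiset (Fin m × ℤ)) T)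

theorem mem_closedSets {w : List (Fin m × ℤ)} {T : Multiset (Fin 3 → ℤ)} {P : Finset ℤ} :
    P ∈ closedSets w T ↔ IsClosedSet (w : Multiset (Fin m × ℤ)) T P := by
  classical
  rw [closedSets, Finset.mem_filter, and_iff_right_iff_imp, Finset.mem_powerset]
  intro h x hx
  rw [Multiset.mem_toFinset]
  exact h.sub x hx

theorem evL_diag_self {Γ : Diagram m} (hΓ : Γ.IsHomotopyLink) {w : List (Fin m × ℤ)}
    {T : Multiset (Fin 3 → ℤ)} {ℓ : HalfEdge Γ.q Γ.f → ℤ} (H : Labels Γ w T ℓ) :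
    evL w T (diag Γ) = 1 := by
  rw [evL_of_labels H, coeff_diag, pairing_of_iso hΓ (Iso.refl Γ), Iso.sign_refl]

/-- A nonzero value requires an isomorphism from the diagram of the code to `Γ`. The labels are
transported along it; as it may reorder half-edges, the triples are obtained up to turns only. -/
theorem evL_diag_ne_zero {Γ : Diagram m} {w : List (Fin m × ℤ)} {T : Multiset (Fin 3 → ℤ)}
    (h : evL w T (diag Γ) ≠ 0) : Γ.IsHomotopyLink ∧ ∃ T' ℓ, Labels Γ w T' ℓ ∧
      Multiset.Rel IsTurn T T' := by
  have hv : Valid (w : Multiset (Fin m × ℤ)) T := by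
    by_contra hv
    rw [evL_apply, ev_of_not_valid hv] at h
    exact h rfl
  obtain ⟨Γ₀, ℓ₀, H₀⟩ := hv.exists_labels
  rw [evL_of_labels H₀, coeff_diag] at h
  obtain ⟨hΓ, ⟨φ⟩⟩ := pairing_ne_zero h
  obtain ⟨T', H', hT', -⟩ := H₀.transport φ
  exact ⟨hΓ, T', _, H', hT'⟩

/-- The code `(w, T)` is, up to turning triples, a code of `glue Γ₁ Γ₂ σ` such that `P` is the set of
labels of `Γ₁`. -/
def IsGlueOf {Γ₁ Γ₂ : Diagram m} (w : List (Fin m × ℤ)) (T : Multiset (Fin 3 → ℤ))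
    (σ : Shuffle Γ₁.q Γ₂.q) (P : Finset ℤ) : Prop :=
  ∃ T' L, Labels (glue Γ₁ Γ₂ σ) w T' L ∧ Multiset.Rel IsTurn T T' ∧ P = partLabels σ L

section

variable {Γ₁ Γ₂ : Diagram m} {w : List (Fin m × ℤ)} {T : Multiset (Fin 3 → ℤ)}
  {σ σ' : Shuffle Γ₁.q Γ₂.q} {P P' : Finset ℤ}

theorem IsGlueOf.isClosedSet (h : IsGlueOf w T σ P) :
    IsClosedSet (w : Multiset (Fin m × ℤ)) T P := by
  obtain ⟨T', L, H, hT, rfl⟩ := h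
  exact H.isClosedSet_partLabels.of_rel (rel_turn_symm hT)

/-- At the code without turns all three values are `1`. The turns of the triples in `P` and of those
outside contribute independent signs, and their product is the sign for the glued diagram. -/
theorem IsGlueOf.evL_eq (h : IsGlueOf w T σ P) (h₁ : Γ₁.IsHomotopyLink) (h₂ : Γ₂.IsHomotopyLink) :
    evL w T (diag (glue Γ₁ Γ₂ σ)) = evL (inWord P w) (inTri P T) (diag Γ₁) *
      evL (outWord P w) (outTri P T) (diag Γ₂) := by
  have hP := h.isClosedSet
  obtain ⟨T', L, H, hT, rfl⟩ := h
  obtain ⟨s₁, hs₁⟩ := exists_sign_of_rel (m := m) (hP.rel_inTri hT)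
  obtain ⟨s₂, hs₂⟩ := exists_sign_of_rel (m := m) (hP.rel_outTri hT)
  have e₁ := hs₁ (isCodeFun_evL (diag Γ₁)) (inWord (partLabels σ L) w) 0
  have e₂ := hs₂ (isCodeFun_evL (diag Γ₂)) (outWord (partLabels σ L) w) 0
  rw [add_zero, add_zero, evL_diag_self h₁ H.unglue_left] at e₁
  rw [add_zero, add_zero, evL_diag_self h₂ H.unglue_right] at e₂
  have e := evL_diag_self (isHomotopyLink_glue σ h₁ h₂) H
  rw [← inTri_add_outTri (partLabels σ L) T', hs₁ (isCodeFun_evL _), add_comm (inTri _ _),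
    hs₂ (isCodeFun_evL _), add_comm (outTri _ _), inTri_add_outTri] at e
  have n₁ : s₁ ≠ 0 := fun h0 => by simp [h0] at e₁
  have n₂ : s₂ ≠ 0 := fun h0 => by simp [h0] at e₂
  apply mul_left_cancel₀ n₁
  apply mul_left_cancel₀ n₂
  linear_combination e + s₂ * evL (outWord (partLabels σ L) w) (outTri (partLabels σ L) T) (diag Γ₂) * e₁ + e₂

/-- The isomorphism from the diagram of the code to the glued diagram is unique, hence so are the
labels of the glued diagram and of its first part. This is where the absence of automorphisms
excludes multiplicities. -/
theorem IsGlueOf.set_unique (h : IsGlueOf w T σ P) (h' : IsGlueOf w T σ P')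
    (hv : Valid (w : Multiset (Fin m × ℤ)) T) (h₁ : Γ₁.IsHomotopyLink) (h₂ : Γ₂.IsHomotopyLink) :
    P = P' := by
  obtain ⟨T₁, L, H, hT, rfl⟩ := h
  obtain ⟨T₂, L', H', hT', rfl⟩ := h'
  obtain ⟨Γ₀, ℓ₀, H₀⟩ := hv.exists_labels
  obtain ⟨φ, hφ⟩ := H₀.exists_iso_of_rel H hT
  obtain ⟨φ', hφ'⟩ := H₀.exists_iso_of_rel H' hT'
  obtain rfl := ((isHomotopyLink_glue σ h₁ h₂).of_iso φ).iso_unique φ φ'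
  have : L = L' := by
    funext h
    obtain ⟨h, rfl⟩ := φ.halfEquiv.surjective h
    rw [hφ, hφ']
  rw [this]

theorem IsGlueOf.shuffle_unique (h : IsGlueOf w T σ P) (h' : IsGlueOf w T σ' P) : σ = σ' := by
  obtain ⟨T₁, L, H, hT, rfl⟩ := h
  obtain ⟨T₂, L', H', hT', e⟩ := h'
  refine H.merges.unique (e ▸ H'.merges) (fun i => ?_) fun i => H.card_word i
  rw [H.word]
  exact List.nodup_ofFn.2 (H.inj.comp fun a b hab => by simpa using hab)

theorem exists_isGlueOf_of_shuffle (h : evL w T (diag (glue Γ₁ Γ₂ σ)) ≠ 0) :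
    ∃ P, IsGlueOf w T σ P := by
  obtain ⟨-, T', L, H, hT⟩ := evL_diag_ne_zero h
  exact ⟨_, T', L, H, hT, rfl⟩

/-- Both parts are recognized up to isomorphism as `Γ₁` and `Γ₂`, and the word `w` itself tells how
to shuffle their legs. -/
theorem exists_isGlueOf_of_set
    (hP : IsClosedSet (w : Multiset (Fin m × ℤ)) T P)
    (h₁ : evL (inWord P w) (inTri P T) (diag Γ₁) ≠ 0)
    (h₂ : evL (outWord P w) (outTri P T) (diag Γ₂) ≠ 0) :
    ∃ σ : Shuffle Γ₁.q Γ₂.q, IsGlueOf w T σ P := by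
  obtain ⟨-, T₁, ℓ₁, H₁, hT₁⟩ := evL_diag_ne_zero h₁
  obtain ⟨-, T₂, ℓ₂, H₂, hT₂⟩ := evL_diag_ne_zero h₂
  obtain ⟨σ, hσ⟩ := exists_merges (w := w) (P := P) H₁.card_word H₂.card_word
  have m₁ : ∀ {x}, (∃ h, ℓ₁ h = x) ↔ x ∈ P := fun {x} => by
    rw [← H₁.mem_lab_iff, ← lab_rel hT₁, mem_lab_in hP]
  have m₂ : ∀ h, ℓ₂ h ∉ P := fun h => by
    have : ℓ₂ h ∈ lab (outWord P w : Multiset (Fin m × ℤ)) T₂ := H₂.mem_lab_iff.2 ⟨h, rfl⟩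
    rw [← lab_rel hT₂, mem_lab_out hP] at this
    exact this.2
  have hlen : ∀ i, (onSeg w i).length = Γ₁.q i + Γ₂.q i := fun i => by
    rw [← H₁.card_word, ← H₂.card_word, onSeg_inWord, onSeg_outWord]
    have := List.length_eq_length_filter_add (l := onSeg w i) (fun x => decide (x ∈ P))
    rw [this]
    congr 2
    exact List.filter_congr fun x _ => by simp
  refine ⟨σ, T₁ + T₂, glueLabel σ ℓ₁ ℓ₂, H₁.glued H₂ hσ hlen fun h h' e => ?_, ?_, ?_⟩
  · exact m₂ h' (e ▸ m₁.1 ⟨h, rfl⟩)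
  · rw [← inTri_add_outTri P T]
    exact hT₁.add hT₂
  · ext x
    rw [← m₁, partLabels, Finset.mem_image]
    simp only [glueLabel_glueHalf, Sum.elim_inl, Finset.mem_univ, true_and]

end

/-- The comultiplication formula: the value of a shuffle product at a code is the sum over all the
ways to split the code in two parts. -/
theorem evL_shuffle {w : List (Fin m × ℤ)} {T : Multiset (Fin 3 → ℤ)}
    (hv : Valid (w : Multiset (Fin m × ℤ)) T) (x y : HT m) :
    evL w T (shuffle m x y) = ∑ P ∈ closedSets w T,
      evL (inWord P w) (inTri P T) x * evL (outWord P w) (outTri P T) y := by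
  classical
  induction x using HT_induction with
  | ha x x' hx hx' => simp only [map_add, LinearMap.add_apply, add_mul, Finset.sum_add_distrib, hx, hx']
  | hs r x hx =>
    simp only [map_smul, LinearMap.smul_apply, smul_eq_mul, mul_assoc, ← Finset.mul_sum, hx]
  | hd Γ₁ =>
  induction y using HT_induction with
  | ha x x' hx hx' => simp only [map_add, mul_add, Finset.sum_add_distrib, hx, hx']
  | hs r x hx =>
    simp only [map_smul, smul_eq_mul, mul_left_comm _ r, ← Finset.mul_sum, hx]
  | hd Γ₂ =>
  rw [shuffle_diag]
  by_cases hΓ : Γ₁.IsHomotopyLink ∧ Γ₂.IsHomotopyLink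
  swap
  · rw [shuffleDiag_eq_zero hΓ, map_zero, Finset.sum_eq_zero]
    intro P _
    by_cases h₁ : Γ₁.IsHomotopyLink
    · rw [diag_eq_zero fun h₂ => hΓ ⟨h₁, h₂⟩, map_zero, mul_zero]
    · rw [diag_eq_zero h₁, map_zero, zero_mul]
  obtain ⟨h₁, h₂⟩ := hΓ
  have : Fintype (Shuffle Γ₁.q Γ₂.q) := Fintype.ofFinite _
  rw [shuffleDiag, finsum_eq_sum_of_fintype, map_sum]
  symm
  have key : ∀ P ∈ closedSets w T, evL (inWord P w) (inTri P T) (diag Γ₁) *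
      evL (outWord P w) (outTri P T) (diag Γ₂) ≠ 0 →
      ∃ σ : Shuffle Γ₁.q Γ₂.q, IsGlueOf w T σ P := fun P hP h =>
    exists_isGlueOf_of_set (mem_closedSets.1 hP) (left_ne_zero_of_mul h) (right_ne_zero_of_mul h)
  choose f hf using key
  -- The nonzero terms correspond bijectively: a closed set determines the shuffle, and a shuffle
  -- determines the set of labels of the first part.
  refine Finset.sum_bij_ne_zero (fun P hP h => f P hP h) (fun _ _ _ => Finset.mem_univ _) ?_ ?_ ?_
  · intro P hP h P' hP' h' e
    have := hf P hP h
    rw [e] at this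
    exact this.set_unique (hf P' hP' h') hv h₁ h₂
  · intro σ _ hσ
    obtain ⟨P, hP⟩ := exists_isGlueOf_of_shuffle hσ
    rw [hP.evL_eq h₁ h₂] at hσ
    exact ⟨P, mem_closedSets.2 hP.isClosedSet, hσ, (hf P _ hσ).shuffle_unique hP⟩
  · intro P hP h
    exact ((hf P hP h).evL_eq h₁ h₂).symm

/-! ### Connected diagrams -/

/-- Every nonempty set of half-edges that is closed under passing to the other end of an edge and
under passing to another half-edge at the same free vertex contains all half-edges. -/
structure Diagram.Conn (Γ : Diagram m) : Prop where
  nonempty : Nonempty (HalfEdge Γ.q Γ.f)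
  eq_univ : ∀ Q : Set (HalfEdge Γ.q Γ.f), (∀ h ∈ Q, Γ.e h ∈ Q) →
    (∀ v c c', Γ.half v c ∈ Q → Γ.half v c' ∈ Q) → Q.Nonempty → ∀ h, h ∈ Q

theorem exists_vert_eq {q : Fin m → ℕ} {f : ℕ} (v : Vertex q f) :
    ∃ h : HalfEdge q f, vert h = v := by
  rcases v with s | v
  · exact ⟨Sum.inl s, rfl⟩
  · exact ⟨Sum.inr (v, 0), rfl⟩

/-- The formulation with half-edges matches closed sets of labels and is easy to follow through a
regluing of edges. -/
theorem conn_iff {Γ : Diagram m} : Γ.Conn ↔ Γ.graph.Connected := by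
  constructor
  · intro H
    have hne : Nonempty (Vertex Γ.q Γ.f) := H.nonempty.map vert
    refine ⟨fun u v => ?_⟩
    obtain ⟨h₀, rfl⟩ := exists_vert_eq u
    obtain ⟨h, rfl⟩ := exists_vert_eq v
    refine H.eq_univ {h | Γ.graph.Reachable (vert h₀) (vert h)} (fun h hh => ?_)
      (fun v c c' hh => hh) ⟨h₀, SimpleGraph.Reachable.refl _⟩ h
    by_cases he : vert h = vert (Γ.e h)
    · have : Γ.graph.Reachable (vert h₀) (vert h) := hh
      rwa [he] at this
    · exact SimpleGraph.Reachable.trans hh (SimpleGraph.Adj.reachable ⟨he, h, rfl, rfl⟩)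
  · intro H
    obtain ⟨v₀⟩ := H.nonempty
    obtain ⟨h₀, -⟩ := exists_vert_eq v₀
    refine ⟨⟨h₀⟩, fun Q he hv ⟨h₁, h₁Q⟩ h => ?_⟩
    have key : ∀ u v, Γ.graph.Walk u v → (∀ h, vert h = u → h ∈ Q) → ∀ h, vert h = v → h ∈ Q := by
      intro u v W
      induction W with
      | nil => exact id
      | cons hadj _ ih =>
        intro hu
        refine ih ?_
        obtain ⟨-, h', h1, h2⟩ := hadj
        have h3 := he h' (hu h' h1)
        intro h'' h4
        rw [← h2] at h4
        generalize Γ.e h' = g at h3 h4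
        rcases g with s | ⟨v, c⟩ <;> rcases h'' with s' | ⟨v', c'⟩ <;> simp [vert] at h4
        · exact h4 ▸ h3
        · exact h4 ▸ hv v c c' h3
    obtain ⟨W⟩ := H.preconnected (vert h₁) (vert h)
    refine key _ _ W (fun h' h4 => ?_) h rfl
    rcases h₁ with s | ⟨v, c⟩ <;> rcases h' with s' | ⟨v', c'⟩ <;> simp [vert] at h4
    · exact h4 ▸ h₁Q
    · exact h4 ▸ hv v c c' h₁Q

/-! ### Components of a code -/

/-- The minimal nonempty closed sets of labels. -/
structure IsComp (W : Multiset (Fin m × ℤ)) (T : Multiset (Fin 3 → ℤ)) (P : Finset ℤ) : Prop where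
  closed : IsClosedSet W T P
  nonempty : P.Nonempty
  eq_of_subset : ∀ Q, IsClosedSet W T Q → Q ⊆ P → Q.Nonempty → Q = P

theorem IsClosedSet.inter {W : Multiset (Fin m × ℤ)} {T : Multiset (Fin 3 → ℤ)} {P Q : Finset ℤ}
    (hP : IsClosedSet W T P) (hQ : IsClosedSet W T Q) : IsClosedSet W T (P ∩ Q) := by
  refine ⟨fun x hx => hP.sub x (Finset.mem_of_mem_inter_left hx), fun x hx => ?_, fun τ hτ c => ?_⟩
  · rw [Finset.mem_inter] at hx ⊢
    exact ⟨hP.neg x hx.1, hQ.neg x hx.2⟩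
  · rw [Finset.mem_inter, Finset.mem_inter, hP.tri τ hτ, hQ.tri τ hτ]

theorem IsClosedSet.sdiff {W : Multiset (Fin m × ℤ)} {T : Multiset (Fin 3 → ℤ)} {P Q : Finset ℤ}
    (hP : IsClosedSet W T P) (hQ : IsClosedSet W T Q) : IsClosedSet W T (P \ Q) := by
  refine ⟨fun x hx => hP.sub x (Finset.mem_sdiff.1 hx).1, fun x hx => ?_, fun τ hτ c => ?_⟩
  · rw [Finset.mem_sdiff] at hx ⊢
    exact ⟨hP.neg x hx.1, fun h => hx.2 (by simpa using hQ.neg _ h)⟩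
  · rw [Finset.mem_sdiff, Finset.mem_sdiff, hP.tri τ hτ, hQ.tri τ hτ]

theorem IsComp.disjoint {W : Multiset (Fin m × ℤ)} {T : Multiset (Fin 3 → ℤ)} {P Q : Finset ℤ}
    (hP : IsComp W T P) (hQ : IsComp W T Q) (h : P ≠ Q) : Disjoint P Q := by
  rw [Finset.disjoint_iff_inter_eq_empty, ← Finset.not_nonempty_iff_eq_empty]
  intro hne
  have hc := hP.closed.inter hQ.closed
  exact h ((hP.eq_of_subset _ hc Finset.inter_subset_left hne).symm.trans
    (hQ.eq_of_subset _ hc Finset.inter_subset_right hne))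

/-- A closed set with `x` of least cardinality is minimal: if `Q` is a smaller nonempty closed set,
then `Q` or its complement in `P` is a smaller closed set with `x`. -/
theorem Valid.exists_comp {W : Multiset (Fin m × ℤ)} {T : Multiset (Fin 3 → ℤ)} (hv : Valid W T)
    {x : ℤ} (hx : x ∈ lab W T) : ∃ P, IsComp W T P ∧ x ∈ P := by
  classical
  have hfull : IsClosedSet W T (lab W T).toFinset := by
    refine ⟨fun y hy => Multiset.mem_toFinset.1 hy, fun y hy => ?_, fun τ hτ c => ?_⟩
    · rw [Multiset.mem_toFinset] at hy ⊢
      exact hv.neg y hy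
    · rw [Multiset.mem_toFinset, Multiset.mem_toFinset, mem_lab, mem_lab]
      exact iff_of_true (Or.inr ⟨τ, hτ, c, rfl⟩) (Or.inr ⟨τ, hτ, 0, rfl⟩)
  obtain ⟨P, ⟨hP, hxP⟩, hmin⟩ := WellFounded.has_min (measure (Finset.card (α := ℤ))).wf
    {P : Finset ℤ | IsClosedSet W T P ∧ x ∈ P} ⟨_, hfull, Multiset.mem_toFinset.2 hx⟩
  refine ⟨P, ⟨hP, ⟨x, hxP⟩, fun Q hQ hQP hne => ?_⟩, hxP⟩
  by_cases hxQ : x ∈ Q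
  · exact Finset.eq_of_subset_of_card_le hQP (not_lt.1 (hmin Q ⟨hQ, hxQ⟩))
  · refine absurd ?_ (hmin (P \ Q) ⟨hP.sdiff hQ, Finset.mem_sdiff.2 ⟨hxP, hxQ⟩⟩)
    exact Finset.card_lt_card (Finset.sdiff_ssubset hQP hne)

section

variable {w : List (Fin m × ℤ)} {T : Multiset (Fin 3 → ℤ)} {P Q : Finset ℤ}

theorem isClosedSet_in (hP : IsClosedSet (w : Multiset (Fin m × ℤ)) T P) :
    IsClosedSet (inWord P w : Multiset (Fin m × ℤ)) (inTri P T) Q ↔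
      IsClosedSet (w : Multiset (Fin m × ℤ)) T Q ∧ Q ⊆ P := by
  constructor
  · intro h
    have hQP : Q ⊆ P := fun x hx => (mem_lab_in hP).1 (h.sub x hx)
    refine ⟨⟨fun x hx => hP.sub x (hQP hx), h.neg, fun τ hτ c => ?_⟩, hQP⟩
    by_cases h0 : τ 0 ∈ P
    · exact h.tri τ (Multiset.mem_filter.2 ⟨hτ, h0⟩) c
    · exact iff_of_false (fun hc => h0 ((hP.tri τ hτ c).1 (hQP hc))) fun hc => h0 (hQP hc)
  · rintro ⟨h, hQP⟩
    exact ⟨fun x hx => (mem_lab_in hP).2 (hQP hx), h.neg,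
      fun τ hτ c => h.tri τ (Multiset.mem_of_mem_filter hτ) c⟩

theorem isClosedSet_out (hP : IsClosedSet (w : Multiset (Fin m × ℤ)) T P) :
    IsClosedSet (outWord P w : Multiset (Fin m × ℤ)) (outTri P T) Q ↔
      IsClosedSet (w : Multiset (Fin m × ℤ)) T Q ∧ Disjoint Q P := by
  constructor
  · intro h
    have hQ : ∀ x ∈ Q, x ∉ P := fun x hx => ((mem_lab_out hP).1 (h.sub x hx)).2
    refine ⟨⟨fun x hx => ((mem_lab_out hP).1 (h.sub x hx)).1, h.neg, fun τ hτ c => ?_⟩,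
      Finset.disjoint_left.2 hQ⟩
    by_cases h0 : τ 0 ∈ P
    · exact iff_of_false (fun hc => hQ _ hc ((hP.tri τ hτ c).2 h0)) fun hc => hQ _ hc h0
    · exact h.tri τ (Multiset.mem_filter.2 ⟨hτ, h0⟩) c
  · rintro ⟨h, hQP⟩
    exact ⟨fun x hx => (mem_lab_out hP).2 ⟨h.sub x hx, Finset.disjoint_left.1 hQP hx⟩, h.neg,
      fun τ hτ c => h.tri τ (Multiset.mem_of_mem_filter hτ) c⟩

/-- Distinct components are disjoint, so removing one of them leaves the others unchanged. -/
theorem isComp_out (hP : IsComp (w : Multiset (Fin m × ℤ)) T P) :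
    IsComp (outWord P w : Multiset (Fin m × ℤ)) (outTri P T) Q ↔
      Q ≠ P ∧ IsComp (w : Multiset (Fin m × ℤ)) T Q := by
  constructor
  · rintro ⟨h1, h2, h3⟩
    rw [isClosedSet_out hP.closed] at h1
    refine ⟨?_, h1.1, h2, fun Q' hQ' hs hne => h3 Q' ?_ hs hne⟩
    · rintro rfl
      exact h2.ne_empty (disjoint_self.1 h1.2)
    · exact (isClosedSet_out hP.closed).2 ⟨hQ', h1.2.mono_left hs⟩
  · rintro ⟨hne, hQ⟩
    exact ⟨(isClosedSet_out hP.closed).2 ⟨hQ.closed, hQ.disjoint hP hne⟩, hQ.nonempty,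
      fun Q' hQ' => hQ.eq_of_subset Q' ((isClosedSet_out hP.closed).1 hQ').1⟩

theorem inWord_outWord (h : Disjoint Q P) : inWord Q (outWord P w) = inWord Q w := by
  rw [inWord, outWord, List.filter_filter, inWord]
  refine List.filter_congr fun x _ => ?_
  by_cases hx : x.2 ∈ Q
  · simp [hx, Finset.disjoint_left.1 h hx]
  · simp [hx]

theorem inTri_outTri (h : Disjoint Q P) : inTri Q (outTri P T) = inTri Q T := by
  rw [inTri, outTri, Multiset.filter_filter, inTri]
  refine Multiset.filter_congr fun x _ => ?_
  exact and_iff_left_of_imp fun hx => Finset.disjoint_left.1 h hx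

/-- A closed subset of `P` pulls back to a set of half-edges closed under passing along edges and
around free vertices, so it is everything if it is not empty. -/
theorem isComp_of_conn (hP : IsClosedSet (w : Multiset (Fin m × ℤ)) T P) {Γ : Diagram m}
    {T' : Multiset (Fin 3 → ℤ)} {ℓ : HalfEdge Γ.q Γ.f → ℤ} (H : Labels Γ (inWord P w) T' ℓ)
    (hT : Multiset.Rel IsTurn (inTri P T) T') (hΓ : Γ.Conn) :
    IsComp (w : Multiset (Fin m × ℤ)) T P := by
  have hmem : ∀ {x}, x ∈ P ↔ ∃ h, ℓ h = x := fun {x} => by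
    rw [← H.mem_lab_iff, ← lab_rel hT, mem_lab_in hP]
  obtain ⟨h₀⟩ := hΓ.nonempty
  refine ⟨hP, ⟨ℓ h₀, hmem.2 ⟨h₀, rfl⟩⟩, fun Q hQ hQP hne => ?_⟩
  have hQ' := ((isClosedSet_in hP).2 ⟨hQ, hQP⟩).of_rel hT
  have hall := hΓ.eq_univ {h | ℓ h ∈ Q} (fun h hh => ?_) (fun v c c' hh => ?_) ?_
  · refine Finset.Subset.antisymm hQP fun x hx => ?_
    obtain ⟨h, rfl⟩ := hmem.1 hx
    exact hall h
  · change ℓ (Γ.e h) ∈ Q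
    rw [H.neg]
    exact hQ.neg _ hh
  · have hτ := H.half_mem v
    exact (hQ'.tri _ hτ c').2 ((hQ'.tri _ hτ c).1 hh)
  · obtain ⟨x, hx⟩ := hne
    obtain ⟨h, rfl⟩ := hmem.1 (hQP hx)
    exact ⟨h, hx⟩

open Classical in
/-- The finite set of components of a code. -/
def comps (w : List (Fin m × ℤ)) (T : Multiset (Fin 3 → ℤ)) : Finset (Finset ℤ) :=
  (closedSets w T).filter (IsComp (w : Multiset (Fin m × ℤ)) T)

theorem mem_comps : P ∈ comps w T ↔ IsComp (w : Multiset (Fin m × ℤ)) T P := by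
  classical
  rw [comps, Finset.mem_filter, and_iff_right_iff_imp, mem_closedSets]
  exact fun h => h.closed

theorem comps_out (hP : P ∈ comps w T) :
    comps (outWord P w) (outTri P T) = (comps w T).erase P := by
  ext Q
  rw [mem_comps, isComp_out (mem_comps.1 hP), Finset.mem_erase, mem_comps]

end

/-! ### Shuffle products of trees -/

/-- The sum over all bijections from the members of a list of functions to a finite set of the
products of the values. -/
def matchSum {B : Type*} [DecidableEq B] : List (B → ℝ) → Finset B → ℝ
  | [], s => if s = ∅ then 1 else 0
  | f :: fs, s => ∑ b ∈ s, f b * matchSum fs (s.erase b)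

theorem matchSum_congr {B ι : Type*} [DecidableEq B] (xs : List ι) {F G : ι → B → ℝ} {s : Finset B}
    (h : ∀ x ∈ xs, ∀ b ∈ s, F x b = G x b) : matchSum (xs.map F) s = matchSum (xs.map G) s := by
  induction xs generalizing s with
  | nil => rfl
  | cons x xs ih =>
    rw [List.map_cons, List.map_cons, matchSum, matchSum]
    refine Finset.sum_congr rfl fun b hb => ?_
    rw [h x List.mem_cons_self b hb, ih fun y hy c hc =>
      h y (List.mem_cons_of_mem _ hy) c (Finset.mem_of_mem_erase hc)]

/-- Only connected diagrams occur in `x`. Therefore only components contribute as the first part in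
the comultiplication formula for a product with first factor `x`. -/
theorem evL_eq_zero_of_not_isComp {w : List (Fin m × ℤ)} {T : Multiset (Fin 3 → ℤ)} {P : Finset ℤ}
    (hP : IsClosedSet (w : Multiset (Fin m × ℤ)) T P)
    (h : ¬ IsComp (w : Multiset (Fin m × ℤ)) T P) {I : Finset (Fin m)} {x : HT m}
    (hx : x ∈ treeSpace I) : evL (inWord P w) (inTri P T) x = 0 := by
  have : treeSpace I ≤ LinearMap.ker (evL (inWord P w) (inTri P T)) := by
    rw [treeSpace, Submodule.span_le]
    rintro _ ⟨Γ, -, hc, -, rfl⟩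
    rw [SetLike.mem_coe, LinearMap.mem_ker]
    by_contra h0
    obtain ⟨-, T', ℓ, H, hT⟩ := evL_diag_ne_zero h0
    exact h (isComp_of_conn hP H hT (conn_iff.2 hc))
  exact this hx

theorem isHomotopyLink_empty : (empty m).IsHomotopyLink where
  no_loop h := absurd rfl ((empty m).e_ne h)
  no_multi h := absurd rfl ((empty m).e_ne h)
  acyclic v := by
    obtain ⟨h, -⟩ := exists_vert_eq v
    exact absurd rfl ((empty m).e_ne h)
  attached v := by
    obtain ⟨h, -⟩ := exists_vert_eq v
    exact absurd rfl ((empty m).e_ne h)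
  distinct i p := p.elim0

theorem evL_empty {w : List (Fin m × ℤ)} {T : Multiset (Fin 3 → ℤ)}
    (hv : Valid (w : Multiset (Fin m × ℤ)) T) :
    evL w T (diag (empty m)) = if comps w T = ∅ then 1 else 0 := by
  split_ifs with hc
  · have hl : lab (w : Multiset (Fin m × ℤ)) T = 0 := by
      refine Multiset.eq_zero_of_forall_notMem fun x hx => ?_
      obtain ⟨P, hP, -⟩ := hv.exists_comp hx
      rw [← mem_comps, hc] at hP
      exact absurd hP (Finset.notMem_empty _)
    have hw : w = [] := by
      refine List.eq_nil_iff_forall_not_mem.2 fun x hx => ?_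
      have : x.2 ∈ lab (w : Multiset (Fin m × ℤ)) T := mem_lab.2 (Or.inl ⟨x.1, hx⟩)
      rw [hl] at this
      exact absurd this (Multiset.notMem_zero _)
    have hT : T = 0 := by
      refine Multiset.eq_zero_of_forall_notMem fun τ hτ => ?_
      have : τ 0 ∈ lab (w : Multiset (Fin m × ℤ)) T := mem_lab.2 (Or.inr ⟨τ, hτ, 0, rfl⟩)
      rw [hl] at this
      exact absurd this (Multiset.notMem_zero _)
    subst hw hT
    refine evL_diag_self isHomotopyLink_empty (ℓ := fun _ => 0) ⟨fun h => ?_, fun h => ?_, ?_, ?_⟩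
    · exact absurd rfl ((empty m).e_ne h)
    · exact absurd rfl ((empty m).e_ne h)
    · exact fun i => rfl
    · rfl
  · by_contra h0
    obtain ⟨-, T', ℓ, H, hT⟩ := evL_diag_ne_zero h0
    obtain ⟨P, hP⟩ := Finset.nonempty_iff_ne_empty.2 hc
    rw [mem_comps] at hP
    obtain ⟨x, hx⟩ := hP.nonempty
    have := hP.closed.sub x hx
    rw [lab_rel hT, H.mem_lab_iff] at this
    obtain ⟨h, -⟩ := this
    exact absurd rfl ((empty m).e_ne h)

/-- The values of shuffle products of trees. -/
theorem evL_shuffleProd {w : List (Fin m × ℤ)} {T : Multiset (Fin 3 → ℤ)}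
    (hv : Valid (w : Multiset (Fin m × ℤ)) T) (xs : List (HT m))
    (hxs : ∀ x ∈ xs, ∃ I, x ∈ treeSpace I) :
    evL w T (shuffleProd xs) =
      matchSum (xs.map fun x P => evL (inWord P w) (inTri P T) x) (comps w T) := by
  induction xs generalizing w T with
  | nil => exact evL_empty hv
  | cons x xs ih =>
    rw [List.map_cons, matchSum]
    change evL w T (shuffle m x (shuffleProd xs)) = _
    rw [evL_shuffle hv]
    obtain ⟨I, hx⟩ := hxs x List.mem_cons_self
    symm
    refine Finset.sum_subset_zero_on_sdiff
      (fun P hP => mem_closedSets.2 (mem_comps.1 hP).closed) (fun P hP => ?_) fun P hP => ?_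
    · rw [Finset.mem_sdiff, mem_closedSets, mem_comps] at hP
      rw [evL_eq_zero_of_not_isComp hP.1 hP.2 hx, zero_mul]
    · have hP' := mem_comps.1 hP
      -- The parts of the code at the remaining components are the same before and after removal of
      -- `P`.
      rw [ih (hv.outCode hP'.closed) fun y hy => hxs y (List.mem_cons_of_mem _ hy), comps_out hP]
      congr 1
      refine matchSum_congr xs fun y _ Q hQ => ?_
      rw [Finset.mem_erase, mem_comps] at hQ
      have hd := hQ.2.disjoint hP' hQ.1
      rw [inWord_outWord hd, inTri_outTri hd]

/-! ### Symmetry of shuffle products of trees -/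

theorem Diagram.IsHomotopyLink.q_le_one {Γ : Diagram m} (H : Γ.IsHomotopyLink) (hc : Γ.Conn)
    (i : Fin m) : Γ.q i ≤ 1 := by
  by_contra h
  rw [not_le] at h
  have := H.distinct i ⟨0, by omega⟩ ⟨1, h⟩ ((conn_iff.1 hc).preconnected _ _)
  simp at this

theorem onSeg_eq_of_perm {w w' : List (Fin m × ℤ)} (h : w.Perm w') {i : Fin m}
    (hi : (onSeg w i).length ≤ 1) : onSeg w i = onSeg w' i := by
  have hp := onSeg_perm h i
  generalize onSeg w i = l at hp hi
  rcases l with _ | ⟨x, _ | ⟨y, l⟩⟩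
  · exact hp.nil_eq
  · exact (List.perm_singleton.1 hp.symm).symm
  · simp at hi

theorem evL_not_valid {w : List (Fin m × ℤ)} {T : Multiset (Fin 3 → ℤ)}
    (h : ¬ Valid (w : Multiset (Fin m × ℤ)) T) (x : HT m) : evL w T x = 0 := by
  rw [evL_apply, ev_of_not_valid h]

/-- A tree has at most one leg on each segment, so there is no order of legs to be changed. -/
theorem evL_tree_perm {w w' : List (Fin m × ℤ)} {T : Multiset (Fin 3 → ℤ)} (h : w.Perm w')
    {I : Finset (Fin m)} {x : HT m} (hx : x ∈ treeSpace I) : evL w T x = evL w' T x := by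
  have key : ∀ {w w' : List (Fin m × ℤ)}, w.Perm w' → ∀ Γ : Diagram m, Γ.Conn →
      evL w T (diag Γ) ≠ 0 → evL w T (diag Γ) = evL w' T (diag Γ) := by
    intro w w' h Γ hc h0
    obtain ⟨hΓ, T', ℓ, H, -⟩ := evL_diag_ne_zero h0
    refine (isCodeFun_evL (diag Γ)).word fun i => onSeg_eq_of_perm h ?_
    rw [H.card_word]
    exact hΓ.q_le_one hc i
  have : treeSpace I ≤ LinearMap.ker (evL w T - evL w' T) := by
    rw [treeSpace, Submodule.span_le]
    rintro _ ⟨Γ, -, hc, -, rfl⟩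
    rw [SetLike.mem_coe, LinearMap.mem_ker, LinearMap.sub_apply, sub_eq_zero]
    by_cases h1 : evL w T (diag Γ) = 0
    · by_cases h2 : evL w' T (diag Γ) = 0
      · rw [h1, h2]
      · exact (key h.symm Γ (conn_iff.2 hc) h2).symm
    · exact key h Γ (conn_iff.2 hc) h1
  have := this hx
  rwa [LinearMap.mem_ker, LinearMap.sub_apply, sub_eq_zero] at this

/-- The components depend only on the multiset of letters, and each factor is evaluated at one
component, where the order is irrelevant by `evL_tree_perm`. -/
theorem evL_shuffleProd_perm {w w' : List (Fin m × ℤ)} {T : Multiset (Fin 3 → ℤ)} (h : w.Perm w')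
    (xs : List (HT m)) (hxs : ∀ x ∈ xs, ∃ I, x ∈ treeSpace I) :
    evL w T (shuffleProd xs) = evL w' T (shuffleProd xs) := by
  have hW : (w : Multiset (Fin m × ℤ)) = w' := Multiset.coe_eq_coe.2 h
  by_cases hv : Valid (w : Multiset (Fin m × ℤ)) T
  · have hv' : Valid (w' : Multiset (Fin m × ℤ)) T := hW ▸ hv
    have hc : comps w T = comps w' T := by
      ext P
      rw [mem_comps, mem_comps, hW]
    rw [evL_shuffleProd hv xs hxs, evL_shuffleProd hv' xs hxs, hc]
    refine matchSum_congr xs fun x hx P _ => ?_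
    obtain ⟨I, hI⟩ := hxs x hx
    exact evL_tree_perm (h.filter _) hI
  · rw [evL_not_valid hv, evL_not_valid (hW ▸ hv)]

/-! ### IHX conditions and codes -/

section Ihx

set_option linter.unusedSimpArgs false

variable {Γ : Diagram m} {u v : Fin Γ.f}

/-- The permutation of half-edges that turns `I` into `H`. -/
def permH (Γ : Diagram m) (u v : Fin Γ.f) : Equiv.Perm (HalfEdge Γ.q Γ.f) :=
  List.formPerm [Γ.half u 1, Γ.half v 2, Γ.half v 1, Γ.half u 2]

/-- The permutation of half-edges that turns `I` into `X`. -/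
def permX (Γ : Diagram m) (u v : Fin Γ.f) : Equiv.Perm (HalfEdge Γ.q Γ.f) :=
  List.formPerm [Γ.half u 2, Γ.half v 2, Γ.half v 1]

theorem permH_symm_leg (s) : (permH Γ u v).symm (Sum.inl s) = Sum.inl s := by
  rw [Equiv.symm_apply_eq, permH, List.formPerm_apply_of_notMem]
  simp

theorem permX_symm_leg (s) : (permX Γ u v).symm (Sum.inl s) = Sum.inl s := by
  rw [Equiv.symm_apply_eq, permX, List.formPerm_apply_of_notMem]
  simp

theorem permH_symm_half {t : Fin Γ.f} (hu : t ≠ u) (hv : t ≠ v) (c) :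
    (permH Γ u v).symm (Γ.half t c) = Γ.half t c := by
  rw [Equiv.symm_apply_eq, permH, List.formPerm_apply_of_notMem]
  simp [hu, hv]

theorem permX_symm_half {t : Fin Γ.f} (hu : t ≠ u) (hv : t ≠ v) (c) :
    (permX Γ u v).symm (Γ.half t c) = Γ.half t c := by
  rw [Equiv.symm_apply_eq, permX, List.formPerm_apply_of_notMem]
  simp [hu, hv]

theorem permH_symm_u (huv : u ≠ v) (ℓ : HalfEdge Γ.q Γ.f → ℤ) :
    (fun c => ℓ ((permH Γ u v).symm (Γ.half u c))) =
      ![ℓ (Γ.half u 0), ℓ (Γ.half u 2), ℓ (Γ.half v 1)] := by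
  have h0 : (permH Γ u v).symm (Γ.half u 0) = Γ.half u 0 := by
    rw [Equiv.symm_apply_eq, permH]
    simp [List.formPerm, Equiv.swap_apply_def, huv, huv.symm]
  have h1 : (permH Γ u v).symm (Γ.half u 1) = Γ.half u 2 := by
    rw [Equiv.symm_apply_eq, permH]
    simp [List.formPerm, Equiv.swap_apply_def, huv, huv.symm]
  have h2 : (permH Γ u v).symm (Γ.half u 2) = Γ.half v 1 := by
    rw [Equiv.symm_apply_eq, permH]
    simp [List.formPerm, Equiv.swap_apply_def, huv, huv.symm]
  funext c
  fin_cases c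
  · exact congrArg ℓ h0
  · exact congrArg ℓ h1
  · exact congrArg ℓ h2

theorem permH_symm_v (huv : u ≠ v) (ℓ : HalfEdge Γ.q Γ.f → ℤ) :
    (fun c => ℓ ((permH Γ u v).symm (Γ.half v c))) =
      ![ℓ (Γ.half v 0), ℓ (Γ.half v 2), ℓ (Γ.half u 1)] := by
  have h0 : (permH Γ u v).symm (Γ.half v 0) = Γ.half v 0 := by
    rw [Equiv.symm_apply_eq, permH]
    simp [List.formPerm, Equiv.swap_apply_def, huv, huv.symm]
  have h1 : (permH Γ u v).symm (Γ.half v 1) = Γ.half v 2 := by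
    rw [Equiv.symm_apply_eq, permH]
    simp [List.formPerm, Equiv.swap_apply_def, huv, huv.symm]
  have h2 : (permH Γ u v).symm (Γ.half v 2) = Γ.half u 1 := by
    rw [Equiv.symm_apply_eq, permH]
    simp [List.formPerm, Equiv.swap_apply_def, huv, huv.symm]
  funext c
  fin_cases c
  · exact congrArg ℓ h0
  · exact congrArg ℓ h1
  · exact congrArg ℓ h2

theorem permX_symm_u (huv : u ≠ v) (ℓ : HalfEdge Γ.q Γ.f → ℤ) :
    (fun c => ℓ ((permX Γ u v).symm (Γ.half u c))) =
      ![ℓ (Γ.half u 0), ℓ (Γ.half u 1), ℓ (Γ.half v 1)] := by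
  have h0 : (permX Γ u v).symm (Γ.half u 0) = Γ.half u 0 := by
    rw [Equiv.symm_apply_eq, permX]
    simp [List.formPerm, Equiv.swap_apply_def, huv, huv.symm]
  have h1 : (permX Γ u v).symm (Γ.half u 1) = Γ.half u 1 := by
    rw [Equiv.symm_apply_eq, permX]
    simp [List.formPerm, Equiv.swap_apply_def, huv, huv.symm]
  have h2 : (permX Γ u v).symm (Γ.half u 2) = Γ.half v 1 := by
    rw [Equiv.symm_apply_eq, permX]
    simp [List.formPerm, Equiv.swap_apply_def, huv, huv.symm]
  funext c
  fin_cases c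
  · exact congrArg ℓ h0
  · exact congrArg ℓ h1
  · exact congrArg ℓ h2

theorem permX_symm_v (huv : u ≠ v) (ℓ : HalfEdge Γ.q Γ.f → ℤ) :
    (fun c => ℓ ((permX Γ u v).symm (Γ.half v c))) =
      ![ℓ (Γ.half v 0), ℓ (Γ.half v 2), ℓ (Γ.half u 2)] := by
  have h0 : (permX Γ u v).symm (Γ.half v 0) = Γ.half v 0 := by
    rw [Equiv.symm_apply_eq, permX]
    simp [List.formPerm, Equiv.swap_apply_def, huv, huv.symm]
  have h1 : (permX Γ u v).symm (Γ.half v 1) = Γ.half v 2 := by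
    rw [Equiv.symm_apply_eq, permX]
    simp [List.formPerm, Equiv.swap_apply_def, huv, huv.symm]
  have h2 : (permX Γ u v).symm (Γ.half v 2) = Γ.half u 2 := by
    rw [Equiv.symm_apply_eq, permX]
    simp [List.formPerm, Equiv.swap_apply_def, huv, huv.symm]
  funext c
  fin_cases c
  · exact congrArg ℓ h0
  · exact congrArg ℓ h1
  · exact congrArg ℓ h2

/-- The triples at the free vertices other than `u` and `v`. -/
def restTri (Γ : Diagram m) (u v : Fin Γ.f) (ℓ : HalfEdge Γ.q Γ.f → ℤ) : Multiset (Fin 3 → ℤ) :=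
  ((Finset.univ.erase u).erase v).val.map fun t c => ℓ (Γ.half t c)

theorem map_univ_pair {α β : Type*} [Fintype α] [DecidableEq α] {u v : α} (huv : u ≠ v)
    (g : α → β) : Finset.univ.val.map g =
      g u ::ₘ g v ::ₘ ((Finset.univ.erase u).erase v).val.map g := by
  have h1 : (Finset.univ : Finset α) = insert u (insert v ((Finset.univ.erase u).erase v)) := by
    rw [Finset.insert_erase, Finset.insert_erase (Finset.mem_univ _)]
    exact Finset.mem_erase.2 ⟨huv.symm, Finset.mem_univ _⟩
  conv_lhs => rw [h1]
  rw [Finset.insert_val_of_notMem, Finset.insert_val_of_notMem, Multiset.map_cons,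
    Multiset.map_cons]
  · simp
  · simp [huv]

theorem tri_ihxI (huv : u ≠ v) (ℓ : HalfEdge Γ.q Γ.f → ℤ) :
    (Finset.univ.val.map fun t c => ℓ (Γ.half t c)) =
      ![ℓ (Γ.half u 0), ℓ (Γ.half u 1), ℓ (Γ.half u 2)] ::ₘ
        ![ℓ (Γ.half v 0), ℓ (Γ.half v 1), ℓ (Γ.half v 2)] ::ₘ restTri Γ u v ℓ := by
  rw [map_univ_pair huv]
  congr 1
  · funext c
    fin_cases c <;> rfl
  · congr 1
    funext c
    fin_cases c <;> rfl

theorem tri_ihxH (huv : u ≠ v) (ℓ : HalfEdge Γ.q Γ.f → ℤ) :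
    (Finset.univ.val.map fun t c => ℓ ((permH Γ u v).symm (Γ.half t c))) =
      ![ℓ (Γ.half u 0), ℓ (Γ.half u 2), ℓ (Γ.half v 1)] ::ₘ
        ![ℓ (Γ.half v 0), ℓ (Γ.half v 2), ℓ (Γ.half u 1)] ::ₘ restTri Γ u v ℓ := by
  rw [map_univ_pair huv, permH_symm_u huv, permH_symm_v huv]
  congr 2
  refine Multiset.map_congr rfl fun t ht => funext fun c => ?_
  rw [Finset.mem_val, Finset.mem_erase, Finset.mem_erase] at ht
  rw [permH_symm_half ht.2.1 ht.1]

theorem tri_ihxX (huv : u ≠ v) (ℓ : HalfEdge Γ.q Γ.f → ℤ) :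
    (Finset.univ.val.map fun t c => ℓ ((permX Γ u v).symm (Γ.half t c))) =
      ![ℓ (Γ.half u 0), ℓ (Γ.half u 1), ℓ (Γ.half v 1)] ::ₘ
        ![ℓ (Γ.half v 0), ℓ (Γ.half v 2), ℓ (Γ.half u 2)] ::ₘ restTri Γ u v ℓ := by
  rw [map_univ_pair huv, permX_symm_u huv, permX_symm_v huv]
  congr 2
  refine Multiset.map_congr rfl fun t ht => funext fun c => ?_
  rw [Finset.mem_val, Finset.mem_erase, Finset.mem_erase] at ht
  rw [permX_symm_half ht.2.1 ht.1]

theorem Labels.reglue {w : List (Fin m × ℤ)} {T : Multiset (Fin 3 → ℤ)}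
    {ℓ : HalfEdge Γ.q Γ.f → ℤ} (H : Labels Γ w T ℓ) (π : Equiv.Perm (HalfEdge Γ.q Γ.f))
    (hπ : ∀ s, π.symm (Sum.inl s) = Sum.inl s) :
    Labels (Γ.reglue π) w (Finset.univ.val.map fun t c => ℓ (π.symm (Γ.half t c)))
      (ℓ ∘ π.symm) where
  inj := H.inj.comp π.symm.injective
  neg h := by
    change ℓ (π.symm (π (Γ.e (π.symm h)))) = _
    rw [Equiv.symm_apply_apply, H.neg]
    rfl
  word i := by
    rw [H.word]
    exact congrArg List.ofFn (funext fun p => congrArg ℓ (hπ _).symm)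
  tri := rfl

end Ihx

/-- Two triples that begin with `e` and `-e` are two free vertices whose half-edges `0` form an
edge. The other two codes in the sum are codes of the reglued diagrams `ihxH` and `ihxX`. -/
theorem ihxSum_eq_zero_of_mem_ihxPerp {I : Finset (Fin m)} {x : HT m} (hx : x ∈ ihxPerp I)
    (w : List (Fin m × ℤ)) (e a b c d : ℤ) (T : Multiset (Fin 3 → ℤ)) :
    ihxSum (fun w T => evL w T x) w e a b c d T = 0 := by
  have hlab := lab_ihx (w : Multiset (Fin m × ℤ)) e a b c d T
  by_cases hv : Valid (w : Multiset (Fin m × ℤ)) (![e, b, a] ::ₘ ![-e, c, d] ::ₘ T)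
  swap
  · rw [ihxSum, evL_not_valid hv, evL_not_valid fun h => hv (h.congr hlab.1),
      evL_not_valid fun h => hv (h.congr hlab.2)]
    ring
  obtain ⟨Γ, ℓ, H⟩ := hv.exists_labels
  obtain ⟨u, hu⟩ := H.exists_half (Multiset.mem_cons_self _ _)
  obtain ⟨v, hv'⟩ := H.exists_half (Multiset.mem_cons_of_mem (Multiset.mem_cons_self _ _))
  have he0 : e ≠ 0 := by
    have := H.ne_zero (Γ.half u 0)
    rwa [hu] at this
  have huv : u ≠ v := by
    rintro rfl
    have := (hu 0).symm.trans (hv' 0)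
    simp at this
    omega
  have hedge : Γ.e (Γ.half u 0) = Γ.half v 0 := by
    apply H.inj
    rw [H.neg, hu, hv']
    rfl
  have hcond : coeff Γ x - coeff (Γ.ihxH u v) x + coeff (Γ.ihxX u v) x = 0 := by
    have := hx.2
    simp only [SetLike.mem_coe, Submodule.mem_iInf, LinearMap.mem_ker, LinearMap.add_apply, LinearMap.sub_apply] at this
    exact this Γ u v ⟨huv, hedge⟩
  have hT := H.tri
  rw [tri_ihxI huv] at hT
  simp only [hu, hv'] at hT
  have hT' : T = restTri Γ u v ℓ := (Multiset.cons_inj_right _).1 ((Multiset.cons_inj_right _).1 hT)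
  have HH : Labels (Γ.ihxH u v) w _ _ := H.reglue (permH Γ u v) permH_symm_leg
  have HX : Labels (Γ.ihxX u v) w _ _ := H.reglue (permX Γ u v) permX_symm_leg
  rw [tri_ihxH huv] at HH
  rw [tri_ihxX huv] at HX
  simp only [hu, hv', ← hT'] at HH HX
  change Labels (Γ.ihxH u v) w (![e, a, c] ::ₘ ![-e, d, b] ::ₘ T) _ at HH
  change Labels (Γ.ihxX u v) w (![e, b, c] ::ₘ ![-e, d, a] ::ₘ T) _ at HX
  rw [ihxSum, evL_of_labels H, evL_of_labels HH, evL_of_labels HX]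
  exact hcond

/-- In every matching exactly one factor is evaluated at `b₀`, where the alternating sum vanishes;
all the other factors are common to the three terms. -/
theorem matchSum_ihx {B ι : Type*} [DecidableEq B] (xs : List ι) {F G K : ι → B → ℝ} {s : Finset B}
    {b₀ : B} (hb : b₀ ∈ s) (h₀ : ∀ x ∈ xs, F x b₀ - G x b₀ + K x b₀ = 0)
    (hG : ∀ x ∈ xs, ∀ b ∈ s, b ≠ b₀ → F x b = G x b)
    (hK : ∀ x ∈ xs, ∀ b ∈ s, b ≠ b₀ → F x b = K x b) :
    matchSum (xs.map F) s - matchSum (xs.map G) s + matchSum (xs.map K) s = 0 := by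
  induction xs generalizing s with
  | nil =>
    have : s ≠ ∅ := Finset.ne_empty_of_mem hb
    simp [matchSum, this]
  | cons x xs ih =>
    simp only [List.map_cons, matchSum]
    rw [← Finset.sum_sub_distrib, ← Finset.sum_add_distrib]
    refine Finset.sum_eq_zero fun b hbs => ?_
    by_cases hbb : b = b₀
    · subst hbb
      rw [← matchSum_congr xs (F := F) (G := G) fun y hy c hc => hG y (List.mem_cons_of_mem _ hy) c
          (Finset.mem_of_mem_erase hc) (Finset.ne_of_mem_erase hc),
        ← matchSum_congr xs (F := F) (G := K) fun y hy c hc => hK y (List.mem_cons_of_mem _ hy) c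
          (Finset.mem_of_mem_erase hc) (Finset.ne_of_mem_erase hc)]
      have := h₀ x List.mem_cons_self
      linear_combination matchSum (xs.map F) (s.erase b) * this
    · rw [← hG x List.mem_cons_self b hbs hbb, ← hK x List.mem_cons_self b hbs hbb]
      have := ih (s := s.erase b) (Finset.mem_erase.2 ⟨Ne.symm hbb, hb⟩)
        (fun y hy => h₀ y (List.mem_cons_of_mem _ hy))
        (fun y hy c hc => hG y (List.mem_cons_of_mem _ hy) c (Finset.mem_of_mem_erase hc))
        (fun y hy c hc => hK y (List.mem_cons_of_mem _ hy) c (Finset.mem_of_mem_erase hc))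
      linear_combination F x b * this

/-- The condition is symmetric in the four branches `x`, `y`, `z`, `t`. Hence the three codes in an
IHX relation have the same closed sets, and so the same components. -/
theorem isClosedSet_cons_cons {W : Multiset (Fin m × ℤ)} {T : Multiset (Fin 3 → ℤ)}
    {e x y z t : ℤ} {Q : Finset ℤ} :
    IsClosedSet W (![e, x, y] ::ₘ ![-e, z, t] ::ₘ T) Q ↔
      (∀ r ∈ Q, r ∈ lab W (![e, x, y] ::ₘ ![-e, z, t] ::ₘ T)) ∧ (∀ r ∈ Q, -r ∈ Q) ∧
        (∀ τ ∈ T, ∀ c, τ c ∈ Q ↔ τ 0 ∈ Q) ∧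
        (x ∈ Q ↔ e ∈ Q) ∧ (y ∈ Q ↔ e ∈ Q) ∧ (z ∈ Q ↔ e ∈ Q) ∧ (t ∈ Q ↔ e ∈ Q) := by
  constructor
  · intro h
    have hneg : -e ∈ Q ↔ e ∈ Q := ⟨fun h' => by simpa using h.neg _ h', h.neg e⟩
    have h1 := h.tri _ (Multiset.mem_cons_self _ _)
    have h2 := h.tri _ (Multiset.mem_cons_of_mem (Multiset.mem_cons_self _ _))
    refine ⟨h.sub, h.neg, fun τ hτ => h.tri τ (by simp [hτ]), h1 1, h1 2, ?_, ?_⟩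
    · exact (h2 1).trans hneg
    · exact (h2 2).trans hneg
  · rintro ⟨h1, h2, h3, h4, h5, h6, h7⟩
    have hneg : -e ∈ Q ↔ e ∈ Q := ⟨fun h' => by simpa using h2 _ h', h2 e⟩
    refine ⟨h1, h2, fun τ hτ c => ?_⟩
    rw [Multiset.mem_cons, Multiset.mem_cons] at hτ
    rcases hτ with rfl | rfl | hτ
    · fin_cases c
      · exact Iff.rfl
      · exact h4
      · exact h5
    · fin_cases c
      · exact Iff.rfl
      · exact h6.trans hneg.symm
      · exact h7.trans hneg.symm
    · exact h3 τ hτ c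

theorem isComp_congr {W : Multiset (Fin m × ℤ)} {T T' : Multiset (Fin 3 → ℤ)}
    (h : ∀ Q, IsClosedSet W T Q ↔ IsClosedSet W T' Q) {P : Finset ℤ} :
    IsComp W T P ↔ IsComp W T' P := by
  constructor
  · exact fun H => ⟨(h P).1 H.closed, H.nonempty, fun Q hQ => H.eq_of_subset Q ((h Q).2 hQ)⟩
  · exact fun H => ⟨(h P).2 H.closed, H.nonempty, fun Q hQ => H.eq_of_subset Q ((h Q).1 hQ)⟩

theorem inTri_cons_cons {T : Multiset (Fin 3 → ℤ)} {e x y z t : ℤ} {P : Finset ℤ}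
    (hP : ∀ r ∈ P, -r ∈ P) : inTri P (![e, x, y] ::ₘ ![-e, z, t] ::ₘ T) =
      if e ∈ P then ![e, x, y] ::ₘ ![-e, z, t] ::ₘ inTri P T else inTri P T := by
  have hneg : -e ∈ P ↔ e ∈ P := ⟨fun h' => by simpa using hP _ h', hP e⟩
  have h1 : (![e, x, y] : Fin 3 → ℤ) 0 = e := rfl
  have h2 : (![-e, z, t] : Fin 3 → ℤ) 0 = -e := rfl
  simp only [inTri, Multiset.filter_cons, h1, h2, hneg]
  split_ifs
  · simp [Multiset.cons_swap ![e, x, y]]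
  · simp

/-- The shuffle products of solutions of the IHX conditions satisfy the IHX conditions. -/
theorem ihxSum_shuffleProd (xs : List (HT m)) (hxs : ∀ x ∈ xs, ∃ I, x ∈ ihxPerp I)
    (w : List (Fin m × ℤ)) (e a b c d : ℤ) (T : Multiset (Fin 3 → ℤ)) :
    ihxSum (fun w T => evL w T (shuffleProd xs)) w e a b c d T = 0 := by
  have hlab := lab_ihx (w : Multiset (Fin m × ℤ)) e a b c d T
  by_cases hv : Valid (w : Multiset (Fin m × ℤ)) (![e, b, a] ::ₘ ![-e, c, d] ::ₘ T)
  swap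
  · rw [ihxSum, evL_not_valid hv, evL_not_valid fun h => hv (h.congr hlab.1),
      evL_not_valid fun h => hv (h.congr hlab.2)]
    ring
  have htree : ∀ x ∈ xs, ∃ I, x ∈ treeSpace I := fun x hx => (hxs x hx).imp fun _ h => h.1
  have hcH : ∀ Q, IsClosedSet (w : Multiset (Fin m × ℤ)) (![e, a, c] ::ₘ ![-e, d, b] ::ₘ T) Q ↔
      IsClosedSet (w : Multiset (Fin m × ℤ)) (![e, b, a] ::ₘ ![-e, c, d] ::ₘ T) Q := fun Q => by
    rw [isClosedSet_cons_cons, isClosedSet_cons_cons, hlab.1]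
    tauto
  have hcX : ∀ Q, IsClosedSet (w : Multiset (Fin m × ℤ)) (![e, b, c] ::ₘ ![-e, d, a] ::ₘ T) Q ↔
      IsClosedSet (w : Multiset (Fin m × ℤ)) (![e, b, a] ::ₘ ![-e, c, d] ::ₘ T) Q := fun Q => by
    rw [isClosedSet_cons_cons, isClosedSet_cons_cons, hlab.2]
    tauto
  have hH : comps w (![e, a, c] ::ₘ ![-e, d, b] ::ₘ T) =
      comps w (![e, b, a] ::ₘ ![-e, c, d] ::ₘ T) := by
    ext P
    rw [mem_comps, mem_comps, isComp_congr hcH]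
  have hX : comps w (![e, b, c] ::ₘ ![-e, d, a] ::ₘ T) =
      comps w (![e, b, a] ::ₘ ![-e, c, d] ::ₘ T) := by
    ext P
    rw [mem_comps, mem_comps, isComp_congr hcX]
  -- The relation takes place in the component with the edge `e`; the parts of the three codes at
  -- other components coincide.
  obtain ⟨P₀, hP₀, heP⟩ := hv.exists_comp (x := e)
    (mem_lab.2 (Or.inr ⟨_, Multiset.mem_cons_self _ _, 0, rfl⟩))
  rw [ihxSum, evL_shuffleProd hv xs htree, evL_shuffleProd (hv.congr hlab.1.symm) xs htree,
    evL_shuffleProd (hv.congr hlab.2.symm) xs htree, hH, hX]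
  have hout : ∀ {P x y z t}, P ∈ comps w (![e, b, a] ::ₘ ![-e, c, d] ::ₘ T) → P ≠ P₀ →
      inTri P (![e, x, y] ::ₘ ![-e, z, t] ::ₘ T) = inTri P T := fun {P x y z t} hP hne => by
    rw [mem_comps] at hP
    rw [inTri_cons_cons hP.closed.neg, if_neg]
    exact fun h => Finset.disjoint_left.1 (hP.disjoint hP₀ hne) h heP
  refine matchSum_ihx xs (mem_comps.2 hP₀) (fun x hx => ?_) (fun x hx P hP hne => ?_)
    fun x hx P hP hne => ?_
  · obtain ⟨I, hI⟩ := hxs x hx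
    rw [inTri_cons_cons hP₀.closed.neg, inTri_cons_cons hP₀.closed.neg,
      inTri_cons_cons hP₀.closed.neg, if_pos heP, if_pos heP, if_pos heP]
    exact ihxSum_eq_zero_of_mem_ihxPerp hI _ _ _ _ _ _ _
  · rw [hout hP hne, hout hP hne]
  · rw [hout hP hne, hout hP hne]

/-! ### Trees -/

/-- With `q` legs and `f` free vertices, a tree has `q + f - 1` edges, and there are twice as many
half-edges: `q + 3 f = 2 (q + f - 1)`. -/
theorem Diagram.IsHomotopyLink.card_halfEdge {Γ : Diagram m} (H : Γ.IsHomotopyLink) (hc : Γ.Conn) :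
    Γ.f + 2 = ∑ i, Γ.q i := by
  classical
  have htree : Γ.graph.IsTree := ⟨conn_iff.1 hc, H.acyclic⟩
  have h1 := htree.card_edgeFinset
  have h2 := Γ.graph.dart_card_eq_twice_card_edges
  have h3 : Fintype.card (HalfEdge Γ.q Γ.f) = 2 * Γ.graph.edgeFinset.card := by
    rw [← h2]
    refine Fintype.card_of_bijective (f := fun h => ⟨(vert h, vert (Γ.e h)), H.adj h⟩) ⟨?_, ?_⟩
    · intro h h' e
      simp only [SimpleGraph.Dart.mk.injEq, Prod.mk.injEq] at e
      exact H.no_multi h h' e.1 e.2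
    · rintro ⟨⟨a, b⟩, hne, h, ha, hb⟩
      exact ⟨h, SimpleGraph.Dart.ext _ _ (Prod.ext ha hb)⟩
  simp only [Fintype.card_sum, Fintype.card_sigma, Fintype.card_fin, Fintype.card_prod] at h1 h3
  omega

/-- Trees, possibly with closed loops, with leaves labeled by the elements of `I`. -/
structure Diagram.IsTreeLike (I : Finset (Fin m)) (Γ : Diagram m) : Prop where
  conn : Γ.Conn
  mem : ∀ i, i ∈ I ↔ 0 < Γ.q i
  card : Γ.f + 2 = I.card

theorem Diagram.IsHomotopyLink.isTreeLike {Γ : Diagram m} (H : Γ.IsHomotopyLink) (hc : Γ.Conn)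
    {I : Finset (Fin m)} (hI : ∀ i, i ∈ I ↔ 0 < Γ.q i) : Γ.IsTreeLike I := by
  refine ⟨hc, hI, ?_⟩
  rw [H.card_halfEdge hc, Finset.card_eq_sum_ones, ← Finset.sum_subset (Finset.subset_univ I)]
  · refine Finset.sum_congr rfl fun i hi => ?_
    have := (hI i).1 hi
    have := H.q_le_one hc i
    omega
  · intro i _ hi
    rw [hI] at hi
    omega

theorem Diagram.IsTreeLike.sum_q {Γ : Diagram m} (H : Γ.IsHomotopyLink) {I : Finset (Fin m)}
    (h : Γ.IsTreeLike I) : ∑ i, Γ.q i = I.card := by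
  rw [← H.card_halfEdge h.conn, h.card]

theorem Diagram.IsTreeLike.unique {Γ : Diagram m} {I J : Finset (Fin m)} (h : Γ.IsTreeLike I)
    (h' : Γ.IsTreeLike J) : I = J := by
  ext i
  rw [h.mem, h'.mem]

/-- Trees with leaves labeled by `I`. -/
def Diagram.IsTree (I : Finset (Fin m)) (Γ : Diagram m) : Prop :=
  Γ.IsHomotopyLink ∧ Γ.IsTreeLike I

theorem treeSpace_eq (I : Finset (Fin m)) :
    treeSpace I = Submodule.span ℝ (diag '' {Γ | Γ.IsTree I}) := by
  rw [treeSpace]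
  congr 1
  ext x
  constructor
  · rintro ⟨Γ, h1, h2, h3, rfl⟩
    exact ⟨Γ, ⟨h1, h1.isTreeLike (conn_iff.2 h2) h3⟩, rfl⟩
  · rintro ⟨Γ, ⟨h1, h2⟩, rfl⟩
    exact ⟨Γ, h1, conn_iff.1 h2.conn, h2.mem, rfl⟩

theorem conn_of_equiv {Γ Γ' : Diagram m} (E : HalfEdge Γ.q Γ.f ≃ HalfEdge Γ'.q Γ'.f)
    (H : Γ.Conn) (h : ∀ Q : Set (HalfEdge Γ'.q Γ'.f), (∀ h ∈ Q, Γ'.e h ∈ Q) →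
      (∀ v c c', Γ'.half v c ∈ Q → Γ'.half v c' ∈ Q) →
      (∀ h, E h ∈ Q → E (Γ.e h) ∈ Q) ∧ ∀ v c c', E (Γ.half v c) ∈ Q → E (Γ.half v c') ∈ Q) :
    Γ'.Conn := by
  refine ⟨H.nonempty.map E, fun Q h1 h2 ⟨x, hx⟩ y => ?_⟩
  obtain ⟨h3, h4⟩ := h Q h1 h2
  have := H.eq_univ {h | E h ∈ Q} h3 h4 ⟨E.symm x, by simpa using hx⟩ (E.symm y)
  simpa using this

theorem Diagram.Conn.of_iso {Γ Γ' : Diagram m} (φ : Iso Γ Γ') (H : Γ.Conn) : Γ'.Conn := by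
  refine conn_of_equiv φ.halfEquiv H fun Q h1 h2 => ⟨fun h hh => ?_, fun v c c' hh => ?_⟩
  · rw [φ.halfEquiv_e]
    exact h1 _ hh
  · rw [φ.halfEquiv_half] at hh ⊢
    exact h2 _ _ _ hh

theorem Diagram.IsTreeLike.of_iso {Γ Γ' : Diagram m} (φ : Iso Γ Γ') {I : Finset (Fin m)}
    (H : Γ.IsTreeLike I) : Γ'.IsTreeLike I :=
  ⟨H.conn.of_iso φ, fun i => by rw [H.mem, φ.q_eq], by rw [← free_card φ, H.card]⟩

theorem Diagram.IsTree.of_iso {Γ Γ' : Diagram m} (φ : Iso Γ Γ') {I : Finset (Fin m)}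
    (H : Γ.IsTree I) : Γ'.IsTree I :=
  ⟨H.1.of_iso φ.symm, H.2.of_iso φ⟩

/-! ### IHX moves preserve connectedness -/

section

variable {Γ : Diagram m} {u v : Fin Γ.f}

/-- The edge between `u` and `v` survives, so the half-edges at `u` and `v` always belong to one
component. Permuting edge ends among them does not change which sets of half-edges are closed. -/
theorem conn_reglue_iff {π : Equiv.Perm (HalfEdge Γ.q Γ.f)} (huv : Γ.e (Γ.half u 0) = Γ.half v 0)
    (hπ : ∀ x, (∃ t c, (t = u ∨ t = v) ∧ x = Γ.half t c ∧ ∃ t' c', (t' = u ∨ t' = v) ∧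
      π x = Γ.half t' c') ∨ π x = x ∧ ∀ c, x ≠ Γ.half u c ∧ x ≠ Γ.half v c)
    (hu : π (Γ.half u 0) = Γ.half u 0) (hv : π (Γ.half v 0) = Γ.half v 0) :
    (Γ.reglue π).Conn ↔ Γ.Conn := by
  have hu' : π.symm (Γ.half u 0) = Γ.half u 0 := by rw [Equiv.symm_apply_eq, hu]
  have key : ∀ (Q : Set (HalfEdge Γ.q Γ.f)) (e : HalfEdge Γ.q Γ.f → HalfEdge Γ.q Γ.f),
      e (Γ.half u 0) = Γ.half v 0 → e (Γ.half v 0) = Γ.half u 0 → (∀ h ∈ Q, e h ∈ Q) →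
      (∀ v c c', Γ.half v c ∈ Q → Γ.half v c' ∈ Q) → ∀ x, π x ∈ Q ↔ x ∈ Q := by
    intro Q e e1 e2 h1 h2 x
    have hQ : ∀ t c t' c', (t = u ∨ t = v) → (t' = u ∨ t' = v) → Γ.half t c ∈ Q →
        Γ.half t' c' ∈ Q := by
      rintro t c t' c' (rfl | rfl) (rfl | rfl) hh
      · exact h2 _ _ _ hh
      · exact h2 _ _ _ (e1 ▸ h1 _ (h2 _ _ 0 hh))
      · exact h2 _ _ _ (e2 ▸ h1 _ (h2 _ _ 0 hh))
      · exact h2 _ _ _ hh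
    rcases hπ x with ⟨t, c, ht, rfl, t', c', ht', he⟩ | ⟨he, -⟩
    · rw [he]
      exact ⟨hQ _ _ _ _ ht' ht, hQ _ _ _ _ ht ht'⟩
    · rw [he]
  have e2 : Γ.e (Γ.half v 0) = Γ.half u 0 := by rw [← huv, Γ.e_e]
  have hv' : π.symm (Γ.half v 0) = Γ.half v 0 := by rw [Equiv.symm_apply_eq, hv]
  constructor
  · intro H
    refine conn_of_equiv (Γ := Γ.reglue π) (Equiv.refl _) H fun Q h1 h2 => ⟨fun h hh => ?_, h2⟩
    change π (Γ.e (π.symm h)) ∈ Q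
    rw [key Q Γ.e huv e2 h1 h2]
    refine h1 _ ?_
    rw [← key Q Γ.e huv e2 h1 h2]
    exact (congrArg (· ∈ Q) (Equiv.apply_symm_apply π h)).mpr hh
  · intro H
    refine conn_of_equiv (Γ := Γ) (Γ' := Γ.reglue π)
      (Equiv.refl (HalfEdge Γ.q Γ.f)) H fun Q h1 h2 => ⟨fun h hh => ?_, h2⟩
    change Γ.e h ∈ Q
    have k := key Q (Γ.reglue π).e
      (show π (Γ.e (π.symm (Γ.half u 0))) = _ by rw [hu', huv, hv])
      (show π (Γ.e (π.symm (Γ.half v 0))) = _ by rw [hv', e2, hu]) h1 h2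
    have h3 := h1 _ ((k h).2 hh)
    change π (Γ.e (π.symm (π h))) ∈ Q at h3
    rw [Equiv.symm_apply_apply] at h3
    exact (k _).1 h3

theorem isTreeLike_ihxH (huv : u ≠ v) (he : Γ.e (Γ.half u 0) = Γ.half v 0) {I : Finset (Fin m)} :
    (Γ.ihxH u v).IsTreeLike I ↔ Γ.IsTreeLike I := by
  have hc : (Γ.ihxH u v).Conn ↔ Γ.Conn := by
    refine conn_reglue_iff he (fun x => ?_) ?_ ?_
    · by_cases hx : x ∈ [Γ.half u 1, Γ.half v 2, Γ.half v 1, Γ.half u 2]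
      · left
        have hx' := List.formPerm_apply_mem_of_mem hx
        simp only [List.mem_cons, List.not_mem_nil, or_false] at hx hx'
        have h1 : ∀ {x : HalfEdge Γ.q Γ.f}, (x = Γ.half u 1 ∨ x = Γ.half v 2 ∨ x = Γ.half v 1 ∨
            x = Γ.half u 2) → ∃ t c, (t = u ∨ t = v) ∧ x = Γ.half t c := by
          rintro x (rfl | rfl | rfl | rfl)
          exacts [⟨u, 1, Or.inl rfl, rfl⟩, ⟨v, 2, Or.inr rfl, rfl⟩, ⟨v, 1, Or.inr rfl, rfl⟩,
            ⟨u, 2, Or.inl rfl, rfl⟩]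
        obtain ⟨t, c, h2, h3⟩ := h1 hx
        obtain ⟨t', c', h4, h5⟩ := h1 hx'
        exact ⟨t, c, h2, h3, t', c', h4, h5⟩
      · by_cases hxx : ∃ c, x = Γ.half u c ∨ x = Γ.half v c
        · left
          obtain ⟨c, h | h⟩ := hxx
          · exact ⟨u, c, Or.inl rfl, h, u, c, Or.inl rfl,
              (List.formPerm_apply_of_notMem hx).trans h⟩
          · exact ⟨v, c, Or.inr rfl, h, v, c, Or.inr rfl,
              (List.formPerm_apply_of_notMem hx).trans h⟩
        · right
          push Not at hxx
          exact ⟨List.formPerm_apply_of_notMem hx, hxx⟩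
    · exact List.formPerm_apply_of_notMem (by simp [huv])
    · exact List.formPerm_apply_of_notMem (by simp [huv.symm])
  exact ⟨fun h => ⟨hc.1 h.conn, h.mem, h.card⟩, fun h => ⟨hc.2 h.conn, h.mem, h.card⟩⟩

theorem isTreeLike_ihxX (huv : u ≠ v) (he : Γ.e (Γ.half u 0) = Γ.half v 0) {I : Finset (Fin m)} :
    (Γ.ihxX u v).IsTreeLike I ↔ Γ.IsTreeLike I := by
  have hc : (Γ.ihxX u v).Conn ↔ Γ.Conn := by
    refine conn_reglue_iff he (fun x => ?_) ?_ ?_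
    · by_cases hx : x ∈ [Γ.half u 2, Γ.half v 2, Γ.half v 1]
      · left
        have hx' := List.formPerm_apply_mem_of_mem hx
        simp only [List.mem_cons, List.not_mem_nil, or_false] at hx hx'
        have h1 : ∀ {x : HalfEdge Γ.q Γ.f}, (x = Γ.half u 2 ∨ x = Γ.half v 2 ∨ x = Γ.half v 1) →
            ∃ t c, (t = u ∨ t = v) ∧ x = Γ.half t c := by
          rintro x (rfl | rfl | rfl)
          exacts [⟨u, 2, Or.inl rfl, rfl⟩, ⟨v, 2, Or.inr rfl, rfl⟩, ⟨v, 1, Or.inr rfl, rfl⟩]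
        obtain ⟨t, c, h2, h3⟩ := h1 hx
        obtain ⟨t', c', h4, h5⟩ := h1 hx'
        exact ⟨t, c, h2, h3, t', c', h4, h5⟩
      · by_cases hxx : ∃ c, x = Γ.half u c ∨ x = Γ.half v c
        · left
          obtain ⟨c, h | h⟩ := hxx
          · exact ⟨u, c, Or.inl rfl, h, u, c, Or.inl rfl,
              (List.formPerm_apply_of_notMem hx).trans h⟩
          · exact ⟨v, c, Or.inr rfl, h, v, c, Or.inr rfl,
              (List.formPerm_apply_of_notMem hx).trans h⟩
        · right
          push Not at hxx
          exact ⟨List.formPerm_apply_of_notMem hx, hxx⟩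
    · exact List.formPerm_apply_of_notMem (by simp [huv])
    · exact List.formPerm_apply_of_notMem (by simp [huv.symm])
  exact ⟨fun h => ⟨hc.1 h.conn, h.mem, h.card⟩, fun h => ⟨hc.2 h.conn, h.mem, h.card⟩⟩

end

/-! ### Elements of the tree spaces and their coefficients -/

theorem finite_isTree (I : Finset (Fin m)) : {Γ : Diagram m | Γ.IsTree I}.Finite := by
  refine (finite_bounded (I.card + 2)).subset fun Γ h => ⟨fun i => ?_, ?_⟩
  · have := h.1.q_le_one h.2.conn i
    omega
  · have := h.2.card
    omega

/-- The trees with leaves labeled by `I`. -/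
def trees (I : Finset (Fin m)) : Finset (Diagram m) := (finite_isTree I).toFinset

theorem mem_trees {I : Finset (Fin m)} {Γ : Diagram m} : Γ ∈ trees I ↔ Γ.IsTree I := by
  simp [trees]

theorem recon_treeSpace {I : Finset (Fin m)} {x : HT m} (hx : x ∈ treeSpace I) :
    recon (trees I) (fun Γ => coeff Γ x) = x := by
  refine recon_coeff ?_
  rw [treeSpace_eq] at hx
  convert hx using 3
  ext Γ
  exact mem_trees

theorem coeff_treeSpace {I : Finset (Fin m)} {x : HT m} (hx : x ∈ treeSpace I) {Γ : Diagram m}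
    (hΓ : ¬ Γ.IsTree I) : coeff Γ x = 0 := by
  rw [← recon_treeSpace hx]
  refine coeff_recon_of_not fun Γ' hΓ' => ⟨fun φ => hΓ ?_⟩
  exact (mem_trees.1 hΓ').of_iso φ.symm

theorem recon_mem_treeSpace (I : Finset (Fin m)) (c : Diagram m → ℝ) :
    recon (trees I) c ∈ treeSpace I := by
  rw [treeSpace_eq]
  exact Submodule.sum_mem _ fun Γ hΓ => Submodule.smul_mem _ _
    (Submodule.subset_span ⟨Γ, mem_trees.1 hΓ, rfl⟩)

/-! ### The orders of shuffle products -/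

theorem shuffle_mem_chains {n₁ n₂ : ℕ} {k₁ k₂ : ℤ} {x y : HT m} (hx : x ∈ chains m n₁ k₁)
    (hy : y ∈ chains m n₂ k₂) : shuffle m x y ∈ chains m (n₁ + n₂) (k₁ + k₂) := by
  induction hx using Submodule.span_induction with
  | zero => simp
  | add x x' _ _ h h' =>
    rw [map_add]
    exact Submodule.add_mem _ h h'
  | smul r x _ h =>
    rw [map_smul]
    exact Submodule.smul_mem _ r h
  | mem x hx =>
  obtain ⟨Γ₁, H₁, o₁, f₁, rfl⟩ := hx
  induction hy using Submodule.span_induction with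
  | zero => simp
  | add x x' _ _ h h' =>
    rw [map_add]
    exact Submodule.add_mem _ h h'
  | smul r x _ h =>
    rw [map_smul]
    exact Submodule.smul_mem _ r h
  | mem x hx =>
  obtain ⟨Γ₂, H₂, o₂, f₂, rfl⟩ := hx
  rw [shuffle_diag, shuffleDiag]
  have : Fintype (Shuffle Γ₁.q Γ₂.q) := Fintype.ofFinite _
  rw [finsum_eq_sum_of_fintype]
  refine Submodule.sum_mem _ fun σ _ => Submodule.subset_span
    ⟨_, isHomotopyLink_glue σ H₁ H₂, ?_, ?_, rfl⟩
  · rw [hasOrder_iff] at o₁ o₂ ⊢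
    change ∑ i, (Γ₁.q i + Γ₂.q i) + (Γ₁.f + Γ₂.f) = _
    rw [Finset.sum_add_distrib]
    omega
  · change ((Γ₁.f + Γ₂.f : ℕ) : ℤ) ≤ _
    push_cast
    omega

theorem treeSpace_le_chains (I : LabelSet m) :
    treeSpace I.1 ≤ chains m (I.1.card - 1) ((I.1.card - 2 : ℕ) : ℤ) := by
  rw [treeSpace_eq, Submodule.span_le]
  rintro _ ⟨Γ, ⟨h1, h2⟩, rfl⟩
  have h3 := h2.card
  have h4 := h2.sum_q h1
  refine Submodule.subset_span ⟨Γ, h1, ?_, ?_, rfl⟩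
  · rw [hasOrder_iff]
    omega
  · omega

theorem shuffleProd_mem_chains {r : ℕ} (I : Fin r → LabelSet m) (a : Fin r → HT m)
    (ha : ∀ j, a j ∈ treeSpace (I j).1) : shuffleProd (List.ofFn a) ∈
      chains m (∑ j, ((I j).1.card - 1)) ((∑ j, ((I j).1.card - 2) : ℕ) : ℤ) := by
  induction r with
  | zero =>
    refine Submodule.subset_span ⟨empty m, isHomotopyLink_empty, ?_, ?_, ?_⟩
    · rw [hasOrder_iff]
      simp [empty]
    · simp [empty]
    · simp [shuffleProd]
  | succ r ih =>
    rw [List.ofFn_succ, Fin.sum_univ_succ, Fin.sum_univ_succ, Nat.cast_add]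
    exact shuffle_mem_chains (treeSpace_le_chains _ (ha 0)) (ih _ _ fun j => ha j.succ)

/-! ### Families of diagrams -/

/-- A code of a diagram, up to the order of the word. -/
def LCode (Γ : Diagram m) (X : Multiset (Fin m × ℤ) × Multiset (Fin 3 → ℤ)) : Prop :=
  ∃ (w : List (Fin m × ℤ)) (ℓ : _), Labels Γ w X.2 ℓ ∧ (w : Multiset (Fin m × ℤ)) = X.1

theorem lab_zero : lab (0 : Multiset (Fin m × ℤ)) 0 = 0 := rfl

theorem lab_sum {A : Type*} (s : Finset A) (W : A → Multiset (Fin m × ℤ))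
    (T : A → Multiset (Fin 3 → ℤ)) :
    lab (∑ a ∈ s, W a) (∑ a ∈ s, T a) = ∑ a ∈ s, lab (W a) (T a) := by
  classical
  induction s using Finset.induction_on with
  | empty => simp [lab_zero]
  | insert a s ha ih => rw [Finset.sum_insert ha, Finset.sum_insert ha, Finset.sum_insert ha,
      lab_add, ih]

theorem LCode.valid {Γ : Diagram m} {X : Multiset (Fin m × ℤ) × Multiset (Fin 3 → ℤ)}
    (h : LCode Γ X) : Valid X.1 X.2 := by
  obtain ⟨w, ℓ, H, hw⟩ := h
  exact hw ▸ H.valid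

theorem Labels.coe_word {Γ : Diagram m} {w : List (Fin m × ℤ)} {T : Multiset (Fin 3 → ℤ)}
    {ℓ : HalfEdge Γ.q Γ.f → ℤ} (H : Labels Γ w T ℓ) :
    (w : Multiset (Fin m × ℤ)) =
      ∑ i, ∑ p, {((i, ℓ (Γ.leg i p)) : Fin m × ℤ)} := by
  have h1 := sum_onSeg w fun i x => (i, x)
  simp only [Prod.mk.eta, List.map_id'] at h1
  rw [← h1]
  refine Finset.sum_congr rfl fun i _ => ?_
  rw [H.word, List.map_ofFn, coe_ofFn]
  rfl

/-- The codes `D` represent the diagrams `c`, with distinct labels. -/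
structure IsFamily {A : Type*} [Fintype A] (c : A → Diagram m)
    (D : A → Multiset (Fin m × ℤ) × Multiset (Fin 3 → ℤ)) : Prop where
  code : ∀ a, LCode (c a) (D a)
  nodup : (lab (∑ a, (D a).1) (∑ a, (D a).2)).Nodup

theorem IsFamily.valid {A : Type*} [Fintype A] {c : A → Diagram m}
    {D : A → Multiset (Fin m × ℤ) × Multiset (Fin 3 → ℤ)} (H : IsFamily c D) :
    Valid (∑ a, (D a).1) (∑ a, (D a).2) := by
  refine ⟨H.nodup, fun h => ?_, fun x hx => ?_⟩
  · rw [lab_sum, Multiset.mem_sum] at h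
    obtain ⟨a, -, ha⟩ := h
    exact (H.code a).valid.zero ha
  · rw [lab_sum, Multiset.mem_sum] at hx ⊢
    obtain ⟨a, ha, hx⟩ := hx
    exact ⟨a, ha, (H.code a).valid.neg x hx⟩

theorem IsFamily.eq_of_mem {A : Type*} [Fintype A] {c : A → Diagram m}
    {D : A → Multiset (Fin m × ℤ) × Multiset (Fin 3 → ℤ)} (H : IsFamily c D) {a b : A} {x : ℤ}
    (ha : x ∈ lab (D a).1 (D a).2) (hb : x ∈ lab (D b).1 (D b).2) : a = b := by
  classical
  by_contra hne
  have h := H.nodup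
  rw [lab_sum, ← Finset.add_sum_erase _ _ (Finset.mem_univ a), Multiset.nodup_add] at h
  refine Multiset.disjoint_left.1 h.2.2 ha (Multiset.mem_sum.2 ⟨b, ?_, hb⟩)
  exact Finset.mem_erase.2 ⟨Ne.symm hne, Finset.mem_univ b⟩

theorem nodup_sum {A : Type*} (s : Finset A) (M : A → Multiset ℤ) (h : ∀ a, (M a).Nodup)
    (hd : ∀ a b x, x ∈ M a → x ∈ M b → a = b) : (∑ a ∈ s, M a).Nodup := by
  classical
  induction s using Finset.induction_on with
  | empty => simp
  | insert a s ha ih =>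
    rw [Finset.sum_insert ha, Multiset.nodup_add]
    refine ⟨h a, ih, Multiset.disjoint_left.2 fun {x} hx hx' => ?_⟩
    obtain ⟨b, hb, hxb⟩ := Multiset.mem_sum.1 hx'
    exact ha (hd a b x hx hxb ▸ hb)

/-- Relabeling by the `j`-th copy of the integers. -/
def shiftLabel (j : ℕ) (x : ℤ) : ℤ := x.sign * (Nat.pair j x.natAbs : ℤ)

theorem shiftLabel_neg (j : ℕ) (x : ℤ) : shiftLabel j (-x) = -shiftLabel j x := by
  simp [shiftLabel]

/-- The sign of a nonzero label is preserved, and its absolute value is paired with the index. So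
the copies of the labels are disjoint and `-x` still goes to the negative. -/
theorem shiftLabel_inj {i j : ℕ} {x y : ℤ} (hx : x ≠ 0) (hy : y ≠ 0)
    (h : shiftLabel i x = shiftLabel j y) : i = j ∧ x = y := by
  have hpos : ∀ (i : ℕ) {x : ℤ}, x ≠ 0 → (0 : ℤ) < (Nat.pair i x.natAbs : ℤ) := fun i x hx => by
    have := Nat.right_le_pair i x.natAbs
    have := Int.natAbs_pos.2 hx
    omega
  have hs : ∀ (i : ℕ) {x : ℤ}, x ≠ 0 → (shiftLabel i x).sign = x.sign := fun i x hx => by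
    rw [shiftLabel, Int.sign_mul, Int.sign_sign, Int.sign_eq_one_of_pos (hpos i hx), mul_one]
  have ha : ∀ (i : ℕ) {x : ℤ}, x ≠ 0 → (shiftLabel i x).natAbs = Nat.pair i x.natAbs :=
    fun i x hx => by
      rw [shiftLabel, Int.natAbs_mul, Int.natAbs_sign_of_ne_zero hx, one_mul, Int.natAbs_natCast]
  have h1 := (hs i hx).symm.trans ((congrArg Int.sign h).trans (hs j hy))
  have h2 := (ha i hx).symm.trans ((congrArg Int.natAbs h).trans (ha j hy))
  rw [Nat.pair_eq_pair] at h2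
  refine ⟨h2.1, ?_⟩
  rw [← Int.sign_mul_natAbs x, ← Int.sign_mul_natAbs y, h1, h2.2]

theorem exists_isFamily {A : Type*} [Fintype A] (c : A → Diagram m) : ∃ D, IsFamily c D := by
  choose w T ℓ H using fun a => exists_labels (c a)
  let E := Fintype.equivFin A
  have H' : ∀ a, Labels (c a) ((w a).map (Prod.map id (shiftLabel (E a))))
      ((T a).map fun τ => shiftLabel (E a) ∘ τ) (shiftLabel (E a) ∘ ℓ a) := fun a => by
    refine (H a).relabel _ (fun x hx y hy h => ?_) fun x _ => shiftLabel_neg _ x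
    exact (shiftLabel_inj (fun h0 => (H a).valid.zero (h0 ▸ hx))
      (fun h0 => (H a).valid.zero (h0 ▸ hy)) h).2
  refine ⟨fun a => (((w a).map (Prod.map id (shiftLabel (E a))) : List (Fin m × ℤ)),
    (T a).map fun τ => shiftLabel (E a) ∘ τ), fun a => ⟨_, _, H' a, rfl⟩, ?_⟩
  rw [lab_sum]
  refine nodup_sum _ _ (fun a => (H' a).valid.nodup) fun a b x ha hb => ?_
  obtain ⟨h, rfl⟩ := (H' a).mem_lab_iff.1 ha
  obtain ⟨h', e⟩ := (H' b).mem_lab_iff.1 hb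
  have := (shiftLabel_inj ((H b).ne_zero h') ((H a).ne_zero h) e).1
  exact (E.injective (Fin.ext this)).symm

/-- Functions on codes that do not depend on the order of the word if there are `k` triples. -/
def IsPermInvariant (f : List (Fin m × ℤ) → Multiset (Fin 3 → ℤ) → ℝ) (k : ℕ) : Prop :=
  ∀ w w' T, Multiset.card T = k → w.Perm w' → f w T = f w' T

theorem LCode.card {Γ : Diagram m} {X : Multiset (Fin m × ℤ) × Multiset (Fin 3 → ℤ)}
    (h : LCode Γ X) : Multiset.card X.2 = Γ.f := by
  obtain ⟨w, ℓ, H, -⟩ := h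
  exact H.card_tri

theorem IsFamily.card {A : Type*} [Fintype A] {c : A → Diagram m}
    {D : A → Multiset (Fin m × ℤ) × Multiset (Fin 3 → ℤ)} (H : IsFamily c D) :
    Multiset.card (∑ a, (D a).2) = ∑ a, (c a).f := by
  rw [Multiset.card_sum]
  exact Finset.sum_congr rfl fun a _ => (H.code a).card

/-- Matching the half-edges of each member gives a relabeling from one code of the union to the
other, up to the order of the word. This order does not matter by symmetry. -/
theorem IsFamily.value_unique {A : Type*} [Fintype A] {c : A → Diagram m}
    {D D' : A → Multiset (Fin m × ℤ) × Multiset (Fin 3 → ℤ)} (H : IsFamily c D)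
    (H' : IsFamily c D') {f : List (Fin m × ℤ) → Multiset (Fin 3 → ℤ) → ℝ} (hf : IsCodeFun f)
    (hs : IsPermInvariant f (∑ a, (c a).f)) {w w' : List (Fin m × ℤ)}
    (hw : (w : Multiset (Fin m × ℤ)) = ∑ a, (D a).1)
    (hw' : (w' : Multiset (Fin m × ℤ)) = ∑ a, (D' a).1) :
    f w (∑ a, (D a).2) = f w' (∑ a, (D' a).2) := by
  classical
  choose v ℓ L hv using H.code
  choose v' ℓ' L' hv' using H'.code
  have hmem : ∀ a h, ℓ a h ∈ lab (D a).1 (D a).2 := fun a h => by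
    rw [← hv a]
    exact (L a).mem_lab_iff.2 ⟨h, rfl⟩
  have hmem' : ∀ a h, ℓ' a h ∈ lab (D' a).1 (D' a).2 := fun a h => by
    rw [← hv' a]
    exact (L' a).mem_lab_iff.2 ⟨h, rfl⟩
  have hinj : ∀ a h b h', ℓ a h = ℓ b h' → ∃ e : a = b, e ▸ h = h' := by
    intro a h b h' e
    obtain rfl := H.eq_of_mem (hmem a h) (e ▸ hmem b h')
    exact ⟨rfl, (L a).inj e⟩
  let g : ℤ → ℤ := fun x => if hx : ∃ a, ∃ h, ℓ a h = x then ℓ' hx.choose hx.choose_spec.choose else 0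
  have hg : ∀ a h, g (ℓ a h) = ℓ' a h := fun a h => by
    have hx : ∃ b, ∃ h', ℓ b h' = ℓ a h := ⟨a, h, rfl⟩
    have : g (ℓ a h) = ℓ' hx.choose hx.choose_spec.choose := dif_pos hx
    rw [this]
    have h2 := hx.choose_spec.choose_spec
    generalize hx.choose_spec.choose = h' at h2 ⊢
    generalize hx.choose = b at h' h2 ⊢
    obtain ⟨rfl, rfl⟩ := hinj _ _ _ _ h2
    rfl
  have hlab : ∀ x, x ∈ lab (w : Multiset (Fin m × ℤ)) (∑ a, (D a).2) → ∃ a h, ℓ a h = x := by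
    intro x hx
    rw [hw, lab_sum, Multiset.mem_sum] at hx
    obtain ⟨a, -, hx⟩ := hx
    rw [← hv a, (L a).mem_lab_iff] at hx
    exact ⟨a, hx⟩
  have hT : (∑ a, (D a).2).map (fun τ => g ∘ τ) = ∑ a, (D' a).2 := by
    have hadd : ∀ M : Multiset (Fin 3 → ℤ), M.map (fun τ => g ∘ τ) =
        Multiset.mapAddMonoidHom (fun τ => g ∘ τ) M := fun _ => rfl
    rw [hadd, map_sum]
    refine Finset.sum_congr rfl fun a _ => ?_
    rw [← hadd, (L a).tri, (L' a).tri, Multiset.map_map]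
    exact Multiset.map_congr rfl fun t _ => funext fun x => hg a _
  have hW : ((w.map (Prod.map id g) : List (Fin m × ℤ)) : Multiset (Fin m × ℤ)) = w' := by
    have hadd : ∀ M : Multiset (Fin m × ℤ), M.map (Prod.map id g) =
        Multiset.mapAddMonoidHom (Prod.map id g) M := fun _ => rfl
    rw [← Multiset.map_coe, hw, hw', hadd, map_sum]
    refine Finset.sum_congr rfl fun a _ => ?_
    rw [← hv a, ← hv' a, (L a).coe_word, (L' a).coe_word, map_sum]
    refine Finset.sum_congr rfl fun i _ => ?_
    rw [map_sum]
    refine Finset.sum_congr rfl fun p _ => ?_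
    rw [← hadd, Multiset.map_singleton, Prod.map, hg]
    rfl
  have hval : Valid (w : Multiset (Fin m × ℤ)) (∑ a, (D a).2) := hw ▸ H.valid
  rw [← hf.relabel g hval, hT]
  · exact hs _ _ _ H'.card (Multiset.coe_eq_coe.1 hW)
  · intro x hx y hy e
    obtain ⟨a, h, rfl⟩ := hlab x hx
    obtain ⟨b, h', rfl⟩ := hlab y hy
    rw [hg, hg] at e
    obtain rfl := H'.eq_of_mem (hmem' a h) (e ▸ hmem' b h')
    rw [(L' a).inj e]
  · intro x hx
    obtain ⟨a, h, rfl⟩ := hlab x hx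
    rw [hg, ← (L a).neg, hg, (L' a).neg]

/-- The value of a function on codes at the union of a family of diagrams. -/
def glueVal {A : Type*} [Fintype A] (f : List (Fin m × ℤ) → Multiset (Fin 3 → ℤ) → ℝ)
    (c : A → Diagram m) : ℝ :=
  f (∑ a, ((exists_isFamily c).choose a).1).toList (∑ a, ((exists_isFamily c).choose a).2)

theorem IsFamily.glueVal_eq {A : Type*} [Fintype A] {c : A → Diagram m}
    {D : A → Multiset (Fin m × ℤ) × Multiset (Fin 3 → ℤ)} (H : IsFamily c D)
    {f : List (Fin m × ℤ) → Multiset (Fin 3 → ℤ) → ℝ} (hf : IsCodeFun f)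
    (hs : IsPermInvariant f (∑ a, (c a).f)) {w : List (Fin m × ℤ)}
    (hw : (w : Multiset (Fin m × ℤ)) = ∑ a, (D a).1) :
    glueVal f c = f w (∑ a, (D a).2) :=
  (exists_isFamily c).choose_spec.value_unique H hf hs (Multiset.coe_toList _) hw

theorem exists_coe_eq (W : Multiset (Fin m × ℤ)) :
    ∃ w : List (Fin m × ℤ), (w : Multiset (Fin m × ℤ)) = W := ⟨W.toList, W.coe_toList⟩

theorem glueVal_comp {A A' : Type*} [Fintype A] [Fintype A'] (σ : A' ≃ A) (c : A → Diagram m)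
    {f : List (Fin m × ℤ) → Multiset (Fin 3 → ℤ) → ℝ} (hf : IsCodeFun f)
    (hs : IsPermInvariant f (∑ a, (c a).f)) : glueVal f (fun a => c (σ a)) = glueVal f c := by
  obtain ⟨D, H⟩ := exists_isFamily c
  have H' : IsFamily (fun a => c (σ a)) fun a => D (σ a) := by
    refine ⟨fun a => H.code _, ?_⟩
    rw [Equiv.sum_comp σ fun a => (D a).1, Equiv.sum_comp σ fun a => (D a).2]
    exact H.nodup
  obtain ⟨w, hw⟩ := exists_coe_eq (∑ a, (D a).1)
  rw [H.glueVal_eq hf hs hw, H'.glueVal_eq hf _ (w := w), Equiv.sum_comp σ fun a => (D a).2]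
  · rw [Equiv.sum_comp σ fun a => (D a).1, hw]
  · rwa [Equiv.sum_comp σ fun a => (c a).f]

/-! ### Replacing one member of a family -/

section Update

variable {A : Type*} [Fintype A] [DecidableEq A] {c : A → Diagram m}
  {D : A → Multiset (Fin m × ℤ) × Multiset (Fin 3 → ℤ)}

theorem sum_update_snd {M N : Type*} [AddCommMonoid N] (p : M → N) (D : A → M) (a : A) (X : M) :
    ∑ b, p (Function.update D a X b) = p X + ∑ b ∈ Finset.univ.erase a, p (D b) := by
  rw [← Finset.add_sum_erase _ _ (Finset.mem_univ a), Function.update_self]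
  congr 1
  refine Finset.sum_congr rfl fun b hb => ?_
  rw [Function.update_of_ne (Finset.ne_of_mem_erase hb)]

theorem sum_eq_add_erase {N : Type*} [AddCommMonoid N] (g : A → N) (a : A) :
    ∑ b, g b = g a + ∑ b ∈ Finset.univ.erase a, g b :=
  (Finset.add_sum_erase _ _ (Finset.mem_univ a)).symm

theorem IsFamily.update (H : IsFamily c D) (a : A) {t : Diagram m}
    {X : Multiset (Fin m × ℤ) × Multiset (Fin 3 → ℤ)} (hX : LCode t X)
    (hlab : lab X.1 X.2 = lab (D a).1 (D a).2) :
    IsFamily (Function.update c a t) (Function.update D a X) := by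
  refine ⟨fun b => ?_, ?_⟩
  · by_cases hb : b = a
    · subst hb
      rwa [Function.update_self, Function.update_self]
    · rw [Function.update_of_ne hb, Function.update_of_ne hb]
      exact H.code b
  · have := H.nodup
    rw [lab_sum] at this ⊢
    convert this using 2 with b
    by_cases hb : b = a
    · subst hb
      rw [Function.update_self, hlab]
    · rw [Function.update_of_ne hb]

theorem sum_f_update {t : Diagram m} (a : A) (ht : t.f = (c a).f) :
    ∑ b, (Function.update c a t b).f = ∑ b, (c b).f := by
  refine Finset.sum_congr rfl fun b _ => ?_
  by_cases hb : b = a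
  · subst hb
    rw [Function.update_self, ht]
  · rw [Function.update_of_ne hb]

variable {f : List (Fin m × ℤ) → Multiset (Fin 3 → ℤ) → ℝ}

/-- As a function of one member, the value at a family changes by the sign of an isomorphism. With
the next lemma, it is a functional on oriented homotopy link diagrams. -/
theorem glueVal_update_iso (hf : IsCodeFun f) (hs : IsPermInvariant f (∑ a, (c a).f)) (a : A)
    {t : Diagram m} (φ : Iso (c a) t) :
    glueVal f c = φ.sign * glueVal f (Function.update c a t) := by
  obtain ⟨D, H⟩ := exists_isFamily c
  obtain ⟨w, ℓ, L, hw⟩ := H.code a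
  obtain ⟨T', L', hT, hsign⟩ := L.transport φ
  have hX : LCode t ((D a).1, T') := ⟨w, _, L', hw⟩
  have H' := H.update a hX (lab_rel hT).symm
  obtain ⟨v, hv⟩ := exists_coe_eq (∑ a, (D a).1)
  have hv' : (v : Multiset (Fin m × ℤ)) = ∑ b, (Function.update D a ((D a).1, T') b).1 := by
    rw [hv, sum_update_snd Prod.fst, sum_eq_add_erase (fun a => (D a).1) a]
  rw [H.glueVal_eq hf hs hv, H'.glueVal_eq hf (by rwa [sum_f_update a (free_card φ).symm]) hv',
    sum_update_snd Prod.snd, hsign hf, ← mul_assoc, φ.sign_mul_self, one_mul,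
    sum_eq_add_erase (fun a => (D a).2) a]

/-- A member is a sub-diagram of the union, and sub-diagrams inherit the homotopy link condition. -/
theorem glueVal_eq_zero (hf : IsCodeFun f) (hs : IsPermInvariant f (∑ a, (c a).f)) (a : A)
    (h : ¬ (c a).IsHomotopyLink) : glueVal f c = 0 := by
  obtain ⟨D, H⟩ := exists_isFamily c
  obtain ⟨v, hv⟩ := exists_coe_eq (∑ a, (D a).1)
  rw [H.glueVal_eq hf hs hv]
  refine hf.zero fun hc => h ?_
  obtain ⟨w, ℓ, L, hw⟩ := H.code a
  rw [L.isHomotopyLink_iff]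
  refine hc.mono L.valid (fun x hx => ?_) fun τ hτ => Multiset.mem_sum.2 ⟨a, Finset.mem_univ a, hτ⟩
  rw [← Multiset.mem_coe, hv]
  refine Multiset.mem_sum.2 ⟨a, Finset.mem_univ a, ?_⟩
  rwa [← hw]

/-- An IHX move in one member is an IHX move in the union; the triples of the other members are
carried along. -/
theorem glueVal_ihx (hf : IsCodeFun f) (hs : IsPermInvariant f (∑ a, (c a).f))
    (hihx : ∀ w e a b d d' T, Multiset.card T + 2 = ∑ a, (c a).f → ihxSum f w e a b d d' T = 0)
    (a : A) {u v : Fin (c a).f} (huv : u ≠ v) (he : (c a).e ((c a).half u 0) = (c a).half v 0) :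
    glueVal f c - glueVal f (Function.update c a ((c a).ihxH u v)) +
      glueVal f (Function.update c a ((c a).ihxX u v)) = 0 := by
  obtain ⟨D, H⟩ := exists_isFamily c
  obtain ⟨w, ℓ, L, hw⟩ := H.code a
  have LH : Labels ((c a).ihxH u v) w _ _ := L.reglue (permH (c a) u v) permH_symm_leg
  have LX : Labels ((c a).ihxX u v) w _ _ := L.reglue (permX (c a) u v) permX_symm_leg
  have L₀ := L.tri
  rw [tri_ihxI huv, ← he, L.neg] at L₀
  rw [tri_ihxH huv, ← he, L.neg] at LH
  rw [tri_ihxX huv, ← he, L.neg] at LX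
  set e := ℓ ((c a).half u 0)
  set T₀ := restTri (c a) u v ℓ
  have hl := lab_ihx (D a).1 e (ℓ ((c a).half u 2)) (ℓ ((c a).half u 1)) (ℓ ((c a).half v 1))
    (ℓ ((c a).half v 2)) T₀
  have hXH : LCode ((c a).ihxH u v) ((D a).1, ![e, ℓ ((c a).half u 2), ℓ ((c a).half v 1)] ::ₘ
      ![-e, ℓ ((c a).half v 2), ℓ ((c a).half u 1)] ::ₘ T₀) := ⟨w, _, LH, hw⟩
  have hXX : LCode ((c a).ihxX u v) ((D a).1, ![e, ℓ ((c a).half u 1), ℓ ((c a).half v 1)] ::ₘ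
      ![-e, ℓ ((c a).half v 2), ℓ ((c a).half u 2)] ::ₘ T₀) := ⟨w, _, LX, hw⟩
  have HH := H.update a hXH (by rw [L₀]; exact hl.1)
  have HX := H.update a hXX (by rw [L₀]; exact hl.2)
  obtain ⟨z, hz⟩ := exists_coe_eq (∑ a, (D a).1)
  have hz' : ∀ T', (z : Multiset (Fin m × ℤ)) = ∑ b, (Function.update D a ((D a).1, T') b).1 := by
    intro T'
    rw [hz, sum_update_snd Prod.fst, sum_eq_add_erase (fun a => (D a).1) a]
  have hcard := H.card
  rw [H.glueVal_eq hf hs hz, HH.glueVal_eq hf (by rwa [sum_f_update (t := (c a).ihxH u v) a rfl]) (hz' _),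
    HX.glueVal_eq hf (by rwa [sum_f_update (t := (c a).ihxX u v) a rfl]) (hz' _), sum_update_snd Prod.snd,
    sum_update_snd Prod.snd]
  rw [sum_eq_add_erase (fun a => (D a).2) a, L₀] at hcard ⊢
  simp only [Multiset.cons_add] at hcard ⊢
  refine hihx z e _ _ _ _ (T₀ + ∑ b ∈ Finset.univ.erase a, (D b).2) ?_
  rw [← hcard]
  simp

end Update

/-! ### Shuffle products evaluated at families of trees -/

theorem filter_sum_eq {A α : Type*} [Fintype A] [DecidableEq A] (M : A → Multiset α) (a : A)
    (p : α → Prop) [DecidablePred p] (h : ∀ x ∈ M a, p x) (h' : ∀ b ≠ a, ∀ x ∈ M b, ¬ p x) :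
    (∑ b, M b).filter p = M a := by
  rw [sum_eq_add_erase M a, Multiset.filter_add, Multiset.filter_eq_self.2 h,
    Multiset.filter_eq_nil.2, add_zero]
  intro x hx
  obtain ⟨b, hb, hxb⟩ := Multiset.mem_sum.1 hx
  exact h' b (Finset.ne_of_mem_erase hb) x hxb

theorem matchSum_image {A B ι : Type*} [DecidableEq A] [DecidableEq B] (xs : List ι)
    (F : ι → B → ℝ) {P : A → B} (hP : Function.Injective P) (s : Finset A) :
    matchSum (xs.map F) (s.image P) = matchSum (xs.map fun x a => F x (P a)) s := by
  induction xs generalizing s with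
  | nil => simp [matchSum]
  | cons x xs ih =>
    rw [List.map_cons, List.map_cons, matchSum, matchSum, Finset.sum_image fun a _ b _ h => hP h]
    refine Finset.sum_congr rfl fun a _ => ?_
    rw [← ih, Finset.image_erase hP]

theorem mem_lab_of_mem_word {W : Multiset (Fin m × ℤ)} {T : Multiset (Fin 3 → ℤ)} {x : Fin m × ℤ}
    (h : x ∈ W) : x.2 ∈ lab W T := mem_lab.2 (Or.inl ⟨x.1, h⟩)

theorem mem_lab_of_mem_tri {W : Multiset (Fin m × ℤ)} {T : Multiset (Fin 3 → ℤ)} {τ : Fin 3 → ℤ}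
    (h : τ ∈ T) (c : Fin 3) : τ c ∈ lab W T := mem_lab.2 (Or.inr ⟨τ, h, c, rfl⟩)

section

variable {A : Type*} [Fintype A] {c : A → Diagram m}
  {D : A → Multiset (Fin m × ℤ) × Multiset (Fin 3 → ℤ)} {w : List (Fin m × ℤ)}

theorem IsFamily.isClosedSet (H : IsFamily c D) (hw : (w : Multiset (Fin m × ℤ)) = ∑ a, (D a).1)
    (a : A) : IsClosedSet (w : Multiset (Fin m × ℤ)) (∑ a, (D a).2)
      (lab (D a).1 (D a).2).toFinset := by
  refine ⟨fun x hx => ?_, fun x hx => ?_, fun τ hτ t => ?_⟩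
  · rw [Multiset.mem_toFinset] at hx
    rw [hw, lab_sum, Multiset.mem_sum]
    exact ⟨a, Finset.mem_univ a, hx⟩
  · rw [Multiset.mem_toFinset] at hx ⊢
    exact (H.code a).valid.neg x hx
  · obtain ⟨b, -, hb⟩ := Multiset.mem_sum.1 hτ
    rw [Multiset.mem_toFinset, Multiset.mem_toFinset]
    constructor
    · intro h
      obtain rfl := H.eq_of_mem h (mem_lab_of_mem_tri hb t)
      exact mem_lab_of_mem_tri hb 0
    · intro h
      obtain rfl := H.eq_of_mem h (mem_lab_of_mem_tri hb 0)
      exact mem_lab_of_mem_tri hb t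

theorem IsFamily.inTri_eq (H : IsFamily c D) (a : A) :
    inTri (lab (D a).1 (D a).2).toFinset (∑ a, (D a).2) = (D a).2 := by
  classical
  refine filter_sum_eq (fun a => (D a).2) a _ (fun τ hτ => ?_) fun b hb τ hτ h => hb ?_
  · rw [Multiset.mem_toFinset]
    exact mem_lab_of_mem_tri hτ 0
  · rw [Multiset.mem_toFinset] at h
    exact H.eq_of_mem (mem_lab_of_mem_tri hτ 0) h

theorem IsFamily.inWord_eq (H : IsFamily c D) (hw : (w : Multiset (Fin m × ℤ)) = ∑ a, (D a).1)
    (a : A) : (inWord (lab (D a).1 (D a).2).toFinset w : Multiset (Fin m × ℤ)) = (D a).1 := by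
  classical
  rw [inWord, ← Multiset.filter_coe, hw]
  refine filter_sum_eq (fun a => (D a).1) a _ (fun x hx => ?_) fun b hb x hx h => hb ?_
  · rw [Multiset.mem_toFinset]
    exact mem_lab_of_mem_word hx
  · rw [Multiset.mem_toFinset] at h
    exact H.eq_of_mem (mem_lab_of_mem_word hx) h

theorem IsFamily.exists_labels_in (H : IsFamily c D)
    (hw : (w : Multiset (Fin m × ℤ)) = ∑ a, (D a).1) {a : A} (hc : (c a).IsHomotopyLink)
    (hc' : (c a).Conn) :
    ∃ ℓ, Labels (c a) (inWord (lab (D a).1 (D a).2).toFinset w)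
      (inTri (lab (D a).1 (D a).2).toFinset (∑ a, (D a).2)) ℓ := by
  obtain ⟨v, ℓ, L, hv⟩ := H.code a
  refine ⟨ℓ, ?_⟩
  rw [H.inTri_eq a]
  refine L.congr_word fun i => onSeg_eq_of_perm ?_ ?_
  · rw [← Multiset.coe_eq_coe, hv, H.inWord_eq hw]
  · rw [L.card_word]
    exact hc.q_le_one hc' i

/-- The components of the union of connected diagrams are its members, so matching factors to
components means matching factors to members. -/
theorem glueVal_shuffleProd [DecidableEq A] (hc : ∀ a, (c a).IsHomotopyLink ∧ (c a).Conn)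
    (xs : List (HT m)) (hxs : ∀ x ∈ xs, ∃ I, x ∈ treeSpace I) :
    glueVal (fun w T => evL w T (shuffleProd xs)) c =
      matchSum (xs.map fun x a => coeff (c a) x) Finset.univ := by
  obtain ⟨D, H⟩ := exists_isFamily c
  obtain ⟨w, hw⟩ := exists_coe_eq (∑ a, (D a).1)
  rw [H.glueVal_eq (isCodeFun_evL _) (fun v v' T _ h => evL_shuffleProd_perm h xs hxs) hw]
  have hv : Valid (w : Multiset (Fin m × ℤ)) (∑ a, (D a).2) := hw ▸ H.valid
  have hcomp : ∀ a, IsComp (w : Multiset (Fin m × ℤ)) (∑ a, (D a).2)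
      (lab (D a).1 (D a).2).toFinset := fun a => by
    obtain ⟨ℓ, L⟩ := H.exists_labels_in hw (hc a).1 (hc a).2
    exact isComp_of_conn (H.isClosedSet hw a) L
      (Multiset.rel_refl_of_refl_on fun τ _ => ⟨1, rfl⟩) (hc a).2
  have hcomps : comps w (∑ a, (D a).2) =
      Finset.univ.image fun a => (lab (D a).1 (D a).2).toFinset := by
    ext P
    rw [mem_comps, Finset.mem_image]
    constructor
    · intro hP
      obtain ⟨x, hx⟩ := hP.nonempty
      have := hP.closed.sub x hx
      rw [hw, lab_sum, Multiset.mem_sum] at this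
      obtain ⟨a, ha, hxa⟩ := this
      refine ⟨a, ha, ?_⟩
      by_contra hne
      exact Finset.disjoint_left.1 ((hcomp a).disjoint hP hne) (Multiset.mem_toFinset.2 hxa) hx
    · rintro ⟨a, -, rfl⟩
      exact hcomp a
  have hinj : Function.Injective fun a => (lab (D a).1 (D a).2).toFinset := by
    intro a b hab
    obtain ⟨x, hx⟩ := (hcomp a).nonempty
    have hx' : x ∈ (lab (D b).1 (D b).2).toFinset := by
      have h : (lab (D a).1 (D a).2).toFinset = (lab (D b).1 (D b).2).toFinset := hab
      rwa [← h]
    exact H.eq_of_mem (Multiset.mem_toFinset.1 hx) (Multiset.mem_toFinset.1 hx')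
  rw [evL_shuffleProd hv xs hxs, hcomps, matchSum_image _ _ hinj]
  refine matchSum_congr xs fun x _ a _ => ?_
  obtain ⟨ℓ, L⟩ := H.exists_labels_in hw (hc a).1 (hc a).2
  exact evL_of_labels L x

end

/-! ### Decomposition into trees -/

theorem filter_sum_of_unique {α : Type*} (M : Multiset α) (κ : α → ℤ) (S : Finset (Finset ℤ))
    (h : ∀ x ∈ M, ∃ P ∈ S, κ x ∈ P) (hd : ∀ P ∈ S, ∀ Q ∈ S, P ≠ Q → Disjoint P Q) :
    ∑ P : S, M.filter (fun x => κ x ∈ P.1) = M := by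
  induction M using Multiset.induction_on with
  | empty => simp
  | cons x M ih =>
    obtain ⟨P, hP, hx⟩ := h x (Multiset.mem_cons_self _ _)
    simp only [Multiset.filter_cons]
    rw [Finset.sum_add_distrib, ih fun y hy => h y (Multiset.mem_cons_of_mem hy),
      Fintype.sum_eq_single ⟨P, hP⟩, if_pos hx, Multiset.singleton_add]
    intro Q hQ
    rw [if_neg]
    exact fun hxQ => Finset.disjoint_left.1 (hd _ Q.2 _ hP fun e => hQ (Subtype.ext e)) hxQ hx

/-- The value of a symmetric function at a diagram is the value at the family of its
components. -/
theorem CodeHL.exists_family {w : List (Fin m × ℤ)} {T : Multiset (Fin 3 → ℤ)} (H : CodeHL w T) :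
    ∃ (S : Finset (Finset ℤ)) (c : S → Diagram m), (∀ a, (c a).IsHomotopyLink ∧ (c a).Conn) ∧
      ∑ a, (c a).f = Multiset.card T ∧ ∑ a, ∑ i, (c a).q i = w.length ∧
      ∀ f, IsCodeFun f → IsPermInvariant f (Multiset.card T) → glueVal f c = f w T := by
  have hv := H.valid
  have hcomp : ∀ P : comps w T, IsComp (w : Multiset (Fin m × ℤ)) T P.1 := fun P => mem_comps.1 P.2
  have hval : ∀ P : comps w T, Valid (inWord P.1 w : Multiset (Fin m × ℤ)) (inTri P.1 T) :=
    fun P => hv.inCode (hcomp P).closed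
  choose c ℓ L using fun P => (hval P).exists_labels
  have hdisj : ∀ P ∈ comps w T, ∀ Q ∈ comps w T, P ≠ Q → Disjoint P Q := fun P hP Q hQ h =>
    (mem_comps.1 hP).disjoint (mem_comps.1 hQ) h
  have hex : ∀ x ∈ lab (w : Multiset (Fin m × ℤ)) T, ∃ P ∈ comps w T, x ∈ P := fun x hx => by
    obtain ⟨P, hP, hxP⟩ := hv.exists_comp hx
    exact ⟨P, mem_comps.2 hP, hxP⟩
  have hT : ∑ P : comps w T, inTri P.1 T = T :=
    filter_sum_of_unique T (fun τ => τ 0) _ (fun τ hτ => hex _ (mem_lab_of_mem_tri hτ 0)) hdisj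
  have hW : ∑ P : comps w T, (inWord P.1 w : Multiset (Fin m × ℤ)) = w := by
    rw [← filter_sum_of_unique (w : Multiset (Fin m × ℤ)) (fun x => x.2) (comps w T)
      (fun x hx => hex _ (mem_lab_of_mem_word hx)) hdisj]
    refine Finset.sum_congr rfl fun P _ => ?_
    rw [Multiset.filter_coe, inWord]
  have hF : IsFamily c fun P : comps w T =>
      ((inWord P.1 w : Multiset (Fin m × ℤ)), inTri P.1 T) := by
    refine ⟨fun P => ⟨_, ℓ P, L P, rfl⟩, ?_⟩
    rw [hW, hT]
    exact hv.nodup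
  have hcard : ∑ a, (c a).f = Multiset.card T := by
    rw [← hF.card, hT]
  refine ⟨comps w T, c, fun P => ⟨?_, ?_⟩, hcard, ?_, fun f hf hs => ?_⟩
  · rw [(L P).isHomotopyLink_iff]
    exact H.mono (hval P) (fun x hx => List.mem_of_mem_filter hx)
      fun τ hτ => Multiset.mem_of_mem_filter hτ
  · have hmem : ∀ {x}, x ∈ P.1 ↔ ∃ h, ℓ P h = x := fun {x} => by
      rw [← (L P).mem_lab_iff, mem_lab_in (hcomp P).closed]
    obtain ⟨x₀, hx₀⟩ := (hcomp P).nonempty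
    obtain ⟨h₀, -⟩ := hmem.1 hx₀
    refine ⟨⟨h₀⟩, fun Q hQ hQ' ⟨h₁, hh₁⟩ h => ?_⟩
    classical
    -- A set of half-edges of one part that is closed under edges and free vertices gives a closed
    -- set of labels of the whole code. Minimality of the component `P` forces it to be everything.
    have hcl : IsClosedSet (w : Multiset (Fin m × ℤ)) T
        (Finset.univ.filter (· ∈ Q) |>.image (ℓ P)) := by
      refine ((isClosedSet_in (hcomp P).closed).1 ⟨fun x hx => ?_, fun x hx => ?_,
        fun τ hτ t => ?_⟩).1
      · obtain ⟨h, -, rfl⟩ := Finset.mem_image.1 hx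
        exact (L P).mem_lab_iff.2 ⟨h, rfl⟩
      · obtain ⟨h, hh, rfl⟩ := Finset.mem_image.1 hx
        rw [← (L P).neg]
        exact Finset.mem_image_of_mem _ (by simpa using hQ h (by simpa using hh))
      · obtain ⟨v, hv⟩ := (L P).exists_half hτ
        have : ∀ t, τ t ∈ (Finset.univ.filter (· ∈ Q) |>.image (ℓ P)) ↔ (c P).half v t ∈ Q := by
          intro t
          rw [← hv t, (L P).inj.mem_finset_image]
          simp
        rw [this, this]
        exact ⟨hQ' v t 0, hQ' v 0 t⟩
    have := (hcomp P).eq_of_subset _ hcl (fun x hx => ?_) ⟨ℓ P h₁, ?_⟩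
    · have hh : ℓ P h ∈ P.1 := hmem.2 ⟨h, rfl⟩
      rw [← this, (L P).inj.mem_finset_image] at hh
      simpa using hh
    · obtain ⟨h, -, rfl⟩ := Finset.mem_image.1 hx
      exact hmem.2 ⟨h, rfl⟩
    · exact Finset.mem_image_of_mem _ (by simpa using hh₁)
  · have := congrArg Multiset.card hW
    rw [Multiset.card_sum] at this
    rw [← Multiset.coe_card, ← this]
    refine Finset.sum_congr rfl fun P _ => ?_
    rw [Multiset.coe_card, (L P).length_word]
  · rw [hF.glueVal_eq hf (hcard ▸ hs) hW.symm, hT]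

/-! ### Dependence on one member of a family -/

section Slot

variable {A : Type*} [Fintype A] [DecidableEq A] (c : A → Diagram m) (a : A)
  (f : List (Fin m × ℤ) → Multiset (Fin 3 → ℤ) → ℝ) (I : Finset (Fin m))

open Classical in
/-- The value at a family as a function of one of its members. -/
def slotFun (t : Diagram m) : ℝ :=
  if t.IsTreeLike I then glueVal f (Function.update c a t) else 0

/-- The solution of the IHX conditions given by the dependence on one member of a family. -/
def slotVec : HT m := recon (trees I) (slotFun c a f I)

variable {c a f I}

theorem perm_update (ha : (c a).IsTreeLike I) (hs : IsPermInvariant f (∑ b, (c b).f))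
    {t : Diagram m} (ht : t.IsTreeLike I) :
    IsPermInvariant f (∑ b, (Function.update c a t b).f) := by
  have h1 := ha.card
  have h2 := ht.card
  rwa [sum_f_update a (by omega)]

theorem isDiagramFun_slotFun (hf : IsCodeFun f) (hs : IsPermInvariant f (∑ b, (c b).f))
    (ha : (c a).IsTreeLike I) : IsDiagramFun (slotFun c a f I) where
  zero {t} h := by
    rw [slotFun]
    split_ifs with ht
    · exact glueVal_eq_zero hf (perm_update ha hs ht) a (by rwa [Function.update_self])
    · rfl
  iso {t t'} φ := by
    rw [slotFun, slotFun]
    by_cases ht : t.IsTreeLike I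
    · rw [if_pos ht, if_pos (ht.of_iso φ)]
      have key : ∃ φ' : Iso (Function.update c a t a) t', φ'.sign = φ.sign := by
        have : ∀ s, s = t → ∃ φ' : Iso s t', φ'.sign = φ.sign := by
          rintro s rfl
          exact ⟨φ, rfl⟩
        exact this _ (Function.update_self ..)
      obtain ⟨φ', hφ'⟩ := key
      rw [glueVal_update_iso hf (perm_update ha hs ht) a φ', hφ', Function.update_idem]
    · rw [if_neg ht, if_neg fun h => ht (h.of_iso φ.symm), mul_zero]

theorem coeff_slotVec (hf : IsCodeFun f) (hs : IsPermInvariant f (∑ b, (c b).f))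
    (ha : (c a).IsTreeLike I) (t : Diagram m) :
    coeff t (slotVec c a f I) = slotFun c a f I t := by
  have hd := isDiagramFun_slotFun hf hs ha
  by_cases ht : t.IsTree I
  · exact coeff_recon hd ⟨t, mem_trees.2 ht, ⟨Iso.refl t⟩⟩
  · rw [slotVec, coeff_treeSpace (recon_mem_treeSpace I _) ht]
    symm
    by_cases h : t.IsHomotopyLink
    · rw [slotFun, if_neg fun h' => ht ⟨h, h'⟩]
    · exact hd.zero h

theorem slotFun_ihx (hf : IsCodeFun f) (hs : IsPermInvariant f (∑ b, (c b).f))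
    (hihx : ∀ w e a b d d' T, Multiset.card T + 2 = ∑ a, (c a).f → ihxSum f w e a b d d' T = 0)
    (ha : (c a).IsTreeLike I) {t : Diagram m} {u v : Fin t.f} (huv : u ≠ v)
    (he : t.e (t.half u 0) = t.half v 0) :
    slotFun c a f I t - slotFun c a f I (t.ihxH u v) + slotFun c a f I (t.ihxX u v) = 0 := by
  rw [slotFun, slotFun, slotFun]
  by_cases ht : t.IsTreeLike I
  · rw [if_pos ht, if_pos ((isTreeLike_ihxH huv he).2 ht), if_pos ((isTreeLike_ihxX huv he).2 ht)]
    have h1 := ha.card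
    have h2 := ht.card
    have hsum := sum_f_update (c := c) (t := t) a (by omega)
    have hs' := perm_update ha hs ht
    rw [← hsum] at hihx
    have key : ∀ (c' : A → Diagram m), IsPermInvariant f (∑ b, (c' b).f) →
        (∀ w e a b d d' T, Multiset.card T + 2 = ∑ a, (c' a).f → ihxSum f w e a b d d' T = 0) →
        ∀ t : Diagram m, c' a = t → ∀ u v : Fin t.f, u ≠ v → t.e (t.half u 0) = t.half v 0 →
        glueVal f c' - glueVal f (Function.update c' a (t.ihxH u v)) +
          glueVal f (Function.update c' a (t.ihxX u v)) = 0 := by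
      rintro c' h1 h2 t rfl u v huv he
      exact glueVal_ihx hf h1 h2 a huv he
    have := key _ hs' hihx t (Function.update_self ..) u v huv he
    rwa [Function.update_idem, Function.update_idem] at this
  · rw [if_neg ht, if_neg fun h => ht ((isTreeLike_ihxH huv he).1 h),
      if_neg fun h => ht ((isTreeLike_ihxX huv he).1 h)]
    simp

/-- With the other members frozen, the leading coefficients form a solution of the IHX conditions in
the remaining tree. This is what permits the passage from functions on families to tensors one
factor at a time. -/
theorem slotVec_mem (hf : IsCodeFun f) (hs : IsPermInvariant f (∑ b, (c b).f))
    (hihx : ∀ w e a b d d' T, Multiset.card T + 2 = ∑ a, (c a).f → ihxSum f w e a b d d' T = 0)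
    (ha : (c a).IsTreeLike I) : slotVec c a f I ∈ ihxPerp I := by
  refine ⟨recon_mem_treeSpace I _, ?_⟩
  simp only [SetLike.mem_coe, Submodule.mem_iInf, LinearMap.mem_ker, LinearMap.add_apply,
    LinearMap.sub_apply]
  rintro t u v ⟨huv, he⟩
  rw [coeff_slotVec hf hs ha, coeff_slotVec hf hs ha, coeff_slotVec hf hs ha]
  exact slotFun_ihx hf hs hihx ha huv he

end Slot

/-! ### Sums over bijections -/

section Match

variable {B ι : Type*} [Fintype B] [DecidableEq B]

theorem matchSum_ofFn {r : ℕ} (F : Fin r → B → ℝ) (s : Finset B) :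
    matchSum (List.ofFn F) s = ∑ g : Fin r → B,
      open Classical in
      if Function.Injective g ∧ Finset.univ.image g = s then ∏ j, F j (g j) else 0 := by
  classical
  induction r generalizing s with
  | zero =>
    rw [Fintype.sum_unique]
    simp [matchSum, Function.injective_of_subsingleton, eq_comm]
  | succ r ih =>
    rw [List.ofFn_succ, matchSum, ← (Fin.consEquiv fun _ => B).sum_comp, Fintype.sum_prod_type,
      ← Finset.sum_subset (Finset.subset_univ s)]
    · refine Finset.sum_congr rfl fun b hb => ?_
      rw [ih, Finset.mul_sum]
      refine Finset.sum_congr rfl fun g _ => ?_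
      have hiff : (Function.Injective g ∧ Finset.univ.image g = s.erase b) ↔
          (Function.Injective (Fin.cons b g : Fin (r + 1) → B) ∧
            Finset.univ.image (Fin.cons b g : Fin (r + 1) → B) = s) := by
        have himg : Finset.univ.image (Fin.cons b g : Fin (r + 1) → B) =
            insert b (Finset.univ.image g) := by
          ext x
          simp [Fin.exists_fin_succ, eq_comm]
        rw [Fin.cons_injective_iff, himg]
        constructor
        · rintro ⟨h1, h2⟩
          refine ⟨⟨fun h => ?_, h1⟩, by rw [h2, Finset.insert_erase hb]⟩
          have : b ∈ Finset.univ.image g := by simpa using h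
          rw [h2] at this
          simp at this
        · rintro ⟨⟨h1, h2⟩, h3⟩
          refine ⟨h2, ?_⟩
          rw [← h3, Finset.erase_insert]
          simpa using h1
      simp only [Fin.consEquiv, Equiv.coe_fn_mk, hiff]
      rw [mul_ite, mul_zero, Fin.prod_univ_succ]
      rfl
    · intro b _ hb
      refine Finset.sum_eq_zero fun g _ => if_neg fun h => hb ?_
      rw [← h.2]
      exact Finset.mem_image.2 ⟨0, Finset.mem_univ _, rfl⟩

/-- Between sets of equal size the sum over matchings is a permanent; if the sizes differ, both
sides are zero. -/
theorem matchSum_univ [Fintype ι] [DecidableEq ι] (L : List ι) (hL : L.Nodup) (hL' : ∀ i, i ∈ L)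
    (F : ι → B → ℝ) :
    matchSum (L.map F) Finset.univ = ∑ β : ι ≃ B, ∏ j, F j (β j) := by
  classical
  let E : Fin L.length ≃ ι := hL.getEquivOfForallMemList L hL'
  have h1 : L.map F = List.ofFn fun i => F (E i) := by
    conv_lhs => rw [← List.ofFn_get L, List.map_ofFn]
    rfl
  rw [h1, matchSum_ofFn, ← Finset.sum_filter]
  refine Finset.sum_bij' (fun g hg => E.symm.trans (Equiv.ofBijective g ?_)) (fun β _ => E.trans β)
    ?_ ?_ ?_ ?_ ?_
  · rw [Finset.mem_filter] at hg
    exact ⟨hg.2.1, fun b => by simpa using (hg.2.2 ▸ Finset.mem_univ b : b ∈ Finset.univ.image g)⟩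
  · exact fun _ _ => Finset.mem_univ _
  · intro β _
    rw [Finset.mem_filter]
    exact ⟨Finset.mem_univ _, (E.trans β).injective,
      Finset.image_univ_of_surjective (E.trans β).surjective⟩
  · intro g _
    funext i
    exact congrArg g (E.symm_apply_apply i)
  · intro β _
    ext i
    simp
  · intro g _
    rw [← E.prod_comp]
    refine Finset.prod_congr rfl fun j _ => ?_
    rw [Equiv.trans_apply, Equiv.symm_apply_apply]
    rfl

end Match

/-! ### Symmetric tensors -/

/-- The positions in a product with multiplicities `ν`. -/
abbrev SIdx (ν : LabelSet m → ℕ) : Type := Σ I : LabelSet m, Fin (ν I)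

/-- The symmetric tensor product, as a multilinear map. -/
def symProd (ν : LabelSet m → ℕ) :
    MultilinearMap ℝ (fun j : SIdx ν => ihxPerp j.1.1) (SymTensor ν) :=
  MultilinearMap.compMultilinearMap (β := fun I : LabelSet m => Fin (ν I))
    (N := fun I _ => ihxPerp I.1) (M₁ := fun I => SymmetricPower ℝ (Fin (ν I)) (ihxPerp I.1))
    (PiTensorProduct.tprod ℝ) fun _ => SymmetricPower.tprod ℝ

theorem symProd_apply (ν : LabelSet m → ℕ) (x : ∀ j : SIdx ν, ihxPerp j.1.1) :
    symProd ν x = PiTensorProduct.tprod ℝ fun I => SymmetricPower.tprod ℝ fun k => x ⟨I, k⟩ := rfl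

theorem span_symProd (ν : LabelSet m → ℕ) :
    Submodule.span ℝ (Set.range (symProd ν)) = ⊤ := by
  rw [← top_le_iff, ← PiTensorProduct.submodule_span_eq_top
    (g := fun (I : LabelSet m) (x : Fin (ν I) → ihxPerp I.1) => SymmetricPower.tprod ℝ x)
    fun I => SymmetricPower.span_tprod_eq_top ℝ (Fin (ν I)) (ihxPerp I.1), Submodule.span_le]
  rintro _ ⟨x, rfl⟩
  exact Submodule.subset_span ⟨fun j => x j.1 j.2, rfl⟩

/-- A single tree need not satisfy IHX, so it has to be projected before it can enter a symmetric
tensor. The choice of projection is harmless, as it is the identity on solutions. -/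
theorem exists_retr (I : LabelSet m) :
    ∃ g : HT m →ₗ[ℝ] ihxPerp I.1, g ∘ₗ (ihxPerp I.1).subtype = LinearMap.id :=
  LinearMap.exists_leftInverse_of_injective _ (Submodule.ker_subtype _)

/-- A projection to the space of solutions of the IHX conditions. -/
def retr (I : LabelSet m) : HT m →ₗ[ℝ] ihxPerp I.1 := (exists_retr I).choose

theorem retr_coe (I : LabelSet m) (x : ihxPerp I.1) : retr I x = x :=
  LinearMap.congr_fun (exists_retr I).choose_spec x

/-- The symmetric tensor product of projections to the spaces of solutions of the IHX conditions. -/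
def symProj (ν : LabelSet m → ℕ) : MultilinearMap ℝ (fun _ : SIdx ν => HT m) (SymTensor ν) :=
  (symProd ν).compLinearMap fun j => retr j.1

theorem symProj_coe (ν : LabelSet m → ℕ) (x : ∀ j : SIdx ν, ihxPerp j.1.1) :
    symProj ν (fun j => (x j : HT m)) = symProd ν x := by
  rw [symProj, MultilinearMap.compLinearMap_apply]
  simp only [retr_coe]

/-- The bijections of positions that preserve the sets of labels. -/
abbrev TypeEquiv (ν ν' : LabelSet m → ℕ) : Type :=
  {γ : SIdx ν ≃ SIdx ν' // ∀ a, (γ a).1 = a.1}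

theorem TypeEquiv.exists_perm {ν ν' : LabelSet m → ℕ} (γ : TypeEquiv ν ν') :
    ∃ π : ∀ I, Fin (ν I) ≃ Fin (ν' I), ∀ I j, γ.1 ⟨I, j⟩ = ⟨I, π I j⟩ := by
  have h : ∀ I j, ∃ j', γ.1 ⟨I, j⟩ = ⟨I, j'⟩ := fun I j => by
    have := γ.2 ⟨I, j⟩
    generalize γ.1 ⟨I, j⟩ = b at this
    obtain ⟨J, j'⟩ := b
    dsimp only at this
    subst this
    exact ⟨j', rfl⟩
  have h' : ∀ I j, ∃ j', γ.1.symm ⟨I, j⟩ = ⟨I, j'⟩ := fun I j => by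
    have := γ.2 (γ.1.symm ⟨I, j⟩)
    rw [Equiv.apply_symm_apply] at this
    generalize γ.1.symm ⟨I, j⟩ = b at this
    obtain ⟨J, j'⟩ := b
    dsimp only at this
    subst this
    exact ⟨j', rfl⟩
  choose p hp using h
  choose p' hp' using h'
  refine ⟨fun I => ⟨p I, p' I, fun j => ?_, fun j => ?_⟩, hp⟩
  · have := hp' I (p I j)
    rw [← hp, Equiv.symm_apply_apply] at this
    simpa using this.symm
  · have := hp I (p' I j)
    rw [← hp', Equiv.apply_symm_apply] at this
    simpa using this.symm

theorem TypeEquiv.eq {ν ν' : LabelSet m → ℕ} (γ : TypeEquiv ν ν') : ν = ν' := by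
  obtain ⟨π, -⟩ := γ.exists_perm
  funext I
  simpa using Fintype.card_congr (π I)

theorem symProj_comp {ν : LabelSet m → ℕ} (γ : TypeEquiv ν ν) (x : SIdx ν → HT m) :
    symProj ν (fun j => x (γ.1 j)) = symProj ν x := by
  obtain ⟨π, hπ⟩ := γ.exists_perm
  rw [symProj, MultilinearMap.compLinearMap_apply, MultilinearMap.compLinearMap_apply,
    symProd_apply, symProd_apply]
  congr 1
  funext I
  simp only [hπ]
  exact SymmetricPower.tprod_equiv (π I) fun k => retr I (x ⟨I, k⟩)

/-! ### The symbol of a combination of diagrams as a symmetric tensor -/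

open Classical in
/-- A diagram, divided by the number of elements of `s` isomorphic to it. -/
def normDiag (s : Finset (Diagram m)) (t : Diagram m) : HT m := (isoCount s t)⁻¹ • diag t

theorem recon_eq_sum_normDiag (s : Finset (Diagram m)) (f : Diagram m → ℝ) :
    recon s f = ∑ t ∈ s, f t • normDiag s t := by
  rw [recon]
  refine Finset.sum_congr rfl fun t _ => ?_
  rw [normDiag, smul_smul, div_eq_mul_inv]

/-- The value of a combination of diagrams at the disjoint union of a family of diagrams. -/
def glueCoeff {A : Type*} [Fintype A] (c : A → Diagram m) : HT m →ₗ[ℝ] ℝ :=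
  evL (∑ a, ((exists_isFamily c).choose a).1).toList (∑ a, ((exists_isFamily c).choose a).2)

open Classical in
/-- The families of trees with given sets of labels. -/
def treeFamilies (ν : LabelSet m → ℕ) : Finset (SIdx ν → Diagram m) :=
  Fintype.piFinset fun j => trees j.1.1

open Classical in
/-- The part of a combination of diagrams given by forests with multiplicities `ν`. -/
def symPart (ν : LabelSet m → ℕ) : HT m →ₗ[ℝ] SymTensor ν :=
  (Nat.card (TypeEquiv ν ν) : ℝ)⁻¹ • ∑ c ∈ treeFamilies ν,
    (glueCoeff c).smulRight (symProj ν fun j => normDiag (trees j.1.1) (c j))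

theorem symPart_apply (ν : LabelSet m → ℕ) (x : HT m) :
    symPart ν x = (Nat.card (TypeEquiv ν ν) : ℝ)⁻¹ • ∑ c ∈ treeFamilies ν,
      glueVal (fun w T => evL w T x) c • symProj ν fun j => normDiag (trees j.1.1) (c j) := by
  rw [symPart, LinearMap.smul_apply, LinearMap.sum_apply]
  rfl

theorem isTree_of_mem_treeFamilies {ν : LabelSet m → ℕ} {c : SIdx ν → Diagram m}
    (hc : c ∈ treeFamilies ν) (j : SIdx ν) : (c j).IsTree j.1.1 :=
  mem_trees.1 (Fintype.mem_piFinset.1 hc j)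

/-- Each factor is expanded in trees by `recon`, and the tensor is multiplied out. -/
theorem sum_treeFamilies (ν : LabelSet m → ℕ) (x : SIdx ν → HT m) :
    ∑ c ∈ treeFamilies ν, (∏ j, coeff (c j) (x j)) •
        symProj ν (fun j => normDiag (trees j.1.1) (c j)) =
      symProj ν fun j => recon (trees j.1.1) fun t => coeff t (x j) := by
  classical
  simp only [recon_eq_sum_normDiag]
  rw [MultilinearMap.map_sum_finset]
  refine Finset.sum_congr rfl fun c _ => ?_
  rw [MultilinearMap.map_smul_univ]

/-- At a family of trees the shuffle product is a sum over bijections of products of coefficients.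
For each bijection, summing over families reassembles the factors. -/
theorem symPart_shuffleProd (ν ν' : LabelSet m → ℕ) (x : ∀ j : SIdx ν', ihxPerp j.1.1)
    (L : List (SIdx ν')) (hL : L.Nodup) (hL' : ∀ j, j ∈ L) :
    symPart ν (shuffleProd (L.map fun j => (x j : HT m))) =
      (Nat.card (TypeEquiv ν ν) : ℝ)⁻¹ • ∑ γ : TypeEquiv ν ν',
        symProj ν fun j => (x (γ.1 j) : HT m) := by
  classical
  have hx : ∀ y ∈ L.map fun j => (x j : HT m), ∃ I, y ∈ treeSpace I := fun y hy => by
    obtain ⟨j, -, rfl⟩ := List.mem_map.1 hy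
    exact ⟨_, (x j).2.1⟩
  rw [symPart_apply]
  congr 1
  have h1 : ∀ c ∈ treeFamilies ν,
      glueVal (fun w T => evL w T (shuffleProd (L.map fun j => (x j : HT m)))) c =
        ∑ γ : SIdx ν ≃ SIdx ν', ∏ j, coeff (c j) (x (γ j) : HT m) := fun c hc => by
    rw [glueVal_shuffleProd (fun a => ⟨(isTree_of_mem_treeFamilies hc a).1,
      (isTree_of_mem_treeFamilies hc a).2.conn⟩) _ hx, List.map_map]
    rw [show ((fun y a => coeff (c a) y) ∘ fun j => (x j : HT m)) =
      fun j a => coeff (c a) (x j : HT m) from rfl, matchSum_univ L hL hL']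
    refine Fintype.sum_equiv (Equiv.symmEquiv _ _) _ _ fun β => ?_
    rw [← β.symm.prod_comp]
    refine Finset.prod_congr rfl fun a _ => ?_
    rw [Equiv.apply_symm_apply]
    rfl
  rw [Finset.sum_congr rfl fun c hc => by rw [h1 c hc, Finset.sum_smul], Finset.sum_comm,
    Finset.sum_congr rfl fun γ _ => sum_treeFamilies ν fun j => (x (γ j) : HT m)]
  -- A bijection that matches different sets of labels contributes zero, since an element of one
  -- tree space has no coefficients at trees with other leaves.
  rw [← Finset.sum_subset (Finset.subset_univ
    (Finset.univ.filter fun γ : SIdx ν ≃ SIdx ν' => ∀ a, (γ a).1 = a.1)),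
    ← Finset.sum_subtype_eq_sum_filter, Finset.subtype_univ]
  · refine Finset.sum_congr rfl fun γ _ => ?_
    congr 1
    funext j
    refine recon_treeSpace ?_
    have h : treeSpace (γ.1 j).1.1 = treeSpace j.1.1 := by rw [γ.2 j]
    exact h ▸ (x (γ.1 j)).2.1
  · intro γ _ hγ
    have : ∃ a, (γ a).1 ≠ a.1 := by simpa using hγ
    obtain ⟨a, ha⟩ := this
    refine MultilinearMap.map_coord_zero _ a ?_
    rw [recon]
    refine Finset.sum_eq_zero fun t ht => ?_
    rw [coeff_treeSpace (x (γ a)).2.1, zero_div, zero_smul]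
    intro h
    exact ha (Subtype.ext (h.2.unique (mem_trees.1 ht).2))

theorem card_typeEquiv_ne_zero (ν : LabelSet m → ℕ) : (Nat.card (TypeEquiv ν ν) : ℝ) ≠ 0 := by
  have : Nonempty (TypeEquiv ν ν) := ⟨⟨Equiv.refl _, fun _ => rfl⟩⟩
  exact Nat.cast_ne_zero.2 Nat.card_pos.ne'

/-- All bijections that preserve the label sets give the same symmetric tensor, and the normalizing
factor in `symPart` is the inverse of their number. -/
theorem symPart_shuffleProd_self (ν : LabelSet m → ℕ) (x : ∀ j : SIdx ν, ihxPerp j.1.1)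
    (L : List (SIdx ν)) (hL : L.Nodup) (hL' : ∀ j, j ∈ L) :
    symPart ν (shuffleProd (L.map fun j => (x j : HT m))) = symProd ν x := by
  rw [symPart_shuffleProd ν ν x L hL hL',
    Finset.sum_congr rfl fun γ _ => symProj_comp γ fun j => (x j : HT m), Finset.sum_const,
    Finset.card_univ, ← Nat.card_eq_fintype_card, symProj_coe, ← Nat.cast_smul_eq_nsmul ℝ, smul_smul,
    inv_mul_cancel₀ (card_typeEquiv_ne_zero ν), one_smul]

theorem symPart_shuffleProd_of_ne {ν ν' : LabelSet m → ℕ} (h : ν ≠ ν')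
    (x : ∀ j : SIdx ν', ihxPerp j.1.1) (L : List (SIdx ν')) (hL : L.Nodup) (hL' : ∀ j, j ∈ L) :
    symPart ν (shuffleProd (L.map fun j => (x j : HT m))) = 0 := by
  have : IsEmpty (TypeEquiv ν ν') := ⟨fun γ => h γ.eq⟩
  rw [symPart_shuffleProd ν ν' x L hL hL', Finset.univ_eq_empty, Finset.sum_empty, smul_zero]

/-! ### Iterated expansions in one coordinate -/

section Expand

variable {A X : Type*} [Fintype A] [DecidableEq A] [DecidableEq X]

theorem sum_piFinset_eq_sum_update {N : Type*} [AddCommMonoid N] (s : A → Finset X) (a : A) (x₀ : X)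
    (F : (A → X) → N) :
    ∑ c ∈ Fintype.piFinset s, F c =
      ∑ c ∈ Fintype.piFinset (Function.update s a {x₀}), ∑ t ∈ s a, F (Function.update c a t) := by
  rw [Finset.sum_sigma']
  refine Finset.sum_bij' (fun c _ => (⟨Function.update c a x₀, c a⟩ : Σ _ : A → X, X))
    (fun p _ => Function.update p.1 a p.2) ?_ ?_ ?_ ?_ ?_
  · intro c hc
    rw [Fintype.mem_piFinset] at hc
    rw [Finset.mem_sigma, Fintype.mem_piFinset]
    refine ⟨fun b => ?_, hc a⟩
    by_cases hb : b = a
    · subst hb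
      simp
    · simpa [Function.update_of_ne hb] using hc b
  · rintro ⟨c, t⟩ hp
    rw [Finset.mem_sigma, Fintype.mem_piFinset] at hp
    rw [Fintype.mem_piFinset]
    intro b
    by_cases hb : b = a
    · subst hb
      simpa using hp.2
    · simpa [Function.update_of_ne hb] using hp.1 b
  · intro c _
    simp
  · rintro ⟨c, t⟩ hp
    rw [Finset.mem_sigma, Fintype.mem_piFinset] at hp
    have := hp.1 a
    rw [Function.update_self, Finset.mem_singleton] at this
    simp [← this]
  · intro c _
    simp

/-- By `h`, summation against the kernel `K a` replaces the `a`-th member by `e a`. Doing this for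
one coordinate after the other evaluates the whole sum at `e`. -/
theorem sum_piFinset_mul_prod (S : Finset A) (s : A → Finset X) (G : (A → X) → ℝ) (K : A → X → ℝ)
    (e : A → X) (he : ∀ a, e a ∈ s a) (hs : ∀ a, a ∉ S → s a = {e a})
    (h : ∀ c, (∀ a, c a ∈ s a) → ∀ a ∈ S,
      ∑ t ∈ s a, G (Function.update c a t) * K a t = G (Function.update c a (e a))) :
    ∑ c ∈ Fintype.piFinset s, G c * ∏ a ∈ S, K a (c a) = G e := by
  induction S using Finset.induction_on generalizing s with
  | empty =>
    have : s = fun a => {e a} := funext fun a => hs a (Finset.notMem_empty a)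
    rw [this, Fintype.piFinset_singleton, Finset.sum_singleton, Finset.prod_empty, mul_one]
  | insert a S ha ih =>
    have hsub : ∀ b, Function.update s a {e a} b ⊆ s b := fun b => by
      by_cases hb : b = a
      · subst hb
        simpa using he b
      · rw [Function.update_of_ne hb]
    rw [sum_piFinset_eq_sum_update s a (e a), ← ih (Function.update s a {e a})]
    · refine Finset.sum_congr rfl fun c hc => ?_
      rw [Fintype.mem_piFinset] at hc
      have hca := hc a
      rw [Function.update_self, Finset.mem_singleton] at hca
      have h1 := h c (fun b => hsub b (hc b)) a (Finset.mem_insert_self a S)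
      rw [← hca, Function.update_eq_self] at h1
      rw [← h1, Finset.sum_mul]
      refine Finset.sum_congr rfl fun t _ => ?_
      rw [Finset.prod_insert ha, Function.update_self, mul_assoc]
      congr 2
      refine Finset.prod_congr rfl fun b hb => ?_
      rw [Function.update_of_ne]
      rintro rfl
      exact ha hb
    · intro b
      by_cases hb : b = a
      · subst hb
        simp
      · rw [Function.update_of_ne hb]
        exact he b
    · intro b hb
      by_cases hba : b = a
      · subst hba
        simp
      · rw [Function.update_of_ne hba]
        exact hs b (by simp [hba, hb])
    · intro c hc b hb
      have hba : b ≠ a := fun h => ha (h ▸ hb)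
      rw [Function.update_of_ne hba]
      exact h c (fun b => hsub b (hc b)) b (Finset.mem_insert_of_mem hb)

end Expand

/-! ### Functionals on symmetric tensors -/

/-- The linear form on a symmetric power given by a symmetric multilinear form. -/
def symLift {ι : Type} {M : Type*} [AddCommGroup M] [Module ℝ M]
    (g : MultilinearMap ℝ (fun _ : ι => M) ℝ)
    (h : ∀ (e : Equiv.Perm ι) x, g (fun i => x (e i)) = g x) : SymmetricPower ℝ ι M →ₗ[ℝ] ℝ where
  -- The symmetric power is the quotient of the tensor power by the congruence generated by
  -- permutations of factors, which a symmetric form respects.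
  toFun := AddCon.lift (addConGen (SymmetricPower.Rel ℝ ι M))
    (PiTensorProduct.lift g).toAddMonoidHom <| AddCon.addConGen_le.2 <| by
      rintro _ _ ⟨e, x⟩
      rw [AddCon.ker_rel]
      simp [h]
  map_add' x y := map_add _ x y
  map_smul' r x := AddCon.induction_on x fun x => (PiTensorProduct.lift g).map_smul r x

theorem symLift_tprod {ι : Type} {M : Type*} [AddCommGroup M] [Module ℝ M]
    (g : MultilinearMap ℝ (fun _ : ι => M) ℝ)
    (h : ∀ (e : Equiv.Perm ι) x, g (fun i => x (e i)) = g x) (x : ι → M) :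
    symLift g h (SymmetricPower.tprod ℝ x) = g x := by
  change PiTensorProduct.lift g (PiTensorProduct.tprod ℝ x) = g x
  rw [PiTensorProduct.lift.tprod]

/-- The product of linear forms, as a multilinear form. -/
def prodForm {ι : Type} [Fintype ι] {M : Type*} [AddCommGroup M] [Module ℝ M]
    (ℓ : ι → M →ₗ[ℝ] ℝ) : MultilinearMap ℝ (fun _ : ι => M) ℝ :=
  (MultilinearMap.mkPiAlgebra ℝ ι ℝ).compLinearMap ℓ

theorem prodForm_apply {ι : Type} [Fintype ι] {M : Type*} [AddCommGroup M] [Module ℝ M]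
    (ℓ : ι → M →ₗ[ℝ] ℝ) (x : ι → M) : prodForm ℓ x = ∏ i, ℓ i (x i) := rfl

/-- The permanent, as a linear form on the symmetric power. -/
def permForm {r : ℕ} {M : Type*} [AddCommGroup M] [Module ℝ M]
    (ℓ : Fin r → M →ₗ[ℝ] ℝ) : SymmetricPower ℝ (Fin r) M →ₗ[ℝ] ℝ :=
  symLift (∑ π : Equiv.Perm (Fin r), prodForm fun i => ℓ (π i)) fun e x => by
    rw [MultilinearMap.sum_apply, MultilinearMap.sum_apply]
    refine Fintype.sum_equiv (Equiv.mulRight e⁻¹) _ _ fun π => ?_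
    rw [prodForm_apply, prodForm_apply]
    symm
    rw [← Equiv.prod_comp e]
    simp

theorem permForm_tprod {r : ℕ} {M : Type*} [AddCommGroup M] [Module ℝ M]
    (ℓ : Fin r → M →ₗ[ℝ] ℝ) (x : Fin r → M) :
    permForm ℓ (SymmetricPower.tprod ℝ x) = ∑ π : Equiv.Perm (Fin r), ∏ i, ℓ (π i) (x i) := by
  rw [permForm, symLift_tprod, MultilinearMap.sum_apply]
  rfl

/-- The coefficient of a forest, as a linear form on symmetric tensors. -/
def forestForm {ν : LabelSet m → ℕ} (d : SIdx ν → Diagram m) : SymTensor ν →ₗ[ℝ] ℝ :=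
  PiTensorProduct.lift ((MultilinearMap.mkPiAlgebra ℝ (LabelSet m) ℝ).compLinearMap fun I =>
    permForm fun k => (coeff (d ⟨I, k⟩)).domRestrict (ihxPerp I.1))

theorem forestForm_symProd {ν : LabelSet m → ℕ} (d : SIdx ν → Diagram m)
    (x : ∀ j : SIdx ν, ihxPerp j.1.1) :
    forestForm d (symProd ν x) = ∑ π : ∀ I : LabelSet m, Equiv.Perm (Fin (ν I)),
      ∏ j : SIdx ν, coeff (d (Equiv.sigmaCongrRight π j)) (x j : HT m) := by
  classical
  rw [symProd_apply, forestForm, PiTensorProduct.lift.tprod, MultilinearMap.compLinearMap_apply,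
    MultilinearMap.mkPiAlgebra_apply]
  simp only [permForm_tprod]
  rw [Finset.prod_univ_sum, Fintype.piFinset_univ]
  refine Finset.sum_congr rfl fun π _ => ?_
  rw [Fintype.prod_sigma]
  rfl

theorem sum_f_treeFamilies {ν : LabelSet m → ℕ} {c : SIdx ν → Diagram m}
    (hc : c ∈ treeFamilies ν) : ∑ j, (c j).f = ∑ I, ν I * (I.1.card - 2) := by
  rw [Fintype.sum_sigma]
  refine Finset.sum_congr rfl fun I _ => ?_
  rw [Finset.sum_congr rfl fun k _ => show (c ⟨I, k⟩).f = I.1.card - 2 by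
    have := (isTree_of_mem_treeFamilies hc ⟨I, k⟩).2.card
    dsimp only at this
    omega]
  simp

/-- Up to a nonzero constant, this linear form reads the coefficient of `x` at the forest `d` off
the symmetric tensor. So the tensor determines the leading coefficients at forests. -/
theorem forestForm_symPart {k : ℕ} {x : HT m} (hs : IsPermInvariant (fun w T => evL w T x) k)
    (hihx : ∀ w e a b d d' T, Multiset.card T + 2 = k →
      ihxSum (fun w T => evL w T x) w e a b d d' T = 0)
    {ν : LabelSet m → ℕ} (hk : ∑ I, ν I * (I.1.card - 2) = k) {d : SIdx ν → Diagram m}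
    (hd : d ∈ treeFamilies ν) :
    forestForm d (symPart ν x) = (Nat.card (TypeEquiv ν ν) : ℝ)⁻¹ *
      (Fintype.card (∀ I : LabelSet m, Equiv.Perm (Fin (ν I))) *
        glueVal (fun w T => evL w T x) d) := by
  classical
  have hf : IsCodeFun fun w T => evL w T x := isCodeFun_evL x
  have hsum : ∀ c ∈ treeFamilies ν, ∑ j, (c j).f = k := fun c hc =>
    (sum_f_treeFamilies hc).trans hk
  rw [symPart_apply, map_smul, map_sum, smul_eq_mul]
  congr 1
  simp only [map_smul, smul_eq_mul, symProj, MultilinearMap.compLinearMap_apply,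
    forestForm_symProd, Finset.mul_sum]
  rw [Finset.sum_comm, Fintype.card, ← nsmul_eq_mul]
  refine Finset.sum_eq_card_nsmul fun π _ => ?_
  have hdπ : (fun j => d (Equiv.sigmaCongrRight π j)) ∈ treeFamilies ν :=
    Fintype.mem_piFinset.2 fun j => mem_trees.2 (isTree_of_mem_treeFamilies hd _)
  rw [← glueVal_comp (Equiv.sigmaCongrRight π) d hf (by rwa [hsum d hd])]
  -- For a fixed permutation `π`, the sum over families reproduces the value at the permuted family,
  -- which equals the value at `d`.
  refine sum_piFinset_mul_prod Finset.univ _ (glueVal fun w T => evL w T x)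
    (fun j t => coeff (d (Equiv.sigmaCongrRight π j)) (retr j.1 (normDiag (trees j.1.1) t) : HT m))
    _ (Fintype.mem_piFinset.1 hdπ) (fun j hj => absurd (Finset.mem_univ j) hj) ?_
  intro c hc j _
  have hc' : c ∈ treeFamilies ν := Fintype.mem_piFinset.2 hc
  have ha := (isTree_of_mem_treeFamilies hc' j).2
  have hs' : IsPermInvariant (fun w T => evL w T x) (∑ b, (c b).f) := by rwa [hsum c hc']
  have hmem := slotVec_mem hf hs' (by rwa [hsum c hc']) ha
  have h1 : ∑ t ∈ trees j.1.1, glueVal (fun w T => evL w T x) (Function.update c j t) *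
      coeff (d (Equiv.sigmaCongrRight π j)) (retr j.1 (normDiag (trees j.1.1) t) : HT m) =
      coeff (d (Equiv.sigmaCongrRight π j))
        (retr j.1 (slotVec c j (fun w T => evL w T x) j.1.1) : HT m) := by
    rw [slotVec, recon_eq_sum_normDiag, map_sum, AddSubmonoidClass.coe_finset_sum, map_sum]
    refine Finset.sum_congr rfl fun t ht => ?_
    rw [map_smul, Submodule.coe_smul, map_smul, smul_eq_mul, slotFun,
      if_pos (mem_trees.1 ht).2]
  rw [h1]
  -- Summing over the `j`-th tree gives the projection of `slotVec`, which already satisfies IHX and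
  -- is therefore fixed by `retr`.
  have h2 := retr_coe j.1 ⟨_, hmem⟩
  dsimp only at h2
  rw [h2, coeff_slotVec hf hs' ha, slotFun, if_pos]
  exact (isTree_of_mem_treeFamilies hd (Equiv.sigmaCongrRight π j)).2

theorem glueVal_eq_zero_of_symPart {k : ℕ} {x : HT m}
    (hs : IsPermInvariant (fun w T => evL w T x) k)
    (hihx : ∀ w e a b d d' T, Multiset.card T + 2 = k →
      ihxSum (fun w T => evL w T x) w e a b d d' T = 0)
    {ν : LabelSet m → ℕ} (hk : ∑ I, ν I * (I.1.card - 2) = k) {d : SIdx ν → Diagram m}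
    (hd : d ∈ treeFamilies ν) (h : symPart ν x = 0) : glueVal (fun w T => evL w T x) d = 0 := by
  have h1 := forestForm_symPart hs hihx hk hd
  rw [h, map_zero, eq_comm, mul_eq_zero, mul_eq_zero] at h1
  rcases h1 with h1 | h1 | h1
  · exact absurd h1 (inv_ne_zero (card_typeEquiv_ne_zero ν))
  · exact absurd h1 (Nat.cast_ne_zero.2 Fintype.card_ne_zero)
  · exact h1

/-! ### Cocycles whose symbol vanishes -/

theorem evL_eq_zero_of_mem_chains {n : ℕ} {k : ℤ} {x : HT m} (hx : x ∈ chains m n k)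
    {w : List (Fin m × ℤ)} {T : Multiset (Fin 3 → ℤ)} (h : k < Multiset.card T) :
    evL w T x = 0 := by
  by_cases hv : Valid (w : Multiset (Fin m × ℤ)) T
  · obtain ⟨Γ, ℓ, H⟩ := hv.exists_labels
    rw [evL_of_labels H]
    refine coeff_eq_zero_of_mem_chains hx fun h' => ?_
    rw [← H.card_tri] at h'
    exact absurd h'.2 (not_le.2 h)
  · exact evL_not_valid hv x

theorem isSTUFun_evL {x : HT m} (hx : x ∈ cocycles m) : IsSTUFun fun w T => evL w T x := by
  have : (fun w T => evL w T x) = ev fun Γ => coeff Γ x := by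
    funext w T
    exact evL_apply w T x
  rw [this]
  exact mem_cocycles_iff.1 hx

theorem isPermInvariant_of_swap {f : List (Fin m × ℤ) → Multiset (Fin 3 → ℤ) → ℝ} {k : ℕ}
    (h : ∀ pre x y post T, Multiset.card T = k →
      f (pre ++ x :: y :: post) T = f (pre ++ y :: x :: post) T) : IsPermInvariant f k := by
  intro w w' T hT hw
  have key : ∀ pre, f (pre ++ w) T = f (pre ++ w') T := by
    induction hw with
    | nil => exact fun _ => rfl
    | cons x _ ih =>
      intro pre
      have := ih (pre ++ [x])
      simpa using this
    | swap x y l => exact fun pre => h pre y x l T hT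
    | trans _ _ ih₁ ih₂ => exact fun pre => (ih₁ pre).trans (ih₂ pre)
  exact key []

/-- The values of `x` at codes with `k + 1` triples vanish, so STU makes its leading coefficients
symmetric in the legs. -/
theorem isPermInvariant_evL {n k : ℕ} {x : HT m} (hx : x ∈ HW m n k) :
    IsPermInvariant (fun w T => evL w T x) k := by
  refine isPermInvariant_of_swap fun pre y z post T hT => ?_
  refine (isSTUFun_evL hx.1).symm_of_top (isCodeFun_evL x) (fun w τ => ?_) pre post y z
  refine evL_eq_zero_of_mem_chains hx.2 ?_
  rw [Multiset.card_cons, hT]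
  push_cast
  omega

/-- The components are sorted by their sets of leaf labels. A tree with `f` free vertices has `f +
2` legs, hence `2 (f + 1)` vertices, which yields the condition on the order. -/
theorem exists_multiplicity {S : Type*} [Fintype S] {c : S → Diagram m} {n k : ℕ}
    (hc : ∀ a, (c a).IsHomotopyLink ∧ (c a).Conn) (hk : ∑ a, (c a).f = k)
    (hn : ∑ a, ∑ i, (c a).q i + k = 2 * n) :
    ∃ (ν : Multiplicity m n k) (σ : SIdx ν.1 ≃ S), (fun j => c (σ j)) ∈ treeFamilies ν.1 := by
  classical
  let I : S → Finset (Fin m) := fun a => Finset.univ.filter fun i => 0 < (c a).q i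
  have hI : ∀ a, (c a).IsTreeLike (I a) := fun a =>
    (hc a).1.isTreeLike (hc a).2 fun i => by simp [I]
  let J : S → LabelSet m := fun a => ⟨I a, by have := (hI a).card; omega⟩
  let ν : LabelSet m → ℕ := fun K => Fintype.card {a // J a = K}
  let σ : SIdx ν ≃ S := (Equiv.sigmaCongrRight fun K =>
    (Fintype.equivFin {a // J a = K}).symm).trans (Equiv.sigmaFiberEquiv J)
  have hσ : ∀ j, J (σ j) = j.1 := fun j => ((Fintype.equivFin {a // J a = j.1}).symm j.2).2
  have hsum : ∀ g : LabelSet m → ℕ, ∑ K, ν K * g K = ∑ a, g (J a) := fun g => by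
    rw [← σ.sum_comp, Fintype.sum_sigma]
    refine Finset.sum_congr rfl fun K _ => ?_
    rw [Finset.sum_congr rfl fun i _ => congrArg g (hσ ⟨K, i⟩)]
    simp
  have hf : ∀ a, (J a).1.card = (c a).f + 2 := fun a => (hI a).card.symm
  refine ⟨⟨ν, ?_, ?_⟩, σ, ?_⟩
  · have h1 : ∑ a, (∑ i, (c a).q i + (c a).f) = ∑ a, 2 * ((c a).f + 1) :=
      Finset.sum_congr rfl fun a _ => by
        rw [(hI a).sum_q (hc a).1, ← (hI a).card]
        omega
    rw [Finset.sum_add_distrib, hk, hn, ← Finset.mul_sum] at h1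
    rw [hsum fun K => K.1.card - 1]
    rw [Finset.sum_congr rfl fun a _ => show (J a).1.card - 1 = (c a).f + 1 by rw [hf a]; rfl]
    omega
  · rw [hsum fun K => K.1.card - 2, ← hk]
    exact Finset.sum_congr rfl fun a _ => by rw [hf a]; rfl
  · refine Fintype.mem_piFinset.2 fun j => mem_trees.2 ⟨(hc _).1, ?_⟩
    have h1 := hI (σ j)
    have h2 : I (σ j) = j.1.1 := congrArg Subtype.val (hσ j)
    rwa [h2] at h1

/-- Only coefficients at diagrams with exactly `k` free vertices are in question. Each is the value
at the family of components, which is recovered from the symmetric tensor and thus zero. -/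
theorem mem_chains_of_symPart_eq_zero {n k : ℕ} {x : HT m} (hx : x ∈ HW m n k)
    (h : ∀ ν : Multiplicity m n k, symPart ν.1 x = 0) : x ∈ chains m n ((k : ℤ) - 1) := by
  have hs := isPermInvariant_evL hx
  have hf : IsCodeFun fun w T => evL w T x := isCodeFun_evL x
  rw [mem_chains_iff hx.2]
  intro Γ hΓ hk
  by_cases hk' : Γ.f = k
  swap
  · exact coeff_eq_zero_of_mem_chains hx.2 fun h' => hk' (by omega)
  by_cases H : Γ.IsHomotopyLink
  swap
  · exact (isDiagramFun_coeff x).zero H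
  obtain ⟨w, T, ℓ, L⟩ := exists_labels Γ
  have hT : Multiset.card T = k := L.card_tri.trans hk'
  obtain ⟨S, c, hc, hcf, hcq, hval⟩ := (L.isHomotopyLink_iff.1 H).exists_family
  rw [hT] at hcf hval
  obtain ⟨ν, σ, hν⟩ := exists_multiplicity hc hcf (n := n) (by
    rw [hcq, L.length_word, ← hk']
    exact hasOrder_iff.1 hΓ)
  rw [← evL_of_labels L, ← hval _ hf hs, ← glueVal_comp σ c hf (by rwa [hcf])]
  exact glueVal_eq_zero_of_symPart hs
    (fun w e a b d d' T _ => (isSTUFun_evL hx.1).ihxSum_eq_zero hf w e a b d d' T) ν.2.2 hν (h ν)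

/-! ### Cocycles with a given shuffle product as leading part -/

theorem evL_eq_zero_of_order {n : ℕ} {k : ℤ} {x : HT m} (hx : x ∈ chains m n k)
    {w : List (Fin m × ℤ)} {T : Multiset (Fin 3 → ℤ)} (h : w.length + Multiset.card T ≠ 2 * n) :
    evL w T x = 0 := by
  by_cases hv : Valid (w : Multiset (Fin m × ℤ)) T
  · obtain ⟨Γ, ℓ, H⟩ := hv.exists_labels
    rw [evL_of_labels H]
    refine coeff_eq_zero_of_mem_chains hx fun h' => h ?_
    rw [H.card_tri, H.length_word]
    exact hasOrder_iff.1 h'.1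
  · exact evL_not_valid hv x

/-- A shuffle product of IHX solutions meets the symmetry and IHX conditions of `exists_isSTUFun`;
the resulting function of codes is realized by an element through its coefficients. -/
theorem exists_cocycle_of_shuffleProd {n k : ℕ} {xs : List (HT m)}
    (hxs : ∀ x ∈ xs, ∃ I, x ∈ ihxPerp I) (hP : shuffleProd xs ∈ chains m n k) :
    ∃ x ∈ HW m n k, x - shuffleProd xs ∈ chains m n ((k : ℤ) - 1) := by
  obtain ⟨F, hF, hSTU, hFk, hFtop, hFn⟩ := exists_isSTUFun (n := n) (k := k)
    (isCodeFun_evL (shuffleProd xs))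
    (fun pre x y post T _ => evL_shuffleProd_perm ((List.Perm.swap y x post).append_left pre) xs
      fun z hz => (hxs z hz).imp fun _ h => h.1)
    (fun w e a b c d T _ => ihxSum_shuffleProd xs hxs w e a b c d T)
    (fun w T h => evL_eq_zero_of_order hP h)
  have hd := hF.isDiagramFun
  have hc : ∀ Γ, coeff Γ (recon (ofOrder m n) (IsCodeFun.onDiagram F)) =
      IsCodeFun.onDiagram F Γ := by
    refine coeff_recon_ofOrder hd fun Γ hΓ => ?_
    obtain ⟨w, T, ℓ, H⟩ := exists_labels Γ
    rw [hF.onDiagram_eq H]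
    refine hFn w T fun h => hΓ (hasOrder_iff.2 ?_)
    rw [← H.length_word, ← H.card_tri, h]
  have hx : recon (ofOrder m n) (IsCodeFun.onDiagram F) ∈ chains m n k := by
    refine recon_mem_chains hd fun Γ _ hk => ?_
    obtain ⟨w, T, ℓ, H⟩ := exists_labels Γ
    rw [hF.onDiagram_eq H]
    refine hFtop w T ?_
    rw [H.card_tri]
    exact_mod_cast hk
  refine ⟨_, ⟨mem_cocycles_iff.2 ?_, hx⟩, (mem_chains_iff (sub_mem hx hP)).2 fun Γ hΓ hk => ?_⟩
  · simp only [hc]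
    rwa [hF.ev_onDiagram]
  · by_cases hk' : Γ.f = k
    · obtain ⟨w, T, ℓ, H⟩ := exists_labels Γ
      rw [map_sub, hc, hF.onDiagram_eq H, ← evL_of_labels H,
        hFk w T (by rw [H.card_tri, hk']), sub_self]
    · exact coeff_eq_zero_of_mem_chains (sub_mem hx hP) fun h => hk' (by omega)

theorem symbol_mk_eq {n k : ℕ} {x : HT m} (hx : x ∈ HW m n k) {y : HT m}
    (h : x - y ∈ chains m n ((k : ℤ) - 1)) :
    symbol m n k (Submodule.Quotient.mk ⟨x, hx⟩) = Submodule.Quotient.mk y := by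
  rw [symbol, Submodule.mapQ_apply, Submodule.subtype_apply]
  exact (Submodule.Quotient.eq _).2 h

/-- A cocycle representing a class in the kernel is a combination of diagrams with at most `k - 1`
free vertices, hence lies in the previous step of the filtration. -/
theorem symbol_injective (m n k : ℕ) : Function.Injective (symbol m n k) := by
  rw [← LinearMap.ker_eq_bot, LinearMap.ker_eq_bot']
  intro q hq
  induction q using Submodule.Quotient.induction_on with | _ x => ?_
  rw [symbol, Submodule.mapQ_apply, Submodule.Quotient.mk_eq_zero] at hq
  rw [Submodule.Quotient.mk_eq_zero]
  exact ⟨x.2.1, hq⟩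

/-! ### The list of factors of a symmetric tensor -/

/-- The list of all positions. -/
def positions (ν : LabelSet m → ℕ) : List (SIdx ν) :=
  (Finset.univ : Finset (LabelSet m)).toList.flatMap fun I => List.ofFn fun j => ⟨I, j⟩

theorem mem_positions (ν : LabelSet m → ℕ) (j : SIdx ν) : j ∈ positions ν :=
  List.mem_flatMap.2 ⟨j.1, by simp, List.mem_ofFn.2 ⟨j.2, rfl⟩⟩

theorem nodup_positions (ν : LabelSet m → ℕ) : (positions ν).Nodup := by
  rw [positions, List.nodup_flatMap]
  refine ⟨fun I _ => List.nodup_ofFn.2 fun j j' h => by simpa using h, ?_⟩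
  refine (Finset.nodup_toList _).imp fun {I J} h => ?_
  rw [Function.onFun, List.disjoint_left]
  intro a ha hb
  obtain ⟨j, rfl⟩ := List.mem_ofFn.1 ha
  obtain ⟨j', hj'⟩ := List.mem_ofFn.1 hb
  exact h (congrArg Sigma.fst hj').symm

theorem map_positions {ν : LabelSet m → ℕ} {M : Type*} (x : (I : LabelSet m) → Fin (ν I) → M) :
    (positions ν).map (fun j => x j.1 j.2) =
      (Finset.univ : Finset (LabelSet m)).toList.flatMap fun I => List.ofFn (x I) := by
  rw [positions, List.map_flatMap]
  simp only [List.map_ofFn]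
  rfl

theorem sum_get_positions (ν : LabelSet m → ℕ) (g : LabelSet m → ℕ) :
    ∑ i : Fin (positions ν).length, g ((positions ν).get i).1 = ∑ I, ν I * g I := by
  classical
  refine (((nodup_positions ν).getEquivOfForallMemList _ (mem_positions ν)).sum_comp
    fun j : SIdx ν => g j.1).trans ?_
  rw [Fintype.sum_sigma]
  simp

theorem ofFn_get_positions {ν : LabelSet m → ℕ} (x : SIdx ν → HT m) :
    (List.ofFn fun i => x ((positions ν).get i)) = (positions ν).map x := by
  conv_rhs => rw [← List.ofFn_get (positions ν), List.map_ofFn]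
  rfl

/-- The shuffle product of the factors of a symmetric tensor. -/
def symShuffle {ν : LabelSet m → ℕ} (x : ∀ j : SIdx ν, ihxPerp j.1.1) : HT m :=
  shuffleProd ((positions ν).map fun j => (x j : HT m))

theorem symShuffle_mem_chains {n k : ℕ} (ν : Multiplicity m n k)
    (x : ∀ j : SIdx ν.1, ihxPerp j.1.1) : symShuffle x ∈ chains m n k := by
  have := shuffleProd_mem_chains (fun i => ((positions ν.1).get i).1)
    (fun i => (x ((positions ν.1).get i) : HT m)) fun i => (x _).2.1
  rw [ofFn_get_positions fun j => (x j : HT m),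
    sum_get_positions ν.1 fun I => I.1.card - 1, sum_get_positions ν.1 fun I => I.1.card - 2,
    ν.2.1, ν.2.2] at this
  exact this

theorem exists_cocycle_of_symShuffle {n k : ℕ} (ν : Multiplicity m n k)
    (x : ∀ j : SIdx ν.1, ihxPerp j.1.1) :
    ∃ y ∈ HW m n k, y - symShuffle x ∈ chains m n ((k : ℤ) - 1) := by
  refine exists_cocycle_of_shuffleProd (fun y hy => ?_) (symShuffle_mem_chains ν x)
  obtain ⟨j, -, rfl⟩ := List.mem_map.1 hy
  exact ⟨_, (x j).2⟩

/-! ### The isomorphism -/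

instance (n k : ℕ) : Finite (Multiplicity m n k) := by
  refine Finite.of_injective (β := LabelSet m → Fin (n + 1))
    (fun ν I => ⟨ν.1 I, Nat.lt_succ_of_le ?_⟩) fun ν ν' h => ?_
  -- As `|I| ≥ 2`, one has `ν I ≤ ν I * (|I| - 1) ≤ n`.
  · refine le_trans ?_ (ν.2.1 ▸ Finset.single_le_sum
      (f := fun I => ν.1 I * (I.1.card - 1)) (fun _ _ => Nat.zero_le _) (Finset.mem_univ I))
    exact Nat.le_mul_of_pos_right _ (by have := I.2; omega)
  · refine Subtype.ext (funext fun I => ?_)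
    simpa using congrFun h I

theorem symPart_eq_zero_of_mem_chains {n k : ℕ} (ν : Multiplicity m n k) {x : HT m}
    (hx : x ∈ chains m n ((k : ℤ) - 1)) : symPart ν.1 x = 0 := by
  rw [symPart_apply, Finset.sum_eq_zero, smul_zero]
  intro c hc
  have h : glueVal (fun w T => evL w T x) c = 0 := by
    refine evL_eq_zero_of_mem_chains hx ?_
    rw [(exists_isFamily c).choose_spec.card, sum_f_treeFamilies hc, ν.2.2]
    omega
  rw [h, zero_smul]

open Classical in
/-- The leading part of a cocycle as a symmetric tensor. -/
def leading (m n k : ℕ) : HW m n k →ₗ[ℝ] DirectSum (Multiplicity m n k) fun ν => SymTensor ν.1 :=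
  haveI := Fintype.ofFinite (Multiplicity m n k)
  ∑ ν : Multiplicity m n k,
    DirectSum.lof ℝ (Multiplicity m n k) (fun ν => SymTensor ν.1) ν ∘ₗ symPart ν.1 ∘ₗ
      (HW m n k).subtype

theorem leading_eq_zero {n k : ℕ} (x : HW m n k) :
    leading m n k x = 0 ↔ ∀ ν : Multiplicity m n k, symPart ν.1 (x : HT m) = 0 := by
  classical
  letI := Fintype.ofFinite (Multiplicity m n k)
  have h1 : leading m n k x = ∑ ν : Multiplicity m n k,
      DirectSum.lof ℝ (Multiplicity m n k) (fun ν => SymTensor ν.1) ν (symPart ν.1 (x : HT m)) := by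
    rw [leading, LinearMap.sum_apply]
    rfl
  rw [h1]
  constructor
  · intro h ν
    have h2 := congrArg (DirectSum.component ℝ (Multiplicity m n k) (fun ν => SymTensor ν.1) ν) h
    rw [map_sum, map_zero, Fintype.sum_eq_single ν, DirectSum.component.lof_self] at h2
    · exact h2
    · intro ν' hν'
      rw [DirectSum.component.of, dif_neg hν']
  · intro h
    exact Finset.sum_eq_zero fun ν _ => by rw [h ν, map_zero]

/-- A cocycle has vanishing leading tensors exactly if it has no diagrams with `k` free vertices:
one direction is the recovery of coefficients, the other holds since all the families evaluated have
`k` free vertices. -/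
theorem ker_leading (m n k : ℕ) :
    LinearMap.ker (leading m n k) = (HW m n ((k : ℤ) - 1)).submoduleOf (HW m n k) := by
  ext x
  rw [LinearMap.mem_ker, leading_eq_zero, Submodule.submoduleOf, Submodule.mem_comap]
  exact ⟨fun h => ⟨x.2.1, mem_chains_of_symPart_eq_zero x.2 h⟩,
    fun h ν => symPart_eq_zero_of_mem_chains ν h.2⟩

open Classical in
theorem leading_eq_lof {n k : ℕ} {ν : Multiplicity m n k} {x : ∀ j : SIdx ν.1, ihxPerp j.1.1}
    {y : HT m} (hy : y ∈ HW m n k) (h : y - symShuffle x ∈ chains m n ((k : ℤ) - 1)) :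
    leading m n k ⟨y, hy⟩ = DirectSum.lof ℝ (Multiplicity m n k) (fun ν => SymTensor ν.1) ν
      (symProd ν.1 x) := by
  letI := Fintype.ofFinite (Multiplicity m n k)
  have key : ∀ ν' : Multiplicity m n k, symPart ν'.1 y = symPart ν'.1 (symShuffle x) := fun ν' => by
    rw [← sub_add_cancel y (symShuffle x), map_add, symPart_eq_zero_of_mem_chains ν' h, zero_add]
  rw [leading, LinearMap.sum_apply, Fintype.sum_eq_single ν]
  · change DirectSum.lof ℝ (Multiplicity m n k) (fun ν => SymTensor ν.1) ν (symPart ν.1 y) = _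
    rw [key, symShuffle,
      symPart_shuffleProd_self ν.1 x _ (nodup_positions _) (mem_positions _)]
  · intro ν' hν'
    change DirectSum.lof ℝ (Multiplicity m n k) (fun ν => SymTensor ν.1) ν' (symPart ν'.1 y) = 0
    rw [key, symShuffle, symPart_shuffleProd_of_ne (fun e => hν' (Subtype.ext e)) x _
      (nodup_positions _) (mem_positions _), map_zero]

open Classical in
/-- Symmetric tensors of solutions of the IHX conditions span. -/
theorem directSum_induction {n k : ℕ}
    {p : (DirectSum (Multiplicity m n k) fun ν => SymTensor ν.1) → Prop} (zero : p 0)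
    (hadd : ∀ x y, p x → p y → p (x + y)) (smul : ∀ (r : ℝ) x, p x → p (r • x))
    (lof : ∀ (ν : Multiplicity m n k) (x : ∀ j : SIdx ν.1, ihxPerp j.1.1),
      p (DirectSum.lof ℝ (Multiplicity m n k) (fun ν => SymTensor ν.1) ν (symProd ν.1 x))) (z) :
    p z := by
  induction z using DirectSum.induction_on with
  | zero => exact zero
  | add x y hx hy => exact hadd x y hx hy
  | of ν t =>
    change p (DirectSum.lof ℝ (Multiplicity m n k) (fun ν => SymTensor ν.1) ν t)
    have ht : t ∈ Submodule.span ℝ (Set.range (symProd ν.1)) := span_symProd ν.1 ▸ Submodule.mem_top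
    induction ht using Submodule.span_induction with
    | mem t ht =>
      obtain ⟨x, rfl⟩ := ht
      exact lof ν x
    | zero => rwa [map_zero]
    | add t u _ _ ht hu =>
      rw [map_add]
      exact hadd _ _ ht hu
    | smul r t _ ht =>
      rw [map_smul]
      exact smul r _ ht

theorem leading_surjective (m n k : ℕ) : Function.Surjective (leading m n k) := by
  classical
  refine directSum_induction ⟨0, map_zero _⟩ ?_ ?_ fun ν x => ?_
  · rintro _ _ ⟨x, rfl⟩ ⟨y, rfl⟩
    exact ⟨x + y, map_add _ x y⟩
  · rintro r _ ⟨x, rfl⟩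
    exact ⟨r • x, map_smul _ r x⟩
  · obtain ⟨y, hy, h⟩ := exists_cocycle_of_symShuffle ν x
    exact ⟨⟨y, hy⟩, leading_eq_lof hy h⟩

/-- The leading part of a class of cocycles. -/
def leadingQuot (m n k : ℕ) :
    HWQuot m n k →ₗ[ℝ] DirectSum (Multiplicity m n k) fun ν => SymTensor ν.1 :=
  -- Negatives in the direct sum are given by the scalar `-1`.
  letI : AddCommGroup (DirectSum (Multiplicity m n k) fun ν => SymTensor ν.1) :=
    Module.addCommMonoidToAddCommGroup ℝ
  Submodule.liftQ ((HW m n ((k : ℤ) - 1)).submoduleOf (HW m n k)) (leading m n k)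
    (le_of_eq (ker_leading m n k).symm)

theorem leadingQuot_mk {n k : ℕ} (x : HW m n k) :
    leadingQuot m n k (Submodule.Quotient.mk x) = leading m n k x := rfl

theorem leadingQuot_bijective (m n k : ℕ) : Function.Bijective (leadingQuot m n k) := by
  constructor
  · rw [injective_iff_map_eq_zero]
    intro q hq
    induction q using Submodule.Quotient.induction_on with | _ x => ?_
    rw [leadingQuot_mk, ← LinearMap.mem_ker, ker_leading] at hq
    exact (Submodule.Quotient.mk_eq_zero _).2 hq
  · intro z
    obtain ⟨x, rfl⟩ := leading_surjective m n k z
    exact ⟨Submodule.Quotient.mk x, rfl⟩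

/-- The filtration quotients of the cocycles are direct sums of spaces of symmetric tensors. -/
def leadingEquiv (m n k : ℕ) :
    HWQuot m n k ≃ₗ[ℝ] DirectSum (Multiplicity m n k) fun ν => SymTensor ν.1 :=
  LinearEquiv.ofBijective (leadingQuot m n k) (leadingQuot_bijective m n k)

theorem leadingEquiv_mk {n k : ℕ} (x : HW m n k) :
    leadingEquiv m n k (Submodule.Quotient.mk x) = leading m n k x := rfl

open Classical in
-- Any cocycle whose leading part is the shuffle product has both the right symbol and the right
-- leading tensor, and the leading tensor determines its class.
theorem symbol_leadingEquiv_symm {n k : ℕ} (ν : Multiplicity m n k)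
    (x : ∀ j : SIdx ν.1, ihxPerp j.1.1) :
    symbol m n k ((leadingEquiv m n k).symm (DirectSum.lof ℝ (Multiplicity m n k)
      (fun ν => SymTensor ν.1) ν (symProd ν.1 x))) = Submodule.Quotient.mk (symShuffle x) := by
  obtain ⟨y, hy, h⟩ := exists_cocycle_of_symShuffle ν x
  rw [← symbol_mk_eq hy h, ← leading_eq_lof hy h, ← leadingEquiv_mk, LinearEquiv.symm_apply_apply]

/-- One inclusion holds because the pure symmetric tensors span and correspond to shuffle products,
the other because every shuffle product of IHX solutions is the leading part of a cocycle. -/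
theorem range_symbol (m n k : ℕ) : LinearMap.range (symbol m n k) =
    Submodule.span ℝ {y | ∃ (r : ℕ) (I : Fin r → LabelSet m) (a : (j : Fin r) → ihxPerp (I j).1),
      ∑ j, ((I j).1.card - 1) = n ∧ ∑ j, ((I j).1.card - 2) = k ∧
      y = Submodule.Quotient.mk (shuffleProd (List.ofFn fun j => (a j : HT m)))} := by
  classical
  refine le_antisymm ?_ (Submodule.span_le.2 ?_)
  · rintro _ ⟨q, rfl⟩
    obtain ⟨z, rfl⟩ := (leadingEquiv m n k).symm.surjective q
    induction z using directSum_induction with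
    | zero =>
      rw [map_zero, map_zero]
      exact zero_mem _
    | hadd x y hx hy =>
      rw [map_add, map_add]
      exact add_mem hx hy
    | smul r x hx =>
      rw [map_smul, map_smul]
      exact Submodule.smul_mem _ _ hx
    | lof ν x =>
      rw [symbol_leadingEquiv_symm]
      refine Submodule.subset_span ⟨_, fun i => ((positions ν.1).get i).1,
        fun i => x ((positions ν.1).get i), ?_, ?_, ?_⟩
      · rw [sum_get_positions ν.1 fun I => I.1.card - 1, ν.2.1]
      · rw [sum_get_positions ν.1 fun I => I.1.card - 2, ν.2.2]
      · rw [ofFn_get_positions fun j => (x j : HT m), symShuffle]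
  · rintro _ ⟨r, I, a, hn, hk, rfl⟩
    have h1 := shuffleProd_mem_chains I (fun j => (a j : HT m)) fun j => (a j).2.1
    rw [hn, hk] at h1
    obtain ⟨y, hy, h⟩ := exists_cocycle_of_shuffleProd (fun z hz => by
      obtain ⟨j, rfl⟩ := List.mem_ofFn.1 hz
      exact ⟨_, (a j).2⟩) h1
    exact ⟨_, symbol_mk_eq hy h⟩

end HLink

end

theorem proposition4p4 (n k : ℕ) :
    -- the filtration quotient embeds into diagrams modulo diagrams with fewer free vertices,
    Function.Injective (HLink.symbol (n + 1) n k) ∧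
    -- its image is spanned by shuffle products of combinations of trees satisfying IHX,
    LinearMap.range (HLink.symbol (n + 1) n k) =
      Submodule.span ℝ {y | ∃ (r : ℕ) (I : Fin r → HLink.LabelSet (n + 1))
        (a : (j : Fin r) → HLink.ihxPerp (I j).1),
        ∑ j, ((I j).1.card - 1) = n ∧ ∑ j, ((I j).1.card - 2) = k ∧
        y = Submodule.Quotient.mk
          (HLink.shuffleProd (List.ofFn fun j => (a j : HLink.HT (n + 1))))} ∧
    -- and the shuffle product gives an isomorphism with the sum of products of symmetric powers
    ∃ Φ : (DirectSum (HLink.Multiplicity (n + 1) n k) fun ν => HLink.SymTensor ν.1) ≃ₗ[ℝ]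
        HLink.HWQuot (n + 1) n k,
      ∀ (ν : HLink.Multiplicity (n + 1) n k)
        (x : (I : HLink.LabelSet (n + 1)) → Fin (ν.1 I) → HLink.ihxPerp I.1),
        HLink.symbol (n + 1) n k
            (Φ (DirectSum.lof ℝ (HLink.Multiplicity (n + 1) n k)
              (fun ν => HLink.SymTensor ν.1) ν
              (PiTensorProduct.tprod ℝ fun I => SymmetricPower.tprod ℝ (x I)))) =
          Submodule.Quotient.mk
            (HLink.shuffleProd ((Finset.univ : Finset (HLink.LabelSet (n + 1))).toList.flatMap
              fun I => List.ofFn fun j => (x I j : HLink.HT (n + 1)))) := by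
  refine ⟨HLink.symbol_injective _ n k, HLink.range_symbol _ n k,
    (HLink.leadingEquiv (n + 1) n k).symm, fun ν x => ?_⟩
  have h := HLink.symbol_leadingEquiv_symm ν fun j => x j.1 j.2
  rw [HLink.symShuffle,
    HLink.map_positions fun I j => (x I j : HLink.HT (n + 1)), HLink.symProd_apply] at h
  convert h using 4
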